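/- Let $X$ be a smooth projective complex variety and let $D=D_1+\dots+D_n$ be a reduced simple normal crossings divisor on $X$ with irreducible components $D_1,\dots,D_n$, such that the sheaf $\Omega^1_X(\log D)$ of logarithmic one-forms is a trivial vector bundle. Denote by $D^i_j$ ($i\ge 1$, $j\ge 1$) the irreducible components of the intersections of $i$ different components of $D$, with their reduced structure; each $D^i_j$ is smooth of codimension $i$ in $X$. Write $\omega_X$ and $\omega_{D^i_j}$ for the canonical sheaves. Let $D'$ be the (possibly empty) sum of some of the components of $D$. Let $\mathcal E$ be a quasi-coherent sheaf on $X$ that is $D$-regular: locally on $X$, functions defining the irreducible components of $D$, taken in any order, form a regular sequence on $\mathcal E$, in the sense that each of them is a non-zero-divisor on the quotient of $\mathcal E$ by the previous ones (the last quotient is allowed to be zero). Suppose that for every $k\ge 1$ $$H^k(X,\omega_X\otimes\mathcal E)=0\qquad\text{and}\qquad H^k\bigl(D^i_j,\ \omega_{D^i_j}\otimes\mathcal E|_{D^i_j}\bigr)=0\quad\text{for all } i,j \text{ with } D^i_j\not\subseteq D'.$$ Then $$H^k\bigl(X,\ \Omega^p_X(\log D')(-D')\otimes\mathcal E\bigr)=0\qquad\text{for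 all } p\ge 0 \text{ and } k\ge 1.$$ -/

import Mathlib

open CategoryTheory TopologicalSpace AlgebraicGeometry Opposite

noncomputable section

namespace LogBott

/-! ### Sheaves of modules: tensor product, trivial bundles, cohomology -/

/-- The tensor product `M ⊗ N` of two `𝒪_X`-modules: the sheaf associated with
`U ↦ M(U) ⊗ N(U)`, the tensor product being taken over `𝒪_X(U)`. -/
def tensor {X : Scheme.{0}} (M N : X.Modules) : X.Modules :=
  (PresheafOfModules.sheafification (𝟙 X.ringCatSheaf.obj)).obj
    (PresheafOfModules.Monoidal.tensorObj (R := X.presheaf)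
      ((Scheme.Modules.toPresheafOfModules X).obj M)
      ((Scheme.Modules.toPresheafOfModules X).obj N))

/-- The trivial bundle `𝒪_X ^ r`. -/
def trivialBundle (X : Scheme.{0}) (r : ℕ) : X.Modules :=
  (SheafOfModules.free (Fin r) : SheafOfModules.{0} X.ringCatSheaf)

/-- Quasi-coherence of an `𝒪_X`-module. -/
def IsQuasicoherent {X : Scheme.{0}} (M : X.Modules) : Prop :=
  SheafOfModules.IsQuasicoherent (R := X.ringCatSheaf) M

/-- The abelian sheaf underlying an `𝒪_X`-module. -/
def abelianSheaf {X : Scheme.{0}} (M : X.Modules) :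
    Sheaf (Opens.grothendieckTopology X) AddCommGrpCat.{0} :=
  ⟨M.presheaf, M.isSheaf⟩

/-- The sheaf cohomology group `H^k(X, M)` of an `𝒪_X`-module. -/
def cohomology {X : Scheme.{0}} (M : X.Modules) (k : ℕ) : Type :=
  Sheaf.H.{0} (abelianSheaf M) k

/-! ### Projective varieties and reduced closed subvarieties -/

attribute [local instance] MvPolynomial.gradedAlgebra

/-- `X` is projective over `ℂ`: it is a closed subscheme of a projective space over `ℂ`. -/
def IsProjective {X : Scheme.{0}} (f : X ⟶ Spec (.of ℂ)) : Prop :=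
  ∃ (N : ℕ) (i : X ⟶ Proj (MvPolynomial.homogeneousSubmodule (Fin (N + 1)) ℂ)),
    IsClosedImmersion i ∧
      i ≫ Proj.toSpecZero (MvPolynomial.homogeneousSubmodule (Fin (N + 1)) ℂ) ≫
        Spec.map (CommRingCat.ofHom (algebraMap ℂ
          (MvPolynomial.homogeneousSubmodule (Fin (N + 1)) ℂ 0))) = f

/-- The ideal sheaf of all functions vanishing on `Z`. -/
def idealOf {X : Scheme.{0}} (Z : IrreducibleCloseds X) : X.IdealSheafData :=
  Scheme.IdealSheafData.vanishingIdeal ⟨Z, Z.isClosed⟩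

/-- An irreducible closed subset of `X` with its reduced scheme structure. -/
def subvariety {X : Scheme.{0}} (Z : IrreducibleCloseds X) : Scheme.{0} :=
  (idealOf Z).subscheme

/-- The inclusion of a closed subvariety. -/
def inclusion {X : Scheme.{0}} (Z : IrreducibleCloseds X) : subvariety Z ⟶ X :=
  (idealOf Z).subschemeι

instance {X : Scheme.{0}} (Z : IrreducibleCloseds X) : IrreducibleSpace (subvariety Z) := by
  have hr : Set.range (inclusion Z) = (Z : Set X) :=
    (Scheme.IdealSheafData.range_subschemeι _).trans
      (Scheme.IdealSheafData.coe_support_vanishingIdeal _)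
  have hp : IsPreimmersion (inclusion Z) :=
    inferInstanceAs (IsPreimmersion (idealOf Z).subschemeι)
  have hZ : IsIrreducible (Set.range (inclusion Z)) := hr ▸ Z.isIrreducible
  have := isIrreducible_iff_irreducibleSpace.mp hZ
  exact (inclusion Z).isEmbedding.toHomeomorph.irreducibleSpace_iff.mpr this

/-! ### Subsheaves of a constant sheaf cut out by conditions at the points -/

section Lattice

variable {X : Scheme.{0}} [IrreducibleSpace X]

/-- The local ring `𝒪_{X,x}`, as a subring of the function field. -/
def localRing (x : X) : Subring X.functionField :=
  (algebraMap (X.presheaf.stalk x) X.functionField).range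

/-- The rational function on `X` given by the germ at `x ∈ U` of a section of `𝒪_X` over `U`. -/
def toRational {U : X.Opens} (r : Γ(X, U)) (x : U) : X.functionField :=
  algebraMap (X.presheaf.stalk x.1) X.functionField (X.presheaf.germ U x.1 x.2 r)

lemma toRational_const {U : X.Opens} (r : Γ(X, U)) (x y : U) :
    toRational r x = toRational r y := by
  have : Nonempty U := ⟨x⟩
  simp only [toRational]
  rw [Scheme.algebraMap_germ_eq_germToFunctionField (hx := x.2),
    Scheme.algebraMap_germ_eq_germToFunctionField (hx := y.2)]

lemma toRational_mem {U : X.Opens} (r : Γ(X, U)) (x : U) : toRational r x ∈ localRing x.1 :=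
  ⟨_, rfl⟩

lemma toRational_res {U V : X.Opens} (i : V ⟶ U) (r : Γ(X, U)) (x : V) :
    toRational (X.presheaf.map i.op r) x = toRational r ⟨x.1, i.le x.2⟩ := by
  simp only [toRational]
  rw [TopCat.Presheaf.germ_res_apply]

variable {V : Type} [AddCommGroup V] [Module X.functionField V]

/-- Given a vector space `V` over the function field of `X` and, for every point `x`, an
`𝒪_{X,x}`-submodule `L x` of `V`, the sections over `U` of the corresponding subsheaf of the
constant sheaf `V`: locally constant functions `s : U → V` with `s x ∈ L x` for all `x ∈ U`. -/
def latticeSections (L : ∀ x : X, Submodule (localRing x) V) (U : X.Opens) :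
    AddSubgroup (U → V) where
  carrier := {s | IsLocallyConstant s ∧ ∀ x : U, s x ∈ L x.1}
  add_mem' ha hb := ⟨ha.1.add hb.1, fun x => add_mem (ha.2 x) (hb.2 x)⟩
  zero_mem' := ⟨IsLocallyConstant.const 0, fun _ => zero_mem _⟩
  neg_mem' ha := ⟨ha.1.neg, fun x => neg_mem (ha.2 x)⟩

/-- A section of `𝒪_X` over `U` acts by multiplication with the rational function it defines. -/
instance (L : ∀ x : X, Submodule (localRing x) V) (U : X.Opens) :
    Module Γ(X, U) (latticeSections L U) where
  smul r s := ⟨fun x => toRational r x • s.1 x, by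
    refine ⟨?_, fun x => (L x.1).smul_mem ⟨_, toRational_mem r x⟩ (s.2.2 x)⟩
    rw [IsLocallyConstant.iff_exists_open]
    intro x
    obtain ⟨W, hW, hx, h⟩ := (IsLocallyConstant.iff_exists_open _).mp s.2.1 x
    exact ⟨W, hW, hx, fun y hy => by
      rw [h y hy, toRational_const r y x]⟩⟩
  one_smul s := Subtype.ext <| funext fun x => by
    change toRational 1 x • s.1 x = s.1 x
    simp [toRational]
  mul_smul a b s := Subtype.ext <| funext fun x => by
    change toRational (a * b) x • s.1 x = toRational a x • toRational b x • s.1 x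
    simp [toRational, mul_smul]
  smul_zero a := Subtype.ext <| funext fun x => smul_zero (toRational a x)
  smul_add a s t := Subtype.ext <| funext fun x => smul_add (toRational a x) (s.1 x) (t.1 x)
  add_smul a b s := Subtype.ext <| funext fun x => by
    change toRational (a + b) x • s.1 x = toRational a x • s.1 x + toRational b x • s.1 x
    simp [toRational, add_smul]
  zero_smul s := Subtype.ext <| funext fun x => by
    change toRational 0 x • s.1 x = 0
    simp [toRational]

/-- Restriction of sections of a lattice sheaf. -/
def latticeRes (L : ∀ x : X, Submodule (localRing x) V) {U W : X.Opens} (i : W ⟶ U) :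
    latticeSections L U →+ latticeSections L W where
  toFun s := ⟨fun x => s.1 ⟨x.1, i.le x.2⟩,
    s.2.1.comp_continuous (f := fun x : W => (⟨x.1, i.le x.2⟩ : U)) (by fun_prop),
    fun x => s.2.2 ⟨x.1, i.le x.2⟩⟩
  map_zero' := rfl
  map_add' _ _ := rfl

/-- The abelian presheaf underlying a lattice sheaf. -/
def latticePresheaf (L : ∀ x : X, Submodule (localRing x) V) : TopCat.Presheaf Ab X where
  obj U := AddCommGrpCat.of (latticeSections L U.unop)
  map i := AddCommGrpCat.ofHom (latticeRes L i.unop)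
  map_id _ := rfl
  map_comp _ _ := rfl

instance (L : ∀ x : X, Submodule (localRing x) V) (U : (Opens X)ᵒᵖ) :
    Module (X.ringCatSheaf.obj.obj U) ((latticePresheaf L).obj U) :=
  inferInstanceAs (Module Γ(X, U.unop) (latticeSections L U.unop))

/-- The conditions defining a lattice sheaf are local. -/
def latticePredicate (L : ∀ x : X, Submodule (localRing x) V) :
    TopCat.LocalPredicate (X := X.toTopCat) (fun _ => V) where
  pred {U} s := IsLocallyConstant s ∧ ∀ x : U, s x ∈ L x.1
  res i _ h := (latticeRes L i ⟨_, h⟩).2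
  locality {U} s h := by
    refine ⟨?_, fun x => ?_⟩
    · rw [IsLocallyConstant.iff_exists_open]
      intro x
      obtain ⟨W, hx, i, hW⟩ := h x
      obtain ⟨W', hW', hx', h'⟩ := (IsLocallyConstant.iff_exists_open _).mp hW.1 ⟨x.1, hx⟩
      have hW'' := W.isOpen.isOpenMap_subtype_val W' hW'
      refine ⟨Subtype.val ⁻¹' (Subtype.val '' W'), hW''.preimage continuous_subtype_val,
        ⟨_, hx', rfl⟩, ?_⟩
      rintro y ⟨z, hz, hzy⟩
      have := h' z hz
      convert! this using 2
      exact Subtype.ext hzy.symm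
    · obtain ⟨W, hx, i, hW⟩ := h x
      exact hW.2 ⟨x.1, hx⟩

lemma latticePresheaf_isSheaf (L : ∀ x : X, Submodule (localRing x) V) :
    (latticePresheaf L).IsSheaf := by
  rw [TopCat.Presheaf.isSheaf_iff_isSheaf_comp' (forget Ab)]
  exact TopCat.subpresheafToTypes.isSheaf (latticePredicate L)

/-- The `𝒪_X`-module whose sections over `U ≠ ∅` are the `v : V` with `v ∈ L x` for all
`x ∈ U`. -/
def latticeSheaf (L : ∀ x : X, Submodule (localRing x) V) : X.Modules where
  val := PresheafOfModules.ofPresheaf (latticePresheaf L) (fun U W i r s =>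
    Subtype.ext <| funext fun x => by
      change toRational r _ • s.1 _ = toRational (X.presheaf.map i r) x • s.1 _
      exact congrArg (· • s.1 ⟨x.1, i.unop.le x.2⟩) (toRational_res i.unop r x).symm)
  isSheaf := latticePresheaf_isSheaf L

end Lattice

/-! ### Simple normal crossings divisors and their strata -/

section Divisor

variable {X : Scheme.{0}}

/-- `t ∈ 𝒪_{X,x}` is a local equation of `Z` at `x`: it generates the stalk at `x` of the ideal
sheaf of `Z`. (If `x ∉ Z`, the local equations are the units.) -/
def IsLocalEquation (Z : IrreducibleCloseds X) (x : X) (t : X.presheaf.stalk x) : Prop :=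
  ∀ (U : X.affineOpens) (hx : x ∈ U.1),
    ((idealOf Z).ideal U).map (X.presheaf.germ U.1 x hx).hom = Ideal.span {t}

/-- The reduced divisor whose irreducible components are the members of `D` has simple normal
crossings: at every point `x`, the components through `x` have local equations that form part of
a regular system of parameters of the (regular) local ring `𝒪_{X,x}`, i.e. that are linearly
independent in the cotangent space `𝔪_x / 𝔪_x²`. -/
def IsSNC (D : Finset (IrreducibleCloseds X)) : Prop :=
  ∀ x : X, ∃ t : {Z : IrreducibleCloseds X // Z ∈ D ∧ x ∈ Z} →
      IsLocalRing.maximalIdeal (X.presheaf.stalk x),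
    (∀ Z, IsLocalEquation Z.1 x (t Z).1) ∧
      LinearIndependent (IsLocalRing.ResidueField (X.presheaf.stalk x))
        (fun Z => (IsLocalRing.maximalIdeal (X.presheaf.stalk x)).toCotangent (t Z))

/-- `Z` is an irreducible component of the intersection of a non-empty set of components
of `D`. -/
def IsStratum (D : Finset (IrreducibleCloseds X)) (Z : IrreducibleCloseds X) : Prop :=
  ∃ I ⊆ D, I.Nonempty ∧ Maximal (fun W : IrreducibleCloseds X => ∀ Y ∈ I, W ≤ Y) Z

/-- The support of a divisor, given by its set of components. -/
def support (D : Finset (IrreducibleCloseds X)) : Set X :=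
  {x | ∃ Y ∈ D, x ∈ Y}

/-- `E` is `D`-regular: locally, on a small affine open set `U`, functions defining the
components of `D` form, in whichever order, a regular sequence on `E(U)`, i.e. each of them is a
non-zero-divisor modulo the previous ones. -/
def IsDivisorRegular (D : Finset (IrreducibleCloseds X)) (E : X.Modules) : Prop :=
  ∀ x : X, ∃ (U : X.affineOpens) (_ : x ∈ U.1) (t : IrreducibleCloseds X → Γ(X, U.1)),
    (∀ Z ∈ D, (idealOf Z).ideal U = Ideal.span {t Z}) ∧
      ∀ l : List (IrreducibleCloseds X), l.Nodup → (∀ Z, Z ∈ l ↔ Z ∈ D) →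
        RingTheory.Sequence.IsWeaklyRegular Γ(E, U.1) (l.map t)

end Divisor

/-! ### Differential forms, as subsheaves of the constant sheaf of rational forms

On a smooth variety, the sheaves of `p`-forms and of logarithmic `p`-forms are locally free, hence
embed into the constant sheaf of rational `p`-forms. -/

section Forms

variable {X : Scheme.{0}} [IrreducibleSpace X] (f : X ⟶ Spec (.of ℂ))

/-- The embedding of the constants into the function field. -/
def constants : CommRingCat.of ℂ ⟶ X.functionField :=
  (Scheme.ΓSpecIso (.of ℂ)).inv ≫ f.appTop ≫ X.presheaf.germ ⊤ (genericPoint X) trivial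

/-- The Kähler differentials of the function field over `ℂ`: the rational `1`-forms on `X`. -/
abbrev RationalOneForms : ModuleCat.{0} X.functionField :=
  CommRingCat.KaehlerDifferential (constants f)

/-- The rational `p`-forms on `X`. -/
abbrev RationalForms (p : ℕ) : ModuleCat.{0} X.functionField :=
  (RationalOneForms f).exteriorPower p

/-- The differential of a rational function. -/
abbrev d (g : X.functionField) : RationalOneForms f :=
  CommRingCat.KaehlerDifferential.d (f := constants f) g

/-- A germ of a function at `x`, as a rational function. -/
abbrev ofGerm (x : X) (g : X.presheaf.stalk x) : X.functionField :=
  algebraMap (X.presheaf.stalk x) X.functionField g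

/-- The stalk of `Ω^1_X(log D)` at `x`: the `𝒪_{X,x}`-module generated by the differentials `dg`,
`g ∈ 𝒪_{X,x}`, and by the logarithmic differentials `dt / t`, `t` a local equation at `x` of a
component of `D`. -/
def logOneFormsAt (D : Finset (IrreducibleCloseds X)) (x : X) :
    Submodule (localRing x) (RationalOneForms f) :=
  Submodule.span (localRing x)
    ({ω | ∃ g : X.presheaf.stalk x, ω = d f (ofGerm x g)} ∪
      {ω | ∃ Z ∈ D, ∃ t : X.presheaf.stalk x, IsLocalEquation Z x t ∧
        ofGerm x t • ω = d f (ofGerm x t)})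

/-- The stalk of `Ω^p_X(log D)` at `x`, generated by the `p`-fold wedge products of elements of
the stalk of `Ω^1_X(log D)`. -/
def logFormsAt (D : Finset (IrreducibleCloseds X)) (p : ℕ) (x : X) :
    Submodule (localRing x) (RationalForms f p) :=
  Submodule.span (localRing x)
    {η | ∃ ω : Fin p → RationalOneForms f, (∀ j, ω j ∈ logOneFormsAt f D x) ∧
      η = ModuleCat.exteriorPower.mk ω}

/-- The stalk of `Ω^p_X(log D)(-D)` at `x`, generated by the products of elements of the stalk
of `Ω^p_X(log D)` with local equations of `D`. -/
def logFormsTwistAt (D : Finset (IrreducibleCloseds X)) (p : ℕ) (x : X) :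
    Submodule (localRing x) (RationalForms f p) :=
  Submodule.span (localRing x)
    {η | ∃ t : IrreducibleCloseds X → X.presheaf.stalk x, (∀ Z ∈ D, IsLocalEquation Z x (t Z)) ∧
      ∃ ω ∈ logFormsAt f D p x, η = ofGerm x (∏ Z ∈ D, t Z) • ω}

/-- The sheaf `Ω^p_X(log D)` of logarithmic `p`-forms. -/
def logForms (D : Finset (IrreducibleCloseds X)) (p : ℕ) : X.Modules :=
  latticeSheaf (logFormsAt f D p)

/-- The sheaf `Ω^p_X(log D)(-D)`. -/
def logFormsTwist (D : Finset (IrreducibleCloseds X)) (p : ℕ) : X.Modules :=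
  latticeSheaf (logFormsTwistAt f D p)

/-- The canonical sheaf `ω_X`: the sheaf of regular forms of top degree, the top degree being the
dimension of the space of rational `1`-forms, i.e. the dimension of `X`. -/
def canonicalSheaf : X.Modules :=
  logForms f ∅ (Module.finrank X.functionField (RationalOneForms f))

end Forms

end LogBott

end

/-! Since Ω¹_X(log D) is trivial, its global sections form a space W = ℂ^r, and Ω^p_X(log D) = Λ^p W
⊗ 𝒪_X. The residue of a global logarithmic form along a component D_j is a regular function on the
projective variety D_j, hence a constant, so each D_j gives a linear functional on W. The
functionals of the components through a given point x are linearly independent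
(`LogData.res_linearIndependent`). Near x there is therefore a basis of W in which every D_j through
x owns one vector, equal to dt_j / t_j up to a regular form, while the remaining vectors are regular
(`LogData.exists_chart`). In this basis everything is monomial: Ω^p_X(log D')(-D') is generated by
the products v_P of basis vectors, each multiplied by the equations of D' and of those components
outside D' that are attached to a member of P.

Let I_j be the ideal of D_j, put I_A = Σ_{j ∈ A} I_j, and let W_B ⊆ Λ^p W be spanned by the products
of forms without residues along the D_j, j ∈ B. For a partition of the components into T, S, A set
H(T, S, A) = Σ_{T = K ⊔ L} (∏_{j ∈ S ∪ K} I_j) · (W_{A ∪ L} ⊗ E) ⊆ Λ^p W ⊗ E (`stratH`, `stratFam`).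
The sheaf of the theorem is H(D ∖ D', D', ∅) (`LogData.acyclic_twist_iff`). Removing j from T gives
H = P + Q with P = H(T, S ∪ j, A) and Q = H(T, S, A ∪ j), and the monomial description yields Q ∩ (P
+ I_A H) = I_{A ∪ j} Q and P ∩ I_A H = I_A P (`stratH_inf_sup`, `stratH_inf_smul`; the second uses
the regularity of E). So H / I_A H is an extension of Q / I_{A ∪ j} Q by P / I_A P, and induction on
T (`acyc_stratFam`) reduces its acyclicity to the case T = ∅.

For T = ∅ the set S is the complement of A, and the quotient consists of dim W_A copies
(`acyc_ofConst`) of the restriction of 𝒪(-Σ_{j ∉ A} D_j) ⊗ E to the intersection of the D_j, j ∈ A.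
By normal crossings this intersection is a disjoint union of strata Z. The forms in W without
residues along A restrict to a frame of the rational one-forms on Z in which the regular forms are
again monomial, whence ω_Z = 𝒪_Z(-Σ_{j ∉ A} D_j) (`LogData.acyclic_canonicalSheaf_component_iff`);
for A = ∅ this is ω_X = 𝒪_X(-D) (`LogData.acyclic_canonicalSheaf_iff`). These are the sheaves whose
cohomology is assumed to vanish: A only contains components outside D', so Z is not contained in D'
(`acyc_strata`).

Subsheaves of a power of E are handled as families of submodules of its stalks (`Fam`), and
quotients as sheaves of functions with values in quotients of stalks (`quotSheaf`), so that
exactness is checked point by point (`EtSheaf.shortExact`). The passage from Z to X uses that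
push-forward along a closed embedding preserves acyclicity (`Acyclic.pushAb`) and the computation of
the stalks of a pull-back (`pullStalk_eq_zero_iff`, `pullStalk_surjective`). -/

open CategoryTheory TopologicalSpace AlgebraicGeometry Opposite

noncomputable section

namespace LogBott

/-! ### Abelian sheaves with prescribed fibres -/

/-- The abelian sheaves on `X`. -/
abbrev AbSheaf (X : TopCat.{0}) := Sheaf (Opens.grothendieckTopology X) AddCommGrpCat.{0}

/-- An abelian sheaf has no higher cohomology. -/
def Acyclic {X : TopCat.{0}} (F : AbSheaf X) : Prop :=
  ∀ k : ℕ, 1 ≤ k → Subsingleton (Sheaf.H.{0} F k)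

/-- A sheaf of abelian groups whose sections over `U` are functions on `U` with values in a family
of abelian groups, and such that two sections which agree at a point agree near that point. -/
structure EtSheaf (X : TopCat.{0}) where
  T : X → Type
  [grp : ∀ x, AddCommGroup (T x)]
  P : TopCat.LocalPredicate T
  zero_mem : ∀ U : Opens X, P.pred (U := U) (fun _ => 0)
  add_mem : ∀ {U : Opens X} {s t : ∀ x : U, T x}, P.pred s → P.pred t → P.pred (fun x => s x + t x)
  neg_mem : ∀ {U : Opens X} {s : ∀ x : U, T x}, P.pred s → P.pred (fun x => - s x)
  germ_eq : ∀ {U : Opens X} {s t : ∀ x : U, T x}, P.pred s → P.pred t → ∀ x : U, s x = t x →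
    ∃ V : Opens X, x.1 ∈ V ∧ ∀ y : U, y.1 ∈ V → s y = t y

attribute [instance] EtSheaf.grp

namespace EtSheaf

variable {X : TopCat.{0}}

/-- The sections over an open set. -/
def sections (S : EtSheaf X) (U : Opens X) : AddSubgroup (∀ x : U, S.T x.1) where
  carrier := {s | S.P.pred s}
  add_mem' := S.add_mem
  zero_mem' := S.zero_mem U
  neg_mem' := S.neg_mem

/-- The restriction of sections. -/
def res (S : EtSheaf X) {U V : Opens X} (i : V ⟶ U) : S.sections U →+ S.sections V where
  toFun s := ⟨fun x => s.1 ⟨x.1, i.le x.2⟩, S.P.res i s.1 s.2⟩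
  map_zero' := rfl
  map_add' _ _ := rfl

/-- The underlying presheaf of abelian groups. -/
def toPresheaf (S : EtSheaf X) : TopCat.Presheaf AddCommGrpCat.{0} X where
  obj U := AddCommGrpCat.of (S.sections U.unop)
  map i := AddCommGrpCat.ofHom (S.res i.unop)
  map_id _ := rfl
  map_comp _ _ := rfl

lemma toPresheaf_isSheaf (S : EtSheaf X) : S.toPresheaf.IsSheaf := by
  rw [TopCat.Presheaf.isSheaf_iff_isSheaf_comp' (forget AddCommGrpCat)]
  exact TopCat.subpresheafToTypes.isSheaf S.P

/-- The underlying sheaf of abelian groups. -/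
def toSheaf (S : EtSheaf X) : AbSheaf X := ⟨S.toPresheaf, S.toPresheaf_isSheaf⟩

/-- The values at a point of the local sections. -/
def IsValue (S : EtSheaf X) (x : X) (v : S.T x) : Prop :=
  ∃ (U : Opens X) (hx : x ∈ U) (s : ∀ x : U, S.T x), S.P.pred s ∧ s ⟨x, hx⟩ = v

lemma isValue (S : EtSheaf X) {U : Opens X} {s : ∀ x : U, S.T x} (hs : S.P.pred s) (x : U) :
    S.IsValue x.1 (s x) := ⟨U, x.2, s, hs, rfl⟩

lemma isValue_zero (S : EtSheaf X) (x : X) : S.IsValue x 0 :=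
  ⟨⊤, trivial, _, S.zero_mem ⊤, rfl⟩

/-- If a function is, near each point, pointwise related to a section in such a way that it is
determined, then it is a section. -/
lemma pred_of_locally (S : EtSheaf X) {U : Opens X} (s : ∀ x : U, S.T x)
    (h : ∀ x : U, ∃ (V : Opens X) (_ : x.1 ∈ V) (t : ∀ y : V, S.T y), S.P.pred t ∧
      ∀ y (hU : y ∈ U) (hV : y ∈ V), s ⟨y, hU⟩ = t ⟨y, hV⟩) : S.P.pred s := by
  refine S.P.locality s fun x => ?_
  obtain ⟨V, hx, t, ht, hst⟩ := h x
  refine ⟨U ⊓ V, ⟨x.2, hx⟩, homOfLE inf_le_left, ?_⟩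
  have := S.P.res (homOfLE (inf_le_right : U ⊓ V ≤ V)) t ht
  convert! this using 1
  funext y
  exact hst y.1 y.2.1 y.2.2

/-- A morphism given by homomorphisms between the fibres. -/
structure Hom (S S' : EtSheaf X) where
  φ : ∀ x, S.T x →+ S'.T x
  pred : ∀ {U : Opens X} {s : ∀ x : U, S.T x}, S.P.pred s → S'.P.pred (fun x => φ x.1 (s x))

/-- The morphism of sheaves given by a morphism of fibres. -/
def Hom.map {S S' : EtSheaf X} (f : Hom S S') : S.toSheaf ⟶ S'.toSheaf where
  hom := { app := fun U => AddCommGrpCat.ofHom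
            { toFun := fun s => (⟨fun x => f.φ x.1 (s.1 x), f.pred s.2⟩ : S'.sections U.unop)
              map_zero' := Subtype.ext <| funext fun x => map_zero (f.φ x.1)
              map_add' := fun s t => Subtype.ext <| funext fun x =>
                map_add (f.φ x.1) (s.1 x) (t.1 x) }
           naturality := fun _ _ _ => rfl }

end EtSheaf

lemma app_congr {X : TopCat.{0}} {F G : AbSheaf X} {f g : F ⟶ G} (h : f = g)
    (U : (Opens X)ᵒᵖ) (s : F.obj.obj U) : f.hom.app U s = g.hom.app U s := by rw [h]

lemma app_naturality {X : TopCat.{0}} {F G : AbSheaf X} (f : F ⟶ G) {U V : (Opens X)ᵒᵖ}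
    (i : U ⟶ V) (s : F.obj.obj U) :
    f.hom.app V (F.obj.map i s) = G.obj.map i (f.hom.app U s) :=
  ConcreteCategory.congr_hom (f.hom.naturality i) s

lemma epi_of_locally_surjective {X : TopCat.{0}} {F G : AbSheaf X} (f : F ⟶ G)
    (h : ∀ (U : Opens X) (t : G.obj.obj (op U)) (x : X), x ∈ U →
      ∃ (V : Opens X) (i : V ⟶ U) (s : F.obj.obj (op V)), x ∈ V ∧
        f.hom.app (op V) s = G.obj.map i.op t) : Epi f := by
  rw [← Sheaf.isLocallySurjective_iff_epi' AddCommGrpCat.{0}]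
  exact (TopCat.Presheaf.isLocallySurjective_iff (ℱ := F.obj) (𝒢 := G.obj) f.hom).2
    fun U t x hx => by
      obtain ⟨V, i, s, hxV, hs⟩ := h U t x hx
      exact ⟨V, i.le, ⟨s, hs⟩, hxV⟩

lemma locally_surjective_of_epi {X : TopCat.{0}} {F G : AbSheaf X} (f : F ⟶ G) [Epi f]
    (U : Opens X) (t : G.obj.obj (op U)) (x : X) (hx : x ∈ U) :
      ∃ (V : Opens X) (i : V ⟶ U) (s : F.obj.obj (op V)), x ∈ V ∧
        f.hom.app (op V) s = G.obj.map i.op t := by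
  have h := (Sheaf.isLocallySurjective_iff_epi' AddCommGrpCat.{0} f).2 inferInstance
  obtain ⟨V, i, ⟨s, hs⟩, hxV⟩ :=
    (TopCat.Presheaf.isLocallySurjective_iff (ℱ := F.obj) (𝒢 := G.obj) f.hom).1 h U t x hx
  exact ⟨V, homOfLE i, s, hxV, hs⟩

lemma mono_of_sections_injective {X : TopCat.{0}} {F G : AbSheaf X} (f : F ⟶ G)
    (h : ∀ (U : Opens X) (s : F.obj.obj (op U)), f.hom.app (op U) s = 0 → s = 0) : Mono f := by
  refine Preadditive.mono_of_cancel_zero _ fun {W} g hg => ?_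
  ext U w
  refine h U.unop _ ?_
  exact app_congr hg U w

/-! ### Exactness of sheaves of functions, tested on the fibres. -/

namespace EtSheaf

variable {X : TopCat.{0}}

lemma Hom.mono {S S' : EtSheaf X} (f : Hom S S')
    (inj : ∀ x v, S.IsValue x v → f.φ x v = 0 → v = 0) : Mono f.map := by
  refine mono_of_sections_injective _ fun U s hs => Subtype.ext <| funext fun x => ?_
  exact inj x.1 _ (S.isValue s.2 x) (congrFun (congrArg Subtype.val hs) x)

/-- A preimage of the value at `x` is itself the value of a local section; the image of that section
agrees with the given one at `x`, hence near `x` by `germ_eq`. -/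
lemma Hom.epi {S S' : EtSheaf X} (f : Hom S S')
    (surj : ∀ x v, S'.IsValue x v → ∃ w, S.IsValue x w ∧ f.φ x w = v) : Epi f.map := by
  refine epi_of_locally_surjective _ fun U t x hx => ?_
  obtain ⟨w, ⟨V, hxV, s, hs, hsw⟩, hw⟩ := surj x (t.1 ⟨x, hx⟩) (S'.isValue t.2 ⟨x, hx⟩)
  obtain ⟨W, hxW, h⟩ := S'.germ_eq (S'.P.res (homOfLE inf_le_left : U ⊓ V ⟶ U) t.1 t.2)
    (f.pred (S.P.res (homOfLE inf_le_right : U ⊓ V ⟶ V) s hs)) ⟨x, hx, hxV⟩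
    (by subst hsw; exact hw.symm)
  refine ⟨U ⊓ V ⊓ W, homOfLE (inf_le_left.trans inf_le_left),
    ⟨_, S.P.res (homOfLE (inf_le_left.trans inf_le_right) : U ⊓ V ⊓ W ⟶ V) s hs⟩,
    ⟨⟨hx, hxV⟩, hxW⟩, Subtype.ext <| funext fun y => ?_⟩
  exact (h ⟨y.1, y.2.1⟩ y.2.2).symm

/-- A section of the kernel lifts. -/
lemma Hom.lift_pred {S S' : EtSheaf X} (f : Hom S S')
    (inj : ∀ x v, S.IsValue x v → f.φ x v = 0 → v = 0) {U : Opens X} {s : ∀ x : U, S.T x}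
    (hval : ∀ x : U, S.IsValue x.1 (s x)) (hs : S'.P.pred (fun x : U => f.φ x.1 (s x))) :
    S.P.pred s := by
  refine S.pred_of_locally s fun x => ?_
  obtain ⟨V, hxV, t, ht, htx⟩ := hval x
  obtain ⟨W, hxW, h⟩ := S'.germ_eq (S'.P.res (homOfLE inf_le_left : U ⊓ V ⟶ U) _ hs)
    (f.pred (S.P.res (homOfLE inf_le_right : U ⊓ V ⟶ V) t ht)) ⟨x, x.2, hxV⟩
    (congrArg (f.φ x.1) htx.symm)
  refine ⟨V ⊓ W, ⟨hxV, hxW⟩, _, S.P.res (homOfLE inf_le_left : V ⊓ W ⟶ V) t ht, ?_⟩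
  intro y hU hV
  have h1 : f.φ y (s ⟨y, hU⟩) = f.φ y (t ⟨y, hV.1⟩) := h ⟨y, hU, hV.1⟩ hV.2
  -- The hypothesis `inj` only speaks about values of sections, so the difference is first exhibited
  -- as such a value.
  obtain ⟨V', hy, r, hr, hry⟩ := hval ⟨y, hU⟩
  have h2 : S.IsValue y (s ⟨y, hU⟩ - t ⟨y, hV.1⟩) := by
    refine ⟨V' ⊓ V, ⟨hy, hV.1⟩, _, S.add_mem
      (S.P.res (homOfLE inf_le_left : V' ⊓ V ⟶ V') r hr)
      (S.neg_mem (S.P.res (homOfLE inf_le_right : V' ⊓ V ⟶ V) t ht)), ?_⟩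
    rw [← hry, sub_eq_add_neg]
    rfl
  exact sub_eq_zero.1 (inj y _ h2 ((map_sub _ _ _).trans (sub_eq_zero.2 h1)))

/-- A criterion for the exactness of a sequence of sheaves in terms of the fibres. -/
lemma shortExact {S₁ S₂ S₃ : EtSheaf X} (f : Hom S₁ S₂) (g : Hom S₂ S₃)
    (inj : ∀ x v, S₁.IsValue x v → f.φ x v = 0 → v = 0)
    (zero : ∀ x v, S₁.IsValue x v → g.φ x (f.φ x v) = 0)
    (exact : ∀ x v, S₂.IsValue x v → g.φ x v = 0 → ∃ w, S₁.IsValue x w ∧ f.φ x w = v)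
    (surj : ∀ x v, S₃.IsValue x v → ∃ w, S₂.IsValue x w ∧ g.φ x w = v) :
    ∃ w, (ShortComplex.mk f.map g.map w).ShortExact := by
  have w : f.map ≫ g.map = 0 := by
    ext U s
    exact Subtype.ext <| funext fun x => zero x.1 _ (S₁.isValue s.2 x)
  have hm : Mono f.map := f.mono inj
  have he : Epi g.map := g.epi surj
  refine ⟨w, ShortComplex.ShortExact.mk' ?_ hm he⟩
  -- Exactness in the middle: a morphism killed by `g` is lifted fibre by fibre. The lifts are
  -- unique among values of sections, and this makes them sections, additive and compatible with
  -- restriction.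
  refine ShortComplex.exact_of_f_is_kernel _ (Limits.KernelFork.IsLimit.ofι' f.map w ?_)
  intro A k hk
  have key : ∀ (U : Opens X) (a : A.obj.obj (op U)) (x : U), ∃ w, S₁.IsValue x.1 w ∧
      f.φ x.1 w = (k.hom.app (op U) a : S₂.sections U).1 x := by
    intro U a x
    refine exact x.1 _ (S₂.isValue (k.hom.app (op U) a : S₂.sections U).2 x) ?_
    exact congrFun (congrArg Subtype.val (app_congr hk (op U) a)) x
  choose l hl hfl using key
  have uniq : ∀ (x : X) (v w : S₁.T x), S₁.IsValue x v → S₁.IsValue x w → f.φ x v = f.φ x w →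
      v = w := by
    intro x v w ⟨U, hx, s, hs, hsv⟩ ⟨V, hy, t, ht, htw⟩ h
    have h2 : S₁.IsValue x (v - w) := by
      refine ⟨U ⊓ V, ⟨hx, hy⟩, _, S₁.add_mem
        (S₁.P.res (homOfLE inf_le_left : U ⊓ V ⟶ U) s hs)
        (S₁.neg_mem (S₁.P.res (homOfLE inf_le_right : U ⊓ V ⟶ V) t ht)), ?_⟩
      rw [← hsv, ← htw, sub_eq_add_neg]
      rfl
    exact sub_eq_zero.1 (inj x _ h2 (by rw [map_sub, h, sub_self]))
  have isv : ∀ (x : X) (v w : S₁.T x), S₁.IsValue x v → S₁.IsValue x w →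
      S₁.IsValue x (v + w) := by
    intro x v w ⟨U, hx, s, hs, hsv⟩ ⟨V, hy, t, ht, htw⟩
    refine ⟨U ⊓ V, ⟨hx, hy⟩, _, S₁.add_mem
      (S₁.P.res (homOfLE inf_le_left : U ⊓ V ⟶ U) s hs)
      (S₁.P.res (homOfLE inf_le_right : U ⊓ V ⟶ V) t ht), ?_⟩
    rw [← hsv, ← htw]
    rfl
  have hp : ∀ (U : Opens X) (a : A.obj.obj (op U)), S₁.P.pred (fun x : U => l U a x) := by
    intro U a
    refine f.lift_pred inj (hl U a) ?_
    have := (k.hom.app (op U) a : S₂.sections U).2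
    convert! this using 1
    funext x
    exact hfl U a x
  refine ⟨{ hom := { app := fun U => AddCommGrpCat.ofHom
                      { toFun := fun a => (⟨_, hp U.unop a⟩ : S₁.sections U.unop)
                        map_zero' := ?_
                        map_add' := ?_ }
                     naturality := ?_ } }, ?_⟩
  · refine Subtype.ext <| funext fun x => uniq _ _ _ (hl _ _ _) (S₁.isValue_zero _) ?_
    exact (hfl U.unop 0 x).trans ((congrFun (congrArg Subtype.val
      (map_zero (k.hom.app U).hom)) x).trans (map_zero (f.φ x.1)).symm)
  · intro a b
    refine Subtype.ext <| funext fun x => uniq _ _ _ (hl _ _ _) (isv _ _ _ (hl _ _ _) (hl _ _ _)) ?_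
    refine (hfl U.unop (a + b) x).trans ((congrFun (congrArg Subtype.val
      (map_add (k.hom.app U).hom a b)) x).trans ?_)
    refine Eq.trans ?_ (map_add (f.φ x.1) (l U.unop a x) (l U.unop b x)).symm
    exact (congrArg₂ (· + ·) (hfl U.unop a x) (hfl U.unop b x)).symm
  · intro U V i
    ext a
    refine Subtype.ext <| funext fun x => uniq _ _ _ (hl V.unop _ x)
      (hl U.unop a ⟨x.1, i.unop.le x.2⟩) ?_
    refine (hfl V.unop _ x).trans (Eq.trans ?_ (hfl U.unop a ⟨x.1, i.unop.le x.2⟩).symm)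
    exact congrFun (congrArg Subtype.val (app_naturality k i a)) x
  · ext U a
    exact Subtype.ext <| funext fun x => hfl U.unop a x

end EtSheaf

/-! ### Acyclic sheaves -/

lemma Acyclic.of_iso {X : TopCat.{0}} {F G : AbSheaf X} (e : F ≅ G) (h : Acyclic F) :
    Acyclic G := by
  intro k hk
  have := h k hk
  refine subsingleton_of_forall_eq 0 fun y => ?_
  have h1 : Sheaf.H.map e.hom k (Sheaf.H.map e.inv k y) = y := by
    rw [← Sheaf.H.map_comp_apply, e.inv_hom_id, Sheaf.H.map_id_apply]
  rw [← h1, Subsingleton.elim (Sheaf.H.map e.inv k y) 0, map_zero]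

/-- In the long exact sequence the middle group lies between two zero groups. -/
lemma Acyclic.of_shortExact {X : TopCat.{0}} {S : ShortComplex (AbSheaf X)} (hS : S.ShortExact)
    (h₁ : Acyclic S.X₁) (h₃ : Acyclic S.X₃) : Acyclic S.X₂ := by
  intro k hk
  have := h₁ k hk
  have := h₃ k hk
  refine subsingleton_of_forall_eq 0 fun y => ?_
  obtain ⟨z, hz⟩ := Abelian.Ext.covariant_sequence_exact₂ _ hS y (Subsingleton.elim _ _)
  rw [← hz, Subsingleton.elim z 0, Abelian.Ext.zero_comp]

lemma Acyclic.of_isZero {X : TopCat.{0}} {F : AbSheaf X} (h : Limits.IsZero F) : Acyclic F :=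
  fun k _ => Sheaf.subsingleton_H_of_isZero h k

namespace EtSheaf

variable {X : TopCat.{0}}

/-- A sheaf of functions has no higher cohomology. -/
def IsAcyclic (S : EtSheaf X) : Prop := Acyclic S.toSheaf

lemma isAcyclic_of_exact {S₁ S₂ S₃ : EtSheaf X} (f : Hom S₁ S₂) (g : Hom S₂ S₃)
    (inj : ∀ x v, S₁.IsValue x v → f.φ x v = 0 → v = 0)
    (zero : ∀ x v, S₁.IsValue x v → g.φ x (f.φ x v) = 0)
    (exact : ∀ x v, S₂.IsValue x v → g.φ x v = 0 → ∃ w, S₁.IsValue x w ∧ f.φ x w = v)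
    (surj : ∀ x v, S₃.IsValue x v → ∃ w, S₂.IsValue x w ∧ g.φ x w = v)
    (h₁ : S₁.IsAcyclic) (h₃ : S₃.IsAcyclic) : S₂.IsAcyclic := by
  obtain ⟨w, h⟩ := shortExact f g inj zero exact surj
  exact Acyclic.of_shortExact h h₁ h₃

lemma Hom.isIso {S S' : EtSheaf X} (f : Hom S S')
    (inj : ∀ x v, S.IsValue x v → f.φ x v = 0 → v = 0)
    (surj : ∀ x v, S'.IsValue x v → ∃ w, S.IsValue x w ∧ f.φ x w = v) : IsIso f.map := by
  have := f.mono inj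
  have := f.epi surj
  exact isIso_of_mono_of_epi _

lemma isAcyclic_iff_of_bijective {S S' : EtSheaf X} (f : Hom S S')
    (inj : ∀ x v, S.IsValue x v → f.φ x v = 0 → v = 0)
    (surj : ∀ x v, S'.IsValue x v → ∃ w, S.IsValue x w ∧ f.φ x w = v) :
    S.IsAcyclic ↔ S'.IsAcyclic := by
  have := f.isIso inj surj
  exact ⟨Acyclic.of_iso (asIso f.map), Acyclic.of_iso (asIso f.map).symm⟩

lemma isAcyclic_of_values_zero {S : EtSheaf X} (h : ∀ x v, S.IsValue x v → v = 0) :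
    S.IsAcyclic := by
  refine Acyclic.of_isZero ((Limits.IsZero.iff_id_eq_zero _).2 ?_)
  ext U s
  exact Subtype.ext <| funext fun x => h _ _ (S.isValue (s : S.sections U.unop).2 x)

end EtSheaf

/-! ### Push-forward along closed embeddings -/

section Pushforward

variable {Z X : TopCat.{0}} (f : Z ⟶ X)

/-- The push-forward of abelian sheaves. -/
abbrev pushAb : AbSheaf Z ⥤ AbSheaf X := TopCat.Sheaf.pushforward AddCommGrpCat.{0} f

attribute [local instance] Limits.reflectsLimits_of_reflectsIsomorphisms in
instance : Limits.PreservesFiniteLimits (TopCat.Sheaf.pullback AddCommGrpCat.{0} f) := by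
  unfold TopCat.Sheaf.pullback
  apply Functor.sheafPullbackConstruction.preservesFiniteLimits

instance pullback_preservesMonomorphisms :
    (TopCat.Sheaf.pullback AddCommGrpCat.{0} f).PreservesMonomorphisms where
  preserves g _ := preserves_mono_of_preservesLimit _ g

/-- The left adjoint, the inverse image, preserves monomorphisms. This makes dimension shifting
along `f` possible. -/
instance : (pushAb f).PreservesInjectiveObjects :=
  @Functor.preservesInjectiveObjects_of_adjunction_of_preservesMonomorphisms _ _ _ _ _ _
    (TopCat.Sheaf.pullbackPushforwardAdjunction AddCommGrpCat.{0} f)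
    (pullback_preservesMonomorphisms f)

instance : (pushAb f).IsRightAdjoint :=
  (TopCat.Sheaf.pullbackPushforwardAdjunction AddCommGrpCat.{0} f).isRightAdjoint

instance : (pushAb f).PreservesZeroMorphisms where
  map_zero _ _ := rfl

variable {f}

/-- Near a point of the image, a lift over an open subset of `Z` is a lift over the trace of an open
subset of `X`, because `f` is an embedding. Away from the closed image there are open sets with
empty preimage, over which every section is zero. -/
lemma pushAb_map_epi (hf : Topology.IsClosedEmbedding f) {F G : AbSheaf Z} (g : F ⟶ G) [Epi g] :
    Epi ((pushAb f).map g) := by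
  refine epi_of_locally_surjective _ fun U t x hx => ?_
  by_cases hxZ : x ∈ Set.range f
  · obtain ⟨z, rfl⟩ := hxZ
    obtain ⟨V, i, s, hzV, hs⟩ := locally_surjective_of_epi g ((Opens.map f).obj U) t z hx
    obtain ⟨W, hW, hWV⟩ := hf.isOpen_iff.1 V.isOpen
    let W' : Opens X := U ⊓ ⟨W, hW⟩
    have hle : (Opens.map f).obj W' ≤ V := fun y hy => by
      change y ∈ (V : Set Z)
      rw [← hWV]
      exact hy.2
    refine ⟨W', homOfLE inf_le_left, F.obj.map (homOfLE hle).op s, ⟨hx, ?_⟩, ?_⟩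
    · have : z ∈ (V : Set Z) := hzV
      rwa [← hWV] at this
    · refine (app_naturality g (homOfLE hle).op s).trans ?_
      rw [hs]
      exact (ConcreteCategory.congr_hom (G.obj.map_comp i.op (homOfLE hle).op) t).symm
  · let W : Opens X := U ⊓ ⟨(Set.range f)ᶜ, hf.isClosed_range.isOpen_compl⟩
    have hW : (Opens.map f).obj W = ⊥ := by
      ext y
      simp only [Opens.map_coe, Opens.coe_bot, Set.mem_empty_iff_false, iff_false]
      exact fun hy => hy.2 ⟨y, rfl⟩
    refine ⟨W, homOfLE inf_le_left, 0, ⟨hx, hxZ⟩, ?_⟩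
    have hterm : Limits.IsTerminal (G.obj.obj (op ((Opens.map f).obj W))) := by
      rw [hW]
      exact TopCat.Sheaf.isTerminalOfEmpty G
    have hz : Limits.IsZero (G.obj.obj (op ((Opens.map f).obj W))) :=
      (Limits.isZero_zero _).of_iso (hterm.uniqueUpToIso Limits.HasZeroObject.zeroIsTerminal)
    have := AddCommGrpCat.subsingleton_of_isZero hz
    exact Subsingleton.elim (α := G.obj.obj (op ((Opens.map f).obj W))) _ _

lemma pushAb_shortExact (hf : Topology.IsClosedEmbedding f) {S : ShortComplex (AbSheaf Z)}
    (hS : S.ShortExact) : (S.map (pushAb f)).ShortExact := by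
  have := hS.mono_f
  have := hS.epi_g
  have : Epi (S.map (pushAb f)).g := pushAb_map_epi hf S.g
  have : Mono (S.map (pushAb f)).f := inferInstanceAs (Mono ((pushAb f).map S.f))
  exact ShortComplex.ShortExact.mk' (hS.exact.map_of_mono_of_preservesKernel (pushAb f)
    inferInstance inferInstance) inferInstance inferInstance

/-- Dimension shifting: embed `F` in an injective sheaf, whose push-forward is again injective. In
degree one the question is whether global sections of the quotient lift, and this is the same
question on `Z` and on `X`, since a sheaf and its push-forward have the same global sections. -/
lemma subsingleton_H_pushAb (hf : Topology.IsClosedEmbedding f) (k : ℕ) :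
    ∀ F : AbSheaf Z, (∀ j, 1 ≤ j → j ≤ k + 1 → Subsingleton (Sheaf.H.{0} F j)) →
      Subsingleton (Sheaf.H.{0} ((pushAb f).obj F) (k + 1)) := by
  induction k with
  | zero =>
    intro F hF
    let S : ShortComplex (AbSheaf Z) := ShortComplex.mk (Injective.ι F)
      (Limits.cokernel.π (Injective.ι F)) (by simp)
    have hS : S.ShortExact :=
      ShortComplex.ShortExact.mk' (ShortComplex.exact_cokernel _) inferInstance inferInstance
    have hS' := pushAb_shortExact hf hS
    have hinj : Injective (S.map (pushAb f)).X₂ :=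
      inferInstanceAs (Injective ((pushAb f).obj (Injective.under F)))
    have h1 := hF 1 le_rfl le_rfl
    refine subsingleton_of_forall_eq 0 fun y => ?_
    obtain ⟨q', hq'⟩ := Abelian.Ext.covariant_sequence_exact₁ _ hS' y
      (Abelian.Ext.eq_zero_of_injective _) rfl
    let q : Sheaf.H ((pushAb f).obj S.X₃) 0 := q'
    let e := Sheaf.H.equiv₀ (pushAb f |>.obj S.X₃) (T := (⊤ : Opens X)) Limits.isTerminalTop
    let e' := Sheaf.H.equiv₀ S.X₃ (T := (⊤ : Opens Z)) Limits.isTerminalTop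
    -- The class `q` is a global section of the quotient sheaf on `Z`; as H¹ of `F` vanishes it
    -- lifts to the injective sheaf, and so its image under the connecting map on `X` is zero.
    obtain ⟨p, hp⟩ := Abelian.Ext.covariant_sequence_exact₃ _ hS (e'.symm (e q)) rfl
      (@Subsingleton.elim _ h1 _ _)
    let a := Sheaf.H.equiv₀ S.X₂ (T := (⊤ : Opens Z)) Limits.isTerminalTop p
    let p' := (Sheaf.H.equiv₀ (pushAb f |>.obj S.X₂) (T := (⊤ : Opens X))
      Limits.isTerminalTop).symm a
    have hpq : p'.comp (Abelian.Ext.mk₀ ((pushAb f).map S.g)) (add_zero 0) = q := by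
      apply e.injective
      refine (Sheaf.H.equiv₀_naturality Limits.isTerminalTop ((pushAb f).map S.g) p').symm.trans ?_
      have h2 : S.g.hom.app (op ⊤) a = e' (Sheaf.H.map S.g 0 p) :=
        Sheaf.H.equiv₀_naturality Limits.isTerminalTop S.g p
      have h3 : e' (Sheaf.H.map S.g 0 p) = e q :=
        (congrArg e' hp).trans (AddEquiv.apply_symm_apply e' (e q))
      have h4 : Sheaf.H.equiv₀ (pushAb f |>.obj S.X₂) (T := (⊤ : Opens X))
          Limits.isTerminalTop p' = a := AddEquiv.apply_symm_apply _ _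
      exact (congrArg (fun z => ((pushAb f).map S.g).hom.app (op ⊤) z) h4).trans (h2.trans h3)
    refine hq'.symm.trans ((congrArg (fun z : Sheaf.H ((pushAb f).obj S.X₃) 0 =>
      Abelian.Ext.comp z hS'.extClass rfl) hpq.symm).trans ?_)
    refine (Abelian.Ext.comp_assoc p' (Abelian.Ext.mk₀ ((pushAb f).map S.g)) hS'.extClass
      (add_zero 0) (zero_add 1) (by rfl)).trans ?_
    exact (congrArg (fun z => Abelian.Ext.comp p' z rfl) hS'.comp_extClass).trans
      (Abelian.Ext.comp_zero _ _ _ _ _)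
  | succ k ih =>
    intro F hF
    let S : ShortComplex (AbSheaf Z) := ShortComplex.mk (Injective.ι F)
      (Limits.cokernel.π (Injective.ι F)) (by simp)
    have hS : S.ShortExact :=
      ShortComplex.ShortExact.mk' (ShortComplex.exact_cokernel _) inferInstance inferInstance
    have hS' := pushAb_shortExact hf hS
    have hinj : Injective (S.map (pushAb f)).X₂ :=
      inferInstanceAs (Injective ((pushAb f).obj (Injective.under F)))
    have hinj' : Injective S.X₂ := inferInstanceAs (Injective (Injective.under F))
    -- For j ≥ 1 the connecting map embeds H^j of the quotient in H^(j+1) of `F`, so the quotient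
    -- satisfies the induction hypothesis.
    have hQ : Subsingleton (Sheaf.H.{0} ((pushAb f).obj S.X₃) (k + 1)) := by
      refine ih _ fun j hj hjk => subsingleton_of_forall_eq 0 fun y => ?_
      have := hF (j + 1) (by omega) (by omega)
      obtain ⟨j, rfl⟩ : ∃ i, j = i + 1 := ⟨j - 1, by omega⟩
      obtain ⟨p, hp⟩ := Abelian.Ext.covariant_sequence_exact₃ _ hS y rfl
        (@Subsingleton.elim _ this _ _)
      rw [← hp, Abelian.Ext.eq_zero_of_injective p, Abelian.Ext.zero_comp]
    refine subsingleton_of_forall_eq 0 fun y => ?_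
    obtain ⟨q, hq⟩ := Abelian.Ext.covariant_sequence_exact₁ _ hS' y
      (Abelian.Ext.eq_zero_of_injective _) rfl
    refine hq.symm.trans ((congrArg (fun z : Sheaf.H ((pushAb f).obj S.X₃) (k + 1) =>
      Abelian.Ext.comp z hS'.extClass rfl) (@Subsingleton.elim _ hQ q 0)).trans ?_)
    exact Abelian.Ext.zero_comp _ _ _ _ _

/-- The push-forward along a closed embedding of a sheaf without higher cohomology has no higher
cohomology. -/
lemma Acyclic.pushAb (hf : Topology.IsClosedEmbedding f) {F : AbSheaf Z} (hF : Acyclic F) :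
    Acyclic ((pushAb f).obj F) := by
  intro k hk
  obtain ⟨k, rfl⟩ : ∃ i, k = i + 1 := ⟨k - 1, by omega⟩
  exact subsingleton_H_pushAb hf k F fun j hj _ => hF j hj

/-- Comparison of a sheaf of functions on `X` with the push-forward of a sheaf of functions on a
closed subspace. -/
lemma EtSheaf.isAcyclic_of_closedEmbedding (hf : Topology.IsClosedEmbedding f)
    {G : EtSheaf Z} {G' : EtSheaf X} (φ : ∀ z, G'.T (f z) →+ G.T z)
    (pred : ∀ {U : Opens X} {s : ∀ x : U, G'.T x}, G'.P.pred s →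
      G.P.pred (U := (Opens.map f).obj U) (fun z => φ z.1 (s ⟨f z.1, z.2⟩)))
    (inj : ∀ z v, G'.IsValue (f z) v → φ z v = 0 → v = 0)
    (surj : ∀ z v, G.IsValue z v → ∃ w, G'.IsValue (f z) w ∧ φ z w = v)
    (zero : ∀ x, x ∉ Set.range f → ∀ v, G'.IsValue x v → v = 0)
    (hG : G.IsAcyclic) : G'.IsAcyclic := by
  let Φ : G'.toSheaf ⟶ (LogBott.pushAb f).obj G.toSheaf :=
    { hom := { app := fun U => AddCommGrpCat.ofHom
                { toFun := fun s => (⟨fun z => φ z.1 (s.1 ⟨f z.1, z.2⟩), pred s.2⟩ :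
                    G.sections ((Opens.map f).obj U.unop))
                  map_zero' := Subtype.ext <| funext fun x => map_zero (φ x.1)
                  map_add' := fun s t => Subtype.ext <| funext fun z =>
                    map_add (φ z.1) (s.1 ⟨f z.1, z.2⟩) (t.1 ⟨f z.1, z.2⟩) }
               naturality := fun _ _ _ => rfl } }
  have : Mono Φ := by
    refine mono_of_sections_injective _ fun U s hs => Subtype.ext <| funext fun x => ?_
    by_cases hxZ : x.1 ∈ Set.range f
    · obtain ⟨z, hz⟩ := hxZ
      obtain ⟨x, hx⟩ := x
      subst hz
      exact inj z _ (G'.isValue (s : G'.sections U).2 ⟨f z, hx⟩)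
        (congrFun (congrArg Subtype.val hs) ⟨z, hx⟩)
    · exact zero x.1 hxZ _ (G'.isValue (s : G'.sections U).2 x)
  have : Epi Φ := by
    refine epi_of_locally_surjective _ fun U t x hx => ?_
    by_cases hxZ : x ∈ Set.range f
    · obtain ⟨z, rfl⟩ := hxZ
      let t' : G.sections ((Opens.map f).obj U) := t
      obtain ⟨w, ⟨V, hxV, s, hs, hsw⟩, hw⟩ := surj z (t'.1 ⟨z, hx⟩) (G.isValue t'.2 ⟨z, hx⟩)
      obtain ⟨W, hzW, h⟩ := G.germ_eq
        (G.P.res ((Opens.map f).map (homOfLE inf_le_left : U ⊓ V ⟶ U)) t'.1 t'.2)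
        (pred (G'.P.res (homOfLE inf_le_right : U ⊓ V ⟶ V) s hs)) ⟨z, hx, hxV⟩
        (by subst hsw; exact hw.symm)
      obtain ⟨W', hW', hWW'⟩ := hf.isOpen_iff.1 W.isOpen
      have hzW' : z ∈ (W : Set Z) := hzW
      rw [← hWW'] at hzW'
      refine ⟨U ⊓ V ⊓ ⟨W', hW'⟩, homOfLE (inf_le_left.trans inf_le_left),
        (⟨_, G'.P.res (homOfLE (inf_le_left.trans inf_le_right) :
          U ⊓ V ⊓ ⟨W', hW'⟩ ⟶ V) s hs⟩ : G'.sections _),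
        ⟨⟨hx, hxV⟩, hzW'⟩, Subtype.ext <| funext fun y => ?_⟩
      have hy : y.1 ∈ (W : Set Z) := by
        rw [← hWW']
        exact y.2.2
      exact (h ⟨y.1, y.2.1⟩ hy).symm
    · refine ⟨U ⊓ ⟨(Set.range f)ᶜ, hf.isClosed_range.isOpen_compl⟩, homOfLE inf_le_left, 0,
        ⟨hx, hxZ⟩, Subtype.ext <| funext fun y => (y.2.2 ⟨y.1, rfl⟩).elim⟩
  have := isIso_of_mono_of_epi Φ
  exact Acyclic.of_iso (asIso Φ).symm (Acyclic.pushAb hf hG)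

end Pushforward

end LogBott

namespace LogBott

/-! ### Stalks of sheaves of modules -/

section Stalk

variable {X : Scheme.{0}} (M : X.Modules)

/-- The stalk of an `𝒪_X`-module. -/
def St (x : X) : Type := M.presheaf.stalk x

instance (x : X) : AddCommGroup (St M x) :=
  inferInstanceAs (AddCommGroup (M.presheaf.stalk x))

instance (x : X) : Module (X.presheaf.stalk x) (St M x) :=
  PresheafOfModules.instModuleCarrierStalkCommRingCatCarrierAbPresheafOpensCarrier
    (R := X.presheaf) M.1 x

variable {M}

/-- The germ of a section. -/
def germM {U : X.Opens} (x : X) (hx : x ∈ U) : Γ(M, U) →+ St M x :=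
  (TopCat.Presheaf.germ M.presheaf U x hx).hom

lemma germM_smul {U : X.Opens} (x : X) (hx : x ∈ U) (r : Γ(X, U)) (m : Γ(M, U)) :
    germM x hx (r • m) = X.presheaf.germ U x hx r • germM x hx m :=
  PresheafOfModules.germ_smul (R := X.presheaf) M.1 x U hx r m

lemma germM_res {U V : X.Opens} (x : X) (h : V ≤ U) (hx : x ∈ V) (m : Γ(M, U)) :
    germM x hx (M.presheaf.map (homOfLE h).op m) = germM x (h hx) m :=
  TopCat.Presheaf.germ_res_apply M.presheaf (homOfLE h) x hx m

lemma exists_germM {x : X} (v : St M x) :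
    ∃ (U : X.Opens) (hx : x ∈ U) (m : Γ(M, U)), germM x hx m = v :=
  TopCat.Presheaf.exists_germ_eq M.presheaf v

lemma exists_res_eq_of_germM_eq {U V : X.Opens} {x : X} {hU : x ∈ U} {hV : x ∈ V} {m : Γ(M, U)}
    {m' : Γ(M, V)} (h : germM x hU m = germM x hV m') :
    ∃ (W : X.Opens) (_ : x ∈ W) (i : W ≤ U) (j : W ≤ V),
      M.presheaf.map (homOfLE i).op m = M.presheaf.map (homOfLE j).op m' := by
  obtain ⟨W, hW, i, j, h⟩ := TopCat.Presheaf.germ_eq M.presheaf x hU hV m m' h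
  exact ⟨W, hW, i.le, j.le, h⟩

lemma germM_eq_near {U V : X.Opens} {x : X} {hU : x ∈ U} {hV : x ∈ V} {m : Γ(M, U)}
    {m' : Γ(M, V)} (h : germM x hU m = germM x hV m') :
    ∃ (W : X.Opens) (_ : x ∈ W), ∀ y (_ : y ∈ W) (hU : y ∈ U) (hV : y ∈ V),
      germM y hU m = germM y hV m' := by
  obtain ⟨W, hW, i, j, h⟩ := exists_res_eq_of_germM_eq h
  refine ⟨W, hW, fun y hy hU hV => ?_⟩
  rw [← germM_res y i hy, ← germM_res y j hy, h]

/-- The germs of a tuple of sections. -/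
def gt {ι : Type} {U : X.Opens} (e : ι → Γ(M, U)) (x : X) (hx : x ∈ U) : ι → St M x :=
  fun i => germM x hx (e i)

lemma gt_add {ι : Type} {U : X.Opens} (e e' : ι → Γ(M, U)) (x : X) (hx : x ∈ U) :
    gt (e + e') x hx = gt e x hx + gt e' x hx := funext fun _ => map_add _ _ _

lemma gt_neg {ι : Type} {U : X.Opens} (e : ι → Γ(M, U)) (x : X) (hx : x ∈ U) :
    gt (-e) x hx = - gt e x hx := funext fun _ => map_neg _ _

lemma gt_zero {ι : Type} {U : X.Opens} (x : X) (hx : x ∈ U) :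
    gt (0 : ι → Γ(M, U)) x hx = 0 := funext fun _ => map_zero _

/-- The restriction of a tuple of sections. -/
def rt {ι : Type} {U V : X.Opens} (h : V ≤ U) (e : ι → Γ(M, U)) : ι → Γ(M, V) :=
  fun i => M.presheaf.map (homOfLE h).op (e i)

lemma gt_rt {ι : Type} {U V : X.Opens} (h : V ≤ U) (e : ι → Γ(M, U)) (x : X) (hx : x ∈ V) :
    gt (rt h e) x hx = gt e x (h hx) := funext fun _ => germM_res _ _ _ _

lemma gt_smul {ι : Type} {U : X.Opens} (r : Γ(X, U)) (e : ι → Γ(M, U)) (x : X) (hx : x ∈ U) :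
    gt (fun i => r • e i) x hx = X.presheaf.germ U x hx r • gt e x hx :=
  funext fun _ => germM_smul _ _ _ _

lemma exists_gt {ι : Type} [Finite ι] {x : X} (v : ι → St M x) :
    ∃ (U : X.Opens) (hx : x ∈ U) (e : ι → Γ(M, U)), gt e x hx = v := by
  choose U hU m hm using fun i => exists_germM (v i)
  have := Fintype.ofFinite ι
  refine ⟨Finset.univ.inf U, ?_, fun i => M.presheaf.map
    (homOfLE (Finset.inf_le (Finset.mem_univ i))).op (m i), funext fun i => ?_⟩
  · rw [← SetLike.mem_coe, Opens.coe_finset_inf]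
    simpa using hU
  · exact (germM_res _ _ _ _).trans (hm i)

lemma gt_eq_near {ι : Type} [Finite ι] {U V : X.Opens} {x : X} {hU : x ∈ U} {hV : x ∈ V}
    {e : ι → Γ(M, U)} {e' : ι → Γ(M, V)} (h : gt e x hU = gt e' x hV) :
    ∃ (W : X.Opens) (_ : x ∈ W), ∀ y (_ : y ∈ W) (hU : y ∈ U) (hV : y ∈ V),
      gt e y hU = gt e' y hV := by
  choose W hW h using fun i => germM_eq_near (congrFun h i)
  have := Fintype.ofFinite ι
  have hle : ∀ i, Finset.univ.inf W ≤ W i := fun i => Finset.inf_le (Finset.mem_univ i)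
  refine ⟨Finset.univ.inf W, ?_, fun y hy hU hV => funext fun i => h i y (hle i hy) hU hV⟩
  rw [← SetLike.mem_coe, Opens.coe_finset_inf]
  simpa using hW

end Stalk

/-! ### Open families of submodules of the stalks -/

section Fam

variable {X : Scheme.{0}}

lemma mem_inf {U V : X.Opens} {x : X} (h : x ∈ U) (h' : x ∈ V) : x ∈ U ⊓ V := ⟨h, h'⟩

lemma mem_left {U V : X.Opens} {x : X} (h : x ∈ U ⊓ V) : x ∈ U := h.1

lemma mem_right {U V : X.Opens} {x : X} (h : x ∈ U ⊓ V) : x ∈ V := h.2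

lemma mem_top (x : X) : x ∈ (⊤ : X.Opens) := trivial

/-- The restriction of a function. -/
def rs {U V : X.Opens} (h : V ≤ U) (g : Γ(X, U)) : Γ(X, V) := X.presheaf.map (homOfLE h).op g

lemma germ_rs {U V : X.Opens} (h : V ≤ U) (g : Γ(X, U)) (x : X) (hx : x ∈ V) :
    X.presheaf.germ V x hx (rs h g) = X.presheaf.germ U x (h hx) g :=
  TopCat.Presheaf.germ_res_apply _ _ _ _ _

variable {M : X.Modules} {ι : Type}

/-- The germ `a` comes from a section all of whose germs lie in a family of ideals. -/
def IdealSpread (I : ∀ x : X, Ideal (X.presheaf.stalk x)) (x : X) (a : X.presheaf.stalk x) : Prop :=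
  ∃ (U : X.Opens) (hx : x ∈ U) (g : Γ(X, U)),
    X.presheaf.germ U x hx g = a ∧ ∀ y (hy : y ∈ U), X.presheaf.germ U y hy g ∈ I y

/-- The germ `a` comes from a tuple of sections all of whose germs lie in a family of
submodules. -/
def Spread (H : ∀ x : X, Submodule (X.presheaf.stalk x) (ι → St M x)) (x : X) (a : ι → St M x) :
    Prop :=
  ∃ (U : X.Opens) (hx : x ∈ U) (e : ι → Γ(M, U)), gt e x hx = a ∧ ∀ y (hy : y ∈ U), gt e y hy ∈ H y

lemma IdealSpread.zero (I : ∀ x : X, Ideal (X.presheaf.stalk x)) (x : X) : IdealSpread I x 0 :=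
  ⟨⊤, mem_top x, 0, map_zero _, fun y hy => by rw [map_zero]; exact zero_mem _⟩

lemma IdealSpread.add {I : ∀ x : X, Ideal (X.presheaf.stalk x)} {x : X} {a b : X.presheaf.stalk x}
    (ha : IdealSpread I x a) (hb : IdealSpread I x b) : IdealSpread I x (a + b) := by
  obtain ⟨U, hU, e, he, h⟩ := ha
  obtain ⟨U', hU', e', he', h'⟩ := hb
  refine ⟨U ⊓ U', mem_inf hU hU', rs inf_le_left e + rs inf_le_right e', ?_, fun y hy => ?_⟩
  · rw [map_add, germ_rs, germ_rs, he, he']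
  · rw [map_add, germ_rs, germ_rs]
    exact add_mem (h y (mem_left hy)) (h' y (mem_right hy))

lemma IdealSpread.mul {I J : ∀ x : X, Ideal (X.presheaf.stalk x)} {x : X} {a b : X.presheaf.stalk x}
    (ha : IdealSpread I x a) (hb : IdealSpread J x b) :
    IdealSpread (fun x => I x * J x) x (a * b) := by
  obtain ⟨U, hU, e, he, h⟩ := ha
  obtain ⟨U', hU', e', he', h'⟩ := hb
  refine ⟨U ⊓ U', mem_inf hU hU', rs inf_le_left e * rs inf_le_right e', ?_, fun y hy => ?_⟩
  · rw [map_mul, germ_rs, germ_rs, he, he']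
  · rw [map_mul, germ_rs, germ_rs]
    exact Ideal.mul_mem_mul (h y (mem_left hy)) (h' y (mem_right hy))

lemma IdealSpread.mono {I J : ∀ x : X, Ideal (X.presheaf.stalk x)} {x : X} {a : X.presheaf.stalk x}
    (hIJ : ∀ x, I x ≤ J x) (ha : IdealSpread I x a) : IdealSpread J x a := by
  obtain ⟨U, hU, e, he, h⟩ := ha
  exact ⟨U, hU, e, he, fun y hy => hIJ y (h y hy)⟩

lemma IdealSpread.top (x : X) (a : X.presheaf.stalk x) : IdealSpread (fun _ => ⊤) x a := by
  obtain ⟨U, hU, g, rfl⟩ := TopCat.Presheaf.exists_germ_eq X.presheaf a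
  exact ⟨U, hU, g, rfl, fun _ _ => trivial⟩

lemma IdealSpread.mul_left {I : ∀ x : X, Ideal (X.presheaf.stalk x)} {x : X}
    (r : X.presheaf.stalk x) {a : X.presheaf.stalk x} (ha : IdealSpread I x a) :
    IdealSpread I x (r * a) :=
  IdealSpread.mono (I := fun y => (⊤ : Ideal (X.presheaf.stalk y)) * I y)
    (fun _ => Ideal.mul_le_right) ((IdealSpread.top x r).mul ha)

lemma Spread.zero (H : ∀ x : X, Submodule (X.presheaf.stalk x) (ι → St M x)) (x : X) :
    Spread H x 0 :=
  ⟨⊤, mem_top x, 0, gt_zero _ _, fun y hy => by rw [gt_zero]; exact zero_mem _⟩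

lemma Spread.add {H : ∀ x : X, Submodule (X.presheaf.stalk x) (ι → St M x)} {x : X}
    {a b : ι → St M x} (ha : Spread H x a) (hb : Spread H x b) : Spread H x (a + b) := by
  obtain ⟨U, hU, e, he, h⟩ := ha
  obtain ⟨U', hU', e', he', h'⟩ := hb
  refine ⟨U ⊓ U', mem_inf hU hU', rt inf_le_left e + rt inf_le_right e', ?_, fun y hy => ?_⟩
  · rw [gt_add, gt_rt, gt_rt, he, he']
  · rw [gt_add, gt_rt, gt_rt]
    exact add_mem (h y (mem_left hy)) (h' y (mem_right hy))

lemma Spread.mono {H H' : ∀ x : X, Submodule (X.presheaf.stalk x) (ι → St M x)} {x : X}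
    {a : ι → St M x} (hHH' : ∀ x, H x ≤ H' x) (ha : Spread H x a) : Spread H' x a := by
  obtain ⟨U, hU, e, he, h⟩ := ha
  exact ⟨U, hU, e, he, fun y hy => hHH' y (h y hy)⟩

lemma Spread.smul {I : ∀ x : X, Ideal (X.presheaf.stalk x)}
    {H : ∀ x : X, Submodule (X.presheaf.stalk x) (ι → St M x)} {x : X} {r : X.presheaf.stalk x}
    {a : ι → St M x} (hr : IdealSpread I x r) (ha : Spread H x a) :
    Spread (fun x => I x • H x) x (r • a) := by
  obtain ⟨U, hU, g, hg, h⟩ := hr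
  obtain ⟨U', hU', e, he, h'⟩ := ha
  refine ⟨U ⊓ U', mem_inf hU hU', fun i => (rs inf_le_left g : Γ(X, U ⊓ U')) •
    (rt inf_le_right e i : Γ(M, U ⊓ U')),
    ?_, fun y hy => ?_⟩
  · rw [gt_smul, germ_rs, hg]
    exact congrArg (r • ·) ((gt_rt _ _ _ _).trans he)
  · rw [gt_smul, germ_rs]
    refine Submodule.smul_mem_smul (h y (mem_left hy)) ?_
    exact (gt_rt inf_le_right e y hy).symm ▸ (h' y (mem_right hy))

lemma Spread.smul_left {H : ∀ x : X, Submodule (X.presheaf.stalk x) (ι → St M x)} {x : X}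
    (r : X.presheaf.stalk x) {a : ι → St M x} (ha : Spread H x a) : Spread H x (r • a) :=
  (Spread.smul (IdealSpread.top x r) ha).mono fun _ => Submodule.smul_le_right

/-- A family of ideals of the local rings, generated by sections over open sets. -/
@[ext]
structure IdFam (X : Scheme.{0}) where
  at' : ∀ x : X, Ideal (X.presheaf.stalk x)
  spread : ∀ x, ∀ a ∈ at' x, IdealSpread at' x a

/-- A family of submodules of the powers of the stalks of an `𝒪_X`-module, generated by sections
over open sets. -/
@[ext]
structure Fam (M : X.Modules) (ι : Type) where
  at' : ∀ x : X, Submodule (X.presheaf.stalk x) (ι → St M x)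
  spread : ∀ x, ∀ a ∈ at' x, Spread at' x a

/-- Membership in a family is an open condition: tuples with the same germ at `x` have the same
germs near `x`, so it propagates from the witness provided by `spread`. This gives the property
`germ_eq` for the quotient sheaves. -/
lemma Fam.near [Finite ι] (H : Fam M ι) {U : X.Opens} {x : X} {hx : x ∈ U} {e : ι → Γ(M, U)}
    (h : gt e x hx ∈ H.at' x) : ∃ (V : X.Opens) (_ : x ∈ V), ∀ y (_ : y ∈ V) (hy : y ∈ U),
      gt e y hy ∈ H.at' y := by
  obtain ⟨V, hV, e', he, h'⟩ := H.spread x _ h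
  obtain ⟨W, hW, h⟩ := gt_eq_near he
  refine ⟨V ⊓ W, mem_inf hV hW, fun y hy hyU => ?_⟩
  rw [← h y (mem_right hy) (mem_left hy) hyU]
  exact h' y (mem_left hy)

instance : LE (Fam M ι) := ⟨fun H H' => ∀ x, H.at' x ≤ H'.at' x⟩

/-- The sum of two families. -/
instance : Max (Fam M ι) := ⟨fun H H' => ⟨fun x => H.at' x ⊔ H'.at' x, fun x a ha => by
  obtain ⟨b, hb, c, hc, rfl⟩ := Submodule.mem_sup.1 ha
  exact ((H.spread x b hb).mono fun _ => le_sup_left).add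
    ((H'.spread x c hc).mono fun _ => le_sup_right)⟩⟩

@[simp] lemma Fam.sup_at (H H' : Fam M ι) (x : X) : (H ⊔ H').at' x = H.at' x ⊔ H'.at' x := rfl

/-- The zero family. -/
instance : Bot (Fam M ι) := ⟨⟨fun _ => ⊥, fun x a ha => by
  rw [(Submodule.mem_bot _).1 ha]
  exact Spread.zero _ _⟩⟩

/-- The family of the whole stalks. -/
def Fam.full (M : X.Modules) (ι : Type) [Finite ι] : Fam M ι := ⟨fun _ => ⊤, fun x a _ => by
  obtain ⟨U, hU, e, rfl⟩ := exists_gt a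
  exact ⟨U, hU, e, rfl, fun _ _ => trivial⟩⟩

/-- The product of a family of ideals and a family of submodules. -/
instance : SMul (IdFam X) (Fam M ι) := ⟨fun I H => ⟨fun x => I.at' x • H.at' x, fun x a ha => by
  refine Submodule.smul_induction_on ha (fun r hr m hm => ?_) (fun m m' hm hm' => hm.add hm')
  exact Spread.smul (I.spread x r hr) (H.spread x m hm)⟩⟩

@[simp] lemma Fam.smul_at (I : IdFam X) (H : Fam M ι) (x : X) :
    (I • H).at' x = I.at' x • H.at' x := rfl

/-- The family generated by the multiples of tuples of global functions. -/
def Fam.ofVectors (M : X.Modules) {ι : Type} (W : Set (ι → Γ(X, ⊤))) : Fam M ι :=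
  ⟨fun x => Submodule.span _ {a | ∃ w ∈ W, ∃ m : St M x,
    a = fun i => X.presheaf.germ ⊤ x (mem_top x) (w i) • m}, fun x a ha => by
  induction ha using Submodule.span_induction with
  | mem a ha =>
    obtain ⟨w, hw, m, rfl⟩ := ha
    obtain ⟨U, hU, e, rfl⟩ := exists_germM m
    have key : ∀ y (hy : y ∈ U), gt (fun i => (rs le_top (w i) : Γ(X, U)) • e) y hy =
        fun i => X.presheaf.germ ⊤ y (mem_top y) (w i) • germM y hy e := by
      intro y hy
      funext i
      refine (germM_smul _ _ _ _).trans ?_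
      rw [germ_rs]
    refine ⟨U, hU, _, key x hU, fun y hy => ?_⟩
    rw [key]
    exact Submodule.subset_span ⟨w, hw, _, rfl⟩
  | zero => exact Spread.zero _ _
  | add m m' _ _ hm hm' => exact hm.add hm'
  | smul r m _ hm => exact hm.smul_left r⟩

/-- The product of two families of ideals. -/
instance : Mul (IdFam X) := ⟨fun I J => ⟨fun x => I.at' x * J.at' x, fun x a ha => by
  refine Submodule.mul_induction_on ha (fun r hr m hm => ?_) (fun m m' hm hm' => hm.add hm')
  exact (I.spread x r hr).mul (J.spread x m hm)⟩⟩

@[simp] lemma IdFam.mul_at (I J : IdFam X) (x : X) : (I * J).at' x = I.at' x * J.at' x := rfl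

/-- The sum of two families of ideals. -/
instance : Max (IdFam X) := ⟨fun I J => ⟨fun x => I.at' x ⊔ J.at' x, fun x a ha => by
  obtain ⟨b, hb, c, hc, rfl⟩ := Submodule.mem_sup.1 ha
  exact ((I.spread x b hb).mono fun _ => le_sup_left).add
    ((J.spread x c hc).mono fun _ => le_sup_right)⟩⟩

@[simp] lemma IdFam.sup_at (I J : IdFam X) (x : X) : (I ⊔ J).at' x = I.at' x ⊔ J.at' x := rfl

instance : Bot (IdFam X) := ⟨⟨fun _ => ⊥, fun x a ha => by
  rw [(Submodule.mem_bot _).1 ha]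
  exact IdealSpread.zero _ _⟩⟩

instance : One (IdFam X) := ⟨⟨fun _ => ⊤, fun x a _ => IdealSpread.top x a⟩⟩

/-- The stalks of an ideal sheaf. -/
def IdFam.ofIdealSheaf (J : X.IdealSheafData) : IdFam X :=
  ⟨fun x => Submodule.span _ {a | ∃ (U : X.affineOpens) (hx : x ∈ U.1), ∃ g ∈ J.ideal U,
        X.presheaf.germ U.1 x hx g = a},
    fun x a ha => by
  induction ha using Submodule.span_induction with
  | mem a ha =>
    obtain ⟨U, hU, g, hg, rfl⟩ := ha
    exact ⟨U.1, hU, g, rfl, fun y hy => Submodule.subset_span ⟨U, hy, g, hg, rfl⟩⟩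
  | zero => exact IdealSpread.zero _ _
  | add m m' _ _ hm hm' => exact hm.add hm'
  | smul r m _ hm => exact hm.mul_left r⟩

lemma IdFam.map_le_ofIdealSheaf (J : X.IdealSheafData) (x : X) (U : X.affineOpens) (hx : x ∈ U.1) :
    (J.ideal U).map (X.presheaf.germ U.1 x hx).hom ≤ (IdFam.ofIdealSheaf J).at' x :=
  Ideal.map_le_iff_le_comap.2 fun g hg => Submodule.subset_span ⟨U, hx, g, hg, rfl⟩

end Fam

/-! ### Quotients of families as sheaves -/

section Quot

variable {X : Scheme.{0}} {M : X.Modules} {ι : Type} [Finite ι]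

/-- The sheaf of classes modulo `H₂` of the sections of `H₁`. -/
def quotSheaf (H₁ H₂ : Fam M ι) : EtSheaf X.toTopCat where
  T x := (ι → St M x) ⧸ H₂.at' x
  P :=
    { pred := fun {U} s => ∀ x : U, ∃ (V : X.Opens) (_ : x.1 ∈ V) (e : ι → Γ(M, V)),
        ∀ y (hU : y ∈ U) (hV : y ∈ V), gt e y hV ∈ H₁.at' y ∧
          s ⟨y, hU⟩ = Submodule.Quotient.mk (gt e y hV)
      res := fun {U V} i s hs x => by
        obtain ⟨W, hx, e, h⟩ := hs ⟨x.1, i.le x.2⟩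
        exact ⟨W, hx, e, fun y hU hV => h y (i.le hU) hV⟩
      locality := fun {U} s hs x => by
        obtain ⟨V, hx, i, h⟩ := hs x
        obtain ⟨W, hxW, e, h⟩ := h ⟨x.1, hx⟩
        refine ⟨W ⊓ V, mem_inf hxW hx, rt inf_le_left e, fun y hU hV => ?_⟩
        rw [gt_rt]
        exact h y (mem_right hV) (mem_left hV) }
  zero_mem U x := ⟨⊤, mem_top _, 0, fun y _ hV => by
    rw [gt_zero]
    exact ⟨zero_mem _, rfl⟩⟩
  add_mem hs ht x := by
    obtain ⟨V, hx, e, h⟩ := hs x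
    obtain ⟨V', hx', e', h'⟩ := ht x
    refine ⟨V ⊓ V', mem_inf hx hx', rt inf_le_left e + rt inf_le_right e', fun y hU hV => ?_⟩
    rw [gt_add, gt_rt, gt_rt]
    exact ⟨add_mem (h y hU (mem_left hV)).1 (h' y hU (mem_right hV)).1,
      congrArg₂ (· + ·) (h y hU (mem_left hV)).2 (h' y hU (mem_right hV)).2⟩
  neg_mem hs x := by
    obtain ⟨V, hx, e, h⟩ := hs x
    refine ⟨V, hx, -e, fun y hU hV => ?_⟩
    rw [gt_neg]
    exact ⟨neg_mem (h y hU hV).1, congrArg (- ·) (h y hU hV).2⟩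
  germ_eq {U s t} hs ht x hst := by
    obtain ⟨V, hx, e, h⟩ := hs x
    obtain ⟨V', hx', e', h'⟩ := ht x
    rw [(h _ x.2 hx).2, (h' _ x.2 hx').2, Submodule.Quotient.eq] at hst
    have key : ∀ y (hy : y ∈ V ⊓ V'), gt (rt inf_le_left e + -rt inf_le_right e') y hy =
        gt e y (mem_left hy) - gt e' y (mem_right hy) := by
      intro y hy
      rw [gt_add, gt_neg, gt_rt, gt_rt, sub_eq_add_neg]
    rw [← key x.1 (mem_inf hx hx')] at hst
    obtain ⟨W, hW, hn⟩ := H₂.near hst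
    refine ⟨W ⊓ (V ⊓ V'), mem_inf hW (mem_inf hx hx'), fun y hy => ?_⟩
    have := hn y.1 (mem_left hy) (mem_right hy)
    rw [key] at this
    rw [(h y.1 y.2 (mem_left (mem_right hy))).2, (h' y.1 y.2 (mem_right (mem_right hy))).2]
    exact (Submodule.Quotient.eq _).2 this

/-- No inclusion of `H₂` in `H₁` is assumed: the sheaf stands for the image of `H₁` modulo `H₂`,
that is, for H₁ / (H₁ ∩ H₂). -/
lemma quotSheaf_isValue_iff {H₁ H₂ : Fam M ι} {x : X} (v : (ι → St M x) ⧸ H₂.at' x) :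
    (quotSheaf H₁ H₂).IsValue x v ↔ ∃ m ∈ H₁.at' x, Submodule.Quotient.mk m = v := by
  constructor
  · rintro ⟨U, hx, s, hs, rfl⟩
    obtain ⟨V, hxV, e, h⟩ := hs ⟨x, hx⟩
    exact ⟨_, (h x hx hxV).1, (h x hx hxV).2.symm⟩
  · rintro ⟨m, hm, rfl⟩
    obtain ⟨U, hx, e, rfl, h⟩ := H₁.spread x m hm
    exact ⟨U, hx, fun y => Submodule.Quotient.mk (gt e y.1 y.2),
      fun z => ⟨U, z.2, e, fun y _ hV => ⟨h y hV, rfl⟩⟩, rfl⟩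

/-- The quotient of two families has no higher cohomology. -/
def Acyc (H₁ H₂ : Fam M ι) : Prop := (quotSheaf H₁ H₂).IsAcyclic

variable {M' : X.Modules} {ι' : Type} [Finite ι']

/-- Additive maps between the powers of the stalks which send sections to sections. -/
structure FibreMap (M : X.Modules) (ι : Type) (M' : X.Modules) (ι' : Type) where
  φ : ∀ x : X, (ι → St M x) →+ (ι' → St M' x)
  spread : ∀ {U : X.Opens} (e : ι → Γ(M, U)) (x : X), x ∈ U →
    ∃ (V : X.Opens) (_ : x ∈ V) (e' : ι' → Γ(M', V)), ∀ y (hU : y ∈ U) (hV : y ∈ V),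
      gt e' y hV = φ y (gt e y hU)

/-- The identity. -/
def FibreMap.id (M : X.Modules) (ι : Type) : FibreMap M ι M ι :=
  ⟨fun _ => AddMonoidHom.id _, fun {U} e _ hx => ⟨U, hx, e, fun _ _ _ => rfl⟩⟩

/-- The induced map between quotients. -/
def FibreMap.hom (f : FibreMap M ι M' ι') {H₁ H₂ : Fam M ι} {H₁' H₂' : Fam M' ι'}
    (h₁ : ∀ x, ∀ m ∈ H₁.at' x, f.φ x m ∈ H₁'.at' x)
    (h₂ : ∀ x, ∀ m ∈ H₂.at' x, f.φ x m ∈ H₂'.at' x) :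
    EtSheaf.Hom (quotSheaf H₁ H₂) (quotSheaf H₁' H₂') where
  φ x := QuotientAddGroup.map (H₂.at' x).toAddSubgroup (H₂'.at' x).toAddSubgroup (f.φ x) (h₂ x)
  pred {U s} hs x := by
    obtain ⟨V, hx, e, h⟩ := hs x
    obtain ⟨W, hxW, e', h'⟩ := f.spread e x.1 hx
    refine ⟨W ⊓ V, mem_inf hxW hx, rt inf_le_left e', fun y hU hV => ?_⟩
    rw [gt_rt, h' y (mem_right hV) (mem_left hV)]
    exact ⟨h₁ y _ (h y hU (mem_right hV)).1,
      congrArg (QuotientAddGroup.map (H₂.at' y).toAddSubgroup (H₂'.at' y).toAddSubgroup (f.φ y)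
        (h₂ y)) (h y hU (mem_right hV)).2⟩

/-- From the exact sequence 0 → H₂/H₃ → H₁/H₃ → H₁/H₂ → 0. The dévissages below are iterations of
this. -/
lemma Acyc.trans {H₁ H₂ H₃ : Fam M ι} (h₁₂ : H₂ ≤ H₁) (h₂₃ : H₃ ≤ H₂) (h : Acyc H₁ H₂)
    (h' : Acyc H₂ H₃) : Acyc H₁ H₃ := by
  refine EtSheaf.isAcyclic_of_exact
    ((FibreMap.id M ι).hom (H₁ := H₂) (H₂ := H₃) (H₁' := H₁) (H₂' := H₃)
      (fun x m hm => h₁₂ x hm) (fun x m hm => hm))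
    ((FibreMap.id M ι).hom (H₁ := H₁) (H₂ := H₃) (H₁' := H₁) (H₂' := H₂)
      (fun x m hm => hm) (fun x m hm => h₂₃ x hm)) ?_ ?_ ?_ ?_ h' h
  · intro x v hv hv'
    obtain ⟨m, hm, rfl⟩ := (quotSheaf_isValue_iff _).1 hv
    exact hv'
  · intro x v hv
    obtain ⟨m, hm, rfl⟩ := (quotSheaf_isValue_iff _).1 hv
    exact (Submodule.Quotient.mk_eq_zero _).2 hm
  · intro x v hv hv'
    obtain ⟨m, hm, rfl⟩ := (quotSheaf_isValue_iff _).1 hv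
    exact ⟨Submodule.Quotient.mk m, (quotSheaf_isValue_iff _).2 ⟨m,
      (Submodule.Quotient.mk_eq_zero _).1 hv', rfl⟩, rfl⟩
  · intro x v hv
    obtain ⟨m, hm, rfl⟩ := (quotSheaf_isValue_iff _).1 hv
    exact ⟨Submodule.Quotient.mk m, (quotSheaf_isValue_iff _).2 ⟨m, hm, rfl⟩, rfl⟩

/-- A map between powers of different modules is allowed, since only the induced map of the
quotients has to be bijective on values. -/
lemma Acyc.iff_of_fibreMap (f : FibreMap M ι M' ι') {H₁ H₂ : Fam M ι} {H₁' H₂' : Fam M' ι'}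
    (h₁ : ∀ x, ∀ m ∈ H₁.at' x, f.φ x m ∈ H₁'.at' x)
    (h₂ : ∀ x, ∀ m ∈ H₂.at' x, f.φ x m ∈ H₂'.at' x)
    (inj : ∀ x, ∀ m ∈ H₁.at' x, f.φ x m ∈ H₂'.at' x → m ∈ H₂.at' x)
    (surj : ∀ x, ∀ m ∈ H₁'.at' x, ∃ n ∈ H₁.at' x, m - f.φ x n ∈ H₂'.at' x) :
    Acyc H₁ H₂ ↔ Acyc H₁' H₂' := by
  refine EtSheaf.isAcyclic_iff_of_bijective (f.hom h₁ h₂) ?_ ?_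
  · intro x v hv hv'
    obtain ⟨m, hm, rfl⟩ := (quotSheaf_isValue_iff _).1 hv
    exact (Submodule.Quotient.mk_eq_zero _).2
      (inj x m hm ((Submodule.Quotient.mk_eq_zero _).1 hv'))
  · intro x v hv
    obtain ⟨m, hm, rfl⟩ := (quotSheaf_isValue_iff _).1 hv
    obtain ⟨n, hn, h⟩ := surj x m hm
    refine ⟨Submodule.Quotient.mk n, (quotSheaf_isValue_iff _).2 ⟨n, hn, rfl⟩, ?_⟩
    exact ((Submodule.Quotient.eq _).2 h).symm

lemma Acyc.of_le {H₁ H₂ : Fam M ι} (h : H₁ ≤ H₂) : Acyc H₁ H₂ := by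
  refine EtSheaf.isAcyclic_of_values_zero fun x v hv => ?_
  obtain ⟨m, hm, rfl⟩ := (quotSheaf_isValue_iff _).1 hv
  exact (Submodule.Quotient.mk_eq_zero _).2 (h x hm)

/-- The second isomorphism theorem. -/
lemma Acyc.iff_of_sup {H₁ H₂ H₁' H₂' : Fam M ι} (h₁ : ∀ x, H₁'.at' x = H₁.at' x ⊔ H₂'.at' x)
    (h₂ : ∀ x, H₂.at' x = H₁.at' x ⊓ H₂'.at' x) : Acyc H₁ H₂ ↔ Acyc H₁' H₂' := by
  refine Acyc.iff_of_fibreMap (FibreMap.id M ι) (fun x m hm => ?_) (fun x m hm => ?_)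
    (fun x m hm hm' => ?_) (fun x m hm => ?_)
  · rw [h₁]
    exact Submodule.mem_sup_left hm
  · rw [h₂] at hm
    exact hm.2
  · rw [h₂]
    exact ⟨hm, hm'⟩
  · rw [h₁] at hm
    obtain ⟨a, ha, b, hb, rfl⟩ := Submodule.mem_sup.1 hm
    refine ⟨a, ha, ?_⟩
    change a + b - a ∈ _
    rwa [add_sub_cancel_left]

end Quot

end LogBott

namespace LogBott

/-! ### The abelian sheaf underlying a tensor product -/

/-- A locally bijective morphism to a sheaf identifies the associated sheaf. -/
lemma nonempty_iso_of_locally_bijective {X : TopCat.{0}} {P : TopCat.Presheaf AddCommGrpCat.{0} X}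
    {Q : AbSheaf X} (α : P ⟶ Q.obj)
    (inj : ∀ (U : Opens X) (s : P.obj (op U)), α.app (op U) s = 0 → ∀ x ∈ U,
      ∃ (V : Opens X) (i : V ⟶ U), x ∈ V ∧ P.map i.op s = 0)
    (surj : ∀ (U : Opens X) (t : Q.obj.obj (op U)), ∀ x ∈ U,
      ∃ (V : Opens X) (i : V ⟶ U) (s : P.obj (op V)), x ∈ V ∧
        α.app (op V) s = Q.obj.map i.op t) :
    Nonempty ((presheafToSheaf (Opens.grothendieckTopology X) AddCommGrpCat.{0}).obj P ≅ Q) := by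
  have h1 : Presheaf.IsLocallySurjective (Opens.grothendieckTopology X) α :=
    (TopCat.Presheaf.isLocallySurjective_iff (ℱ := P) (𝒢 := Q.obj) α).2 fun U t x hx => by
      obtain ⟨V, i, s, hxV, hs⟩ := surj U t x hx
      exact ⟨V, i.le, ⟨s, hs⟩, hxV⟩
  have h2 : Presheaf.IsLocallyInjective (Opens.grothendieckTopology X) α := by
    refine ⟨fun {U} s t h x hx => ?_⟩
    have h0 : α.app U (s - t) = 0 := (map_sub (α.app U).hom s t).trans (sub_eq_zero.2 h)
    obtain ⟨V, i, hxV, hi⟩ := inj U.unop (s - t) h0 x hx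
    refine ⟨V, i, ?_, hxV⟩
    exact sub_eq_zero.1 ((map_sub (P.map i.op).hom s t).symm.trans hi)
  have hW := (GrothendieckTopology.W_iff_isLocallyBijective (Opens.grothendieckTopology X) α).2 ⟨h2, h1⟩
  have := ((Opens.grothendieckTopology X).W_iff α).1 hW
  exact ⟨asIso ((presheafToSheaf (Opens.grothendieckTopology X) AddCommGrpCat.{0}).map α) ≪≫
    asIso ((sheafificationAdjunction (Opens.grothendieckTopology X)
      AddCommGrpCat.{0}).counit.app Q)⟩

lemma EtSheaf.add_apply {X : TopCat.{0}} {S : EtSheaf X} {U : Opens X} (s t : S.sections U)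
    (x : U) : (s + t).1 x = s.1 x + t.1 x := rfl

section Tensor

variable {X : Scheme.{0}} (M N : X.Modules)

/-- The tensor product of the sections. -/
abbrev TensorSections (U : X.Opens) : Type := TensorProduct Γ(X, U) Γ(M, U) Γ(N, U)

/-- The presheaf of the tensor products of the sections. -/
def tensorPresheaf : TopCat.Presheaf AddCommGrpCat.{0} X.toTopCat :=
  (PresheafOfModules.Monoidal.tensorObj (R := X.presheaf)
      ((Scheme.Modules.toPresheafOfModules X).obj M)
      ((Scheme.Modules.toPresheafOfModules X).obj N)).presheaf

variable {M N}

/-- The restriction of tensors. -/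
def tensorRes {U V : X.Opens} (i : V ⟶ U) : TensorSections M N U →+ TensorSections M N V :=
  ((tensorPresheaf M N).map i.op).hom

lemma tensorRes_tmul {U V : X.Opens} (i : V ⟶ U) (m : Γ(M, U)) (n : Γ(N, U)) :
    tensorRes i (m ⊗ₜ[Γ(X, U)] n) =
      (M.presheaf.map i.op m) ⊗ₜ[Γ(X, V)] (N.presheaf.map i.op n) := rfl

/-- A criterion for a family of pairings to identify the tensor product. -/
lemma nonempty_tensor_iso {Q : AbSheaf X.toTopCat}
    (β : ∀ U : X.Opens, TensorSections M N U →+ Q.obj.obj (op U))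
    (nat : ∀ (U V : X.Opens) (i : V ⟶ U) (m : Γ(M, U)) (n : Γ(N, U)),
      β V ((M.presheaf.map i.op m) ⊗ₜ[Γ(X, V)] (N.presheaf.map i.op n)) =
        Q.obj.map i.op (β U (m ⊗ₜ[Γ(X, U)] n)))
    (inj : ∀ (U : X.Opens) (s : TensorSections M N U), β U s = 0 → ∀ x ∈ U,
      ∃ (V : X.Opens) (i : V ⟶ U), x ∈ V ∧ tensorRes i s = 0)
    (surj : ∀ (U : X.Opens) (t : Q.obj.obj (op U)), ∀ x ∈ U,
      ∃ (V : X.Opens) (i : V ⟶ U) (s : TensorSections M N V), x ∈ V ∧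
        β V s = Q.obj.map i.op t) :
    Nonempty (abelianSheaf (tensor M N) ≅ Q) := by
  refine nonempty_iso_of_locally_bijective (P := tensorPresheaf M N)
    { app := fun U => AddCommGrpCat.ofHom (β U.unop)
      naturality := fun U V i => ?_ } inj surj
  ext s
  change TensorSections M N U.unop at s
  change β V.unop (tensorRes i.unop s) = Q.obj.map i (β U.unop s)
  induction s using TensorProduct.induction_on with
  | zero =>
    rw [map_zero, map_zero, map_zero]
    exact (map_zero (Q.obj.map i).hom).symm
  | tmul m n => exact nat _ _ i.unop m n
  | add s t hs ht =>
    rw [map_add, map_add, map_add, hs, ht]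
    exact (map_add (Q.obj.map i).hom _ _).symm

lemma tensorRes_comp {U V W : X.Opens} (i : V ⟶ U) (j : W ⟶ V) (s : TensorSections M N U) :
    tensorRes j (tensorRes i s) = tensorRes (j ≫ i) s :=
  (ConcreteCategory.congr_hom ((tensorPresheaf M N).map_comp i.op j.op) s).symm

end Tensor

/-! ### The tensor product with a lattice sheaf -/

section LatticeTensor

variable {X : Scheme.{0}} [IsIntegral X] {V : Type} [AddCommGroup V] [Module X.functionField V]
  {ι : Type} (b : Module.Basis ι X.functionField V)
  (L : ∀ x : X, Submodule (localRing x) V) (E : X.Modules)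

lemma ofGerm_injective (x : X) : Function.Injective (ofGerm x) :=
  IsFractionRing.injective (X.presheaf.stalk x) X.functionField

lemma ofGerm_germ {U : X.Opens} (g : Γ(X, U)) (x y : X) (hx : x ∈ U) (hy : y ∈ U) :
    ofGerm x (X.presheaf.germ U x hx g) = ofGerm y (X.presheaf.germ U y hy g) :=
  toRational_const g ⟨x, hx⟩ ⟨y, hy⟩

lemma ofGerm_add (x : X) (a c : X.presheaf.stalk x) :
    ofGerm x (a + c) = ofGerm x a + ofGerm x c := map_add _ _ _

lemma ofGerm_mul (x : X) (a c : X.presheaf.stalk x) :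
    ofGerm x (a * c) = ofGerm x a * ofGerm x c := map_mul _ _ _

lemma ofGerm_zero (x : X) : ofGerm x 0 = 0 := map_zero _

/-- The local coordinates of a vector, when they are integral. -/
def coef (x : X) (v : V) (i : ι) : X.presheaf.stalk x :=
  open Classical in if h : b.repr v i ∈ localRing x then h.choose else 0

variable {b} in
lemma ofGerm_coef {x : X} {v : V} {i : ι} (h : b.repr v i ∈ localRing x) :
    ofGerm x (coef b x v i) = b.repr v i := by
  rw [coef, dif_pos h]
  exact h.choose_spec

/-- The lattice `L` consists of vectors with integral coordinates and is locally generated by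
vectors whose coordinates are independent on `E`. -/
structure IsFrame : Prop where
  spread : ∀ x, ∀ v ∈ L x, ∃ U : X.Opens, x ∈ U ∧ ∀ y ∈ U, v ∈ L y
  integral : ∀ x, ∀ v ∈ L x, ∀ i, b.repr v i ∈ localRing x
  independent : ∀ x, ∃ (κ : Type) (_ : Fintype κ) (l : κ → V), (∀ q, l q ∈ L x) ∧
    L x ≤ Submodule.span (localRing x) (Set.range l) ∧
    ∀ n : κ → St E x, (∀ i, ∑ q, coef b x (l q) i • n q = 0) → n = 0

variable {b L E}

lemma IsFrame.coef_add (h : IsFrame b L E) {x : X} {v w : V} (hv : v ∈ L x) (hw : w ∈ L x) (i : ι) :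
    coef b x (v + w) i = coef b x v i + coef b x w i := by
  apply ofGerm_injective
  rw [ofGerm_add, ofGerm_coef (h.integral x _ hv i), ofGerm_coef (h.integral x _ hw i),
    ofGerm_coef (h.integral x _ (add_mem hv hw) i), map_add, Finsupp.add_apply]

lemma IsFrame.coef_smul (h : IsFrame b L E) {x : X} {v : V} (hv : v ∈ L x) (i : ι)
    (a : X.presheaf.stalk x) : coef b x (ofGerm x a • v) i = a * coef b x v i := by
  apply ofGerm_injective
  have hav : ofGerm x a • v ∈ L x := (L x).smul_mem ⟨ofGerm x a, ⟨a, rfl⟩⟩ hv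
  rw [ofGerm_mul, ofGerm_coef (h.integral x _ hv i), ofGerm_coef (h.integral x _ hav i), map_smul,
    Finsupp.smul_apply, smul_eq_mul]

variable [Fintype ι]

/-- The coordinates of `v` are rational functions. Their germs at `x` extend to sections on a
neighbourhood, and since the local rings embed in the function field these sections still give the
coordinates at the nearby points. -/
lemma IsFrame.exists_coef (h : IsFrame b L E) {x : X} {v : V} (hv : v ∈ L x) :
    ∃ (U : X.Opens) (_ : x ∈ U) (g : ι → Γ(X, U)), ∀ y (hy : y ∈ U), v ∈ L y ∧
      ∀ i, coef b y v i = X.presheaf.germ U y hy (g i) := by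
  obtain ⟨U, hU, hUv⟩ := h.spread x v hv
  choose W hW g hg using fun i => TopCat.Presheaf.exists_germ_eq X.presheaf (coef b x v i)
  have hle : ∀ i, U ⊓ Finset.univ.inf W ≤ W i :=
    fun i => inf_le_right.trans (Finset.inf_le (Finset.mem_univ i))
  have hxW : x ∈ Finset.univ.inf W := by
    rw [← SetLike.mem_coe, Opens.coe_finset_inf]
    simpa using hW
  refine ⟨U ⊓ Finset.univ.inf W, mem_inf hU hxW, fun i => rs (hle i) (g i),
    fun y hy => ⟨hUv y (mem_left hy), fun i => ?_⟩⟩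
  apply ofGerm_injective
  rw [ofGerm_coef (h.integral y _ (hUv y (mem_left hy)) i), germ_rs,
    ofGerm_germ (g i) y x (hle i hy) (hW i)]
  erw [hg i]
  rw [ofGerm_coef (h.integral x _ hv i)]

/-- The family of submodules of the powers of the stalks of `E` corresponding to the tensor product
of a lattice with `E`. -/
def IsFrame.fam (h : IsFrame b L E) : Fam E ι where
  at' x := Submodule.span _ {a | ∃ v ∈ L x, ∃ m : St E x, a = fun i => coef b x v i • m}
  spread x a ha := by
    induction ha using Submodule.span_induction with
    | mem a ha =>
      obtain ⟨v, hv, m, rfl⟩ := ha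
      obtain ⟨U, hU, e, rfl⟩ := exists_germM m
      obtain ⟨W, hW, g, hg⟩ := h.exists_coef hv
      have key : ∀ y (hy : y ∈ U ⊓ W), gt (fun i => (rs inf_le_right (g i) : Γ(X, U ⊓ W)) •
          E.presheaf.map (homOfLE inf_le_left).op e) y hy =
          fun i => coef b y v i • germM y (mem_left hy) e := by
        intro y hy
        funext i
        refine (germM_smul _ _ _ _).trans ?_
        rw [germ_rs, (hg y (mem_right hy)).2 i]
        exact congrArg _ (germM_res _ _ _ _)
      refine ⟨U ⊓ W, mem_inf hU hW, _, key x (mem_inf hU hW), fun y hy => ?_⟩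
      rw [key]
      exact Submodule.subset_span ⟨v, (hg y (mem_right hy)).1, _, rfl⟩
    | zero => exact Spread.zero _ _
    | add m m' _ _ hm hm' => exact hm.add hm'
    | smul r m _ hm => exact hm.smul_left r

lemma IsFrame.fam_at (h : IsFrame b L E) (x : X) : h.fam.at' x =
    Submodule.span _ {a | ∃ v ∈ L x, ∃ m : St E x, a = fun i => coef b x v i • m} := rfl

/-- The value at `x` of the product of a section of a lattice sheaf and a section of `E`. -/
def IsFrame.pairing (h : IsFrame b L E) (U : X.Opens) :
    TensorSections (latticeSheaf L) E U →+ (quotSheaf h.fam ⊥).sections U :=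
  TensorProduct.liftAddHom (R := Γ(X, U)) (M := latticeSections L U) (N := Γ(E, U))
    (AddMonoidHom.mk' (fun s : latticeSections L U => AddMonoidHom.mk' (fun e : Γ(E, U) =>
      (⟨fun x => Submodule.Quotient.mk (fun i => coef b x.1 (s.1 x) i • germM x.1 x.2 e), by
        intro x
        obtain ⟨W, hW, hxW, hc⟩ := (IsLocallyConstant.iff_exists_open _).mp s.2.1 x
        have hW' := U.isOpen.isOpenMap_subtype_val W hW
        obtain ⟨W₁, hW₁, g, hg⟩ := h.exists_coef (s.2.2 x)
        let W₂ : X.Opens := ⟨Subtype.val '' W, hW'⟩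
        let e' : ι → Γ(E, U ⊓ W₁) := fun i => (rs inf_le_right (g i) : Γ(X, U ⊓ W₁)) •
            E.presheaf.map (homOfLE inf_le_left).op e
        have key : ∀ y (hy : y ∈ U ⊓ W₁), gt e' y hy =
            fun i => coef b y (s.1 x) i • germM y (mem_left hy) e := by
          intro y hy
          funext i
          refine (germM_smul _ _ _ _).trans ?_
          rw [germ_rs, (hg y (mem_right hy)).2 i]
          exact congrArg _ (germM_res _ _ _ _)
        have hx₂ : x.1 ∈ W₂ := ⟨x, hxW, rfl⟩
        refine ⟨W₂ ⊓ (U ⊓ W₁), mem_inf hx₂ (mem_inf x.2 hW₁), rt inf_le_right e',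
          fun y hU hV => ?_⟩
        rw [gt_rt, key y (mem_right hV)]
        refine ⟨Submodule.subset_span ⟨_, (hg y (mem_right (mem_right hV))).1, _, rfl⟩, ?_⟩
        obtain ⟨z, hz, rfl⟩ := mem_left hV
        exact congrArg (fun v => Submodule.Quotient.mk fun i => coef b z.1 v i • germM z.1 hU e)
          (hc z hz)⟩ : (quotSheaf h.fam ⊥).sections U))
      (fun e e' => Subtype.ext <| funext fun x => by
        refine congrArg Submodule.Quotient.mk (a₂ := _ + _) (funext fun i => ?_)
        refine (congrArg _ (map_add _ _ _)).trans ?_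
        rw [smul_add]
        rfl))
      (fun s s' => AddMonoidHom.ext fun e => Subtype.ext <| funext fun x => by
        refine congrArg Submodule.Quotient.mk (a₂ := _ + _) (funext fun i => ?_)
        refine (congrArg (· • germM x.1 x.2 e) (h.coef_add (s.2.2 x) (s'.2.2 x) i)).trans ?_
        rw [add_smul]
        rfl))
    (fun r s e => Subtype.ext <| funext fun x => by
      refine congrArg Submodule.Quotient.mk (funext fun i => ?_)
      refine (congrArg (· • germM x.1 x.2 e) (h.coef_smul (s.2.2 x) i _)).trans ?_
      rw [germM_smul, mul_comm, mul_smul])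

lemma IsFrame.pairing_res (h : IsFrame b L E) {U W : X.Opens} (i : W ⟶ U)
    (s : TensorSections (latticeSheaf L) E U) (y : X) (hy : y ∈ W) :
    (h.pairing W (tensorRes i s)).1 ⟨y, hy⟩ = (h.pairing U s).1 ⟨y, i.le hy⟩ := by
  induction s using TensorProduct.induction_on with
  | zero =>
    rw [map_zero, map_zero, map_zero]
    rfl
  | tmul m n =>
    rw [tensorRes_tmul]
    refine congrArg Submodule.Quotient.mk (funext fun j => ?_)
    exact congrArg _ (germM_res y i.le hy n)
  | add s t hs ht =>
    rw [map_add, map_add, map_add]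
    exact congrArg₂ (· + ·) hs ht

/-- A constant section of a lattice sheaf. -/
def constSection {U : X.Opens} (v : V) (hv : ∀ y ∈ U, v ∈ L y) : Γ(latticeSheaf L, U) :=
  (⟨fun _ => v, IsLocallyConstant.const v, fun y => hv y.1 y.2⟩ : latticeSections L U)

lemma IsFrame.pairing_const (h : IsFrame b L E) {U : X.Opens} (v : V) (hv : ∀ y ∈ U, v ∈ L y)
    (e : Γ(E, U)) (x : X) (hx : x ∈ U) :
    (h.pairing U (constSection v hv ⊗ₜ[Γ(X, U)] e)).1 ⟨x, hx⟩ =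
      Submodule.Quotient.mk (fun i => coef b x v i • germM x hx e) := rfl

lemma tensorRes_const {U W : X.Opens} (i : W ⟶ U) (v : V) (hv : ∀ y ∈ U, v ∈ L y) (e : Γ(E, U)) :
    tensorRes i (constSection v hv ⊗ₜ[Γ(X, U)] e) =
      constSection v (fun y hy => hv y (i.le hy)) ⊗ₜ[Γ(X, W)] (E.presheaf.map i.op e) := rfl

lemma IsFrame.exists_pairing (h : IsFrame b L E) {x : X} {a : ι → St E x} (ha : a ∈ h.fam.at' x) :
    ∃ (U : X.Opens) (hx : x ∈ U) (s : TensorSections (latticeSheaf L) E U),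
      (h.pairing U s).1 ⟨x, hx⟩ = Submodule.Quotient.mk a := by
  -- The tensor products are modules over the sections on open sets, not over the stalk; carrying an
  -- arbitrary scalar `r` through the induction lets it be absorbed into the factor from `E`.
  suffices ∀ r : X.presheaf.stalk x, ∃ (U : X.Opens) (hx : x ∈ U)
      (s : TensorSections (latticeSheaf L) E U),
      (h.pairing U s).1 ⟨x, hx⟩ = Submodule.Quotient.mk (r • a) by
    obtain ⟨U, hx, s, hs⟩ := this 1
    exact ⟨U, hx, s, by rw [hs, one_smul]⟩
  rw [h.fam_at] at ha
  induction ha using Submodule.span_induction with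
  | mem a ha =>
    obtain ⟨v, hv, m, rfl⟩ := ha
    intro r
    obtain ⟨U, hU, e, he⟩ := exists_germM (r • m)
    obtain ⟨W, hW, hWv⟩ := h.spread x v hv
    refine ⟨U ⊓ W, mem_inf hU hW, constSection (L := L) v (fun y hy => hWv y (mem_right hy))
      ⊗ₜ[Γ(X, U ⊓ W)] E.presheaf.map (homOfLE inf_le_left).op e, ?_⟩
    refine (h.pairing_const _ _ _ x _).trans ?_
    refine congrArg Submodule.Quotient.mk (funext fun i => ?_)
    rw [germM_res, he]
    exact smul_comm _ _ _
  | zero =>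
    intro r
    refine ⟨⊤, mem_top x, 0, ?_⟩
    rw [map_zero, smul_zero]
    rfl
  | add m m' _ _ hm hm' =>
    intro r
    obtain ⟨U, hU, s, hs⟩ := hm r
    obtain ⟨U', hU', s', hs'⟩ := hm' r
    refine ⟨U ⊓ U', mem_inf hU hU', tensorRes (homOfLE inf_le_left) s +
      tensorRes (homOfLE inf_le_right) s', ?_⟩
    rw [map_add, smul_add]
    refine (EtSheaf.add_apply _ _ _).trans ?_
    rw [h.pairing_res, h.pairing_res, hs, hs']
    exact (Submodule.Quotient.mk_add _).symm
  | smul r' m _ hm =>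
    intro r
    obtain ⟨U, hU, s, hs⟩ := hm (r * r')
    exact ⟨U, hU, s, by rw [hs, mul_smul]⟩

/-- Near `x` a section of the lattice sheaf is a constant vector, hence a combination of the
generators `l q`, and the coefficients move across the tensor sign. The vanishing of a tensor near
`x` can then be read off the finitely many sections `n q` of `E`. -/
lemma exists_tensor_normal_form {x : X} {κ : Type} [Fintype κ] {l : κ → V}
    {U₀ : X.Opens} (hx₀ : x ∈ U₀) (hl : ∀ q, ∀ y ∈ U₀, l q ∈ L y)
    (hspan : L x ≤ Submodule.span (localRing x) (Set.range l)) {U : X.Opens} (hx : x ∈ U)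
    (s : TensorSections (latticeSheaf L) E U) :
    ∃ (W : X.Opens) (_ : x ∈ W) (i : W ≤ U) (j : W ≤ U₀) (n : κ → Γ(E, W)),
      tensorRes (homOfLE i) s = ∑ q, (constSection (L := L) (l q) (fun y hy => hl q y (j hy)) ⊗ₜ[Γ(X, W)] n q :
        TensorSections (latticeSheaf L) E W) := by
  induction s using TensorProduct.induction_on with
  | zero =>
    refine ⟨U ⊓ U₀, mem_inf hx hx₀, inf_le_left, inf_le_right, 0, ?_⟩
    rw [map_zero]
    refine (Finset.sum_eq_zero fun q _ => ?_).symm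
    exact TensorProduct.tmul_zero _ _
  | tmul s e =>
    let s' : latticeSections L U := s
    obtain ⟨c, hc⟩ := (Submodule.mem_span_range_iff_exists_fun _).1 (hspan (s'.2.2 ⟨x, hx⟩))
    choose a ha using fun q => (c q).2
    choose W hW g hg using fun q => TopCat.Presheaf.exists_germ_eq X.presheaf (a q)
    obtain ⟨W₁, hW₁, hxW₁, hs⟩ := (IsLocallyConstant.iff_exists_open _).mp s'.2.1 ⟨x, hx⟩
    have hW₁' := U.isOpen.isOpenMap_subtype_val W₁ hW₁
    let W₂ : X.Opens := ⟨Subtype.val '' W₁, hW₁'⟩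
    have hx₂ : x ∈ W₂ := ⟨_, hxW₁, rfl⟩
    have hW₂ : W₂ ≤ U := by
      rintro _ ⟨z, hz, rfl⟩
      exact z.2
    have hxW : x ∈ Finset.univ.inf W := by
      rw [← SetLike.mem_coe, Opens.coe_finset_inf]
      simpa using hW
    let W₃ : X.Opens := W₂ ⊓ (U₀ ⊓ Finset.univ.inf W)
    have hle : ∀ q, W₃ ≤ W q := fun q => inf_le_right.trans
      (inf_le_right.trans (Finset.inf_le (Finset.mem_univ q)))
    have hW₃ : W₃ ≤ U := inf_le_left.trans hW₂
    have hW₃' : W₃ ≤ U₀ := inf_le_right.trans inf_le_left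
    refine ⟨W₃, mem_inf hx₂ (mem_inf hx₀ hxW), hW₃, hW₃',
      fun q => rs (hle q) (g q) • E.presheaf.map (homOfLE hW₃).op e, ?_⟩
    rw [tensorRes_tmul]
    have key : (latticeSheaf L).presheaf.map (homOfLE hW₃).op s =
        ∑ q, rs (hle q) (g q) •
          (constSection (L := L) (l q) (fun y hy => hl q y (hW₃' hy)) : Γ(latticeSheaf L, W₃)) := by
      refine Subtype.ext (funext fun y => ?_)
      have h1 : ((∑ q, rs (hle q) (g q) •
          (show latticeSections L W₃ from constSection (l q) (fun y hy => hl q y (hW₃' hy))))).1 y = ∑ q, toRational (rs (hle q) (g q)) y • l q := by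
        rw [AddSubgroup.val_finsetSum, Finset.sum_apply]
        rfl
      refine Eq.trans ?_ h1.symm
      change s'.1 ⟨y.1, hW₃ y.2⟩ = _
      obtain ⟨z, hz, hzy⟩ := mem_left y.2
      have h2 : s'.1 ⟨y.1, hW₃ y.2⟩ = s'.1 ⟨x, hx⟩ := by
        rw [← hs z hz]
        exact congrArg s'.1 (Subtype.ext hzy.symm)
      rw [h2, ← hc]
      refine Finset.sum_congr rfl fun q _ => ?_
      have h3 : toRational (rs (hle q) (g q)) y = c q := by
        change ofGerm y.1 (X.presheaf.germ W₃ y.1 y.2 (rs (hle q) (g q))) = _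
        rw [germ_rs, ofGerm_germ _ y.1 x (hle q y.2) (hW q)]
        erw [hg q]
        exact ha q
      rw [h3]
      rfl
    rw [key, TensorProduct.sum_tmul]
    exact Finset.sum_congr rfl fun q _ => TensorProduct.smul_tmul _ _ _
  | add s t hs ht =>
    obtain ⟨W, hW, i, j, n, hn⟩ := hs
    obtain ⟨W', hW', i', j', n', hn'⟩ := ht
    refine ⟨W ⊓ W', mem_inf hW hW', inf_le_left.trans i, inf_le_left.trans j,
      rt inf_le_left n + rt inf_le_right n', ?_⟩
    have h1 : tensorRes (homOfLE (inf_le_left.trans i)) s =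
        tensorRes (homOfLE (inf_le_left : W ⊓ W' ≤ W)) (tensorRes (homOfLE i) s) :=
      (tensorRes_comp _ _ _).symm
    have h2 : tensorRes (homOfLE (inf_le_left.trans i)) t =
        tensorRes (homOfLE (inf_le_right : W ⊓ W' ≤ W')) (tensorRes (homOfLE i') t) :=
      (tensorRes_comp _ _ _).symm
    rw [map_add, h1, h2, hn, hn', map_sum, map_sum, ← Finset.sum_add_distrib]
    refine Finset.sum_congr rfl fun q _ => ?_
    exact (TensorProduct.tmul_add _ _ _).symm

/-- The tensor product of a lattice sheaf with `E`, as a sheaf of functions with values in the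
powers of the stalks of `E`. -/
lemma IsFrame.nonempty_iso (h : IsFrame b L E) :
    Nonempty (abelianSheaf (tensor (latticeSheaf L) E) ≅ (quotSheaf h.fam ⊥).toSheaf) := by
  refine nonempty_tensor_iso h.pairing ?_ ?_ ?_
  · intro U W i m n
    refine Subtype.ext (funext fun y => ?_)
    exact h.pairing_res i (m ⊗ₜ[Γ(X, U)] n) y.1 y.2
  · intro U s hs x hx
    -- Injectivity: once the tensor is in normal form, the vanishing of its image at `x` and the
    -- independence of the coordinates on `E` kill the germs of all coefficients at `x`, hence the
    -- coefficients on a neighbourhood.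
    obtain ⟨κ, _, l, hl, hspan, hind⟩ := h.independent x
    choose W hW hWl using fun q => h.spread x (l q) (hl q)
    have hxW : x ∈ Finset.univ.inf W := by
      rw [← SetLike.mem_coe, Opens.coe_finset_inf]
      simpa using hW
    have hle : ∀ q, Finset.univ.inf W ≤ W q := fun q => Finset.inf_le (Finset.mem_univ q)
    obtain ⟨W', hxW', i, j, n, hn⟩ := exists_tensor_normal_form hxW
      (fun q y hy => hWl q y (hle q hy)) hspan hx s
    have h0 := (h.pairing_res (homOfLE i) s x hxW').trans
      (congrFun (congrArg Subtype.val hs) ⟨x, hx⟩)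
    rw [hn, map_sum] at h0
    have h1 : (⟨x, hxW'⟩ : W').1 = x := rfl
    have h2 : (Submodule.Quotient.mk (fun i => ∑ q, coef b x (l q) i • germM x hxW' (n q)) :
        (ι → St E x) ⧸ (⊥ : Submodule (X.presheaf.stalk x) (ι → St E x))) = 0 := by
      refine Eq.trans ?_ h0
      rw [AddSubgroup.val_finsetSum, Finset.sum_apply]
      refine Eq.trans ?_ (map_sum (Submodule.mkQ _) _ _)
      refine congrArg Submodule.Quotient.mk (funext fun i => ?_)
      rw [Finset.sum_apply]
      rfl
    rw [Submodule.Quotient.mk_eq_zero, Submodule.mem_bot] at h2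
    have h3 := hind _ fun i => congrFun h2 i
    have h4 : gt n x hxW' = gt (0 : κ → Γ(E, W')) x hxW' := by
      rw [gt_zero]
      exact h3
    choose W₁ hW₁ hi hj he using fun q => exists_res_eq_of_germM_eq (congrFun h4 q)
    have hxW₁ : x ∈ Finset.univ.inf W₁ := by
      rw [← SetLike.mem_coe, Opens.coe_finset_inf]
      simpa using hW₁
    have hle₁ : ∀ q, Finset.univ.inf W₁ ≤ W₁ q := fun q => Finset.inf_le (Finset.mem_univ q)
    let W₂ := W' ⊓ Finset.univ.inf W₁
    refine ⟨W₂, homOfLE (inf_le_left.trans i), mem_inf hxW' hxW₁, ?_⟩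
    have h5 : tensorRes (homOfLE (inf_le_left.trans i : W₂ ≤ U)) s =
        tensorRes (homOfLE (inf_le_left : W₂ ≤ W')) (tensorRes (homOfLE i) s) :=
      (tensorRes_comp _ _ _).symm
    rw [h5, hn, map_sum]
    refine Finset.sum_eq_zero fun q _ => ?_
    have h6 : E.presheaf.map (homOfLE (inf_le_left : W₂ ≤ W')).op (n q) = 0 := by
      have h7 : E.presheaf.map (homOfLE (inf_le_right.trans (hle₁ q) : W₂ ≤ W₁ q)).op
          (E.presheaf.map (homOfLE (hi q)).op (n q)) = 0 := by
        rw [he q]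
        exact (congrArg _ (map_zero (E.presheaf.map (homOfLE (hj q)).op).hom)).trans
          (map_zero (E.presheaf.map (homOfLE (inf_le_right.trans (hle₁ q) : W₂ ≤ W₁ q)).op).hom)
      refine Eq.trans ?_ h7
      exact ConcreteCategory.congr_hom (E.presheaf.map_comp (homOfLE (hi q)).op
        (homOfLE (inf_le_right.trans (hle₁ q) : W₂ ≤ W₁ q)).op) (n q)
    rw [tensorRes_const, h6]
    exact TensorProduct.tmul_zero _ _
  · intro U t x hx
    change (quotSheaf h.fam ⊥).sections U at t
    obtain ⟨a, ha, hav⟩ := (quotSheaf_isValue_iff _).1 (EtSheaf.isValue _ t.2 ⟨x, hx⟩)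
    obtain ⟨W, hxW, s, hs⟩ := h.exists_pairing ha
    obtain ⟨W', hxW', h'⟩ := (quotSheaf h.fam ⊥).germ_eq
      ((quotSheaf h.fam ⊥).P.res (homOfLE inf_le_left : U ⊓ W ⟶ U) t.1 t.2)
      ((quotSheaf h.fam ⊥).P.res (homOfLE inf_le_right : U ⊓ W ⟶ W) _ (h.pairing W s).2)
      ⟨x, mem_inf hx hxW⟩ (hav.symm.trans hs.symm)
    refine ⟨U ⊓ W ⊓ W', homOfLE (inf_le_left.trans inf_le_left),
      tensorRes (homOfLE (inf_le_left.trans inf_le_right)) s, mem_inf (mem_inf hx hxW) hxW', ?_⟩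
    refine Subtype.ext (funext fun y => ?_)
    refine (h.pairing_res _ s y.1 y.2).trans ?_
    exact (h' ⟨y.1, mem_left y.2⟩ (mem_right y.2)).symm

/-- The acyclicity of a tensor product with a lattice sheaf. -/
lemma IsFrame.acyclic_iff (h : IsFrame b L E) :
    (∀ k : ℕ, 1 ≤ k → Subsingleton (cohomology (tensor (latticeSheaf L) E) k)) ↔
      Acyc h.fam ⊥ := by
  obtain ⟨e⟩ := h.nonempty_iso
  exact ⟨fun H => Acyclic.of_iso e H, fun H => Acyclic.of_iso e.symm H⟩

end LatticeTensor

end LogBott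

namespace LogBott

/-! ### Products of skyscraper sheaves -/

section Skyscraper

variable {Z : Scheme.{0}} (A : Z → Type) [∀ z, AddCommGroup (A z)]

/-- The abelian presheaf of arbitrary functions with values in a family of groups. -/
def skyPresheaf : TopCat.Presheaf Ab Z where
  obj U := AddCommGrpCat.of (∀ z : U.unop, A z.1)
  map i := AddCommGrpCat.ofHom
    { toFun := fun s z => s ⟨z.1, i.unop.le z.2⟩
      map_zero' := rfl
      map_add' := fun _ _ => rfl }
  map_id _ := rfl
  map_comp _ _ := rfl

lemma skyPresheaf_isSheaf : (skyPresheaf A).IsSheaf := by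
  rw [TopCat.Presheaf.isSheaf_iff_isSheaf_comp' (forget Ab)]
  exact TopCat.Presheaf.toTypes_isSheaf Z.toTopCat A

variable [∀ z, Module (Z.presheaf.stalk z) (A z)]

instance skyModule (U : Z.Opens) : Module Γ(Z, U) (∀ z : U, A z.1) where
  smul r s z := Z.presheaf.germ U z.1 z.2 r • s z
  one_smul s := funext fun z => by
    change Z.presheaf.germ U z.1 z.2 1 • s z = s z
    rw [map_one, one_smul]
  mul_smul r r' s := funext fun z => by
    change Z.presheaf.germ U z.1 z.2 (r * r') • s z =
      Z.presheaf.germ U z.1 z.2 r • Z.presheaf.germ U z.1 z.2 r' • s z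
    rw [map_mul, mul_smul]
  smul_zero r := funext fun z => smul_zero _
  smul_add r s t := funext fun z => smul_add _ _ _
  add_smul r r' s := funext fun z => by
    change Z.presheaf.germ U z.1 z.2 (r + r') • s z =
      Z.presheaf.germ U z.1 z.2 r • s z + Z.presheaf.germ U z.1 z.2 r' • s z
    rw [map_add, add_smul]
  zero_smul s := funext fun z => by
    change Z.presheaf.germ U z.1 z.2 0 • s z = 0
    rw [map_zero, zero_smul]

instance (U : (Opens Z)ᵒᵖ) : Module (Z.ringCatSheaf.obj.obj U) ((skyPresheaf A).obj U) :=
  skyModule A U.unop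

/-- The product over all points of the skyscraper sheaves of a family of modules. -/
def sky : Z.Modules where
  val := PresheafOfModules.ofPresheaf (skyPresheaf A) (fun U W i r s => funext fun z => by
    exact congrArg (· • (show ∀ z : U.unop, A z.1 from s) ⟨z.1, i.unop.le z.2⟩)
      (TopCat.Presheaf.germ_res_apply Z.presheaf i.unop z.1 z.2 r).symm)
  isSheaf := skyPresheaf_isSheaf A

variable {A}

/-- A morphism to the push-forward of a product of skyscraper sheaves. -/
def toSky {X : Scheme.{0}} (f : Z ⟶ X) {E : X.Modules} (ψ : ∀ z, St E (f z) →+ A z)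
    (hψ : ∀ z r m, ψ z (r • m) = f.stalkMap z r • ψ z m) :
    E ⟶ (Scheme.Modules.pushforward f).obj (sky A) where
  val := PresheafOfModules.homMk
    { app := fun U => AddCommGrpCat.ofHom
        { toFun := fun e => (fun z => ψ z.1 (germM (f z.1) z.2 (show Γ(E, U.unop) from e)) :
            ∀ z : (f ⁻¹ᵁ U.unop), A z.1)
          map_zero' := funext fun z => (congrArg _ (map_zero _)).trans (map_zero _)
          map_add' := fun e e' => funext fun z => (congrArg _ (map_add _ _ _)).trans
            (map_add _ _ _) }
      naturality := fun U W i => by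
        ext e
        refine funext fun z => ?_
        exact congrArg (ψ z.1) (germM_res (f z.1) i.unop.le z.2 e) }
    (fun U r e => funext fun z => by
      refine (congrArg (ψ z.1) (germM_smul (M := E) (f z.1) z.2 r e)).trans ?_
      refine (hψ z.1 _ _).trans ?_
      exact congrArg (· • ψ z.1 (germM (f z.1) z.2 (show Γ(E, U.unop) from e)))
        (Scheme.Hom.germ_stalkMap_apply f U.unop z.1 z.2 r))

lemma toSky_app {X : Scheme.{0}} (f : Z ⟶ X) {E : X.Modules} (ψ : ∀ z, St E (f z) →+ A z)
    (hψ : ∀ z r m, ψ z (r • m) = f.stalkMap z r • ψ z m) (U : X.Opens) (e : Γ(E, U))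
    (z : Z) (hz : f z ∈ U) :
    (show ∀ z : (f ⁻¹ᵁ U), A z.1 from (toSky f ψ hψ).app U e) ⟨z, hz⟩ = ψ z (germM (f z) hz e) :=
  rfl

/-- A morphism to a product of skyscraper sheaves. -/
def toSky' {M : Z.Modules} (ψ : ∀ z, St M z →ₗ[Z.presheaf.stalk z] A z) : M ⟶ sky A where
  val := PresheafOfModules.homMk
    { app := fun U => AddCommGrpCat.ofHom
        { toFun := fun e => (fun z => ψ z.1 (germM z.1 z.2 (show Γ(M, U.unop) from e)) :
            ∀ z : U.unop, A z.1)
          map_zero' := funext fun z => (congrArg _ (map_zero _)).trans (map_zero _)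
          map_add' := fun e e' => funext fun z => (congrArg _ (map_add _ _ _)).trans
            (map_add _ _ _) }
      naturality := fun U W i => by
        ext e
        refine funext fun z => ?_
        exact congrArg (ψ z.1) (germM_res z.1 i.unop.le z.2 e) }
    (fun U r e => funext fun z => by
      refine (congrArg (ψ z.1) (germM_smul (M := M) z.1 z.2 r e)).trans ?_
      exact map_smul _ _ _)

end Skyscraper

/-! ### The stalks of a pull-back -/

section Pullback

variable {Z X : Scheme.{0}} (f : Z ⟶ X) (E : X.Modules)

/-- The unit of the adjunction between pull-back and push-forward. -/
abbrev unitHom : E ⟶ (Scheme.Modules.pushforward f).obj ((Scheme.Modules.pullback f).obj E) :=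
  (Scheme.Modules.pullbackPushforwardAdjunction f).unit.app E

/-- The pull-back of a section. -/
def pullSection (U : X.Opens) : Γ(E, U) →+ Γ((Scheme.Modules.pullback f).obj E, f ⁻¹ᵁ U) :=
  ((unitHom f E).app U).hom

lemma pullSection_smul (U : X.Opens) (r : Γ(X, U)) (e : Γ(E, U)) :
    pullSection f E U (r • e) = f.app U r • pullSection f E U e :=
  Scheme.Modules.Hom.app_smul (unitHom f E) r e

/-- The map from the stalk of a module to the stalk of its pull-back. -/
def pullStalk (z : Z) : St E (f z) →+ St ((Scheme.Modules.pullback f).obj E) z :=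
  ((TopCat.Presheaf.stalkFunctor Ab (f z)).map (unitHom f E).mapPresheaf ≫
    TopCat.Presheaf.stalkPushforward Ab f.base
      ((Scheme.Modules.pullback f).obj E).presheaf z).hom

lemma pullStalk_germ (z : Z) {U : X.Opens} (hz : f z ∈ U) (e : Γ(E, U)) :
    pullStalk f E z (germM (f z) hz e) = germM (U := f ⁻¹ᵁ U) z hz (pullSection f E U e) := by
  refine (congrArg (fun t => TopCat.Presheaf.stalkPushforward Ab f.base
    ((Scheme.Modules.pullback f).obj E).presheaf z t)
    (TopCat.Presheaf.stalkFunctor_map_germ_apply U (f z) hz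
    (unitHom f E).mapPresheaf e)).trans ?_
  exact TopCat.Presheaf.stalkPushforward_germ_apply Ab f.base
    ((Scheme.Modules.pullback f).obj E).presheaf U z hz _

lemma pullStalk_smul (z : Z) (r : X.presheaf.stalk (f z)) (m : St E (f z)) :
    pullStalk f E z (r • m) = f.stalkMap z r • pullStalk f E z m := by
  obtain ⟨U, hU, e, rfl⟩ := exists_germM m
  obtain ⟨W, hW, g, rfl⟩ := TopCat.Presheaf.exists_germ_eq X.presheaf r
  have h1 : X.presheaf.germ W (f z) hW g • germM (f z) hU e =
      germM (f z) (mem_inf hU hW) ((rs inf_le_right g : Γ(X, U ⊓ W)) •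
        E.presheaf.map (homOfLE inf_le_left).op e) := by
    rw [germM_smul, germ_rs, germM_res]
  have hz : z ∈ f ⁻¹ᵁ (U ⊓ W) := mem_inf hU hW
  have h2 : pullStalk f E z (germM (f z) hU e) = germM z hz
      (pullSection f E (U ⊓ W) (E.presheaf.map (homOfLE inf_le_left).op e)) := by
    rw [← pullStalk_germ f E z (mem_inf hU hW), germM_res]
  have h3 : pullStalk f E z (germM (f z) (mem_inf hU hW) ((rs inf_le_right g : Γ(X, U ⊓ W)) •
      E.presheaf.map (homOfLE inf_le_left).op e)) = germM z hz (pullSection f E (U ⊓ W)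
        ((rs inf_le_right g : Γ(X, U ⊓ W)) • E.presheaf.map (homOfLE inf_le_left).op e)) :=
    pullStalk_germ f E z (mem_inf hU hW) _
  refine (congrArg _ h1).trans (h3.trans ?_)
  rw [pullSection_smul, germM_smul, h2]
  congr 1
  rw [← Scheme.Hom.germ_stalkMap_apply f (U ⊓ W) z (mem_inf hU hW), germ_rs]

variable {f}

/-- The kernel of the map on stalks to a pull-back along a closed immersion. -/
lemma pullStalk_eq_zero_iff (hf : ∀ z, Function.Surjective (f.stalkMap z)) (z : Z)
    (m : St E (f z)) : pullStalk f E z m = 0 ↔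
      m ∈ (RingHom.ker (f.stalkMap z).hom • (⊤ : Submodule (X.presheaf.stalk (f z)) (St E (f z)))) := by
  constructor
  · intro hm
    -- The stalk of `E` modulo the kernel of the stalk map is a module over the local ring of `Z`,
    -- because the stalk map is surjective. The quotient maps assemble to a morphism from `E` to the
    -- push-forward of a product of skyscrapers; by adjunction it factors through the unit, so a
    -- germ that dies in the pull-back dies in this quotient.
    let K : ∀ z, Ideal (X.presheaf.stalk (f z)) := fun z => RingHom.ker (f.stalkMap z).hom
    let A : Z → Type := fun z => St E (f z) ⧸
      (K z • (⊤ : Submodule (X.presheaf.stalk (f z)) (St E (f z))))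
    let eq : ∀ z, (X.presheaf.stalk (f z) ⧸ K z) ≃+* Z.presheaf.stalk z :=
      fun z => RingHom.quotientKerEquivOfSurjective (f := (f.stalkMap z).hom) (hf z)
    let inst : ∀ z, Module (Z.presheaf.stalk z) (A z) := fun z =>
      Module.compHom (A z) (eq z).symm.toRingHom
    have hsm : ∀ z (r : X.presheaf.stalk (f z)) (a : A z), f.stalkMap z r • a = r • a := by
      intro z r a
      have h1 : (eq z).symm (f.stalkMap z r) = Ideal.Quotient.mk (K z) r := by
        rw [RingEquiv.symm_apply_eq]
        rfl
      change (eq z).symm (f.stalkMap z r) • a = r • a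
      rw [h1]
      rfl
    let ψ : ∀ z, St E (f z) →+ A z := fun z =>
      (Submodule.mkQ (K z • (⊤ : Submodule (X.presheaf.stalk (f z)) (St E (f z))))).toAddMonoidHom
    have hψ : ∀ z r m, ψ z (r • m) = f.stalkMap z r • ψ z m := fun z r m =>
      (map_smul (Submodule.mkQ (K z • (⊤ : Submodule (X.presheaf.stalk (f z)) (St E (f z))))) r m).trans (hsm z r _).symm
    let adj := Scheme.Modules.pullbackPushforwardAdjunction f
    let Φ := (adj.homEquiv E (sky A)).symm (toSky f ψ hψ)
    have hΦ : unitHom f E ≫ (Scheme.Modules.pushforward f).map Φ = toSky f ψ hψ := by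
      rw [← Adjunction.homEquiv_unit]
      exact Equiv.apply_symm_apply _ _
    obtain ⟨U, hU, e, rfl⟩ := exists_germM m
    rw [pullStalk_germ] at hm
    have h0 : germM (U := f ⁻¹ᵁ U) z hU (pullSection f E U e) = germM (U := f ⁻¹ᵁ U) z hU 0 := by
      rw [hm, map_zero]
    obtain ⟨W, hzW, i, j, hres⟩ := exists_res_eq_of_germM_eq h0
    have h1 : (show ∀ z : (f ⁻¹ᵁ U), A z.1 from Φ.app (f ⁻¹ᵁ U) (pullSection f E U e)) ⟨z, hU⟩ =
        ψ z (germM (f z) hU e) := by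
      rw [← toSky_app f ψ hψ]
      exact congrFun (ConcreteCategory.congr_hom
        (congrArg (fun g => Scheme.Modules.Hom.app g U) hΦ) e) ⟨z, hU⟩
    have h2 := ConcreteCategory.congr_hom (Φ.mapPresheaf.naturality (homOfLE i).op)
      (pullSection f E U e)
    have h3 : (show ∀ z : W, A z.1 from Φ.app W
        (((Scheme.Modules.pullback f).obj E).presheaf.map (homOfLE i).op (pullSection f E U e)))
          ⟨z, hzW⟩ = ψ z (germM (f z) hU e) := by
      rw [← h1]
      exact congrFun h2 ⟨z, hzW⟩
    have h4 : ((Scheme.Modules.pullback f).obj E).presheaf.map (homOfLE i).op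
        (pullSection f E U e) = 0 := by
      rw [hres]
      exact map_zero (((Scheme.Modules.pullback f).obj E).presheaf.map (homOfLE j).op).hom
    have h5 : (show ∀ z : W, A z.1 from Φ.app W 0) ⟨z, hzW⟩ = 0 :=
      congrFun (map_zero (Φ.app W).hom) ⟨z, hzW⟩
    rw [h4, h5] at h3
    exact (Submodule.Quotient.mk_eq_zero _).1 h3.symm
  · intro hm
    refine Submodule.smul_induction_on hm (fun r hr m _ => ?_) (fun a b ha hb => ?_)
    · have : f.stalkMap z r = 0 := hr
      rw [pullStalk_smul, this, zero_smul]
    · rw [map_add, ha, hb, add_zero]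

lemma pullStalk_surjective (hf : ∀ z, Function.Surjective (f.stalkMap z)) (z : Z) :
    Function.Surjective (pullStalk f E z) := by
  -- The projection of the pull-back to its stalks modulo the span of the image of `E` vanishes
  -- after composition with the unit, hence is zero by adjunction. So the image spans each stalk,
  -- and the span is superfluous because the stalk maps are surjective.
  let M := (Scheme.Modules.pullback f).obj E
  let S : ∀ z, Submodule (Z.presheaf.stalk z) (St M z) := fun z =>
    Submodule.span _ (Set.range (pullStalk f E z))
  let ψ : ∀ z, St M z →ₗ[Z.presheaf.stalk z] (St M z ⧸ S z) := fun z => (S z).mkQ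
  have hψ : toSky' ψ = 0 := by
    let adj := Scheme.Modules.pullbackPushforwardAdjunction f
    apply (adj.homEquiv E (sky fun z => St M z ⧸ S z)).injective
    rw [Adjunction.homEquiv_unit, Adjunction.homEquiv_unit]
    refine Scheme.Modules.hom_ext _ _ fun U => ?_
    ext e
    refine funext fun z => ?_
    have h1 : ψ z.1 (germM (U := f ⁻¹ᵁ U) z.1 z.2 (pullSection f E U e)) = 0 := by
      refine (congrArg (ψ z.1) (pullStalk_germ f E z.1 z.2 e).symm).trans ?_
      exact (Submodule.Quotient.mk_eq_zero _).2 (Submodule.subset_span ⟨_, rfl⟩)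
    exact h1
  have hS : ∀ a : St M z, a ∈ S z := by
    intro a
    obtain ⟨U, hU, e, rfl⟩ := exists_germM a
    have h1 : (show ∀ z : U, (St M z.1 ⧸ S z.1) from (toSky' ψ).app U e) ⟨z, hU⟩ = 0 := by
      rw [hψ]
      rfl
    exact (Submodule.Quotient.mk_eq_zero _).1 h1
  intro a
  have ha := hS a
  induction ha using Submodule.span_induction with
  | mem a ha => exact ha
  | zero => exact ⟨0, map_zero _⟩
  | add a b _ _ ha hb =>
    obtain ⟨m, rfl⟩ := ha
    obtain ⟨n, rfl⟩ := hb
    exact ⟨m + n, map_add _ _ _⟩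
  | smul r a _ ha =>
    obtain ⟨m, rfl⟩ := ha
    obtain ⟨s, rfl⟩ := hf z r
    exact ⟨s • m, pullStalk_smul f E z s m⟩

variable {E}

/-- Acyclicity of a quotient supported on a closed subscheme. -/
lemma Acyc.of_closedImmersion [IsClosedImmersion f] {ι : Type} [Finite ι] {H₁ H₂ : Fam E ι}
    {G : Fam ((Scheme.Modules.pullback f).obj E) ι}
    (h₁ : ∀ z, ∀ m ∈ H₁.at' (f z), (fun i => pullStalk f E z (m i)) ∈ G.at' z)
    (h₂ : ∀ z, ∀ m ∈ H₂.at' (f z), (fun i => pullStalk f E z (m i)) = 0)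
    (inj : ∀ z, ∀ m ∈ H₁.at' (f z), (fun i => pullStalk f E z (m i)) = 0 → m ∈ H₂.at' (f z))
    (surj : ∀ z, ∀ a ∈ G.at' z, ∃ m ∈ H₁.at' (f z), (fun i => pullStalk f E z (m i)) = a)
    (off : ∀ x, x ∉ Set.range f → H₁.at' x ≤ H₂.at' x) (hG : Acyc G ⊥) : Acyc H₁ H₂ := by
  let τ : ∀ z, (ι → St E (f z)) →+ (ι → St ((Scheme.Modules.pullback f).obj E) z) := fun z =>
    { toFun := fun m i => pullStalk f E z (m i)
      map_zero' := funext fun i => map_zero _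
      map_add' := fun m n => funext fun i => map_add _ _ _ }
  refine EtSheaf.isAcyclic_of_closedEmbedding (f := f.base) (G := quotSheaf G ⊥)
    (G' := quotSheaf H₁ H₂) f.isClosedEmbedding
    (fun z => QuotientAddGroup.map (H₂.at' (f z)).toAddSubgroup
      ((⊥ : Fam _ ι).at' z).toAddSubgroup (τ z) (h₂ z)) ?_ ?_ ?_ ?_ hG
  · intro U s hs z
    obtain ⟨V, hV, e, he⟩ := hs ⟨f z.1, z.2⟩
    refine ⟨f ⁻¹ᵁ V, hV, fun i => pullSection f E V (e i), fun y hyU hyV => ?_⟩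
    have key : gt (fun i => pullSection f E V (e i)) y hyV = τ y (gt e (f y) hyV) :=
      funext fun i => (pullStalk_germ f E y hyV (e i)).symm
    rw [key]
    exact ⟨h₁ y _ (he (f y) hyU hyV).1, congrArg (QuotientAddGroup.map
      (H₂.at' (f y)).toAddSubgroup ((⊥ : Fam _ ι).at' y).toAddSubgroup (τ y) (h₂ y))
      (he (f y) hyU hyV).2⟩
  · intro z v hv hv'
    obtain ⟨m, hm, rfl⟩ := (quotSheaf_isValue_iff _).1 hv
    refine (Submodule.Quotient.mk_eq_zero _).2 (inj z m hm ?_)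
    exact (Submodule.mem_bot _).1 ((Submodule.Quotient.mk_eq_zero _).1 hv')
  · intro z v hv
    obtain ⟨a, ha, rfl⟩ := (quotSheaf_isValue_iff _).1 hv
    obtain ⟨m, hm, rfl⟩ := surj z a ha
    exact ⟨Submodule.Quotient.mk m, (quotSheaf_isValue_iff _).2 ⟨m, hm, rfl⟩, rfl⟩
  · intro x hx v hv
    obtain ⟨m, hm, rfl⟩ := (quotSheaf_isValue_iff _).1 hv
    exact (Submodule.Quotient.mk_eq_zero _).2 (off x hx hm)

end Pullback

end LogBott

namespace LogBott

/-! ### Regular parameters and derivations -/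

section RegularParameters

variable {R : Type} [CommRing R] [IsLocalRing R]

/-- On a formally smooth local algebra over a perfect field, functions which are independent in
the cotangent space have dual derivations. -/
lemma exists_dual_derivations (k : Type) [Field k] [PerfectField k] [Algebra k R]
    [Algebra.FormallySmooth k R] [Algebra.EssFiniteType k R] {J : Type} [Fintype J] [DecidableEq J]
    (t : J → IsLocalRing.maximalIdeal R)
    (ht : LinearIndependent (IsLocalRing.ResidueField R)
      (fun j => (IsLocalRing.maximalIdeal R).toCotangent (t j))) :
    ∃ δ : J → Derivation k R R, ∀ i j, δ i (t j : R) = if i = j then 1 else 0 := by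
  let κ := IsLocalRing.ResidueField R
  have hs : Function.Surjective (algebraMap R κ) := IsLocalRing.residue_surjective
  have hker : RingHom.ker (algebraMap R κ) = IsLocalRing.maximalIdeal R := IsLocalRing.ker_residue
  have : Algebra.FiniteType R κ := Algebra.FiniteType.of_surjective (Algebra.ofId R κ) hs
  have : Algebra.EssFiniteType k κ := Algebra.EssFiniteType.comp k R κ
  have : Algebra.FormallySmooth k κ := inferInstance
  -- The residue field κ is formally smooth over the perfect field `k`, so the map from the
  -- cotangent space 𝔪/𝔪² to κ ⊗ Ω_R is split injective: functionals on the cotangent space extend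
  -- to differentials.
  obtain ⟨l, hl⟩ := (Algebra.FormallySmooth.iff_split_injection (R := k) (P := R) (A := κ) hs).1 this
  have ht' : LinearIndependent κ (fun j =>
      (IsLocalRing.maximalIdeal R).toCotangent (t j)) := ht
  obtain ⟨χ, hχ⟩ : ∃ χ : J → (IsLocalRing.CotangentSpace R →ₗ[κ] κ), ∀ i j,
      χ i ((IsLocalRing.maximalIdeal R).toCotangent (t j)) = if i = j then 1 else 0 := by
    obtain ⟨g, hg⟩ := (Fintype.linearCombination κ (fun j =>
      ((IsLocalRing.maximalIdeal R).toCotangent (t j) : IsLocalRing.CotangentSpace R))).exists_leftInverse_of_injective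
        (LinearMap.ker_eq_bot.2 (linearIndependent_iff_injective_fintypeLinearCombination.1 ht'))
    refine ⟨fun i => LinearMap.proj i ∘ₗ g, fun i j => ?_⟩
    have h1 := LinearMap.congr_fun hg (Pi.single j 1)
    rw [LinearMap.comp_apply, Fintype.linearCombination_apply_single, one_smul] at h1
    change g _ i = _
    rw [h1]
    simp [Pi.single_apply]
  have hmem : ∀ j, (t j : R) ∈ RingHom.ker (algebraMap R κ) := fun j => by
    rw [hker]
    exact (t j).2
  let c : (RingHom.ker (algebraMap R κ)).Cotangent →ₗ[R] IsLocalRing.CotangentSpace R :=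
    Ideal.mapCotangent _ _ (AlgHom.id R R) (by rw [hker]; exact le_rfl)
  have hc : ∀ j, c ((RingHom.ker (algebraMap R κ)).toCotangent ⟨t j, hmem j⟩) =
      (IsLocalRing.maximalIdeal R).toCotangent (t j) := fun j => rfl
  let m : Ω[R⁄k] →ₗ[R] TensorProduct R κ (Ω[R⁄k]) := TensorProduct.mk R κ _ 1
  let ψ : J → (Ω[R⁄k] →ₗ[R] κ) := fun i => (χ i).restrictScalars R ∘ₗ c ∘ₗ l ∘ₗ m
  have hψ : ∀ i j, ψ i (KaehlerDifferential.D k R (t j : R)) = if i = j then 1 else 0 := by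
    intro i j
    have h1 := LinearMap.congr_fun hl ((RingHom.ker (algebraMap R κ)).toCotangent ⟨t j, hmem j⟩)
    change χ i (c (l _)) = _
    rw [← hχ, ← hc]
    exact congrArg (fun z => χ i (c z)) h1
  -- The module Ω_R is projective, so the functionals with values in the residue field lift to `R`.
  -- The matrix of their values on the differentials of the `t j` is the identity modulo the maximal
  -- ideal; multiplying by its inverse makes the duality exact.
  choose Ψ hΨ using fun i => Module.projective_lifting_property (Algebra.linearMap R κ) (ψ i) hs
  let A : Matrix J J R := fun i j => Ψ i (KaehlerDifferential.D k R (t j : R))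
  have hA : A.map (algebraMap R κ) = 1 := by
    ext i j
    rw [Matrix.one_apply, ← hψ, ← hΨ]
    rfl
  have hdet : IsUnit A.det := by
    rw [← isUnit_map_iff (IsLocalRing.residue R)]
    have : IsLocalRing.residue R A.det = 1 := by
      rw [RingHom.map_det]
      exact (congrArg Matrix.det hA).trans Matrix.det_one
    rw [this]
    exact isUnit_one
  refine ⟨fun i => (∑ j, A⁻¹ i j • Ψ j).compDer (KaehlerDifferential.D k R), fun i j => ?_⟩
  have h1 := congrFun (congrFun (Matrix.nonsing_inv_mul A hdet) i) j
  rw [Matrix.mul_apply, Matrix.one_apply] at h1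
  rw [← h1]
  change (∑ j, A⁻¹ i j • Ψ j) _ = _
  rw [LinearMap.sum_apply]
  rfl

variable [IsNoetherianRing R]

/-- Krull's intersection theorem for the residue classes modulo an ideal. -/
lemma mem_of_forall_mem_sup_pow {I : Ideal R} {t w : R} (ht : t ∈ IsLocalRing.maximalIdeal R)
    (h : ∀ n : ℕ, ∃ a, w - t ^ n * a ∈ I) : w ∈ I := by
  have key : ∀ n : ℕ, Submodule.Quotient.mk (p := I) w ∈
      IsLocalRing.maximalIdeal R ^ n • (⊤ : Submodule R (R ⧸ I)) := by
    intro n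
    obtain ⟨a, ha⟩ := h n
    have : Submodule.Quotient.mk (p := I) w = t ^ n • Submodule.Quotient.mk (p := I) a := by
      rw [← Submodule.Quotient.mk_smul]
      exact (Submodule.Quotient.eq I).2 ha
    rw [this]
    exact Submodule.smul_mem_smul (Ideal.pow_mem_pow ht n) trivial
  have h2 := Ideal.iInf_pow_smul_eq_bot_of_isLocalRing (M := R ⧸ I) (IsLocalRing.maximalIdeal R)
    (Ideal.IsPrime.ne_top inferInstance)
  have h3 : Submodule.Quotient.mk (p := I) w ∈ (⊥ : Submodule R (R ⧸ I)) := by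
    rw [← h2, Submodule.mem_iInf]
    exact key
  exact (Submodule.Quotient.mk_eq_zero I).1 ((Submodule.mem_bot R).1 h3)

/-- In characteristic zero, an ideal preserved by a derivation `δ` is prime as soon as it becomes
prime after adding an element `t` with `δ t = 1`. -/
lemma isPrime_of_derivation {k : Type} [Field k] [CharZero k] [Algebra k R] {I : Ideal R} {t : R}
    (ht : t ∈ IsLocalRing.maximalIdeal R) (δ : Derivation k R R) (hδ : δ t = 1)
    (hI : ∀ a ∈ I, δ a ∈ I) (hp : (I ⊔ Ideal.span {t}).IsPrime) : I.IsPrime := by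
  -- If t^(n+1) a ∈ I, then applying δ gives (n+1) t^n a + t^(n+1) δa ∈ I, so in characteristic zero
  -- t^n a is a multiple of t^(n+1) modulo I. Inductively `w` is divisible by every power of `t`
  -- modulo `I`, and Krull's theorem applies.
  have reg : ∀ w, t * w ∈ I → w ∈ I := by
    intro w hw
    refine mem_of_forall_mem_sup_pow ht fun n => ?_
    induction n with
    | zero => exact ⟨w, by simp⟩
    | succ n ih =>
      obtain ⟨a, ha⟩ := ih
      have h1 : t ^ (n + 1) * a ∈ I := by
        have := I.sub_mem hw (I.mul_mem_left t ha)
        convert this using 1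
        ring
      have h2 := hI _ h1
      rw [Derivation.leibniz, Derivation.leibniz_pow, hδ] at h2
      simp only [smul_eq_mul, nsmul_eq_mul, Nat.add_sub_cancel, mul_one] at h2
      have hu : algebraMap k R ((n + 1 : ℕ) : k)⁻¹ * ((n + 1 : ℕ) : R) = 1 := by
        rw [← map_natCast (algebraMap k R), ← map_mul, inv_mul_cancel₀ (Nat.cast_ne_zero.2 n.succ_ne_zero),
          map_one]
      refine ⟨-(algebraMap k R ((n + 1 : ℕ) : k)⁻¹ * δ a), ?_⟩
      have h3 := I.add_mem ha (I.mul_mem_left (algebraMap k R ((n + 1 : ℕ) : k)⁻¹) h2)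
      convert h3 using 1
      linear_combination (-(t ^ n * a)) * hu
  have regp : ∀ n w, t ^ n * w ∈ I → w ∈ I := by
    intro n
    induction n with
    | zero => simp
    | succ n ih =>
      intro w hw
      refine ih w (reg _ ?_)
      convert hw using 1
      ring
  -- Split off the largest power of `t` modulo `I`; there is one, since otherwise `a` would be
  -- divisible by all powers of `t` modulo `I` and lie in `I`.
  have fac : ∀ a, a ∉ I → ∃ n b, a - t ^ n * b ∈ I ∧ b ∉ I ⊔ Ideal.span {t} := by
    intro a ha
    by_contra! hcon
    refine ha (mem_of_forall_mem_sup_pow ht fun n => ?_)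
    induction n with
    | zero => exact ⟨a, by simp⟩
    | succ n ih =>
      obtain ⟨b, hb⟩ := ih
      obtain ⟨c, hc, e, he, rfl⟩ := Submodule.mem_sup.1 (hcon n b hb)
      obtain ⟨e, rfl⟩ := Ideal.mem_span_singleton'.1 he
      refine ⟨e, ?_⟩
      convert I.add_mem hb (I.mul_mem_left (t ^ n) hc) using 1
      ring
  refine ⟨fun h => hp.ne_top (by rw [h, top_sup_eq]), fun {a b} hab => ?_⟩
  by_contra! hcon
  obtain ⟨n, a', ha, ha'⟩ := fac a hcon.1
  obtain ⟨m, b', hb, hb'⟩ := fac b hcon.2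
  have h1 : a' * b' ∈ I := by
    refine regp (n + m) _ ?_
    have h2 := I.sub_mem (I.sub_mem hab (I.mul_mem_left b ha)) (I.mul_mem_left (t ^ n * a') hb)
    convert h2 using 1
    ring
  exact (hp.mem_or_mem (Ideal.mem_sup_left h1)).elim ha' hb'

/-- The parameters are removed one at a time from the maximal ideal, which is generated by all of
them; `C` is the set of those already removed. The derivation dual to the parameter being removed
kills the remaining generators, hence preserves their ideal, and `isPrime_of_derivation` applies. -/
lemma isPrime_span_image {k : Type} [Field k] [CharZero k] [Algebra k R]
    {J : Type} [Fintype J] [DecidableEq J] {t : J → R}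
    (ht : Ideal.span (Set.range t) = IsLocalRing.maximalIdeal R)
    (δ : J → Derivation k R R) (hδ : ∀ i j, δ i (t j) = if i = j then 1 else 0)
    (B : Finset J) : (Ideal.span (t '' B)).IsPrime := by
  suffices ∀ C : Finset J, (Ideal.span (t '' (Cᶜ : Finset J))).IsPrime by
    have := this Bᶜ
    rwa [compl_compl] at this
  intro C
  induction C using Finset.induction_on with
  | empty =>
    rw [Finset.compl_empty, Finset.coe_univ, Set.image_univ, ht]
    infer_instance
  | insert j C hj ih =>
    refine isPrime_of_derivation (t := t j) (ht ▸ Ideal.subset_span ⟨j, rfl⟩) (δ j)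
      (by rw [hδ, if_pos rfl]) ?_ ?_
    · intro a ha
      refine Submodule.span_induction ?_ ?_ ?_ ?_ ha
      · rintro _ ⟨i, hi, rfl⟩
        have : j ≠ i := by
          rintro rfl
          simp at hi
        rw [hδ, if_neg this]
        exact zero_mem _
      · rw [map_zero]
        exact zero_mem _
      · intro x y _ _ hx hy
        rw [map_add]
        exact add_mem hx hy
      · intro r x hx hx'
        rw [smul_eq_mul, Derivation.leibniz]
        exact add_mem (Ideal.mul_mem_left _ _ hx') (by rw [smul_eq_mul, mul_comm]; exact Ideal.mul_mem_left _ _ hx)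
    · rw [← Ideal.span_union, Set.union_comm, Set.singleton_union, ← Set.image_insert_eq,
        ← Finset.coe_insert]
      have : insert j (insert j C)ᶜ = Cᶜ := by
        ext i
        simp only [Finset.mem_insert, Finset.mem_compl, not_or]
        grind
      rwa [this]

/-- Part of a regular system of parameters generates a prime ideal. -/
lemma isPrime_span_of_linearIndependent (k : Type) [Field k] [CharZero k] [Algebra k R]
    [Algebra.FormallySmooth k R] [Algebra.EssFiniteType k R] {J : Type} [Finite J]
    (t : J → IsLocalRing.maximalIdeal R)
    (ht : LinearIndependent (IsLocalRing.ResidueField R)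
      (fun j => (IsLocalRing.maximalIdeal R).toCotangent (t j))) :
    (Ideal.span (Set.range fun j => (t j : R))).IsPrime := by
  classical
  have := Fintype.ofFinite J
  -- The classes are completed to a basis of the cotangent space; by Nakayama's lemma lifts of the
  -- basis generate the maximal ideal.
  let b := Module.Basis.sumExtend ht
  let J' := J ⊕ ↑(Module.Basis.sumExtendIndex ht)
  have hfin : Finite J' := Module.Finite.finite_basis b
  have := Fintype.ofFinite J'
  choose s hs using fun j => Ideal.toCotangent_surjective _ (b j)
  let s' : J' → IsLocalRing.maximalIdeal R := Sum.elim t (fun j => s (Sum.inr j))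
  have hs' : ∀ j, (IsLocalRing.maximalIdeal R).toCotangent (s' j) = b j := by
    rintro (j | j)
    · simp only [b, s', Module.Basis.sumExtend, Module.Basis.reindex_apply, Sum.elim_inl,
        Module.Basis.extend_apply_self]
      exact (congrArg Subtype.val (Equiv.Set.sumDiffSubset_apply_inl
        (ht.linearIndepOn_id.subset_extend (Set.subset_univ _)) ⟨_, j, rfl⟩)).symm
    · exact hs (Sum.inr j)
  have hli : LinearIndependent (IsLocalRing.ResidueField R)
      (fun j => ((IsLocalRing.maximalIdeal R).toCotangent (s' j) : IsLocalRing.CotangentSpace R)) := by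
    have : (fun j => ((IsLocalRing.maximalIdeal R).toCotangent (s' j) : IsLocalRing.CotangentSpace R)) = b :=
      funext hs'
    rw [this]
    exact b.linearIndependent
  obtain ⟨δ, hδ⟩ := exists_dual_derivations k s' hli
  have hspan : Ideal.span (Set.range fun j => (s' j : R)) = IsLocalRing.maximalIdeal R := by
    have h1 := (IsLocalRing.CotangentSpace.span_image_eq_top_iff (R := R) (s := Set.range s')).1 (by
      rw [← Set.range_comp]
      exact (congrArg (fun v => Submodule.span (IsLocalRing.ResidueField R) (Set.range v))
        (funext hs')).trans b.span_eq)
    have h3 := congrArg (Submodule.map (Submodule.subtype _)) h1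
    rw [Submodule.map_span, ← Set.range_comp, Submodule.map_top, Submodule.range_subtype] at h3
    exact h3
  have := isPrime_span_image hspan δ hδ (Finset.univ.map ⟨Sum.inl, Sum.inl_injective⟩)
  have h2 : (fun j => (s' j : R)) '' ((Finset.univ.map ⟨Sum.inl, Sum.inl_injective⟩ : Finset J') : Set J') =
      Set.range fun j => (t j : R) := by
    ext a
    simp [s']
  rwa [h2] at this

end RegularParameters

/-! ### Differential forms on a smooth local ring inside its fraction field -/

section FractionField

variable (k : Type) {R : Type} (K : Type) [Field k] [CommRing R] [IsDomain R] [Field K]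
  [Algebra k R] [Algebra R K] [Algebra k K] [IsScalarTower k R K] [IsFractionRing R K]

/-- A derivation of a ring extends to its field of fractions. -/
lemma exists_extend_derivation (δ : Derivation k R R) : ∃ c : Ω[K⁄k] →ₗ[K] K, ∀ g : R,
    c (KaehlerDifferential.D k K (algebraMap R K g)) = algebraMap R K (δ g) := by
  let S := nonZeroDivisors R
  have hu : ∀ x : S, IsUnit (algebraMap R (Module.End R K) x) := by
    intro x
    have hx : algebraMap R K x ≠ 0 :=
      IsFractionRing.to_map_ne_zero_of_mem_nonZeroDivisors x.2
    rw [Module.End.isUnit_iff]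
    constructor
    · intro a b hab
      simp only [Module.algebraMap_end_apply, Algebra.smul_def] at hab
      exact mul_left_cancel₀ hx hab
    · intro b
      refine ⟨(algebraMap R K x)⁻¹ * b, ?_⟩
      simp only [Module.algebraMap_end_apply, Algebra.smul_def]
      rw [mul_inv_cancel_left₀ hx]
  -- The differentials of `K` are a localization of those of `R`, so contraction with `δ` extends,
  -- the non-zero elements of `R` acting invertibly on `K`.
  let c₀ : Ω[R⁄k] →ₗ[R] K := Algebra.linearMap R K ∘ₗ δ.liftKaehlerDifferential
  let c := (IsLocalizedModule.lift S (KaehlerDifferential.map k k R K) c₀ hu).extendScalarsOfIsLocalization S K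
  refine ⟨c, fun g => ?_⟩
  have h1 := IsLocalizedModule.lift_apply S (KaehlerDifferential.map k k R K) c₀ hu
    (KaehlerDifferential.D k R g)
  rw [KaehlerDifferential.map_D] at h1
  refine h1.trans ?_
  change algebraMap R K (δ.liftKaehlerDifferential _) = _
  rw [Derivation.liftKaehlerDifferential_comp_D]

/-- The module of forms with coefficients in `R`, inside the rational forms. -/
def integralForms : Submodule R (Ω[K⁄k]) :=
  Submodule.span R (Set.range fun g : R => KaehlerDifferential.D k K (algebraMap R K g))

variable {k K}

lemma D_mem_integralForms (g : R) :
    KaehlerDifferential.D k K (algebraMap R K g) ∈ integralForms (R := R) k K :=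
  Submodule.subset_span ⟨g, rfl⟩

lemma map_mem_integralForms (ω : Ω[R⁄k]) :
    KaehlerDifferential.map k k R K ω ∈ integralForms (R := R) k K := by
  have h : ω ∈ Submodule.span R (Set.range (KaehlerDifferential.D k R)) := by
    rw [KaehlerDifferential.span_range_derivation]
    trivial
  induction h using Submodule.span_induction with
  | mem a ha =>
    obtain ⟨g, rfl⟩ := ha
    rw [KaehlerDifferential.map_D]
    exact D_mem_integralForms g
  | zero => rw [map_zero]; exact zero_mem _
  | add a b _ _ ha hb => rw [map_add]; exact add_mem ha hb
  | smul r a _ ha => rw [map_smul]; exact Submodule.smul_mem _ r ha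

variable [Algebra.FormallySmooth k R] {B : Type} [CommRing B] [Algebra R B] [Algebra k B]
  [IsScalarTower k R B]

/-- The restriction of differential forms to a closed subscheme. -/
lemma exists_restrict_forms (h : Function.Surjective (algebraMap R B)) :
    ∃ ρ : integralForms (R := R) k K →ₗ[R] Ω[B⁄k],
      (∀ g, ρ ⟨_, D_mem_integralForms g⟩ = KaehlerDifferential.D k B (algebraMap R B g)) ∧
      ∀ ω, ρ ω = 0 → ∃ t ∈ RingHom.ker (algebraMap R B),
        ω - ⟨_, D_mem_integralForms t⟩ ∈ RingHom.ker (algebraMap R B) •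
          (⊤ : Submodule R (integralForms (R := R) k K)) := by
  let m := (KaehlerDifferential.map k k R K).codRestrict (integralForms (R := R) k K)
    map_mem_integralForms
  have hm : ∀ ω, (m ω : Ω[K⁄k]) = KaehlerDifferential.map k k R K ω := fun _ => rfl
  -- By formal smoothness the differentials of `R` form a projective, hence torsion-free module, so
  -- they embed in their localization, the differentials of `K`.
  have hinj : Function.Injective m := by
    rw [injective_iff_map_eq_zero]
    intro ω hω
    have h1 : KaehlerDifferential.map k k R K ω = 0 := congrArg Subtype.val hω
    rw [IsLocalizedModule.eq_zero_iff (nonZeroDivisors R)] at h1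
    obtain ⟨s, hs⟩ := h1
    exact (smul_eq_zero.1 hs).resolve_left (nonZeroDivisors.coe_ne_zero s)
  have hsurj : Function.Surjective m := by
    rintro ⟨ω, hω⟩
    change ω ∈ Submodule.span _ _ at hω
    induction hω using Submodule.span_induction with
    | mem a ha =>
      obtain ⟨g, rfl⟩ := ha
      exact ⟨KaehlerDifferential.D k R g, Subtype.ext (KaehlerDifferential.map_D k k R K g)⟩
    | zero => exact ⟨0, map_zero _⟩
    | add a b ha' hb' ha hb =>
      obtain ⟨x, hx⟩ := ha
      obtain ⟨y, hy⟩ := hb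
      exact ⟨x + y, by rw [map_add, hx, hy]; rfl⟩
    | smul r a _ ha =>
      obtain ⟨x, hx⟩ := ha
      exact ⟨r • x, by rw [map_smul, hx]; rfl⟩
  let e := LinearEquiv.ofBijective m ⟨hinj, hsurj⟩
  have he : ∀ g, e (KaehlerDifferential.D k R g) = ⟨_, D_mem_integralForms g⟩ := fun g =>
    Subtype.ext (KaehlerDifferential.map_D k k R K g)
  have he' : ∀ g, e.symm ⟨_, D_mem_integralForms g⟩ = KaehlerDifferential.D k R g := fun g => by
    rw [LinearEquiv.symm_apply_eq, he]
  refine ⟨KaehlerDifferential.map k k R B ∘ₗ e.symm.toLinearMap, fun g => ?_, fun ω hω => ?_⟩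
  · rw [LinearMap.comp_apply, LinearEquiv.coe_coe, he', KaehlerDifferential.map_D]
  · obtain ⟨x, rfl⟩ := e.surjective ω
    rw [LinearMap.comp_apply, LinearEquiv.coe_coe, LinearEquiv.symm_apply_apply] at hω
    -- Exactness of the conormal sequence I/I² → B ⊗ Ω_R → Ω_B, where I is the kernel of R → B.
    have h1 : (1 : B) ⊗ₜ[R] x ∈ LinearMap.range (KaehlerDifferential.kerCotangentToTensor k R B) := by
      rw [KaehlerDifferential.range_kerCotangentToTensor k R B h, Submodule.restrictScalars_mem,
        LinearMap.mem_ker, KaehlerDifferential.mapBaseChange_tmul, hω, smul_zero]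
    obtain ⟨t, ht⟩ := h1
    obtain ⟨t, rfl⟩ := Ideal.toCotangent_surjective _ t
    rw [KaehlerDifferential.kerCotangentToTensor_toCotangent] at ht
    refine ⟨t.1, t.2, ?_⟩
    have h2 : (1 : B) ⊗ₜ[R] (x - KaehlerDifferential.D k R t.1) = 0 := by
      rw [TensorProduct.tmul_sub, ht, sub_self]
    have h3 : x - KaehlerDifferential.D k R t.1 ∈
        RingHom.ker (algebraMap R B) • (⊤ : Submodule R (Ω[R⁄k])) := by
      let q : (R ⧸ RingHom.ker (algebraMap R B)) ≃ₗ[R] B :=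
        LinearMap.quotKerEquivOfSurjective (Algebra.linearMap R B) h
      have hq : q 1 = 1 := map_one (algebraMap R B)
      have h5 : (1 : R ⧸ RingHom.ker (algebraMap R B)) ⊗ₜ[R] (x - KaehlerDifferential.D k R t.1) = 0 := by
        apply (TensorProduct.congr q (LinearEquiv.refl R (Ω[R⁄k]))).injective
        rw [TensorProduct.congr_tmul, hq, map_zero]
        exact h2
      have h6 := congrArg (TensorProduct.quotTensorEquivQuotSMul (Ω[R⁄k])
        (RingHom.ker (algebraMap R B))) h5
      rw [← map_one (Ideal.Quotient.mk _), TensorProduct.quotTensorEquivQuotSMul_mk_tmul, map_zero,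
        one_smul] at h6
      exact (Submodule.Quotient.mk_eq_zero _).1 h6
    have h4 := Submodule.mem_map_of_mem (f := e.toLinearMap) h3
    rw [Submodule.map_smul'', Submodule.map_top, LinearEquiv.range, LinearEquiv.coe_coe, map_sub,
      he] at h4
    exact h4

end FractionField

end LogBott

namespace LogBott

/-! ### Submodules of powers of a module, in adapted coordinates -/

section Coordinates

variable {k O N : Type} [Field k] [CommRing O] [AddCommGroup N] [Module O N] (γ : k →+* O)
  {ι κ : Type}

/-- A matrix of constants acts on tuples. -/
def matVec [Fintype κ] (N : Type) [AddCommGroup N] [Module O N] (P : Matrix ι κ k) :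
    (κ → N) →ₗ[O] (ι → N) :=
  LinearMap.pi fun i => ∑ a, γ (P i a) • LinearMap.proj a

lemma matVec_apply [Fintype κ] (P : Matrix ι κ k) (n : κ → N) (i : ι) :
    matVec γ N P n i = ∑ a, γ (P i a) • n a := by
  simp [matVec]

lemma matVec_comp [Fintype κ] {μ : Type} [Fintype μ] (P : Matrix ι κ k) (Q : Matrix κ μ k)
    (n : μ → N) : matVec γ N P (matVec γ N Q n) = matVec γ N (P * Q) n := by
  funext i
  simp only [matVec_apply, Matrix.mul_apply, map_sum, map_mul, Finset.smul_sum, Finset.sum_smul,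
    smul_smul]
  exact Finset.sum_comm

lemma matVec_one [Fintype κ] [DecidableEq κ] (n : κ → N) : matVec γ N (1 : Matrix κ κ k) n = n := by
  funext i
  simp [matVec_apply, Matrix.one_apply, apply_ite γ, ite_smul]

lemma matVec_single [Fintype κ] [DecidableEq κ] (P : Matrix ι κ k) (a : κ) (m : N) :
    matVec γ N P (Pi.single a m) = fun i => γ (P i a) • m := by
  funext i
  rw [matVec_apply, Finset.sum_eq_single a]
  · rw [Pi.single_eq_same]
  · intro b _ hb
    rw [Pi.single_eq_of_ne hb, smul_zero]
  · simp

/-- The submodule of `ι → N` generated by the products of a constant vector in `W` and an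
element of `N`. -/
def vecSpan (N : Type) [AddCommGroup N] [Module O N] (W : Set (ι → k)) : Submodule O (ι → N) :=
  Submodule.span O {a | ∃ w ∈ W, ∃ m : N, a = fun i => γ (w i) • m}

lemma vecSpan_mono {W W' : Set (ι → k)} (h : W ⊆ W') : vecSpan γ N W ≤ vecSpan γ N W' :=
  Submodule.span_mono fun _ ⟨w, hw, m, hm⟩ => ⟨w, h hw, m, hm⟩

lemma vecSpan_span (W : Set (ι → k)) :
    vecSpan γ N (Submodule.span k W : Set (ι → k)) = vecSpan γ N W := by
  refine le_antisymm (Submodule.span_le.2 ?_) (vecSpan_mono γ Submodule.subset_span)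
  rintro _ ⟨w, hw, m, rfl⟩
  change w ∈ Submodule.span k W at hw
  change _ ∈ vecSpan γ N W
  induction hw using Submodule.span_induction generalizing m with
  | mem w hw => exact Submodule.subset_span ⟨w, hw, m, rfl⟩
  | zero =>
    convert zero_mem (vecSpan γ N W) using 1
    funext i
    simp
  | add w w' _ _ h h' =>
    convert add_mem (h m) (h' m) using 1
    funext i
    simp [add_smul]
  | smul r w _ h =>
    convert h (γ r • m) using 1
    funext i
    simp only [Pi.smul_apply, smul_eq_mul, map_mul, smul_smul, mul_comm]

lemma vecSpan_range [Fintype κ] (w : κ → ι → k) :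
    vecSpan γ N (Set.range w) = LinearMap.range (matVec γ N (Matrix.of fun i a => w a i)) := by
  classical
  apply le_antisymm
  · refine Submodule.span_le.2 ?_
    rintro _ ⟨_, ⟨a, rfl⟩, m, rfl⟩
    exact ⟨Pi.single a m, matVec_single γ _ a m⟩
  · rintro _ ⟨n, rfl⟩
    have : matVec γ N (Matrix.of fun i a => w a i) n = ∑ a, fun i => γ (w a i) • n a := by
      funext i
      rw [matVec_apply, Finset.sum_apply]
      rfl
    rw [this]
    exact sum_mem fun a _ => Submodule.subset_span ⟨w a, ⟨a, rfl⟩, _, rfl⟩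

/-- The coordinates with respect to a basis of constant vectors. -/
def basisEquiv [Fintype ι] [Fintype κ] [DecidableEq ι] (N : Type) [AddCommGroup N] [Module O N]
    (b : Module.Basis κ k (ι → k)) : (κ → N) ≃ₗ[O] (ι → N) := by
  classical
  exact LinearEquiv.ofLinearMap (matVec γ N ((Pi.basisFun k ι).toMatrix b))
    (matVec γ N (b.toMatrix (Pi.basisFun k ι)))
    (LinearMap.ext fun n => by
      rw [LinearMap.comp_apply, matVec_comp, Module.Basis.toMatrix_mul_toMatrix_flip, matVec_one]
      rfl)
    (LinearMap.ext fun n => by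
      rw [LinearMap.comp_apply, matVec_comp, Module.Basis.toMatrix_mul_toMatrix_flip, matVec_one]
      rfl)

lemma basisEquiv_single [Fintype ι] [Fintype κ] [DecidableEq ι] [DecidableEq κ]
    (b : Module.Basis κ k (ι → k)) (a : κ) (m : N) :
    basisEquiv γ N b (Pi.single a m) = fun i => γ (b a i) • m :=
  (matVec_single γ _ a m).trans rfl

/-- The tuples with coordinates in given multiples of `N`. -/
def piIdeal (N : Type) [AddCommGroup N] [Module O N] (c : κ → Ideal O) : Submodule O (κ → N) :=
  Submodule.pi Set.univ fun a => c a • (⊤ : Submodule O N)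

lemma mem_piIdeal {c : κ → Ideal O} {n : κ → N} :
    n ∈ piIdeal N c ↔ ∀ a, n a ∈ c a • (⊤ : Submodule O N) := by
  simp [piIdeal, Submodule.mem_pi]

/-- Sums, products with ideals (`smul_piIdeal`) and intersections (`piIdeal_inf_eq`) of such
submodules are computed one coordinate at a time. This reduces the identities between the modules
`stratH` to a single copy of `N`. -/
lemma piIdeal_sup (c c' : κ → Ideal O) : piIdeal N c ⊔ piIdeal N c' = piIdeal N (c ⊔ c') := by
  apply le_antisymm
  · refine sup_le ?_ ?_
    · intro n hn
      exact mem_piIdeal.2 fun a => Submodule.smul_mono_left le_sup_left (mem_piIdeal.1 hn a)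
    · intro n hn
      exact mem_piIdeal.2 fun a => Submodule.smul_mono_left le_sup_right (mem_piIdeal.1 hn a)
  · intro n hn
    have h : ∀ a, ∃ p ∈ c a • (⊤ : Submodule O N), ∃ q ∈ c' a • (⊤ : Submodule O N), p + q = n a := by
      intro a
      have := mem_piIdeal.1 hn a
      rw [Pi.sup_apply, Submodule.sup_smul] at this
      exact Submodule.mem_sup.1 this
    choose p hp q hq hpq using h
    exact Submodule.mem_sup.2 ⟨p, mem_piIdeal.2 hp, q, mem_piIdeal.2 hq, funext hpq⟩

lemma piIdeal_eq_span [Fintype κ] [DecidableEq κ] (c : κ → Ideal O) :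
    piIdeal N c = Submodule.span O {n | ∃ a, ∃ r ∈ c a, ∃ m : N, n = Pi.single a (r • m)} := by
  apply le_antisymm
  · intro n hn
    rw [← Finset.univ_sum_single n]
    refine sum_mem fun a _ => ?_
    have := mem_piIdeal.1 hn a
    refine Submodule.smul_induction_on this (fun r hr m _ => Submodule.subset_span ⟨a, r, hr, m, rfl⟩)
      (fun x y hx hy => ?_)
    rw [Pi.single_add]
    exact add_mem hx hy
  · refine Submodule.span_le.2 ?_
    rintro _ ⟨a, r, hr, m, rfl⟩
    refine mem_piIdeal.2 fun b => ?_
    by_cases h : b = a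
    · subst h
      rw [Pi.single_eq_same]
      exact Submodule.smul_mem_smul hr trivial
    · rw [Pi.single_eq_of_ne h]
      exact zero_mem _

lemma smul_piIdeal [Fintype κ] (I : Ideal O) (c : κ → Ideal O) :
    I • piIdeal N c = piIdeal N fun a => I * c a := by
  classical
  apply le_antisymm
  · refine Submodule.smul_le.2 fun r hr n hn => mem_piIdeal.2 fun a => ?_
    change r • n a ∈ _
    rw [← smul_eq_mul, Submodule.smul_assoc]
    exact Submodule.smul_mem_smul hr (mem_piIdeal.1 hn a)
  · rw [piIdeal_eq_span]
    refine Submodule.span_le.2 ?_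
    rintro _ ⟨a, r, hr, m, rfl⟩
    refine Submodule.mul_induction_on hr (fun s hs u hu => ?_) (fun x y hx hy => ?_)
    · rw [mul_smul]
      have : (Pi.single a (s • u • m) : κ → N) = s • Pi.single a (u • m) := by
        rw [← Pi.single_smul]
      rw [this]
      refine Submodule.smul_mem_smul hs ?_
      rw [piIdeal_eq_span]
      exact Submodule.subset_span ⟨a, u, hu, m, rfl⟩
    · rw [add_smul, Pi.single_add]
      exact add_mem hx hy

lemma piIdeal_inf_eq {c c' c'' : κ → Ideal O} (h : ∀ a, c a • (⊤ : Submodule O N) ⊓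
    c' a • (⊤ : Submodule O N) = c'' a • (⊤ : Submodule O N)) :
    piIdeal N c ⊓ piIdeal N c' = piIdeal N c'' := by
  ext n
  rw [Submodule.mem_inf, mem_piIdeal, mem_piIdeal, mem_piIdeal, ← forall_and]
  exact forall_congr' fun a => by rw [← h, Submodule.mem_inf]

lemma map_basisEquiv_piIdeal [Fintype ι] [Fintype κ] [DecidableEq ι] (b : Module.Basis κ k (ι → k))
    (s : Set κ) [DecidablePred (· ∈ s)] :
    (piIdeal N fun a => if a ∈ s then ⊤ else ⊥).map (basisEquiv γ N b).toLinearMap =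
      vecSpan γ N (b '' s) := by
  classical
  rw [piIdeal_eq_span, Submodule.map_span]
  apply le_antisymm
  · refine Submodule.span_le.2 ?_
    rintro _ ⟨_, ⟨a, r, hr, m, rfl⟩, rfl⟩
    by_cases h : a ∈ s
    · refine Submodule.subset_span ⟨b a, ⟨a, h, rfl⟩, r • m, ?_⟩
      exact basisEquiv_single γ b a _
    · rw [if_neg h] at hr
      rw [(Submodule.mem_bot O).1 hr, zero_smul, Pi.single_zero, map_zero]
      exact zero_mem _
  · refine Submodule.span_le.2 ?_
    rintro _ ⟨_, ⟨a, h, rfl⟩, m, rfl⟩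
    refine Submodule.subset_span ⟨Pi.single a m, ⟨a, 1, ?_, m, by rw [one_smul]⟩, ?_⟩
    · rw [if_pos h]
      trivial
    · exact basisEquiv_single γ b a _

end Coordinates

/-! ### The modules attached to a normal crossings configuration -/

section Configuration

variable {k O : Type} [Field k] [CommRing O] (γ : k →+* O) {J ι : Type} [DecidableEq J]
  (I : J → Ideal O) (W : Finset J → Submodule k (ι → k))

/-- The sum, over the ways to split `T` into `K` and `L`, of the submodules generated by the
multiples by the ideals `I j`, `j ∈ S ∪ K`, of the vectors in `W (A ∪ L)`. -/
def stratH (N : Type) [AddCommGroup N] [Module O N] : List J → Finset J → Finset J → Submodule O (ι → N)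
  | [], S, A => (∏ j ∈ S, I j) • vecSpan γ N (W A)
  | j :: T, S, A => stratH N T (insert j S) A ⊔ stratH N T S (insert j A)

variable {N : Type} [AddCommGroup N] [Module O N] {I W}

lemma stratH_anti (hW : Antitone W) (T : List J) (S : Finset J) {A A' : Finset J} (h : A ⊆ A') :
    stratH γ I W N T S A' ≤ stratH γ I W N T S A := by
  induction T generalizing S A A' with
  | nil => exact Submodule.smul_mono le_rfl (vecSpan_mono γ (hW h))
  | cons j T ih => exact sup_le_sup (ih _ h) (ih _ (Finset.insert_subset_insert j h))

lemma stratH_insert {j : J} (hj : I j = ⊤) (T : List J) (S A : Finset J) :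
    stratH γ I W N T (insert j S) A = stratH γ I W N T S A := by
  induction T generalizing S A with
  | nil =>
    have : ∏ i ∈ insert j S, I i = ∏ i ∈ S, I i :=
      Finset.prod_insert_of_eq_one_if_notMem fun _ => hj.trans Ideal.one_eq_top.symm
    rw [stratH, stratH, this]
  | cons i T ih => rw [stratH, stratH, Finset.insert_comm, ih, ih]

variable {κ : Type} [Fintype ι] [Fintype κ] [DecidableEq ι]

/-- The ideals describing `stratH` in adapted coordinates. -/
def stratC (I : J → Ideal O) (M : κ → Finset J) (T : List J) (S A : Finset J) (a : κ) : Ideal O :=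
  if Disjoint (M a) A then (∏ j ∈ S, I j) * ((T.filter (· ∈ M a)).map I).prod else ⊥

/-- If `j` belongs to `M a`, the second ideal is zero and the first carries the factor `I j`.
Otherwise the first ideal is `I j` times the second and is absorbed by it. -/
lemma stratC_cons {M : κ → Finset J} {j : J} {T : List J} {S A : Finset J} (hS : j ∉ S) (a : κ) :
    stratC I M (j :: T) S A a = stratC I M T (insert j S) A a ⊔ stratC I M T S (insert j A) a := by
  simp only [stratC, Finset.prod_insert hS, Finset.disjoint_insert_right, List.filter_cons]
  by_cases h : Disjoint (M a) A <;> by_cases h' : j ∈ M a <;> simp [h, h']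
  · ring
  · rw [mul_comm (I j), mul_assoc]
    exact Ideal.mul_mono_right Ideal.mul_le_right

variable (I W) in
/-- A basis of constant vectors is adapted to a configuration: each `W B` is spanned by those
members of the basis whose labels are disjoint from `B`. -/
structure IsAdapted (b : Module.Basis κ k (ι → k)) (M : κ → Finset J) (Jx : Finset J) : Prop where
  anti : Antitone W
  eq_top : ∀ j ∉ Jx, I j = ⊤
  subset : ∀ a, M a ⊆ Jx
  eq_span : ∀ B ⊆ Jx, W B = Submodule.span k (b '' {a | Disjoint (M a) B})

variable {b : Module.Basis κ k (ι → k)} {M : κ → Finset J} {Jx : Finset J}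

/-- In an adapted basis the sum over all splittings of `T` is diagonal. Along the vector with label
`M a` the largest contribution puts into L all members of `T` outside `M a`, which leaves the
product of the ideals over T ∩ `M a`. -/
lemma stratH_eq (h : IsAdapted I W b M Jx) (T : List J)
    (S A : Finset J) (hA : A ⊆ Jx) (hT : T.Nodup) (hS : ∀ j ∈ T, j ∉ S) :
    stratH γ I W N T S A =
      (piIdeal N (stratC I M T S A)).map (basisEquiv γ N b).toLinearMap := by
  induction T generalizing S A with
  | nil =>
    rw [stratH, h.eq_span A hA, vecSpan_span, ← map_basisEquiv_piIdeal, ← Submodule.map_smul'', smul_piIdeal]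
    congr 2
    funext a
    simp [stratC, mul_ite]
  | cons j T ih =>
    have h1 : stratH γ I W N T (insert j S) A = _ := ih (insert j S) A hA (List.nodup_cons.1 hT).2
      (fun i hi => by
        rw [Finset.mem_insert]
        rintro (rfl | h')
        · exact (List.nodup_cons.1 hT).1 hi
        · exact hS i (List.mem_cons_of_mem _ hi) h')
    have hjS : j ∉ S := hS j List.mem_cons_self
    by_cases hj : j ∈ Jx
    · rw [stratH, h1, ih S (insert j A) (Finset.insert_subset hj hA) (List.nodup_cons.1 hT).2
        (fun i hi => hS i (List.mem_cons_of_mem _ hi)), ← Submodule.map_sup, piIdeal_sup]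
      congr 2
      funext a
      exact (stratC_cons hjS a).symm
    -- For `j` outside `Jx` the ideal `I j` is the unit ideal, so the summand in which `j` joins `S`
    -- absorbs the one in which it joins `A`.
    · rw [stratH, sup_eq_left.2, h1]
      · congr 2
        funext a
        have : j ∉ M a := fun h' => hj (h.subset a h')
        simp [stratC, Finset.prod_insert hjS, h.eq_top j hj, this]
      · rw [stratH_insert γ (h.eq_top j hj)]
        exact stratH_anti γ h.anti T S (Finset.subset_insert j A)

variable (I) in
/-- Regularity of the generators of the ideals `I j`, on a module. -/
def RegularOn (N : Type) [AddCommGroup N] [Module O N] : Prop :=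
  ∃ t : J → O, (∀ j, I j = Ideal.span {t j}) ∧ (∀ j, ∀ m : N, t j • m = 0 → m = 0) ∧
    ∀ (A : Finset J) (j : J), j ∉ A → ∀ m : N, t j • m ∈ A.sup I • (⊤ : Submodule O N) →
      m ∈ A.sup I • (⊤ : Submodule O N)

lemma RegularOn.list_prod (h : RegularOn I N) (l : List J) : ∃ c : O, (l.map I).prod = Ideal.span {c} ∧
    ∀ m : N, c • m = 0 → m = 0 := by
  obtain ⟨t, ht, h0, -⟩ := h
  induction l with
  | nil => exact ⟨1, by simp, fun m hm => by rwa [one_smul] at hm⟩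
  | cons j l ih =>
    obtain ⟨c, hc, hc'⟩ := ih
    refine ⟨t j * c, ?_, fun m hm => hc' m (h0 j _ ?_)⟩
    · rw [List.map_cons, List.prod_cons, hc, ht, Ideal.span_singleton_mul_span_singleton]
    · rwa [← mul_smul]

/-- Every coordinate ideal `stratC` is either zero or of this form: principal, with a generator
injective on `N`. -/
lemma RegularOn.prod (h : RegularOn I N) (l : List J) (S : Finset J) :
    ∃ c : O, (∏ j ∈ S, I j) * (l.map I).prod = Ideal.span {c} ∧ ∀ m : N, c • m = 0 → m = 0 := by
  obtain ⟨c, hc, h⟩ := h.list_prod (S.toList ++ l)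
  refine ⟨c, ?_, h⟩
  rw [← hc, List.map_append, List.prod_append, Finset.prod_map_toList]

/-- After division by `c`, which is injective on `N`, it remains to see that t_j n ∈ I_A N implies n
∈ I_A N; this is the regularity of t_j on N / I_A N. -/
lemma RegularOn.inf_eq (h : RegularOn I N) {A : Finset J} {j : J} (hj : j ∉ A) {c : O}
    (hc : ∀ m : N, c • m = 0 → m = 0) :
    (Ideal.span {c} * I j) • (⊤ : Submodule O N) ⊓ (Ideal.span {c} * A.sup I) • (⊤ : Submodule O N) =
      (Ideal.span {c} * (I j * A.sup I)) • (⊤ : Submodule O N) := by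
  obtain ⟨t, ht, -, h⟩ := h
  have key : ∀ (K : Ideal O) (m : N), m ∈ (Ideal.span {c} * K) • (⊤ : Submodule O N) ↔
      ∃ n ∈ K • (⊤ : Submodule O N), c • n = m := by
    intro K m
    rw [← smul_eq_mul, Submodule.smul_assoc, Submodule.ideal_span_singleton_smul,
      Submodule.mem_smul_pointwise_iff_exists]
  apply le_antisymm
  · rintro m ⟨hm, hm'⟩
    obtain ⟨n, hn, rfl⟩ := (key _ _).1 hm
    obtain ⟨n', hn', h1⟩ := (key _ _).1 hm'
    have h2 : n = n' := by
      rw [← sub_eq_zero]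
      refine hc _ ?_
      rw [smul_sub, h1, sub_self]
    subst h2
    rw [ht j, Submodule.ideal_span_singleton_smul, Submodule.mem_smul_pointwise_iff_exists] at hn
    obtain ⟨n', -, rfl⟩ := hn
    refine (key _ _).2 ⟨_, ?_, rfl⟩
    rw [← smul_eq_mul, Submodule.smul_assoc, ht j]
    exact Submodule.smul_mem_smul (Ideal.mem_span_singleton_self _) (h A j hj n' hn')
  · refine le_inf (Submodule.smul_mono_left (Ideal.mul_mono_right Ideal.mul_le_left)) ?_
    exact Submodule.smul_mono_left (Ideal.mul_mono_right Ideal.mul_le_right)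

lemma sup_eq_top_of_not_subset (h : IsAdapted I W b M Jx) {A : Finset J} (hA : ¬ A ⊆ Jx) :
    A.sup I = ⊤ := by
  obtain ⟨j, hj, hj'⟩ := Finset.not_subset.1 hA
  exact top_le_iff.1 ((h.eq_top j hj').symm.le.trans (Finset.le_sup hj))

lemma stratH_cons_of_notMem (h : IsAdapted I W b M Jx) {j : J} (hj : j ∉ Jx) (T : List J) (S A : Finset J) :
    stratH γ I W N (j :: T) S A = stratH γ I W N T (insert j S) A := by
  rw [stratH, sup_eq_left, stratH_insert γ (h.eq_top j hj)]
  exact stratH_anti γ h.anti T S (Finset.subset_insert j A)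

/-- This is Q ∩ (P + I_A H) = I_{A ∪ j} Q, with P and Q the two summands of H. The coordinate of Q
is zero if `j` belongs to `M a`; otherwise Q and H have the same coordinate ideal c, that of P is
I_j c, and both sides become (I_j + I_A) c. -/
lemma stratH_inf_sup (h : IsAdapted I W b M Jx) {j : J} {T : List J} {S A : Finset J}
    (hT : (j :: T).Nodup) (hS : ∀ i ∈ j :: T, i ∉ S) :
    stratH γ I W N T S (insert j A) ⊓ (stratH γ I W N T (insert j S) A ⊔
      A.sup I • stratH γ I W N (j :: T) S A) = (insert j A).sup I • stratH γ I W N T S (insert j A) := by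
  by_cases hA : A ⊆ Jx
  · by_cases hj : j ∈ Jx
    · have h1 := stratH_eq γ (N := N) h T S (insert j A) (Finset.insert_subset hj hA) hT.of_cons
        (fun i hi => hS i (List.mem_cons_of_mem _ hi))
      have h2 := stratH_eq γ (N := N) h T (insert j S) A hA hT.of_cons (fun i hi => by
        rw [Finset.mem_insert]
        rintro (rfl | h')
        · exact (List.nodup_cons.1 hT).1 hi
        · exact hS i (List.mem_cons_of_mem _ hi) h')
      have h3 := stratH_eq γ (N := N) h (j :: T) S A hA hT hS
      rw [h1, h2, h3, ← Submodule.map_smul'', ← Submodule.map_smul'', ← Submodule.map_sup,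
        ← Submodule.map_inf _ (basisEquiv γ N b).injective, smul_piIdeal, smul_piIdeal, piIdeal_sup]
      congr 1
      refine piIdeal_inf_eq fun a => ?_
      simp only [Pi.sup_apply, stratC_cons (hS j List.mem_cons_self)]
      simp only [stratC, Finset.disjoint_insert_right, Finset.prod_insert (hS j List.mem_cons_self)]
      by_cases h4 : Disjoint (M a) A
      · by_cases h5 : j ∈ M a
        · simp [h5]
        · simp only [h4, h5, not_false_eq_true, and_self, if_true]
          set c := (∏ j ∈ S, I j) * ((T.filter (· ∈ M a)).map I).prod with hc
          rw [mul_assoc (I j), ← hc, Finset.sup_insert, sup_eq_right.2 (Ideal.mul_le_right : I j * c ≤ c),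
            ← Ideal.sup_mul, inf_eq_right]
          exact Submodule.smul_mono_left Ideal.mul_le_right
      · simp [h4]
    -- Here `I j`, and with it the sum over `insert j A`, is the unit ideal, and both sides are the
    -- module Q.
    · rw [stratH_cons_of_notMem γ h hj, Finset.sup_insert, h.eq_top j hj, top_sup_eq,
        Submodule.top_smul, sup_eq_left.2 Submodule.smul_le_right, inf_eq_left,
        stratH_insert γ (h.eq_top j hj)]
      exact stratH_anti γ h.anti T S (Finset.subset_insert j A)
  · rw [Finset.sup_insert, sup_eq_top_of_not_subset h hA, sup_top_eq, Submodule.top_smul,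
      Submodule.top_smul, inf_eq_left]
    exact le_sup_of_le_right le_sup_right

/-- This is P ∩ I_A H = I_A P. If `j` belongs to `M a`, then P and H have the same coordinate.
Otherwise it reads I_j c N ∩ I_A c N = I_A I_j c N, which is `RegularOn.inf_eq`. -/
lemma stratH_inf_smul (h : IsAdapted I W b M Jx) (hreg : RegularOn I N) {j : J} {T : List J} {S A : Finset J} (hT : (j :: T).Nodup)
    (hS : ∀ i ∈ j :: T, i ∉ S) (hA : j ∉ A) :
    stratH γ I W N T (insert j S) A ⊓ A.sup I • stratH γ I W N (j :: T) S A =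
      A.sup I • stratH γ I W N T (insert j S) A := by
  by_cases hA' : A ⊆ Jx
  · by_cases hj : j ∈ Jx
    · have h2 := stratH_eq γ (N := N) h T (insert j S) A hA' hT.of_cons (fun i hi => by
        rw [Finset.mem_insert]
        rintro (rfl | h')
        · exact (List.nodup_cons.1 hT).1 hi
        · exact hS i (List.mem_cons_of_mem _ hi) h')
      have h3 := stratH_eq γ (N := N) h (j :: T) S A hA' hT hS
      rw [h2, h3, ← Submodule.map_smul'', ← Submodule.map_smul'',
        ← Submodule.map_inf _ (basisEquiv γ N b).injective, smul_piIdeal, smul_piIdeal]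
      congr 1
      refine piIdeal_inf_eq fun a => ?_
      simp only [stratC_cons (hS j List.mem_cons_self)]
      simp only [stratC, Finset.disjoint_insert_right, Finset.prod_insert (hS j List.mem_cons_self)]
      obtain ⟨c, hc, hc'⟩ := hreg.prod (T.filter (· ∈ M a)) S
      by_cases h4 : Disjoint (M a) A
      · by_cases h5 : j ∈ M a
        · simp only [h4, h5, not_true_eq_false, false_and, if_true, if_false, sup_bot_eq]
          rw [inf_eq_right]
          exact Submodule.smul_mono_left Ideal.mul_le_right
        · simp only [h4, h5, not_false_eq_true, and_self, if_true]
          rw [mul_assoc (I j), hc,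
            sup_eq_right.2 (Ideal.mul_le_right : I j * Ideal.span {c} ≤ Ideal.span {c})]
          convert hreg.inf_eq hA hc' using 2
          · rw [mul_comm]
          · rw [mul_comm]
          · ring
      · simp [h4]
    · rw [stratH_cons_of_notMem γ h hj, inf_eq_right]
      exact Submodule.smul_le_right
  · rw [sup_eq_top_of_not_subset h hA', Submodule.top_smul, Submodule.top_smul, stratH, inf_eq_left]
    exact le_sup_left

end Configuration

end LogBott

namespace LogBott

/-! ### Acyclicity of the sheaves attached to a normal crossings configuration -/

section Families

variable {X : Scheme.{0}} {J : Type}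

lemma IdFam.exists_prod (I : J → IdFam X) (S : Finset J) :
    ∃ K : IdFam X, K.at' = fun x => ∏ j ∈ S, (I j).at' x := by
  classical
  induction S using Finset.induction_on with
  | empty => exact ⟨1, funext fun x => Ideal.one_eq_top.symm⟩
  | insert j S hj ih =>
    obtain ⟨K, hK⟩ := ih
    refine ⟨I j * K, funext fun x => ?_⟩
    rw [IdFam.mul_at, hK, Finset.prod_insert hj]

lemma IdFam.exists_sum (I : J → IdFam X) (S : Finset J) :
    ∃ K : IdFam X, K.at' = fun x => S.sup fun j => (I j).at' x := by
  classical
  induction S using Finset.induction_on with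
  | empty => exact ⟨⊥, rfl⟩
  | insert j S hj ih =>
    obtain ⟨K, hK⟩ := ih
    refine ⟨I j ⊔ K, funext fun x => ?_⟩
    rw [IdFam.sup_at, hK, Finset.sup_insert]

/-- The product of finitely many families of ideals. -/
def IdFam.prod (I : J → IdFam X) (S : Finset J) : IdFam X :=
  ⟨fun x => ∏ j ∈ S, (I j).at' x, by
    obtain ⟨K, hK⟩ := IdFam.exists_prod I S
    have h := K.spread
    rwa [hK] at h⟩

@[simp] lemma IdFam.prod_at (I : J → IdFam X) (S : Finset J) (x : X) :
    (IdFam.prod I S).at' x = ∏ j ∈ S, (I j).at' x := rfl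

/-- The sum of finitely many families of ideals. -/
def IdFam.sum (I : J → IdFam X) (S : Finset J) : IdFam X :=
  ⟨fun x => S.sup fun j => (I j).at' x, by
    obtain ⟨K, hK⟩ := IdFam.exists_sum I S
    have h := K.spread
    rwa [hK] at h⟩

@[simp] lemma IdFam.sum_at (I : J → IdFam X) (S : Finset J) (x : X) :
    (IdFam.sum I S).at' x = S.sup fun j => (I j).at' x := rfl

variable (γ : ℂ →+* Γ(X, ⊤)) {ι κ : Type} {E : X.Modules}

/-- The constants in a local ring. -/
def germC (x : X) : ℂ →+* X.presheaf.stalk x := (X.presheaf.germ ⊤ x (mem_top x)).hom.comp γ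

/-- The family generated by the products of constant vectors and elements of the stalks. -/
def Fam.ofConst (E : X.Modules) (W : Set (ι → ℂ)) : Fam E ι :=
  Fam.ofVectors E ((fun w i => γ (w i)) '' W)

lemma Fam.ofConst_at (W : Set (ι → ℂ)) (x : X) :
    (Fam.ofConst γ E W).at' x = vecSpan (germC γ x) (St E x) W := by
  refine congrArg (Submodule.span _) (Set.ext fun a => ?_)
  constructor
  · rintro ⟨_, ⟨w, hw, rfl⟩, m, rfl⟩
    exact ⟨w, hw, m, rfl⟩
  · rintro ⟨w, hw, m, rfl⟩
    exact ⟨_, ⟨w, hw, rfl⟩, m, rfl⟩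

/-- The family of the tuples with entries in given multiples of the stalks. -/
def Fam.pi [Finite κ] (E : X.Modules) (c : κ → IdFam X) : Fam E κ :=
  ⟨fun x => piIdeal (St E x) fun a => (c a).at' x, fun x n hn => by
    classical
    have := Fintype.ofFinite κ
    rw [piIdeal_eq_span] at hn
    induction hn using Submodule.span_induction with
    | mem n hn =>
      obtain ⟨a, r, hr, m, rfl⟩ := hn
      obtain ⟨U, hU, g, rfl, hg⟩ := (c a).spread x r hr
      obtain ⟨V, hV, e, rfl⟩ := exists_germM m
      have key : ∀ y (hy : y ∈ U ⊓ V), gt (Pi.single a ((rs inf_le_left g : Γ(X, U ⊓ V)) •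
          E.presheaf.map (homOfLE inf_le_right).op e) : κ → Γ(E, U ⊓ V)) y hy =
          Pi.single a (X.presheaf.germ U y (mem_left hy) g • germM y (mem_right hy) e) := by
        intro y hy
        funext b
        by_cases hb : b = a
        · subst hb
          rw [Pi.single_eq_same]
          refine (congrArg (germM y hy) (Pi.single_eq_same (M := fun _ => Γ(E, U ⊓ V)) b _)).trans ?_
          rw [germM_smul, germ_rs, germM_res]
        · rw [Pi.single_eq_of_ne hb]
          exact (congrArg (germM y hy) (Pi.single_eq_of_ne (M := fun _ => Γ(E, U ⊓ V)) hb _)).trans (map_zero _)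
      refine ⟨U ⊓ V, mem_inf hU hV, _, key x _, fun y hy => ?_⟩
      rw [key]
      refine (piIdeal_eq_span (N := St E y) fun a => (c a).at' y).ge ?_
      exact Submodule.subset_span ⟨a, _, hg y (mem_left hy), _, rfl⟩
    | zero => exact Spread.zero _ _
    | add m m' _ _ hm hm' => exact hm.add hm'
    | smul r m _ hm => exact hm.smul_left r⟩

lemma Fam.pi_at [Finite κ] (c : κ → IdFam X) (x : X) :
    (Fam.pi E c).at' x = piIdeal (St E x) fun a => (c a).at' x := rfl

/-- The inclusion of a coordinate axis. -/
def FibreMap.single [DecidableEq κ] (E : X.Modules) (a : κ) : FibreMap E Unit E κ :=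
  ⟨fun x => (AddMonoidHom.single _ a).comp (Pi.evalAddMonoidHom _ ()), fun {U} e x hx =>
    ⟨U, hx, Pi.single a (e ()), fun y hU hV => funext fun b => by
      by_cases hb : b = a
      · subst hb
        exact (congrArg (germM y hV) (Pi.single_eq_same (M := fun _ => Γ(E, U)) b _)).trans
          (Pi.single_eq_same (M := fun _ => St E y) b _).symm
      · exact ((congrArg (germM y hV) (Pi.single_eq_of_ne (M := fun _ => Γ(E, U)) hb _)).trans
          (map_zero _)).trans (Pi.single_eq_of_ne (M := fun _ => St E y) hb _).symm⟩⟩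

/-- A matrix of constants acts on tuples of sections. -/
def FibreMap.matVec [Fintype κ] (E : X.Modules) (P : Matrix ι κ ℂ) : FibreMap E κ E ι :=
  ⟨fun x => (LogBott.matVec (germC γ x) (St E x) P).toAddMonoidHom, fun {U} e x hx =>
    ⟨U, hx, fun i => ∑ a, (rs le_top (γ (P i a)) : Γ(X, U)) • e a, fun y hU hV => funext fun i => by
      refine (map_sum (germM y hV) _ _).trans ?_
      refine Eq.trans ?_ (matVec_apply (germC γ y) P (gt e y hV) i).symm
      refine Finset.sum_congr rfl fun a _ => ?_
      rw [germM_smul, germ_rs]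
      rfl⟩⟩

/-- Filter by the set `s` of coordinates in which multiples of `P`, and not only of `R`, are
allowed. Each step adds one copy of the quotient of `P` by `R`, inserted by `FibreMap.single`. -/
lemma acyc_pi [Finite κ] {P R : IdFam X} (hRP : ∀ x, R.at' x ≤ P.at' x)
    (h : Acyc (P • Fam.full E Unit) (R • Fam.full E Unit)) :
    Acyc (Fam.pi E fun _ : κ => P) (Fam.pi E fun _ : κ => R) := by
  classical
  have := Fintype.ofFinite κ
  suffices ∀ s : Finset κ, Acyc (Fam.pi E fun a => if a ∈ s then P else R)
      (Fam.pi E fun _ : κ => R) by simpa using this Finset.univ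
  have hsm : ∀ (x : X) (Q : Ideal (X.presheaf.stalk x)) (m : Unit → St E x),
      m ∈ Q • (⊤ : Submodule (X.presheaf.stalk x) (Unit → St E x)) ↔
        m () ∈ Q • (⊤ : Submodule (X.presheaf.stalk x) (St E x)) := by
    intro x Q m
    have h1 : Q • (⊤ : Submodule (X.presheaf.stalk x) (Unit → St E x)) =
        piIdeal (St E x) fun _ : Unit => Q := by
      have := smul_piIdeal (N := St E x) Q (fun _ : Unit => (⊤ : Ideal (X.presheaf.stalk x)))
      rw [show (fun a : Unit => Q * (⊤ : Ideal (X.presheaf.stalk x))) = fun _ => Q from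
        funext fun _ => Ideal.mul_top _] at this
      rw [← this]
      congr 1
      refine (eq_top_iff.2 fun n _ => mem_piIdeal.2 fun _ => ?_).symm
      rw [Submodule.top_smul]
      trivial
    rw [h1, mem_piIdeal]
    exact ⟨fun h => h (), fun h _ => h⟩
  have hmem : ∀ (s : Finset κ) (x : X) (n : κ → St E x),
      n ∈ (Fam.pi E fun a => if a ∈ s then P else R).at' x ↔
        ∀ b, (b ∈ s → n b ∈ P.at' x • (⊤ : Submodule (X.presheaf.stalk x) (St E x))) ∧
          (b ∉ s → n b ∈ R.at' x • (⊤ : Submodule (X.presheaf.stalk x) (St E x))) := by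
    intro s x n
    refine mem_piIdeal.trans (forall_congr' fun b => ?_)
    by_cases hb : b ∈ s <;> simp [hb]
  intro s
  induction s using Finset.induction_on with
  | empty => exact Acyc.of_le fun x => by simp [Fam.pi_at]
  | insert a s ha ih =>
    refine Acyc.trans (H₂ := Fam.pi E fun b => if b ∈ s then P else R) ?_ ?_ ?_ ih
    · intro x n hn
      refine (hmem _ _ _).2 fun b => ⟨fun _ => ?_, fun hb => ?_⟩
      · by_cases h' : b ∈ s
        · exact ((hmem _ _ _).1 hn b).1 h'
        · exact Submodule.smul_mono_left (hRP x) (((hmem _ _ _).1 hn b).2 h')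
      · exact ((hmem _ _ _).1 hn b).2 fun h' => hb (Finset.mem_insert_of_mem h')
    · intro x n hn
      have := mem_piIdeal.1 hn
      exact (hmem _ _ _).2 fun b => ⟨fun _ => Submodule.smul_mono_left (hRP x) (this b),
        fun _ => this b⟩
    · have hs : ∀ (x : X) (m : Unit → St E x), (FibreMap.single E a).φ x m a = m () := fun x m =>
        Pi.single_eq_same (M := fun _ => St E x) a _
      have hn : ∀ (x : X) (m : Unit → St E x) (b), b ≠ a → (FibreMap.single E a).φ x m b = 0 :=
        fun x m b hb => Pi.single_eq_of_ne (M := fun _ => St E x) hb _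
      refine (Acyc.iff_of_fibreMap (FibreMap.single E a) ?_ ?_ ?_ ?_).1 h
      · intro x m hm
        refine (hmem _ _ _).2 fun b => ?_
        by_cases hb : b = a
        · subst hb
          rw [hs]
          exact ⟨fun _ => (hsm x _ m).1 hm, fun h' => absurd (Finset.mem_insert_self _ _) h'⟩
        · rw [hn x m b hb]
          exact ⟨fun _ => zero_mem _, fun _ => zero_mem _⟩
      · intro x m hm
        refine (hmem _ _ _).2 fun b => ?_
        by_cases hb : b = a
        · subst hb
          rw [hs]
          exact ⟨fun h' => absurd h' ha, fun _ => (hsm x _ m).1 hm⟩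
        · rw [hn x m b hb]
          exact ⟨fun _ => zero_mem _, fun _ => zero_mem _⟩
      · intro x m hm hm'
        have h1 := ((hmem _ _ _).1 hm' a).2 ha
        rw [hs] at h1
        exact (hsm x _ m).2 h1
      · intro x n hn'
        have h1 := (hmem _ _ _).1 hn'
        refine ⟨fun _ => n a, (hsm x _ _).2 ((h1 a).1 (Finset.mem_insert_self _ _)),
          (hmem _ _ _).2 fun b => ?_⟩
        rw [Pi.sub_apply]
        by_cases hb : b = a
        · subst hb
          rw [hs, sub_self]
          exact ⟨fun _ => zero_mem _, fun _ => zero_mem _⟩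
        · rw [hn _ _ b hb, sub_zero]
          exact ⟨fun h' => (h1 b).1 (Finset.mem_insert_of_mem h'), fun h' => (h1 b).2 (by
            simp [hb, h'])⟩

/-- A basis of `W` identifies the family with a power of `E`: the matrix of the basis has a constant
left inverse, so it is injective on all stalks. The quotient is thus a sum of dim W copies of the
one assumed acyclic. -/
lemma acyc_ofConst [Finite ι] {P Q : IdFam X} (W : Submodule ℂ (ι → ℂ))
    (h : Acyc (P • Fam.full E Unit) (Q • P • Fam.full E Unit)) :
    Acyc (P • Fam.ofConst γ E (W : Set (ι → ℂ))) (Q • P • Fam.ofConst γ E (W : Set (ι → ℂ))) := by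
  classical
  have := Fintype.ofFinite ι
  let w := Module.finBasis ℂ W
  let κ := Fin (Module.finrank ℂ W)
  have hle : ∀ x, (Q * P).at' x ≤ P.at' x := fun x => Ideal.mul_le_right
  have h' : Acyc (P • Fam.full E Unit) ((Q * P) • Fam.full E Unit) := by
    have : (Q * P) • Fam.full E Unit = Q • P • Fam.full E Unit :=
      Fam.ext (funext fun x => Submodule.smul_assoc (Q.at' x) (P.at' x) _)
    rwa [this]
  have h1 := acyc_pi (κ := κ) hle h'
  let B : Matrix ι κ ℂ := Matrix.of fun i a => (w a : ι → ℂ) i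
  have hsp : Submodule.span ℂ (Set.range fun a => (w a : ι → ℂ)) = W := by
    have := congrArg (Submodule.map W.subtype) w.span_eq
    rwa [Submodule.map_span, ← Set.range_comp, Submodule.map_top, Submodule.range_subtype] at this
  obtain ⟨C, hC⟩ : ∃ C : Matrix κ ι ℂ, C * B = 1 := by
    have hli : LinearIndependent ℂ fun a => (w a : ι → ℂ) :=
      w.linearIndependent.map' W.subtype (Submodule.ker_subtype W)
    have : Function.Injective B.mulVec := Matrix.mulVec_injective_iff.2 hli
    obtain ⟨g, hg⟩ := B.mulVecLin.exists_leftInverse_of_injective (LinearMap.ker_eq_bot.2 this)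
    refine ⟨LinearMap.toMatrix' g, ?_⟩
    have h2 := congrArg LinearMap.toMatrix' hg
    rwa [LinearMap.toMatrix'_comp, ← Matrix.toLin'_apply', LinearMap.toMatrix'_toLin',
      LinearMap.toMatrix'_id] at h2
  have hat : ∀ x, (Fam.ofConst γ E (W : Set (ι → ℂ))).at' x =
      (⊤ : Submodule (X.presheaf.stalk x) (κ → St E x)).map (matVec (germC γ x) (St E x) B) := by
    intro x
    have h2 := vecSpan_span (germC γ x) (N := St E x) (Set.range fun a => (w a : ι → ℂ))
    rw [hsp, vecSpan_range, ← Submodule.map_top] at h2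
    rw [Fam.ofConst_at, h2]
  have htop : ∀ (x : X) (K : Ideal (X.presheaf.stalk x)),
      K • (⊤ : Submodule (X.presheaf.stalk x) (κ → St E x)) = piIdeal (St E x) fun _ : κ => K := by
    intro x K
    have h2 := smul_piIdeal (N := St E x) K (fun _ : κ => (⊤ : Ideal (X.presheaf.stalk x)))
    rw [show (fun a : κ => K * (⊤ : Ideal (X.presheaf.stalk x))) = fun _ => K from
      funext fun _ => Ideal.mul_top _] at h2
    rw [← h2]
    congr 1
    refine (eq_top_iff.2 fun n _ => mem_piIdeal.2 fun _ => ?_).symm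
    rw [Submodule.top_smul]
    trivial
  have hP : ∀ x, (P • Fam.ofConst γ E (W : Set (ι → ℂ))).at' x =
      ((Fam.pi E fun _ : κ => P).at' x).map (matVec (germC γ x) (St E x) B) := by
    intro x
    rw [Fam.smul_at, hat, ← Submodule.map_smul'', htop]
    rfl
  have hQ : ∀ x, (Q • P • Fam.ofConst γ E (W : Set (ι → ℂ))).at' x =
      ((Fam.pi E fun _ : κ => Q * P).at' x).map (matVec (germC γ x) (St E x) B) := by
    intro x
    rw [Fam.smul_at, Fam.smul_at, hat, ← Submodule.smul_assoc, ← Submodule.map_smul'', htop]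
    rfl
  have hinj : ∀ x, Function.Injective (matVec (germC γ x) (St E x) B) := by
    intro x m n hmn
    have := congrArg (matVec (germC γ x) (St E x) C) hmn
    rwa [matVec_comp, matVec_comp, hC, matVec_one, matVec_one] at this
  refine (Acyc.iff_of_fibreMap (FibreMap.matVec γ E B) ?_ ?_ ?_ ?_).1 h1
  · intro x m hm
    rw [hP]
    exact Submodule.mem_map_of_mem hm
  · intro x m hm
    rw [hQ]
    exact Submodule.mem_map_of_mem hm
  · intro x m hm hm'
    rw [hQ] at hm'
    obtain ⟨n, hn, hnm⟩ := hm'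
    rwa [← hinj x hnm]
  · intro x m hm
    rw [hP] at hm
    obtain ⟨n, hn, rfl⟩ := hm
    refine ⟨n, hn, ?_⟩
    change matVec (germC γ x) (St E x) B n - matVec (germC γ x) (St E x) B n ∈ _
    rw [sub_self]
    exact zero_mem _

variable [DecidableEq J] (I : J → IdFam X) (W : Finset J → Submodule ℂ (ι → ℂ))

/-- The modules `stratH`, as a family. -/
def stratFam (E : X.Modules) : List J → Finset J → Finset J → Fam E ι
  | [], S, A => IdFam.prod I S • Fam.ofConst γ E (W A : Set (ι → ℂ))
  | j :: T, S, A => stratFam E T (insert j S) A ⊔ stratFam E T S (insert j A)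

lemma stratFam_at (T : List J) (S A : Finset J) (x : X) : (stratFam γ I W E T S A).at' x =
    stratH (germC γ x) (fun j => (I j).at' x) W (St E x) T S A := by
  induction T generalizing S A with
  | nil => rw [stratFam, stratH, Fam.smul_at, Fam.ofConst_at, IdFam.prod_at]
  | cons j T ih => rw [stratFam, stratH, Fam.sup_at, ih, ih]

/-- The acyclicity of all the sheaves attached to a configuration follows from that of those which
do not involve a sum. -/
lemma acyc_stratFam [Fintype ι] [DecidableEq ι] [Fintype J]
    (hloc : ∀ x, ∃ (κ : Type) (_ : Fintype κ) (b : Module.Basis κ ℂ (ι → ℂ)) (M : κ → Finset J)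
      (Jx : Finset J), IsAdapted (fun j => (I j).at' x) W b M Jx)
    (hreg : ∀ x, RegularOn (fun j => (I j).at' x) (St E x)) (A₀ : Finset J)
    (base : ∀ S A : Finset J, S ∪ A = Finset.univ → Disjoint S A → A ⊆ A₀ →
      Acyc (stratFam γ I W E [] S A) (IdFam.sum I A • stratFam γ I W E [] S A))
    (T : List J) (S A : Finset J) (hT : T.Nodup) (hTS : ∀ j ∈ T, j ∉ S) (hTA : ∀ j ∈ T, j ∉ A)
    (hSA : Disjoint S A) (hall : ∀ j, j ∈ T ∨ j ∈ S ∨ j ∈ A) (hA : A ⊆ A₀) (hT₀ : ∀ j ∈ T, j ∈ A₀) :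
    Acyc (stratFam γ I W E T S A) (IdFam.sum I A • stratFam γ I W E T S A) := by
  induction T generalizing S A with
  | nil =>
    refine base S A ?_ hSA hA
    ext j
    simpa using hall j
  | cons j T ih =>
    have hj := (List.nodup_cons.1 hT).1
    have hjS := hTS j List.mem_cons_self
    have hjA := hTA j List.mem_cons_self
    have hP := ih (insert j S) A hT.of_cons
      (fun i hi => by
        rw [Finset.mem_insert]
        rintro (rfl | h')
        · exact hj hi
        · exact hTS i (List.mem_cons_of_mem _ hi) h')
      (fun i hi => hTA i (List.mem_cons_of_mem _ hi))
      (Finset.disjoint_insert_left.2 ⟨hjA, hSA⟩)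
      (fun i => by
        have := hall i
        simp only [List.mem_cons, Finset.mem_insert] at this ⊢
        tauto) hA (fun i hi => hT₀ i (List.mem_cons_of_mem _ hi))
    have hQ := ih S (insert j A) hT.of_cons
      (fun i hi => hTS i (List.mem_cons_of_mem _ hi))
      (fun i hi => by
        rw [Finset.mem_insert]
        rintro (rfl | h')
        · exact hj hi
        · exact hTA i (List.mem_cons_of_mem _ hi) h')
      (Finset.disjoint_insert_right.2 ⟨hjS, hSA⟩)
      (fun i => by
        have := hall i
        simp only [List.mem_cons, Finset.mem_insert] at this ⊢
        tauto) (Finset.insert_subset (hT₀ j List.mem_cons_self) hA)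
        (fun i hi => hT₀ i (List.mem_cons_of_mem _ hi))
    -- Let P and Q be the two summands of H. The filtration H ⊇ P + I_A H ⊇ I_A H has the quotients
    -- Q / (Q ∩ (P + I_A H)) = Q / I_{A ∪ j} Q and P / (P ∩ I_A H) = P / I_A P, both covered by the
    -- induction hypothesis.
    refine Acyc.trans (H₂ := stratFam γ I W E T (insert j S) A ⊔
      IdFam.sum I A • stratFam γ I W E (j :: T) S A) ?_ ?_ ?_ ?_
    · intro x
      exact sup_le le_sup_left Submodule.smul_le_right
    · intro x
      exact le_sup_right
    · refine (Acyc.iff_of_sup (H₁ := stratFam γ I W E T S (insert j A)) (fun x => ?_)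
        (fun x => ?_)).1 hQ
      · rw [stratFam, Fam.sup_at, Fam.sup_at, Fam.smul_at, Fam.sup_at]
        apply le_antisymm
        · exact sup_le (le_sup_of_le_right le_sup_left) le_sup_left
        · refine sup_le le_sup_right (sup_le le_sup_left Submodule.smul_le_right)
      · obtain ⟨κ, _, b, M, Jx, had⟩ := hloc x
        rw [Fam.sup_at, Fam.smul_at, Fam.smul_at, stratFam_at, stratFam_at, stratFam_at,
          IdFam.sum_at, IdFam.sum_at]
        exact (stratH_inf_sup (germC γ x) had hT hTS).symm
    · refine (Acyc.iff_of_sup (H₁ := stratFam γ I W E T (insert j S) A) (fun x => rfl)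
        (fun x => ?_)).1 hP
      obtain ⟨κ, _, b, M, Jx, had⟩ := hloc x
      rw [Fam.smul_at, Fam.smul_at, stratFam_at, stratFam_at, IdFam.sum_at]
      exact (stratH_inf_smul (germC γ x) had (hreg x) hT hTS hjA).symm

end Families

end LogBott

namespace LogBott

/-! ### Stalks of quasi-coherent modules -/

section Quasicoherent

variable {X : Scheme.{0}} {E : X.Modules}

lemma fromSpec_scalar {U : X.Opens} (hU : IsAffineOpen U) (V : (Spec Γ(X, U)).Opens)
    (h : hU.fromSpec ''ᵁ V ≤ U) (s : Γ(X, U)) :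
    (hU.fromSpec.appIso V).inv ((Spec Γ(X, U)).presheaf.map V.leTop.op
      ((Scheme.ΓSpecIso Γ(X, U)).inv s)) = X.presheaf.map (homOfLE h).op s := by
  have hV : V ≤ hU.fromSpec ⁻¹ᵁ U := by
    rw [hU.fromSpec_preimage_self]
    exact le_top
  have h1 := Scheme.Hom.appLE_appIso_inv hU.fromSpec hV
  have h2 : hU.fromSpec.appLE U V hV =
      (Scheme.ΓSpecIso Γ(X, U)).inv ≫ (Spec Γ(X, U)).presheaf.map V.leTop.op := by
    rw [Scheme.Hom.appLE, hU.fromSpec_app_self, Category.assoc, ← Functor.map_comp]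
    rfl
  rw [h2] at h1
  exact ConcreteCategory.congr_hom h1 s

lemma fromSpec_image_top {U : X.Opens} (hU : IsAffineOpen U) : hU.fromSpec ''ᵁ ⊤ = U := by
  rw [← hU.fromSpec_preimage_self]
  ext1
  change hU.fromSpec '' hU.fromSpec ⁻¹' (U : Set X) = _
  rw [Set.image_preimage_eq_inter_range, Set.inter_eq_left, hU.range_fromSpec]

/-- Over an affine open set a quasi-coherent module is the sheaf associated with a module, so
restriction to a basic open set is a localization. Quasi-coherence enters through this property. -/
lemma isLocalizedModule_restrict (hE : IsQuasicoherent E) {U : X.Opens} (hU : IsAffineOpen U)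
    (s : Γ(X, U)) : IsLocalizedModule (.powers s)
      ((modulesSpecToSheaf.obj (E.restrict hU.fromSpec)).obj.map
        (PrimeSpectrum.basicOpen s).leTop.op).hom := by
  have : SheafOfModules.IsQuasicoherent (R := X.ringCatSheaf) E := hE
  have h2 : SheafOfModules.IsQuasicoherent (E.restrict hU.fromSpec) :=
    inferInstanceAs (SheafOfModules.IsQuasicoherent
      ((Scheme.Modules.restrictFunctor hU.fromSpec).obj E))
  exact (isIso_fromTildeΓ_iff_isLocalizing (E.restrict hU.fromSpec)).1 inferInstance s

lemma fromSpec_smul {U : X.Opens} (hU : IsAffineOpen U) (V : (Spec Γ(X, U)).Opens)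
    (h : hU.fromSpec ''ᵁ V ≤ U) (s : Γ(X, U)) (e : Γ(E, hU.fromSpec ''ᵁ V)) :
    ((s • (show Γ(E.restrict hU.fromSpec, V) from e) : Γ(E.restrict hU.fromSpec, V)) :
      Γ(E, hU.fromSpec ''ᵁ V)) = (rs h s : Γ(X, hU.fromSpec ''ᵁ V)) • e := by
  have := fromSpec_scalar hU V h s
  exact congrArg (fun r : Γ(X, hU.fromSpec ''ᵁ V) => r • e) this

/-- A germ of a quasi-coherent module is a fraction. -/
lemma exists_smul_eq_germM (hE : IsQuasicoherent E) {U : X.Opens} (hU : IsAffineOpen U) {x : X}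
    (hx : x ∈ U) (v : St E x) : ∃ (s : Γ(X, U)) (e : Γ(E, U)), x ∈ X.basicOpen s ∧
      X.presheaf.germ U x hx s • v = germM x hx e := by
  obtain ⟨V, hV, e₀, rfl⟩ := exists_germM v
  obtain ⟨s, hsV, hxs⟩ := hU.exists_basicOpen_le (V := V) ⟨x, hV⟩ hx
  have hloc := isLocalizedModule_restrict hE hU s
  have himg := hU.fromSpec_image_basicOpen s
  have htop := fromSpec_image_top hU
  let W := hU.fromSpec ''ᵁ PrimeSpectrum.basicOpen s
  have hW : W ≤ V := himg.le.trans hsV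
  have hWU : W ≤ U := himg.le.trans (X.basicOpen_le s)
  have hxW : x ∈ W := himg.ge hxs
  let T := hU.fromSpec ''ᵁ ⊤
  have hWT : W ≤ T := hWU.trans htop.ge
  obtain ⟨⟨e, n⟩, h⟩ := hloc.surj (show Γ(E, W) from E.presheaf.map (homOfLE hW).op e₀)
  obtain ⟨n, N, rfl⟩ := n
  let e' : Γ(E, T) := e
  have h1 : (rs hWU (s ^ N) : Γ(X, W)) • (E.presheaf.map (homOfLE hW).op e₀ : Γ(E, W)) =
      E.presheaf.map (homOfLE hWT).op e' := by
    rw [← fromSpec_smul hU _ hWU]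
    exact h
  refine ⟨s ^ N, E.presheaf.map (homOfLE htop.ge).op e', ?_, ?_⟩
  · rw [Scheme.mem_basicOpen _ _ x hx, map_pow]
    exact ((Scheme.mem_basicOpen _ _ x hx).1 hxs).pow N
  · have h2 := congrArg (germM x hxW) h1
    rw [germM_smul, germ_rs, germM_res, germM_res] at h2
    rw [h2, germM_res]

/-- A section of a quasi-coherent module with zero germ is torsion. -/
lemma exists_smul_eq_zero (hE : IsQuasicoherent E) {U : X.Opens} (hU : IsAffineOpen U) {x : X}
    (hx : x ∈ U) (e : Γ(E, U)) (he : germM x hx e = 0) :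
    ∃ s : Γ(X, U), x ∈ X.basicOpen s ∧ s • e = 0 := by
  have h0 : germM x hx e = germM (U := U) x hx 0 := by rw [he, map_zero]
  obtain ⟨V, hV, i, j, hres⟩ := exists_res_eq_of_germM_eq h0
  obtain ⟨s, hsV, hxs⟩ := hU.exists_basicOpen_le (V := V) ⟨x, hV⟩ hx
  have hloc := isLocalizedModule_restrict hE hU s
  have himg := hU.fromSpec_image_basicOpen s
  have htop := fromSpec_image_top hU
  let W := hU.fromSpec ''ᵁ PrimeSpectrum.basicOpen s
  have hW : W ≤ V := himg.le.trans hsV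
  let T := hU.fromSpec ''ᵁ ⊤
  have hWT : W ≤ T := (himg.le.trans (X.basicOpen_le s)).trans htop.ge
  let e' : Γ(E, T) := E.presheaf.map (homOfLE htop.le).op e
  have h1 : E.presheaf.map (homOfLE hWT).op e' = 0 := by
    have h2 : E.presheaf.map (homOfLE hW).op (E.presheaf.map (homOfLE i).op e) = 0 := by
      rw [hres]
      exact (congrArg _ (map_zero (E.presheaf.map (homOfLE j).op).hom)).trans
        (map_zero (E.presheaf.map (homOfLE hW).op).hom)
    refine Eq.trans ?_ h2
    exact (ConcreteCategory.congr_hom (E.presheaf.map_comp (homOfLE htop.le).op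
      (homOfLE hWT).op) e).symm.trans (ConcreteCategory.congr_hom (E.presheaf.map_comp
        (homOfLE i).op (homOfLE hW).op) e)
  have h1' : ((modulesSpecToSheaf.obj (E.restrict hU.fromSpec)).obj.map
      (PrimeSpectrum.basicOpen s).leTop.op).hom e' = 0 := h1
  obtain ⟨⟨n, N, rfl⟩, h⟩ := (IsLocalizedModule.eq_zero_iff (.powers s) _).1 h1'
  refine ⟨s ^ N, ?_, ?_⟩
  · rw [Scheme.mem_basicOpen _ _ x hx, map_pow]
    exact ((Scheme.mem_basicOpen _ _ x hx).1 hxs).pow N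
  · have h3 : (rs htop.le (s ^ N) : Γ(X, T)) • e' = 0 := by
      rw [← fromSpec_smul hU _ htop.le]
      exact h
    have h4 : E.presheaf.map (homOfLE htop.ge).op ((rs htop.le (s ^ N) : Γ(X, T)) • e') = 0 :=
      (congrArg (E.presheaf.map (homOfLE htop.ge).op).hom h3).trans
        (map_zero (E.presheaf.map (homOfLE htop.ge).op).hom)
    rw [Scheme.Modules.map_smul] at h4
    have h5 : E.presheaf.map (homOfLE htop.ge).op e' = e :=
      (ConcreteCategory.congr_hom (E.presheaf.map_comp (homOfLE htop.le).op
        (homOfLE htop.ge).op) e).symm.trans (ConcreteCategory.congr_hom (E.presheaf.map_id _) e)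
    have h6 : X.presheaf.map (homOfLE htop.ge).op (rs htop.le (s ^ N)) = s ^ N :=
      (ConcreteCategory.congr_hom (X.presheaf.map_comp (homOfLE htop.le).op
        (homOfLE htop.ge).op) (s ^ N)).symm.trans
          (ConcreteCategory.congr_hom (X.presheaf.map_id _) (s ^ N))
    rwa [h5, h6] at h4

/-- The stalks of an ideal sheaf are generated by its sections over any affine open set. -/
lemma IdFam.ofIdealSheaf_at (I : X.IdealSheafData) (x : X) (U : X.affineOpens) (hx : x ∈ U.1) :
    (IdFam.ofIdealSheaf I).at' x = (I.ideal U).map (X.presheaf.germ U.1 x hx).hom := by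
  refine le_antisymm (Submodule.span_le.2 ?_) (IdFam.map_le_ofIdealSheaf I x U hx)
  rintro _ ⟨V, hV, g, hg, rfl⟩
  obtain ⟨_, ⟨W, hW, rfl⟩, hxW, hWUV⟩ := X.isBasis_affineOpens.exists_subset_of_mem_open
    (show x ∈ ((U.1 ⊓ V.1 : X.Opens) : Set X) from ⟨hx, hV⟩) (U.1 ⊓ V.1 : X.Opens).2
  let W' : X.affineOpens := ⟨W, hW⟩
  have hU' : W' ≤ U := fun y hy => (hWUV hy).1
  have hV' : W' ≤ V := fun y hy => (hWUV hy).2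
  have h1 : X.presheaf.germ V.1 x hV g = X.presheaf.germ W x hxW (rs hV' g) :=
    (germ_rs hV' g x hxW).symm
  have h2 : rs hV' g ∈ I.ideal W' := by
    rw [← I.map_ideal hV']
    exact Ideal.mem_map_of_mem _ hg
  rw [← I.map_ideal hU'] at h2
  have h3 := Ideal.mem_map_of_mem (X.presheaf.germ W x hxW).hom h2
  rw [Ideal.map_map] at h3
  rw [h1]
  have h4 : (X.presheaf.germ W x hxW).hom.comp (X.presheaf.map (homOfLE hU').op).hom =
      (X.presheaf.germ U.1 x hx).hom := by
    ext a
    exact germ_rs _ _ _ _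
  rw [← h4]
  exact h3

/-- The stalks of the ideal sheaf of a component at a point. -/
lemma IsLocalEquation.ofIdealSheaf_at {Z : IrreducibleCloseds X} {x : X} {t : X.presheaf.stalk x}
    (h : IsLocalEquation Z x t) : (IdFam.ofIdealSheaf (idealOf Z)).at' x = Ideal.span {t} := by
  obtain ⟨_, ⟨U, hU, rfl⟩, hxU, -⟩ := X.isBasis_affineOpens.exists_subset_of_mem_open
    (show x ∈ ((⊤ : X.Opens) : Set X) from trivial) (⊤ : X.Opens).2
  rw [IdFam.ofIdealSheaf_at _ x ⟨U, hU⟩ hxU]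
  exact h ⟨U, hU⟩ hxU

lemma isLocalEquation_iff {Z : IrreducibleCloseds X} {x : X} {t : X.presheaf.stalk x} :
    IsLocalEquation Z x t ↔ (IdFam.ofIdealSheaf (idealOf Z)).at' x = Ideal.span {t} :=
  ⟨fun h => h.ofIdealSheaf_at, fun h U hx => by rw [← IdFam.ofIdealSheaf_at _ x U hx, h]⟩

lemma sup_span_singleton {R J : Type} [CommRing R] (g : J → R) (A : Finset J) :
    (A.sup fun j => Ideal.span {g j}) = Ideal.span (g '' A) := by
  classical
  induction A using Finset.induction_on with
  | empty => simp
  | insert j A hj ih => rw [Finset.sup_insert, ih, Finset.coe_insert, Set.image_insert_eq, Ideal.span_insert]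

lemma germM_mem_smul {U : X.Opens} {x : X} (hx : x ∈ U) {K : Ideal Γ(X, U)} {e : Γ(E, U)}
    (he : e ∈ K • (⊤ : Submodule Γ(X, U) Γ(E, U))) :
    germM x hx e ∈ K.map (X.presheaf.germ U x hx).hom •
      (⊤ : Submodule (X.presheaf.stalk x) (St E x)) := by
  refine Submodule.smul_induction_on he (fun r hr m _ => ?_) (fun a b ha hb => ?_)
  · rw [germM_smul]
    exact Submodule.smul_mem_smul (Ideal.mem_map_of_mem _ hr) trivial
  · rw [map_add]
    exact add_mem ha hb

/-- An element of K E_x involves finitely many fractions; a common denominator, invertible at `x`,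
turns it into the germ of an element of K E(U). A second such factor kills the difference of two
sections with the same germ. -/
lemma exists_smul_mem (hE : IsQuasicoherent E) {U : X.Opens} (hU : IsAffineOpen U) {x : X}
    (hx : x ∈ U) {K : Ideal Γ(X, U)} (e : Γ(E, U))
    (he : germM x hx e ∈ K.map (X.presheaf.germ U x hx).hom •
      (⊤ : Submodule (X.presheaf.stalk x) (St E x))) :
    ∃ s : Γ(X, U), x ∈ X.basicOpen s ∧ s • e ∈ K • (⊤ : Submodule Γ(X, U) Γ(E, U)) := by
  have hmul : ∀ s s' : Γ(X, U), x ∈ X.basicOpen s → x ∈ X.basicOpen s' → x ∈ X.basicOpen (s * s') := by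
    intro s s' hs hs'
    rw [Scheme.basicOpen_mul]
    exact ⟨hs, hs'⟩
  -- Up to a function invertible at `x`, the germ `n` comes from a section in `K` times the module
  -- of sections.
  let P : St E x → Prop := fun n => ∃ s : Γ(X, U), x ∈ X.basicOpen s ∧
    ∃ e' ∈ K • (⊤ : Submodule Γ(X, U) Γ(E, U)), X.presheaf.germ U x hx s • n = germM x hx e'
  have hadd : ∀ a b, P a → P b → P (a + b) := by
    rintro a b ⟨s, hs, e, he, h⟩ ⟨s', hs', e', he', h'⟩
    refine ⟨s * s', hmul _ _ hs hs', s' • e + s • e', add_mem (Submodule.smul_mem _ _ he)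
      (Submodule.smul_mem _ _ he'), ?_⟩
    rw [map_mul, map_add, germM_smul, germM_smul, ← h, ← h', smul_add, mul_smul, mul_smul]
    congr 1
    rw [smul_comm]
  have hP : P (germM x hx e) := by
    refine Submodule.smul_induction_on he (fun r hr m _ => ?_) hadd
    rw [Ideal.map] at hr
    induction hr using Submodule.span_induction generalizing m with
    | mem r hr =>
      obtain ⟨a, ha, rfl⟩ := hr
      obtain ⟨s, e, hs, he⟩ := exists_smul_eq_germM hE hU hx m
      refine ⟨s, hs, a • e, Submodule.smul_mem_smul ha trivial, ?_⟩
      rw [germM_smul, ← he]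
      exact smul_comm _ _ _
    | zero =>
      refine ⟨1, ?_, 0, zero_mem _, by rw [zero_smul, smul_zero, map_zero]⟩
      rw [Scheme.mem_basicOpen _ _ x hx, map_one]
      exact isUnit_one
    | add a b _ _ ha hb =>
      rw [add_smul]
      exact hadd _ _ (ha m trivial) (hb m trivial)
    | smul c a _ ha =>
      rw [smul_eq_mul, mul_comm, mul_smul]
      exact ha _ trivial
  obtain ⟨s, hs, e', he', h⟩ := hP
  obtain ⟨s', hs', h'⟩ := exists_smul_eq_zero hE hU hx (s • e - e') (by
    rw [map_sub, germM_smul, h, sub_self])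
  refine ⟨s' * s, hmul _ _ hs' hs, ?_⟩
  rw [smul_sub, sub_eq_zero] at h'
  rw [mul_smul, h']
  exact Submodule.smul_mem _ _ he'

/-- `D`-regularity on the stalks. -/
lemma IsDivisorRegular.regularOn {D : Finset (IrreducibleCloseds X)} (hE : IsQuasicoherent E)
    (h : IsDivisorRegular D E) (x : X) : RegularOn (fun Z : {Z : IrreducibleCloseds X // Z ∈ D} =>
      (IdFam.ofIdealSheaf (idealOf Z.1)).at' x) (St E x) := by
  classical
  obtain ⟨U, hx, t, ht, hreg⟩ := h x
  have hat : ∀ Z : {Z : IrreducibleCloseds X // Z ∈ D}, (IdFam.ofIdealSheaf (idealOf Z.1)).at' x =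
      Ideal.span {X.presheaf.germ U.1 x hx (t Z.1)} := by
    intro Z
    rw [IdFam.ofIdealSheaf_at _ x U hx, ht Z.1 Z.2, Ideal.map_span, Set.image_singleton]
  have unit : ∀ s : Γ(X, U.1), x ∈ X.basicOpen s → IsUnit (X.presheaf.germ U.1 x hx s) :=
    fun s hs => (Scheme.mem_basicOpen _ _ x hx).1 hs
  have cancel : ∀ (K : Submodule (X.presheaf.stalk x) (St E x)) (s : Γ(X, U.1)) (m : St E x),
      x ∈ X.basicOpen s → X.presheaf.germ U.1 x hx s • m ∈ K → m ∈ K := by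
    intro K s m hs hm
    obtain ⟨u, hu⟩ := unit s hs
    rw [← hu] at hm
    exact (Submodule.smul_mem_iff_of_isUnit K u.isUnit).1 hm
  let K : Finset {Z : IrreducibleCloseds X // Z ∈ D} → Ideal Γ(X, U.1) := fun A =>
    Ideal.span ((fun Z : {Z : IrreducibleCloseds X // Z ∈ D} => t Z.1) '' (A : Set _))
  have hK : ∀ A, (A.sup fun Z => (IdFam.ofIdealSheaf (idealOf Z.1)).at' x) =
      (K A).map (X.presheaf.germ U.1 x hx).hom := by
    intro A
    simp only [hat, sup_span_singleton, K, Ideal.map_span, Set.image_image]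
  have key : ∀ (A : Finset {Z : IrreducibleCloseds X // Z ∈ D}) (Z) , Z ∉ A → ∀ m : St E x,
      X.presheaf.germ U.1 x hx (t Z.1) • m ∈
        (A.sup fun Z => (IdFam.ofIdealSheaf (idealOf Z.1)).at' x) •
          (⊤ : Submodule (X.presheaf.stalk x) (St E x)) →
      m ∈ (A.sup fun Z => (IdFam.ofIdealSheaf (idealOf Z.1)).at' x) •
          (⊤ : Submodule (X.presheaf.stalk x) (St E x)) := by
    intro A Z hZ m hm
    rw [hK] at hm ⊢
    obtain ⟨s, e, hs, he⟩ := exists_smul_eq_germM hE U.2 hx m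
    refine cancel _ s m hs ?_
    rw [he]
    have h1 : germM x hx (t Z.1 • e) ∈ (K A).map (X.presheaf.germ U.1 x hx).hom •
        (⊤ : Submodule (X.presheaf.stalk x) (St E x)) := by
      rw [germM_smul, ← he, smul_comm]
      exact Submodule.smul_mem _ _ hm
    obtain ⟨s', hs', h2⟩ := exists_smul_mem hE U.2 hx _ h1
    refine cancel _ s' _ hs' ?_
    rw [← germM_smul]
    refine germM_mem_smul hx ?_
    rw [smul_comm] at h2
    -- The components are listed with the members of `A` first, then `Z`, then the others. For this
    -- order the regularity condition at `Z` says that its equation is a non-zero-divisor modulo the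
    -- ideal generated by `A`.
    let rest := (Finset.univ \ insert Z A).toList
    have hr := hreg ((A.toList ++ Z :: rest).map Subtype.val)
      (List.Nodup.map Subtype.val_injective (by
        rw [List.nodup_append]
        refine ⟨A.nodup_toList, List.nodup_cons.2 ⟨by simp [rest], Finset.nodup_toList _⟩, ?_⟩
        intro a ha b hb
        rw [Finset.mem_toList] at ha
        rcases List.mem_cons.1 hb with rfl | hb
        · rintro rfl
          exact hZ ha
        · rintro rfl
          simp [rest, ha] at hb))
      (fun Y => by
        simp only [List.mem_map, List.mem_append, Finset.mem_toList, List.mem_cons, rest,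
          Finset.mem_sdiff, Finset.mem_univ, true_and, Finset.mem_insert, not_or]
        constructor
        · rintro ⟨a, -, rfl⟩
          exact a.2
        · intro hY
          refine ⟨⟨Y, hY⟩, ?_, rfl⟩
          tauto)
    rw [List.map_append, List.map_append, RingTheory.Sequence.isWeaklyRegular_append_iff,
      List.map_cons, List.map_cons, RingTheory.Sequence.isWeaklyRegular_cons_iff] at hr
    have hKA : Ideal.ofList ((A.toList.map Subtype.val).map t) = K A := by
      refine congrArg Ideal.span ?_
      ext a
      simp
    have h3 := hr.2.1
    rw [hKA] at h3
    have h4 : t Z.1 • Submodule.Quotient.mk (p := K A • (⊤ : Submodule Γ(X, U.1) Γ(E, U.1)))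
        (s' • e) = t Z.1 • 0 := by
      rw [smul_zero]
      exact (Submodule.Quotient.mk_eq_zero _).2 h2
    exact (Submodule.Quotient.mk_eq_zero _).1 (h3 h4)
  refine ⟨fun Z => X.presheaf.germ U.1 x hx (t Z.1), hat, fun Z m hm => ?_, key⟩
  -- For the empty set, regularity is injectivity on the stalk itself.
  have := key ∅ Z (Finset.notMem_empty _) m (by rw [hm]; exact zero_mem _)
  rwa [Finset.sup_empty, Submodule.bot_smul] at this

end Quasicoherent

end LogBott

namespace LogBott

/-! ### The local rings of a smooth variety -/

section SmoothStalks

variable {X : Scheme.{0}} (f : X ⟶ Spec (.of ℂ))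

/-- The constant functions. -/
def globalConst : ℂ →+* Γ(X, ⊤) := ((Scheme.ΓSpecIso (.of ℂ)).inv ≫ f.appTop).hom

/-- The algebra structure of a local ring. -/
abbrev stalkAlgebra (x : X) : Algebra ℂ (X.presheaf.stalk x) := (germC (globalConst f) x).toAlgebra

/-- The local ring is a localization of the coordinate ring of an affine chart, which is smooth over
ℂ. -/
lemma smooth_stalk [Smooth f] (x : X) : letI := stalkAlgebra f x
    Algebra.FormallySmooth ℂ (X.presheaf.stalk x) ∧ Algebra.EssFiniteType ℂ (X.presheaf.stalk x) ∧
      IsNoetherianRing (X.presheaf.stalk x) := by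
  let := stalkAlgebra f x
  obtain ⟨_, ⟨U, hU, rfl⟩, hxU, -⟩ := X.isBasis_affineOpens.exists_subset_of_mem_open
    (show x ∈ ((⊤ : X.Opens) : Set X) from trivial) (⊤ : X.Opens).2
  have h1 := f.smooth_appLE (isAffineOpen_top (Spec (.of ℂ))) hU le_top
  let e := (Scheme.ΓSpecIso (.of ℂ)).symm.commRingCatIsoToRingEquiv
  have h2 : ((f.appLE ⊤ U le_top).hom.comp (e : ℂ →+* _)).Smooth :=
    RingHom.Smooth.respectsIso.2 _ e h1
  let : Algebra ℂ Γ(X, U) := ((f.appLE ⊤ U le_top).hom.comp (e : ℂ →+* _)).toAlgebra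
  have : Algebra.Smooth ℂ Γ(X, U) := h2
  let : Algebra Γ(X, U) (X.presheaf.stalk x) := (X.presheaf.germ U x hxU).hom.toAlgebra
  have : IsScalarTower ℂ Γ(X, U) (X.presheaf.stalk x) := by
    refine IsScalarTower.of_algebraMap_eq fun c => ?_
    change germC (globalConst f) x c = X.presheaf.germ U x hxU ((f.appLE ⊤ U le_top).hom (e c))
    exact (germ_rs le_top (f.appTop (e c)) x hxU).symm
  have hloc := hU.isLocalization_stalk ⟨x, hxU⟩
  have hF : Algebra.FormallySmooth Γ(X, U) (X.presheaf.stalk x) :=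
    Algebra.FormallySmooth.of_isLocalization (hU.primeIdealOf ⟨x, hxU⟩).asIdeal.primeCompl
  have hE : Algebra.EssFiniteType Γ(X, U) (X.presheaf.stalk x) :=
    Algebra.EssFiniteType.of_isLocalization _ (hU.primeIdealOf ⟨x, hxU⟩).asIdeal.primeCompl
  have hfin : Algebra.EssFiniteType ℂ (X.presheaf.stalk x) :=
    Algebra.EssFiniteType.comp ℂ Γ(X, U) _
  exact ⟨Algebra.FormallySmooth.comp ℂ Γ(X, U) _, hfin, Algebra.EssFiniteType.isNoetherianRing ℂ _⟩

lemma isPrime_span_stalk [Smooth f] (x : X) {J : Type} [Finite J]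
    (t : J → IsLocalRing.maximalIdeal (X.presheaf.stalk x))
    (ht : LinearIndependent (IsLocalRing.ResidueField (X.presheaf.stalk x))
      (fun j => (IsLocalRing.maximalIdeal (X.presheaf.stalk x)).toCotangent (t j))) :
    (Ideal.span (Set.range fun j => (t j : X.presheaf.stalk x))).IsPrime := by
  let := stalkAlgebra f x
  obtain ⟨h1, h2, h3⟩ := smooth_stalk f x
  exact isPrime_span_of_linearIndependent ℂ t ht

variable [IsIntegral X]

lemma constants_eq (x : X) (c : ℂ) : (constants f).hom c = ofGerm x (germC (globalConst f) x c) := by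
  have : Nonempty ((⊤ : X.Opens) : Type) := ⟨⟨x, trivial⟩⟩
  exact (Scheme.algebraMap_germ_eq_germToFunctionField _ (mem_top x) (globalConst f c)).symm

lemma d_add (a b : X.functionField) : d f (a + b) = d f a + d f b :=
  ModuleCat.Derivation.d_add (CommRingCat.KaehlerDifferential.D (constants f)) a b

lemma d_mul (a b : X.functionField) : d f (a * b) = a • d f b + b • d f a :=
  ModuleCat.Derivation.d_mul (CommRingCat.KaehlerDifferential.D (constants f)) a b

/-- Vector fields dual to local parameters, acting on rational forms. -/
lemma exists_contraction [Smooth f] (x : X) {J : Type} [Fintype J] [DecidableEq J]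
    (t : J → IsLocalRing.maximalIdeal (X.presheaf.stalk x))
    (ht : LinearIndependent (IsLocalRing.ResidueField (X.presheaf.stalk x))
      (fun j => (IsLocalRing.maximalIdeal (X.presheaf.stalk x)).toCotangent (t j))) :
    ∃ c : J → (RationalOneForms f →ₗ[X.functionField] X.functionField),
      (∀ i g, c i (d f (ofGerm x g)) ∈ localRing x) ∧
      ∀ i j, c i (d f (ofGerm x (t j).1)) = if i = j then 1 else 0 := by
  let := stalkAlgebra f x
  let : Algebra ℂ X.functionField := (constants f).hom.toAlgebra
  have : IsScalarTower ℂ (X.presheaf.stalk x) X.functionField :=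
    IsScalarTower.of_algebraMap_eq fun c => constants_eq f x c
  obtain ⟨h1, h2, h3⟩ := smooth_stalk f x
  obtain ⟨δ, hδ⟩ := exists_dual_derivations ℂ t ht
  choose c hc using fun i => exists_extend_derivation ℂ X.functionField (δ i)
  refine ⟨c, fun i g => ⟨δ i g, (hc i g).symm⟩, fun i j => (hc i _).trans ?_⟩
  rw [hδ]
  split_ifs
  · exact map_one _
  · exact map_zero _

end SmoothStalks

end LogBott

namespace LogBott

/-! ### Points specializing to a given point -/

section Specializations

variable {X : Scheme.{0}} {x y : X}

/-- The prime ideal of `𝒪_{X,x}` corresponding to a generization `y` of `x`. -/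
def specIdeal (h : y ⤳ x) : Ideal (X.presheaf.stalk x) :=
  (IsLocalRing.maximalIdeal (X.presheaf.stalk y)).comap (X.presheaf.stalkSpecializes h).hom

lemma stalkSpecializes_germ (h : y ⤳ x) {U : X.Opens} (hx : x ∈ U) (g : Γ(X, U)) :
    X.presheaf.stalkSpecializes h (X.presheaf.germ U x hx g) =
      X.presheaf.germ U y (h.mem_open U.2 hx) g :=
  ConcreteCategory.congr_hom (X.presheaf.germ_stalkSpecializes hx h) g

lemma germ_mem_specIdeal_iff (h : y ⤳ x) {U : X.Opens} (hx : x ∈ U) (g : Γ(X, U)) :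
    X.presheaf.germ U x hx g ∈ specIdeal h ↔ y ∉ X.basicOpen g := by
  rw [Scheme.mem_basicOpen _ _ y (h.mem_open U.2 hx), specIdeal, Ideal.mem_comap,
    IsLocalRing.mem_maximalIdeal, mem_nonunits_iff]
  exact not_congr (iff_of_eq (congrArg IsUnit (stalkSpecializes_germ h hx g)))

lemma exists_germ {x : X} (a : X.presheaf.stalk x) :
    ∃ (U : X.Opens) (hx : x ∈ U) (g : Γ(X, U)), X.presheaf.germ U x hx g = a :=
  TopCat.Presheaf.exists_germ_eq X.presheaf a

lemma exists_affine (x : X) {U : X.Opens} (hx : x ∈ U) :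
    ∃ V : X.affineOpens, x ∈ V.1 ∧ V.1 ≤ U := by
  obtain ⟨_, ⟨V, hV, rfl⟩, hxV, h⟩ := X.isBasis_affineOpens.exists_subset_of_mem_open
    (show x ∈ (U : Set X) from hx) U.2
  exact ⟨⟨V, hV⟩, hxV, h⟩

lemma exists_germ_affine {x : X} (a : X.presheaf.stalk x) :
    ∃ (U : X.affineOpens) (hx : x ∈ U.1) (g : Γ(X, U.1)), X.presheaf.germ U.1 x hx g = a := by
  obtain ⟨U, hx, g, rfl⟩ := exists_germ a
  obtain ⟨V, hV, hVU⟩ := exists_affine x hx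
  exact ⟨V, hV, rs hVU g, germ_rs _ _ _ _⟩

/-- The points of the spectrum of the local ring are the generizations of `x`. -/
lemma exists_specIdeal_eq (P : Ideal (X.presheaf.stalk x)) [hP : P.IsPrime] :
    ∃ (y : X) (h : y ⤳ x), specIdeal h = P := by
  let p : Spec (X.presheaf.stalk x) := ⟨P, hP⟩
  have h : X.fromSpecStalk x p ⤳ x := by
    have : X.fromSpecStalk x p ∈ Set.range (X.fromSpecStalk x) := ⟨p, rfl⟩
    rwa [Scheme.range_fromSpecStalk] at this
  refine ⟨_, h, Ideal.ext fun a => ?_⟩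
  obtain ⟨U, hx, g, rfl⟩ := exists_germ a
  rw [germ_mem_specIdeal_iff]
  have h1 : X.fromSpecStalk x p ∈ X.basicOpen g ↔ p ∈ X.fromSpecStalk x ⁻¹ᵁ X.basicOpen g := Iff.rfl
  rw [h1, Scheme.preimage_basicOpen, Scheme.fromSpecStalk_app hx]
  rw [CommRingCat.comp_apply, CommRingCat.comp_apply, Scheme.basicOpen_res,
    basicOpen_eq_of_affine]
  have h2 : p ∈ X.fromSpecStalk x ⁻¹ᵁ U := h.mem_open U.2 hx
  have h3 : p ∈ X.fromSpecStalk x ⁻¹ᵁ U ⊓ PrimeSpectrum.basicOpen (X.presheaf.germ U x hx g) ↔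
      X.presheaf.germ U x hx g ∉ P := ⟨fun h => h.2, fun h => ⟨h2, h⟩⟩
  exact (not_congr h3).trans not_not

/-- A basic neighbourhood of `y'` is given by a function outside its prime ideal, hence outside the
smaller prime ideal of `y`. -/
lemma specializes_of_specIdeal_le {y' : X} (h : y ⤳ x) (h' : y' ⤳ x)
    (hle : specIdeal h ≤ specIdeal h') : y ⤳ y' := by
  rw [specializes_iff_forall_open]
  intro V hV hy'
  obtain ⟨U, hx, -⟩ := exists_affine x (mem_top x)
  have hy'U := h'.mem_open U.1.2 hx
  obtain ⟨s, hs, hsy⟩ := U.2.exists_basicOpen_le (V := ⟨V, hV⟩) ⟨y', hy'⟩ hy'U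
  by_contra hy
  exact (germ_mem_specIdeal_iff h' hx s).1 (hle ((germ_mem_specIdeal_iff h hx s).2
    fun h0 => hy (hs h0))) hsy

/-- The stalk of the ideal sheaf of a subvariety. -/
abbrev stalkIdeal (Z : IrreducibleCloseds X) (x : X) : Ideal (X.presheaf.stalk x) :=
  (IdFam.ofIdealSheaf (idealOf Z)).at' x

lemma mem_idealOf_iff (Z : IrreducibleCloseds X) (U : X.affineOpens) (g : Γ(X, U.1)) :
    g ∈ (idealOf Z).ideal U ↔ ∀ z ∈ Z, z ∉ X.basicOpen g := by
  have h1 : ∀ p : Spec Γ(X, U.1), U.2.fromSpec p ∈ X.basicOpen g ↔ g ∉ p.asIdeal := by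
    intro p
    have : U.2.fromSpec p ∈ X.basicOpen g ↔ p ∈ U.2.fromSpec ⁻¹ᵁ X.basicOpen g := Iff.rfl
    rw [this, U.2.fromSpec_preimage_basicOpen]
    rfl
  constructor
  · intro hg z hz hzg
    have hzU := X.basicOpen_le g hzg
    have : z ∈ Set.range U.2.fromSpec := by
      rw [U.2.range_fromSpec]
      exact hzU
    obtain ⟨p, rfl⟩ := this
    exact (h1 p).1 hzg ((PrimeSpectrum.mem_vanishingIdeal _ _).1 hg p hz)
  · intro h
    refine (PrimeSpectrum.mem_vanishingIdeal _ _).2 fun p hp => ?_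
    by_contra hg
    exact h _ hp ((h1 p).2 hg)

lemma germ_mem_stalkIdeal {Z : IrreducibleCloseds X} {x : X} {U : X.affineOpens} (hx : x ∈ U.1)
    {g : Γ(X, U.1)} (hg : g ∈ (idealOf Z).ideal U) : X.presheaf.germ U.1 x hx g ∈ stalkIdeal Z x := by
  rw [stalkIdeal, IdFam.ofIdealSheaf_at _ x U hx]
  exact Ideal.mem_map_of_mem _ hg

/-- If `y` is not on `Z`, a basic neighbourhood of `y` in the complement of `Z` is defined by a
function that vanishes on `Z` but not at `y`. -/
lemma stalkIdeal_le_specIdeal_iff (Z : IrreducibleCloseds X) (h : y ⤳ x) :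
    stalkIdeal Z x ≤ specIdeal h ↔ y ∈ Z := by
  obtain ⟨U, hx, -⟩ := exists_affine x (mem_top x)
  constructor
  · intro hle
    by_contra hy
    obtain ⟨s, hs, hsy⟩ := U.2.exists_basicOpen_le (V := ⟨(Z : Set X)ᶜ, Z.isClosed.isOpen_compl⟩)
      ⟨y, hy⟩ (h.mem_open U.1.2 hx)
    exact (germ_mem_specIdeal_iff h hx s).1 (hle (germ_mem_stalkIdeal hx
      ((mem_idealOf_iff Z U s).2 fun z hz hzs => hs hzs hz))) hsy
  · intro hy
    rw [stalkIdeal, IdFam.ofIdealSheaf_at _ x U hx, Ideal.map_le_iff_le_comap]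
    intro g hg
    exact (germ_mem_specIdeal_iff h hx g).2 ((mem_idealOf_iff Z U g).1 hg y hy)

/-- The ideal of a subvariety is the prime ideal of its generic point. -/
lemma stalkIdeal_eq_specIdeal {Z : IrreducibleCloseds X} (h : y ⤳ x) (hy : y ∈ Z)
    (hZ : ∀ z ∈ Z, y ⤳ z) : stalkIdeal Z x = specIdeal h := by
  refine le_antisymm ((stalkIdeal_le_specIdeal_iff Z h).2 hy) fun a ha => ?_
  obtain ⟨U, hx, g, rfl⟩ := exists_germ_affine a
  refine germ_mem_stalkIdeal hx ((mem_idealOf_iff Z U g).2 fun z hz hzg => ?_)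
  exact (germ_mem_specIdeal_iff h hx g).1 ha ((hZ z hz).mem_open (X.basicOpen g).2 hzg)

lemma stalkIdeal_eq_top_iff (Z : IrreducibleCloseds X) (x : X) : stalkIdeal Z x = ⊤ ↔ x ∉ Z := by
  have h0 : specIdeal (specializes_refl x) = IsLocalRing.maximalIdeal (X.presheaf.stalk x) := by
    rw [specIdeal, TopCat.Presheaf.stalkSpecializes_refl]
    exact Ideal.comap_id _
  rw [← stalkIdeal_le_specIdeal_iff Z (specializes_refl x), h0]
  constructor
  · intro h
    rw [h, top_le_iff]
    exact Ideal.IsPrime.ne_top'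
  · intro h
    by_contra h'
    exact h (IsLocalRing.le_maximalIdeal h')

lemma IrreducibleCloseds.exists_generic (Z : IrreducibleCloseds X) : ∃ ζ ∈ Z, ∀ z ∈ Z, ζ ⤳ z := by
  have hg := Z.isIrreducible.isGenericPoint_genericPoint Z.isClosed
  exact ⟨_, hg.mem, fun z hz => hg.specializes hz⟩

/-- The closure of a point. -/
def closureOf (x : X) : IrreducibleCloseds X :=
  ⟨closure {x}, isIrreducible_singleton.closure, isClosed_closure⟩

lemma mem_closureOf {x y : X} : y ∈ closureOf x ↔ x ⤳ y := specializes_iff_mem_closure.symm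

instance (Z : IrreducibleCloseds X) : IsIntegral (subvariety Z) := by
  have : IsReduced (subvariety Z) := by
    have : ∀ U : X.affineOpens, _root_.IsReduced (Γ(X, U.1) ⧸ (idealOf Z).ideal U) := fun U => by
      rw [← Ideal.isRadical_iff_quotient_reduced]
      exact PrimeSpectrum.isRadical_vanishingIdeal _
    have : ∀ U, IsReduced ((idealOf Z).subschemeCover.openCover.X U) := fun U =>
      (affine_isReduced_iff _).2 (this U)
    exact IsReduced.of_openCover _ (idealOf Z).subschemeCover.openCover
  exact isIntegral_of_irreducibleSpace_of_isReduced _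

lemma range_inclusion (Z : IrreducibleCloseds X) : Set.range (inclusion Z) = (Z : Set X) :=
  (Scheme.IdealSheafData.range_subschemeι _).trans
    (Scheme.IdealSheafData.coe_support_vanishingIdeal _)

instance (Z : IrreducibleCloseds X) : IsClosedImmersion (inclusion Z) :=
  inferInstanceAs (IsClosedImmersion (idealOf Z).subschemeι)

end Specializations

end LogBott

namespace LogBott

/-! ### The strata of a simple normal crossings divisor -/

section Strata

variable {X : Scheme.{0}} {D : Finset (IrreducibleCloseds X)}

/-- The ideal of the intersection of some components. -/
abbrev interIdeal (A : Finset {Z : IrreducibleCloseds X // Z ∈ D}) (x : X) :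
    Ideal (X.presheaf.stalk x) := A.sup fun Z => stalkIdeal Z.1 x

lemma linearIndependent_toCotangent_comp {R I J : Type} [CommRing R] [IsLocalRing R]
    (s : J → IsLocalRing.maximalIdeal R) (hs : LinearIndependent (IsLocalRing.ResidueField R)
      (fun j => (IsLocalRing.maximalIdeal R).toCotangent (s j))) {e : I → J}
    (he : Function.Injective e) (t : I → R) (ht : ∀ i, t i = (s (e i)).1) :
    ∃ h : ∀ i, t i ∈ IsLocalRing.maximalIdeal R, LinearIndependent (IsLocalRing.ResidueField R)
      (fun i => (IsLocalRing.maximalIdeal R).toCotangent ⟨t i, h i⟩) := by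
  obtain rfl : t = fun i => (s (e i)).1 := funext ht
  exact ⟨fun i => (s (e i)).2, hs.comp e he⟩

/-- The equation 1 is chosen for the components that miss `x`, so that the equations are indexed by
all of `D`. -/
lemma IsSNC.exists_equations (hD : IsSNC D) (x : X) :
    ∃ t : {Z : IrreducibleCloseds X // Z ∈ D} → X.presheaf.stalk x,
      (∀ j, IsLocalEquation j.1 x (t j)) ∧
      ∃ h : ∀ j : {j : {Z : IrreducibleCloseds X // Z ∈ D} // x ∈ j.1},
        t j.1 ∈ IsLocalRing.maximalIdeal (X.presheaf.stalk x),
        LinearIndependent (IsLocalRing.ResidueField (X.presheaf.stalk x)) (fun j =>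
          (IsLocalRing.maximalIdeal (X.presheaf.stalk x)).toCotangent ⟨t j.1, h j⟩) := by
  classical
  obtain ⟨s, hs, hli⟩ := hD x
  let e : {j : {Z : IrreducibleCloseds X // Z ∈ D} // x ∈ j.1} →
      {Z : IrreducibleCloseds X // Z ∈ D ∧ x ∈ Z} := fun j => ⟨j.1.1, j.1.2, j.2⟩
  have he : Function.Injective e := fun a b hab =>
    Subtype.ext (Subtype.ext (congrArg (fun c => c.1) hab))
  let t : {Z : IrreducibleCloseds X // Z ∈ D} → X.presheaf.stalk x := fun j =>
    if h : x ∈ j.1 then (s ⟨j.1, j.2, h⟩).1 else 1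
  have ht : ∀ j : {j : {Z : IrreducibleCloseds X // Z ∈ D} // x ∈ j.1}, t j.1 = (s (e j)).1 :=
    fun j => dif_pos j.2
  refine ⟨t, fun j => ?_, linearIndependent_toCotangent_comp s hli he (fun j => t j.1) ht⟩
  by_cases h : x ∈ j.1
  · rw [ht ⟨j, h⟩]
    exact hs (e ⟨j, h⟩)
  · have : t j = 1 := dif_neg h
    rw [this, isLocalEquation_iff, Ideal.span_singleton_one]
    exact (stalkIdeal_eq_top_iff j.1 x).2 h

lemma interIdeal_eq_span {x : X} {t : {Z : IrreducibleCloseds X // Z ∈ D} → X.presheaf.stalk x}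
    (ht : ∀ j, IsLocalEquation j.1 x (t j)) (A : Finset {Z : IrreducibleCloseds X // Z ∈ D}) :
    interIdeal A x = Ideal.span (t '' A) := by
  rw [← sup_span_singleton t A]
  exact Finset.sup_congr rfl fun j _ => isLocalEquation_iff.1 (ht j)

lemma IsSNC.isPrime_interIdeal (f : X ⟶ Spec (.of ℂ)) [Smooth f] (hD : IsSNC D) {x : X} {A : Finset {Z : IrreducibleCloseds X // Z ∈ D}}
    (hA : ∀ j ∈ A, x ∈ j.1) : (interIdeal A x).IsPrime := by
  obtain ⟨t, ht, h, hli⟩ := hD.exists_equations x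
  let e : {j // j ∈ A} → {j : {Z : IrreducibleCloseds X // Z ∈ D} // x ∈ j.1} :=
    fun j => ⟨j.1, hA _ j.2⟩
  have he : Function.Injective e := fun a b hab => Subtype.ext (congrArg (fun c => c.1) hab)
  have := isPrime_span_stalk f x _ (hli.comp e he)
  rw [interIdeal_eq_span ht]
  convert! this using 1
  refine congrArg _ (Set.ext fun a => ?_)
  constructor
  · rintro ⟨j, hj, rfl⟩
    exact ⟨⟨j, hj⟩, rfl⟩
  · rintro ⟨j, rfl⟩
    exact ⟨j.1, j.2, rfl⟩

lemma interIdeal_le_specIdeal_iff {x y : X} (h : y ⤳ x)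
    (A : Finset {Z : IrreducibleCloseds X // Z ∈ D}) :
    interIdeal A x ≤ specIdeal h ↔ ∀ j ∈ A, y ∈ j.1 := by
  rw [interIdeal, Finset.sup_le_iff]
  exact forall₂_congr fun j _ => stalkIdeal_le_specIdeal_iff j.1 h

/-- The ideal of the intersection at `x` is generated by part of a regular system of parameters,
hence is prime, and a prime ideal belongs to a generization of `x`. So the intersection has only one
generic point specializing to `x`. -/
lemma IsSNC.exists_generic (f : X ⟶ Spec (.of ℂ)) [Smooth f] (hD : IsSNC D) {x : X} {A : Finset {Z : IrreducibleCloseds X // Z ∈ D}}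
    (hA : ∀ j ∈ A, x ∈ j.1) : ∃ (ζ : X) (h : ζ ⤳ x), specIdeal h = interIdeal A x ∧
      (∀ j ∈ A, ζ ∈ j.1) ∧ ∀ y, y ⤳ x → (∀ j ∈ A, y ∈ j.1) → ζ ⤳ y := by
  have := hD.isPrime_interIdeal f hA
  obtain ⟨ζ, h, hζ⟩ := exists_specIdeal_eq (interIdeal A x)
  refine ⟨ζ, h, hζ, (interIdeal_le_specIdeal_iff h A).1 hζ.ge, fun y hy hyA => ?_⟩
  exact specializes_of_specIdeal_le h hy (hζ.le.trans ((interIdeal_le_specIdeal_iff hy A).2 hyA))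

/-- `Z` is a component of the intersection of the members of `A`. -/
def IsComponent (A : Finset {Z : IrreducibleCloseds X // Z ∈ D}) (Z : IrreducibleCloseds X) : Prop :=
  Maximal (fun W : IrreducibleCloseds X => ∀ j ∈ A, W ≤ j.1) Z

lemma IsComponent.isStratum {A : Finset {Z : IrreducibleCloseds X // Z ∈ D}} {Z : IrreducibleCloseds X}
    (h : IsComponent A Z) (hA : A.Nonempty) : IsStratum D Z := by
  classical
  refine ⟨A.map (Function.Embedding.subtype _), fun Y hY => ?_, hA.map, ?_⟩
  · obtain ⟨j, -, rfl⟩ := Finset.mem_map.1 hY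
    exact j.2
  · have : ∀ W : IrreducibleCloseds X, (∀ Y ∈ A.map (Function.Embedding.subtype _), W ≤ Y) ↔
        ∀ j ∈ A, W ≤ j.1 := fun W => by simp
    simpa only [this] using! h

/-- Through every point there is only one component of the intersection. -/
lemma IsSNC.exists_component (f : X ⟶ Spec (.of ℂ)) [Smooth f] (hD : IsSNC D) {x : X} {A : Finset {Z : IrreducibleCloseds X // Z ∈ D}}
    (hA : ∀ j ∈ A, x ∈ j.1) : ∃ Z : IrreducibleCloseds X, IsComponent A Z ∧ x ∈ Z ∧
      stalkIdeal Z x = interIdeal A x ∧ ∀ W, x ∈ W → (∀ j ∈ A, W ≤ j.1) → W ≤ Z := by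
  obtain ⟨ζ, h, hζ, hζA, hmin⟩ := hD.exists_generic f hA
  -- The generic point of such a `W` is a generization of `x` lying in the intersection, hence a
  -- specialization of `ζ`.
  have hle : ∀ W : IrreducibleCloseds X, x ∈ W → (∀ j ∈ A, W ≤ j.1) → W ≤ closureOf ζ := by
    intro W hx hW
    obtain ⟨w, hw, hwg⟩ := IrreducibleCloseds.exists_generic W
    have := hmin w (hwg x hx) fun j hj => hW j hj hw
    intro z hz
    exact mem_closureOf.2 (this.trans (hwg z hz))
  have hx : x ∈ closureOf ζ := mem_closureOf.2 h
  refine ⟨closureOf ζ, ⟨fun j hj z hz => ?_, fun W hW hWZ => hle W (hWZ hx) hW⟩, hx, ?_, hle⟩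
  · exact (mem_closureOf.1 hz).mem_closed j.1.isClosed (hζA j hj)
  · rw [← hζ]
    exact stalkIdeal_eq_specIdeal h (mem_closureOf.2 (specializes_refl ζ)) fun z hz => mem_closureOf.1 hz

lemma IsSNC.stalkIdeal_component (f : X ⟶ Spec (.of ℂ)) [Smooth f] (hD : IsSNC D) {x : X}
    {A : Finset {Z : IrreducibleCloseds X // Z ∈ D}} {Z : IrreducibleCloseds X}
    (hZ : IsComponent A Z) (hx : x ∈ Z) : stalkIdeal Z x = interIdeal A x := by
  obtain ⟨Z', h, -, h2, h3⟩ := hD.exists_component f (x := x) (A := A) fun j hj => hZ.1 j hj hx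
  rw [hZ.eq_of_le h.1 (h3 Z hx hZ.1), h2]

lemma IsSNC.component_unique (f : X ⟶ Spec (.of ℂ)) [Smooth f] (hD : IsSNC D) {x : X}
    {A : Finset {Z : IrreducibleCloseds X // Z ∈ D}} {Z W : IrreducibleCloseds X}
    (hZ : IsComponent A Z) (hx : x ∈ Z) (hW : IsComponent A W) (hx' : x ∈ W) : Z = W := by
  obtain ⟨Z', h, -, h2, h3⟩ := hD.exists_component f (x := x) (A := A) fun j hj => hZ.1 j hj hx
  rw [hZ.eq_of_le h.1 (h3 Z hx hZ.1), hW.eq_of_le h.1 (h3 W hx' hW.1)]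

/-- A closed subset of a Noetherian space is a finite union of irreducible closed sets, and every
component is one of them. The set `C` may contain further members; they are filtered out where it is
used. -/
lemma exists_components [NoetherianSpace X] (A : Finset {Z : IrreducibleCloseds X // Z ∈ D}) :
    ∃ C : Finset (IrreducibleCloseds X), ∀ Z, IsComponent A Z → Z ∈ C := by
  classical
  let S : Closeds X := ⟨⋂ j ∈ A, (j.1 : Set X), isClosed_biInter fun j _ => j.1.isClosed⟩
  obtain ⟨F, hF, hS⟩ := NoetherianSpace.exists_finset_irreducible S
  let C : Finset (IrreducibleCloseds X) := F.attach.image fun k => ⟨k.1, hF k, k.1.isClosed⟩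
  refine ⟨C, fun Z hZ => ?_⟩
  have hZS : (Z : Set X) ⊆ ⋃ k ∈ F, (k : Set X) := by
    intro z hz
    have h1 : z ∈ S := Set.mem_iInter₂.2 fun j hj => hZ.1 j hj hz
    rw [hS, ← SetLike.mem_coe, Closeds.coe_finset_sup] at h1
    simpa using h1
  obtain ⟨ζ, hζ, hζg⟩ := IrreducibleCloseds.exists_generic Z
  obtain ⟨k, hk, hζk⟩ := Set.mem_iUnion₂.1 (hZS hζ)
  have hle : Z ≤ ⟨k, hF ⟨k, hk⟩, k.isClosed⟩ := fun z hz => (hζg z hz).mem_closed k.isClosed hζk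
  have hkS : ∀ j ∈ A, (⟨k, hF ⟨k, hk⟩, k.isClosed⟩ : IrreducibleCloseds X) ≤ j.1 := by
    intro j hj z hz
    have h1 : k ≤ S := by
      rw [hS]
      exact Finset.le_sup (f := id) hk
    exact Set.mem_iInter₂.1 (h1 hz) j hj
  rw [hZ.eq_of_le hkS hle]
  exact Finset.mem_image.2 ⟨⟨k, hk⟩, Finset.mem_attach _ _, rfl⟩

/-- Expressing `t j` by the members of `A` would give a linear relation between the classes in the
cotangent space. -/
lemma toCotangent_notMem {R J : Type} [CommRing R] [IsLocalRing R] {t : J → R}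
    (h : ∀ j, t j ∈ IsLocalRing.maximalIdeal R) (hli : LinearIndependent (IsLocalRing.ResidueField R)
      (fun j => (IsLocalRing.maximalIdeal R).toCotangent ⟨t j, h j⟩)) (A : Finset J) {j : J}
    (hj : j ∉ A) : t j ∉ Ideal.span (t '' A) := by
  intro hmem
  refine hli.notMem_span_image (s := A) (x := j) hj ?_
  have key : ∀ (r : R), r ∈ Ideal.span (t '' A) → ∀ hr : r ∈ IsLocalRing.maximalIdeal R,
      (IsLocalRing.maximalIdeal R).toCotangent ⟨r, hr⟩ ∈ Submodule.span (IsLocalRing.ResidueField R)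
        ((fun j => (IsLocalRing.maximalIdeal R).toCotangent ⟨t j, h j⟩) '' (A : Set J)) := by
    intro r hr
    induction hr using Submodule.span_induction with
    | mem r hr =>
      obtain ⟨i, hi, rfl⟩ := hr
      exact fun _ => Submodule.subset_span ⟨i, hi, rfl⟩
    | zero => exact fun hr => (map_zero (IsLocalRing.maximalIdeal R).toCotangent).symm ▸ zero_mem _
    | add a b ha hb iha ihb =>
      intro hr
      have hle : Ideal.span (t '' A) ≤ IsLocalRing.maximalIdeal R := by
        rw [Ideal.span_le]
        rintro _ ⟨i, -, rfl⟩
        exact h i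
      have := add_mem (iha (hle ha)) (ihb (hle hb))
      rwa [← map_add] at this
    | smul c a ha iha =>
      intro hr
      have hle : Ideal.span (t '' A) ≤ IsLocalRing.maximalIdeal R := by
        rw [Ideal.span_le]
        rintro _ ⟨i, -, rfl⟩
        exact h i
      have := Submodule.smul_mem _ (IsLocalRing.residue R c) (iha (hle ha))
      have h2 : IsLocalRing.residue R c • (IsLocalRing.maximalIdeal R).toCotangent ⟨a, hle ha⟩ =
          (IsLocalRing.maximalIdeal R).toCotangent ⟨c • a, hr⟩ :=
        ((IsLocalRing.maximalIdeal R).toCotangent.map_smul c ⟨a, hle ha⟩).symm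
      rwa [h2] at this
  exact key _ hmem _

lemma specIdeal_refl (x : X) :
    specIdeal (specializes_refl x) = IsLocalRing.maximalIdeal (X.presheaf.stalk x) := by
  rw [specIdeal, TopCat.Presheaf.stalkSpecializes_refl]
  exact Ideal.comap_id _

lemma IsSNC.maximalIdeal_eq (f : X ⟶ Spec (.of ℂ)) [Smooth f] (hD : IsSNC D) {ζ : X}
    {A : Finset {Z : IrreducibleCloseds X // Z ∈ D}} {Z : IrreducibleCloseds X}
    (hZ : IsComponent A Z) (hζ : ζ ∈ Z) (hg : ∀ z ∈ Z, ζ ⤳ z) :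
    IsLocalRing.maximalIdeal (X.presheaf.stalk ζ) = interIdeal A ζ := by
  rw [← hD.stalkIdeal_component f hZ hζ, stalkIdeal_eq_specIdeal (specializes_refl ζ) hζ hg,
    specIdeal_refl]

/-- The only components of `D` which contain the generic point of a component of an intersection
are the obvious ones. -/
lemma IsSNC.mem_of_generic_mem (f : X ⟶ Spec (.of ℂ)) [Smooth f] (hD : IsSNC D) {ζ : X}
    {A : Finset {Z : IrreducibleCloseds X // Z ∈ D}} {Z : IrreducibleCloseds X}
    (hZ : IsComponent A Z) (hζ : ζ ∈ Z) (hg : ∀ z ∈ Z, ζ ⤳ z)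
    (j : {Z : IrreducibleCloseds X // Z ∈ D}) (hj : ζ ∈ j.1) : j ∈ A := by
  classical
  by_contra hjA
  obtain ⟨t, ht, h, hli⟩ := hD.exists_equations ζ
  have h1 := h ⟨j, hj⟩
  -- At the generic point of `Z` the maximal ideal is generated by the equations of the members of
  -- `A`, so the equation of a further component through that point would not be independent of
  -- them.
  rw [hD.maximalIdeal_eq f hZ hζ hg, interIdeal_eq_span ht] at h1
  refine toCotangent_notMem (t := fun j : {j : {Z : IrreducibleCloseds X // Z ∈ D} // ζ ∈ j.1} => t j.1)
    h hli (A.attach.map ⟨fun j => ⟨j.1, hZ.1 _ j.2 hζ⟩, fun a b hab =>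
      Subtype.ext (congrArg (fun c => c.1) hab)⟩) (j := ⟨j, hj⟩) ?_ ?_
  · intro h
    obtain ⟨i, -, hi⟩ := Finset.mem_map.1 h
    have : i.1 = j := congrArg (fun c => c.1) hi
    exact hjA (this ▸ i.2)
  · convert! h1 using 2
    ext a
    constructor
    · rintro ⟨_, hi, rfl⟩
      obtain ⟨i, -, rfl⟩ := Finset.mem_map.1 hi
      exact ⟨i.1, i.2, rfl⟩
    · rintro ⟨i, hi, rfl⟩
      exact ⟨⟨i, hZ.1 _ hi hζ⟩, Finset.mem_map.2 ⟨⟨i, hi⟩, Finset.mem_attach _ _, rfl⟩, rfl⟩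

end Strata

end LogBott

namespace LogBott

/-! ### Global functions on a projective variety -/

section GlobalFunctions

-- Projective space is proper over the spectrum of the degree-zero part of the polynomial ring, and
-- this part is a quotient of ℂ.
attribute [local instance] MvPolynomial.gradedAlgebra in
lemma IsProjective.isProper {X : Scheme.{0}} {f : X ⟶ Spec (.of ℂ)} (h : IsProjective f) :
    IsProper f := by
  obtain ⟨N, i, hi, rfl⟩ := h
  let 𝒜 := MvPolynomial.homogeneousSubmodule (Fin (N + 1)) ℂ
  have hs : Function.Surjective (algebraMap ℂ (𝒜 0)) := by
    rintro ⟨p, hp⟩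
    have h1 : p ∈ (1 : Submodule ℂ (MvPolynomial (Fin (N + 1)) ℂ)) := by
      rw [← MvPolynomial.homogeneousSubmodule_zero]
      exact hp
    obtain ⟨c, hc⟩ := Submodule.mem_one.1 h1
    exact ⟨c, Subtype.ext hc⟩
  have h1 : IsClosedImmersion (Spec.map (CommRingCat.ofHom (algebraMap ℂ (𝒜 0)))) :=
    IsClosedImmersion.spec_of_surjective _ hs
  have : Algebra.FiniteType ℂ (MvPolynomial (Fin (N + 1)) ℂ) := inferInstance
  have : IsScalarTower ℂ (𝒜 0) (MvPolynomial (Fin (N + 1)) ℂ) :=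
    IsScalarTower.of_algebraMap_eq (R := ℂ) (S := 𝒜 0) fun _ => rfl
  have : Algebra.FiniteType (𝒜 0) (MvPolynomial (Fin (N + 1)) ℂ) :=
    Algebra.FiniteType.of_restrictScalars_finiteType ℂ _ _
  infer_instance

variable {Z : Scheme.{0}} [IsIntegral Z]

/-- A rational function which is regular at all points is a global function. -/
lemma exists_global {a : Z.functionField} (h : ∀ z, a ∈ localRing z) :
    ∃ s : Γ(Z, ⊤), ∀ z, ofGerm z (Z.presheaf.germ ⊤ z (mem_top z) s) = a := by
  choose g hg using h
  choose U hU s hs using fun z => exists_germ (g z)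
  have hcompat : TopCat.Presheaf.IsCompatible Z.sheaf.obj U s := by
    intro z z'
    refine TopCat.Presheaf.section_ext Z.sheaf _ _ _ fun y hy => ?_
    refine (germ_rs (inf_le_left : U z ⊓ U z' ≤ U z) (s z) y hy).trans ?_
    refine Eq.trans ?_ (germ_rs (inf_le_right : U z ⊓ U z' ≤ U z') (s z') y hy).symm
    apply ofGerm_injective
    rw [ofGerm_germ (s z) y z hy.1 (hU z), ofGerm_germ (s z') y z' hy.2 (hU z'), hs, hs]
    exact (hg z).trans (hg z').symm
  obtain ⟨t, ht, -⟩ := TopCat.Sheaf.existsUnique_gluing' Z.sheaf U ⊤ (fun z => homOfLE le_top)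
    (fun z _ => Opens.mem_iSup.2 ⟨z, hU z⟩) s hcompat
  refine ⟨t, fun z => ?_⟩
  have h1 : Z.presheaf.germ ⊤ z (mem_top z) t = g z := by
    rw [← hs z, ← ht z]
    exact (germ_rs le_top t z (hU z)).symm
  rw [h1]
  exact hg z

/-- A rational function on a complete variety which is regular at all points is constant. -/
lemma exists_constant (g : Z ⟶ Spec (.of ℂ)) [UniversallyClosed g] {a : Z.functionField}
    (h : ∀ z, a ∈ localRing z) : ∃ c : ℂ, a = (constants g).hom c := by
  obtain ⟨s, hs⟩ := exists_global h
  -- The global functions on a universally closed integral scheme are integral over ℂ, which is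
  -- algebraically closed.
  have h1 : (globalConst g).IsIntegral :=
    RingHom.isIntegral_respectsIso.2 (f := g.appTop.hom)
      (e := (Scheme.ΓSpecIso (.of ℂ)).symm.commRingCatIsoToRingEquiv)
      (isIntegral_appTop_of_universallyClosed g)
  obtain ⟨c, hc⟩ := (IsAlgClosed.ringHom_bijective_of_isIntegral (globalConst g) h1).2 s
  refine ⟨c, ?_⟩
  rw [constants_eq g (genericPoint Z), ← hs (genericPoint Z), ← hc]
  rfl

end GlobalFunctions

end LogBott

namespace LogBott

/-! ### Logarithmic forms near a point -/

section LogForms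

variable {X : Scheme.{0}} [IsIntegral X]

lemma ofGerm_stalkSpecializes {x y : X} (h : y ⤳ x) (a : X.presheaf.stalk x) :
    ofGerm y (X.presheaf.stalkSpecializes h a) = ofGerm x a := by
  obtain ⟨U, hx, g, rfl⟩ := exists_germ a
  exact (congrArg (ofGerm y) (stalkSpecializes_germ h hx g)).trans (ofGerm_germ g y x _ hx)

lemma exists_ofGerm_eq {x : X} (a : X.presheaf.stalk x) :
    ∃ (U : X.Opens) (_ : x ∈ U), ∀ y ∈ U, ofGerm x a ∈ localRing y := by
  obtain ⟨U, hx, g, rfl⟩ := exists_germ a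
  exact ⟨U, hx, fun y hy => ⟨X.presheaf.germ U y hy g, ofGerm_germ g y x hy hx⟩⟩

lemma localRing_mono {x y : X} (h : y ⤳ x) : localRing x ≤ localRing y := by
  rintro _ ⟨a, rfl⟩
  exact ⟨_, ofGerm_stalkSpecializes h a⟩

lemma spread_of_span {V : Type} [AddCommGroup V] [Module X.functionField V]
    (L : ∀ x : X, Submodule (localRing x) V) {x : X} {S : Set V}
    (hS : ∀ v ∈ S, ∃ U : X.Opens, x ∈ U ∧ ∀ y ∈ U, v ∈ L y) {v : V}
    (hv : v ∈ Submodule.span (localRing x) S) : ∃ U : X.Opens, x ∈ U ∧ ∀ y ∈ U, v ∈ L y := by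
  induction hv using Submodule.span_induction with
  | mem v hv => exact hS v hv
  | zero => exact ⟨⊤, trivial, fun y _ => zero_mem _⟩
  | add v w _ _ hv hw =>
    obtain ⟨U, hU, h1⟩ := hv
    obtain ⟨W, hW, h2⟩ := hw
    exact ⟨U ⊓ W, ⟨hU, hW⟩, fun y hy => add_mem (h1 y hy.1) (h2 y hy.2)⟩
  | smul r v _ hv =>
    obtain ⟨U, hU, h1⟩ := hv
    obtain ⟨_, a, rfl⟩ := r
    obtain ⟨W, hW, h2⟩ := exists_ofGerm_eq a
    exact ⟨U ⊓ W, ⟨hU, hW⟩, fun y hy => (L y).smul_mem ⟨_, h2 y hy.2⟩ (h1 y hy.1)⟩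

lemma stalkIdeal_specializes (Z : IrreducibleCloseds X) {x y : X} (h : y ⤳ x) :
    (stalkIdeal Z x).map (X.presheaf.stalkSpecializes h).hom = stalkIdeal Z y := by
  obtain ⟨U, hx, -⟩ := exists_affine x (mem_top x)
  rw [stalkIdeal, stalkIdeal, IdFam.ofIdealSheaf_at _ x U hx,
    IdFam.ofIdealSheaf_at _ y U (h.mem_open U.1.2 hx), Ideal.map_map]
  congr 1
  ext g
  exact stalkSpecializes_germ h hx g

lemma IsLocalEquation.specializes {Z : IrreducibleCloseds X} {x y : X} (h : y ⤳ x)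
    {t : X.presheaf.stalk x} (ht : IsLocalEquation Z x t) :
    IsLocalEquation Z y (X.presheaf.stalkSpecializes h t) := by
  rw [isLocalEquation_iff] at ht ⊢
  have := stalkIdeal_specializes Z h
  rw [stalkIdeal, ht, Ideal.map_span, Set.image_singleton] at this
  exact this.symm

/-- Near `x` the ideal sheaf is generated by finitely many sections. Each is a multiple of `t` at
`x`, and therefore at nearby points, because the local rings embed in the function field. Conversely
the germ `t` extends to a section lying in the ideals of all nearby points. -/
lemma IsLocalEquation.spread [IsLocallyNoetherian X] {Z : IrreducibleCloseds X} {x : X}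
    {t : X.presheaf.stalk x} (ht : IsLocalEquation Z x t) :
    ∃ (U : X.Opens) (hx : x ∈ U) (g : Γ(X, U)), X.presheaf.germ U x hx g = t ∧
      ∀ y (hy : y ∈ U), IsLocalEquation Z y (X.presheaf.germ U y hy g) := by
  classical
  obtain ⟨U, hx, g, rfl⟩ := exists_germ_affine t
  have : IsNoetherianRing Γ(X, U.1) := IsLocallyNoetherian.component_noetherian U
  obtain ⟨s, hs⟩ := IsNoetherian.noetherian ((idealOf Z).ideal U)
  have hmem : ∀ y (hy : y ∈ U.1), stalkIdeal Z y =
      Ideal.span ((fun a => X.presheaf.germ U.1 y hy a) '' (s : Set Γ(X, U.1))) := by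
    intro y hy
    rw [stalkIdeal, IdFam.ofIdealSheaf_at _ y U hy, ← hs]
    exact Ideal.map_span _ _
  have key : ∀ F : Finset Γ(X, U.1), (∀ a ∈ F, a ∈ s) → ∃ (W : X.Opens) (_ : x ∈ W), ∀ y ∈ W,
      ∀ (hy : y ∈ U.1), ∀ a ∈ F, X.presheaf.germ U.1 y hy a ∈ Ideal.span {X.presheaf.germ U.1 y hy g} := by
    intro F hF
    induction F using Finset.induction_on with
    | empty => exact ⟨⊤, trivial, fun y _ hy a ha => absurd ha (Finset.notMem_empty a)⟩
    | insert a F ha ih =>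
      obtain ⟨W, hW, h⟩ := ih fun b hb => hF b (Finset.mem_insert_of_mem hb)
      have h1 : X.presheaf.germ U.1 x hx a ∈ stalkIdeal Z x := by
        rw [hmem x hx]
        exact Ideal.subset_span ⟨a, hF a (Finset.mem_insert_self _ _), rfl⟩
      rw [stalkIdeal, ht.ofIdealSheaf_at, Ideal.mem_span_singleton'] at h1
      obtain ⟨c, hc⟩ := h1
      obtain ⟨V, hV, c, rfl⟩ := exists_germ c
      have h2 : ofGerm x (X.presheaf.germ V x hV c) * ofGerm x (X.presheaf.germ U.1 x hx g) =
          ofGerm x (X.presheaf.germ U.1 x hx a) := by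
        rw [← ofGerm_mul, hc]
      refine ⟨W ⊓ V, ⟨hW, hV⟩, fun y hy hyU b hb => ?_⟩
      rcases Finset.mem_insert.1 hb with rfl | hb
      · refine Ideal.mem_span_singleton'.2 ⟨X.presheaf.germ V y hy.2 c, ?_⟩
        apply ofGerm_injective
        rw [ofGerm_mul, ofGerm_germ c y x hy.2 hV, ofGerm_germ g y x hyU hx, h2,
          ofGerm_germ b x y hx hyU]
      · exact h y hy.1 hyU b hb
  obtain ⟨W, hW, h⟩ := key s fun a ha => ha
  have hg : X.presheaf.germ U.1 x hx g ∈ stalkIdeal Z x := by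
    rw [stalkIdeal, ht.ofIdealSheaf_at]
    exact Ideal.mem_span_singleton_self _
  obtain ⟨V, hV, g', hg', hV'⟩ := (IdFam.ofIdealSheaf (idealOf Z)).spread x _ hg
  refine ⟨U.1 ⊓ W ⊓ V, ⟨⟨hx, hW⟩, hV⟩, rs (inf_le_left.trans inf_le_left) g, germ_rs _ _ _ _, fun y hy => ?_⟩
  rw [germ_rs, isLocalEquation_iff]
  refine le_antisymm ?_ ?_
  · change stalkIdeal Z y ≤ _
    rw [hmem y hy.1.1, Ideal.span_le]
    rintro _ ⟨a, ha, rfl⟩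
    exact h y hy.1.2 hy.1.1 a ha
  · rw [Ideal.span_singleton_le_iff_mem]
    have h1 : X.presheaf.germ U.1 y hy.1.1 g = X.presheaf.germ V y hy.2 g' := by
      apply ofGerm_injective
      rw [ofGerm_germ g y x hy.1.1 hx, ofGerm_germ g' y x hy.2 hV, hg']
    rw [h1]
    exact hV' y hy.2

variable (f : X ⟶ Spec (.of ℂ))

/-- The logarithmic differential. -/
def dlog (x : X) (t : X.presheaf.stalk x) : RationalOneForms f :=
  (ofGerm x t)⁻¹ • d f (ofGerm x t)

lemma ofGerm_ne_zero {x : X} {t : X.presheaf.stalk x} (ht : t ≠ 0) : ofGerm x t ≠ 0 := fun h =>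
  ht (ofGerm_injective x (h.trans (ofGerm_zero x).symm))

lemma smul_dlog {x : X} {t : X.presheaf.stalk x} (ht : t ≠ 0) :
    ofGerm x t • dlog f x t = d f (ofGerm x t) := by
  rw [dlog, smul_inv_smul₀ (ofGerm_ne_zero ht)]

lemma dlog_specializes {x y : X} (h : y ⤳ x) (t : X.presheaf.stalk x) :
    dlog f y (X.presheaf.stalkSpecializes h t) = dlog f x t := by
  rw [dlog, dlog, ofGerm_stalkSpecializes]

lemma d_mem_logOneFormsAt (D : Finset (IrreducibleCloseds X)) (x : X) (g : X.presheaf.stalk x) :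
    d f (ofGerm x g) ∈ logOneFormsAt f D x := Submodule.subset_span (Or.inl ⟨g, rfl⟩)

lemma smul_mem_logOneFormsAt {D : Finset (IrreducibleCloseds X)} {x : X} (a : X.presheaf.stalk x)
    {ω : RationalOneForms f} (h : ω ∈ logOneFormsAt f D x) : ofGerm x a • ω ∈ logOneFormsAt f D x :=
  (logOneFormsAt f D x).smul_mem ⟨_, a, rfl⟩ h

lemma dlog_mem_logOneFormsAt {D : Finset (IrreducibleCloseds X)} {x : X} {Z : IrreducibleCloseds X}
    (hZ : Z ∈ D) {t : X.presheaf.stalk x} (ht : IsLocalEquation Z x t) (h0 : t ≠ 0) :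
    dlog f x t ∈ logOneFormsAt f D x :=
  Submodule.subset_span (Or.inr ⟨Z, hZ, t, ht, smul_dlog f h0⟩)

lemma logOneFormsAt_mono {D D' : Finset (IrreducibleCloseds X)} (h : D' ⊆ D) (x : X) :
    logOneFormsAt f D' x ≤ logOneFormsAt f D x :=
  Submodule.span_mono (Set.union_subset_union_right _ fun _ ⟨Z, hZ, h'⟩ => ⟨Z, h hZ, h'⟩)

lemma logOneFormsAt_spread [IsLocallyNoetherian X] (D : Finset (IrreducibleCloseds X)) (x : X) :
    ∀ ω ∈ logOneFormsAt f D x, ∃ U : X.Opens, x ∈ U ∧ ∀ y ∈ U, ω ∈ logOneFormsAt f D y := by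
  refine fun ω hω => spread_of_span _ ?_ hω
  rintro ω (⟨g, rfl⟩ | ⟨Z, hZ, t, ht, hω⟩)
  · obtain ⟨U, hx, h⟩ := exists_ofGerm_eq g
    refine ⟨U, hx, fun y hy => ?_⟩
    obtain ⟨g', hg'⟩ := h y hy
    rw [← hg']
    exact d_mem_logOneFormsAt f D y g'
  · obtain ⟨U, hx, g, rfl, h⟩ := ht.spread
    refine ⟨U, hx, fun y hy => Submodule.subset_span (Or.inr ⟨Z, hZ, _, h y hy, ?_⟩)⟩
    rw [ofGerm_germ g y x hy hx, hω]

end LogForms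

end LogBott

namespace LogBott

/-! ### Residues -/

section ClosedImmersion

variable {X Z : Scheme.{0}} (i : Z ⟶ X) (f : X ⟶ Spec (.of ℂ))

lemma isLocallyNoetherian_of_smooth [Smooth f] : IsLocallyNoetherian X := by
  refine ⟨fun U => ?_⟩
  have h1 := f.finiteType_appLE (isAffineOpen_top (Spec (.of ℂ))) U.2 le_top
  let e := (Scheme.ΓSpecIso (.of ℂ)).symm.commRingCatIsoToRingEquiv
  have h2 : ((f.appLE ⊤ U.1 le_top).hom.comp (e : ℂ →+* _)).FiniteType :=
    h1.comp (RingHom.FiniteType.of_surjective _ e.surjective)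
  let : Algebra ℂ Γ(X, U.1) := ((f.appLE ⊤ U.1 le_top).hom.comp (e : ℂ →+* _)).toAlgebra
  have : Algebra.FiniteType ℂ Γ(X, U.1) := h2
  exact Algebra.FiniteType.isNoetherianRing ℂ _

lemma stalkMap_germC (z : Z) (c : ℂ) :
    i.stalkMap z (germC (globalConst f) (i z) c) = germC (globalConst (i ≫ f)) z c := by
  refine (Scheme.Hom.germ_stalkMap_apply i ⊤ z (mem_top _) (globalConst f c)).trans ?_
  have : globalConst (i ≫ f) c = i.appTop (globalConst f c) := by
    change (Scheme.Hom.appTop (i ≫ f)) _ = _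
    rw [Scheme.Hom.comp_appTop]
    rfl
  rw [germC, RingHom.comp_apply, this]
  rfl

variable [IsIntegral Z]

/-- The image of the generic point. -/
abbrev genericImage : X := i (genericPoint Z)

lemma genericImage_specializes (z : Z) : genericImage i ⤳ i z :=
  i.base.hom.map_specializes (genericPoint_specializes z)

lemma ofGerm_stalkMap (z : Z) (a : X.presheaf.stalk (i z)) : ofGerm z (i.stalkMap z a) =
    i.stalkMap (genericPoint Z) (X.presheaf.stalkSpecializes (genericImage_specializes i z) a) :=
  (Scheme.Hom.stalkSpecializes_stalkMap_apply i _ _ (genericPoint_specializes z) a).symm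

variable [IsClosedImmersion i]

lemma ker_stalkMap_genericPoint :
    RingHom.ker (i.stalkMap (genericPoint Z)).hom = IsLocalRing.maximalIdeal _ := by
  have h : Function.Surjective (i.stalkMap (genericPoint Z)).hom := i.stalkMap_surjective _
  have : IsField (Z.presheaf.stalk (genericPoint Z)) := Field.toIsField Z.functionField
  let := this.toField
  exact IsLocalRing.eq_maximalIdeal (RingHom.ker_isMaximal_of_surjective _ h)

lemma stalkMap_eq_zero_iff (z : Z) (a : X.presheaf.stalk (i z)) :
    i.stalkMap z a = 0 ↔ a ∈ specIdeal (genericImage_specializes i z) := by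
  have h1 : a ∈ specIdeal (genericImage_specializes i z) ↔
      X.presheaf.stalkSpecializes (genericImage_specializes i z) a ∈
        RingHom.ker (i.stalkMap (genericPoint Z)).hom := by
    rw [ker_stalkMap_genericPoint]
    rfl
  rw [h1, RingHom.mem_ker]
  have h2 := ofGerm_stalkMap i z a
  constructor
  · intro h
    rw [h, ofGerm_zero] at h2
    exact h2.symm
  · intro h
    refine ofGerm_injective z (h2.trans ?_)
    rw [ofGerm_zero]
    exact h

end ClosedImmersion

/-! ### Residues along a component, modulo functions vanishing at its generic point. -/

section Residue

variable {X : Scheme.{0}} [IsIntegral X]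

/-- The rational functions which are regular and vanish at a point. -/
def vanishingAt (x : X) : AddSubgroup X.functionField :=
  (IsLocalRing.maximalIdeal (X.presheaf.stalk x)).toAddSubgroup.map
    (algebraMap (X.presheaf.stalk x) X.functionField).toAddMonoidHom

lemma ofGerm_mem_vanishingAt_self {x : X} {a : X.presheaf.stalk x} :
    ofGerm x a ∈ vanishingAt x ↔ a ∈ IsLocalRing.maximalIdeal (X.presheaf.stalk x) :=
  ⟨fun ⟨_, hm, h⟩ => ofGerm_injective x h ▸ hm, fun h => ⟨a, h, rfl⟩⟩

lemma ofGerm_mem_vanishingAt {x y : X} (h : y ⤳ x) {a : X.presheaf.stalk x} :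
    ofGerm x a ∈ vanishingAt y ↔ a ∈ specIdeal h := by
  rw [← ofGerm_stalkSpecializes h, ofGerm_mem_vanishingAt_self]
  rfl

lemma mul_mem_vanishingAt {x : X} {a b : X.functionField} (ha : a ∈ localRing x)
    (hb : b ∈ vanishingAt x) : a * b ∈ vanishingAt x := by
  obtain ⟨a, rfl⟩ := ha
  obtain ⟨m, hm, rfl⟩ := hb
  exact ⟨a * m, Ideal.mul_mem_left _ _ hm, ofGerm_mul x a m⟩

lemma one_notMem_vanishingAt (x : X) : (1 : X.functionField) ∉ vanishingAt x := by
  rintro ⟨m, hm, h⟩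
  have : m = 1 := ofGerm_injective x (h.trans (map_one _).symm)
  exact (IsLocalRing.maximalIdeal.isMaximal _).ne_top ((Ideal.eq_top_iff_one _).2 (this ▸ hm))

/-- On `Z` the equation belongs to a regular system of parameters up to a unit; off `Z` it generates
the unit ideal. -/
lemma IsSNC.localEquation_ne_zero {D : Finset (IrreducibleCloseds X)} (hD : IsSNC D)
    {Z : IrreducibleCloseds X} (hZ : Z ∈ D) {x : X} {t : X.presheaf.stalk x}
    (ht : IsLocalEquation Z x t) : t ≠ 0 := by
  rintro rfl
  have h0 : stalkIdeal Z x = ⊥ := by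
    rw [stalkIdeal, ht.ofIdealSheaf_at, Ideal.span_singleton_eq_bot]
  by_cases hx : x ∈ Z
  · obtain ⟨t, ht, h, hli⟩ := hD.exists_equations x
    have h1 := (isLocalEquation_iff.1 (ht ⟨Z, hZ⟩)).symm.trans h0
    rw [Ideal.span_singleton_eq_bot] at h1
    refine hli.ne_zero ⟨⟨Z, hZ⟩, hx⟩ ?_
    have : (⟨t ⟨Z, hZ⟩, h ⟨⟨Z, hZ⟩, hx⟩⟩ : IsLocalRing.maximalIdeal (X.presheaf.stalk x)) = 0 :=
      Subtype.ext h1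
    rw [this, map_zero]
  · exact bot_ne_top (h0.symm.trans ((stalkIdeal_eq_top_iff Z x).2 hx))

variable (f : X ⟶ Spec (.of ℂ))

lemma constants_mem_vanishingAt {x : X} {c : ℂ} :
    (constants f).hom c ∈ vanishingAt x ↔ c = 0 := by
  constructor
  · intro h
    by_contra hc
    refine one_notMem_vanishingAt x ?_
    have := mul_mem_vanishingAt (x := x) (a := (constants f).hom c⁻¹)
      ⟨_, (constants_eq f x _).symm⟩ h
    rwa [← map_mul, inv_mul_cancel₀ hc, map_one] at this
  · rintro rfl
    rw [map_zero]
    exact zero_mem _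

/-- A residue along the component `Y` of `D` with generic point `ζ`. -/
structure IsResidue (D : Finset (IrreducibleCloseds X)) (Y : IrreducibleCloseds X) (ζ : X)
    (ρ : RationalOneForms f →ₗ[X.functionField] X.functionField) : Prop where
  regular : ∀ g : X.presheaf.stalk ζ, ρ (d f (ofGerm ζ g)) ∈ vanishingAt ζ
  self : ∀ t : X.presheaf.stalk ζ, IsLocalEquation Y ζ t → t ≠ 0 → ρ (dlog f ζ t) - 1 ∈ vanishingAt ζ
  other : ∀ Z ∈ D, Z ≠ Y → ∀ t : X.presheaf.stalk ζ, IsLocalEquation Z ζ t →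
    ρ (dlog f ζ t) ∈ vanishingAt ζ

/-- The residue is contraction with τ ∂/∂τ, where τ is an equation of `Y` at `ζ` and ∂/∂τ a
derivation dual to it. Its values matter only modulo functions vanishing at `ζ`, that is, in the
function field of `Y`. -/
lemma exists_residue [Smooth f] {D : Finset (IrreducibleCloseds X)} (hD : IsSNC D)
    {Y : IrreducibleCloseds X} (hY : Y ∈ D) {ζ : X} (hζ : ζ ∈ Y) (hg : ∀ z ∈ Y, ζ ⤳ z) :
    ∃ ρ, IsResidue f D Y ζ ρ := by
  classical
  have hcomp : IsComponent {(⟨Y, hY⟩ : {Z : IrreducibleCloseds X // Z ∈ D})} Y :=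
    ⟨fun j hj => by rw [Finset.mem_singleton.1 hj], fun W hW _ => hW _ (Finset.mem_singleton_self _)⟩
  obtain ⟨t, ht, h, hli⟩ := hD.exists_equations ζ
  have hfin : Fintype {j : {Z : IrreducibleCloseds X // Z ∈ D} // ζ ∈ j.1} := Fintype.ofFinite _
  obtain ⟨c, hc, hc'⟩ := exists_contraction f ζ _ hli
  let j₀ : {j : {Z : IrreducibleCloseds X // Z ∈ D} // ζ ∈ j.1} := ⟨⟨Y, hY⟩, hζ⟩
  let τ := t j₀.1
  have hτm : τ ∈ IsLocalRing.maximalIdeal (X.presheaf.stalk ζ) := h j₀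
  have hτ0 : τ ≠ 0 := by
    intro h0
    refine hli.ne_zero j₀ ?_
    have : (⟨t j₀.1, h j₀⟩ : IsLocalRing.maximalIdeal (X.presheaf.stalk ζ)) = 0 := Subtype.ext h0
    rw [this, map_zero]
  have hτv : ofGerm ζ τ ∈ vanishingAt ζ := ⟨τ, hτm, rfl⟩
  let ρ : RationalOneForms f →ₗ[X.functionField] X.functionField := ofGerm ζ τ • c j₀
  have hρ : ∀ ω, ρ ω = ofGerm ζ τ * c j₀ ω := fun ω => rfl
  have hreg : ∀ g : X.presheaf.stalk ζ, ρ (d f (ofGerm ζ g)) ∈ vanishingAt ζ := by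
    intro g
    rw [hρ, mul_comm]
    exact mul_mem_vanishingAt (hc j₀ g) hτv
  have hinv : ∀ u : X.presheaf.stalk ζ, IsUnit u → (ofGerm ζ u)⁻¹ ∈ localRing ζ := by
    rintro _ ⟨u, rfl⟩
    refine ⟨(u⁻¹ : (X.presheaf.stalk ζ)ˣ), eq_inv_of_mul_eq_one_left ?_⟩
    rw [← map_mul, Units.inv_mul, map_one]
  have hunit : ∀ u : X.presheaf.stalk ζ, IsUnit u → ρ (dlog f ζ u) ∈ vanishingAt ζ := by
    intro u hu
    rw [dlog, map_smul, smul_eq_mul]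
    exact mul_mem_vanishingAt (hinv u hu) (hreg u)
  refine ⟨ρ, hreg, fun s hs hs0 => ?_, fun Z hZ hZY s hs => hunit s ?_⟩
  · have h1 : Ideal.span {τ} = Ideal.span {s} :=
      (isLocalEquation_iff.1 (ht ⟨Y, hY⟩)).symm.trans (isLocalEquation_iff.1 hs)
    obtain ⟨u, hu⟩ := Ideal.span_singleton_eq_span_singleton.1 h1
    have hK : ofGerm ζ τ ≠ 0 := ofGerm_ne_zero hτ0
    have hu0 : ofGerm ζ (u : X.presheaf.stalk ζ) ≠ 0 := ofGerm_ne_zero u.ne_zero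
    -- Another equation is s = τ u with `u` a unit, so dlog s = dlog τ + dlog u, and the contraction
    -- sends dlog τ to 1.
    have h2 : ρ (dlog f ζ s) - 1 = ρ (dlog f ζ (u : X.presheaf.stalk ζ)) := by
      have h3 : ρ (d f (ofGerm ζ τ)) = ofGerm ζ τ := by
        rw [hρ]
        have : c j₀ (d f (ofGerm ζ τ)) = 1 := (hc' j₀ j₀).trans (if_pos rfl)
        rw [this, mul_one]
      rw [← hu, dlog, dlog, ofGerm_mul, d_mul, map_smul, map_smul, map_add, map_smul, map_smul, h3]
      simp only [smul_eq_mul]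
      field_simp
      ring
    rw [h2]
    exact hunit u u.isUnit
  · have h1 : ζ ∉ Z := by
      intro hζZ
      have := hD.mem_of_generic_mem f hcomp hζ hg ⟨Z, hZ⟩ hζZ
      exact hZY (congrArg Subtype.val (Finset.mem_singleton.1 this))
    rw [← stalkIdeal_eq_top_iff, stalkIdeal, hs.ofIdealSheaf_at, Ideal.span_singleton_eq_top] at h1
    exact h1

variable {f}

/-- The residue of a form that is logarithmic at `x` is the class of a function regular at `x`, and
not merely at the generic point `ζ`: on the generators it is 0 or 1. -/
lemma IsResidue.exists_of_mem {D D' : Finset (IrreducibleCloseds X)} {Y : IrreducibleCloseds X} {ζ : X}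
    {ρ : RationalOneForms f →ₗ[X.functionField] X.functionField} (h : IsResidue f D Y ζ ρ)
    (hSNC : IsSNC D) (hD : D' ⊆ D) {x : X} (hx : ζ ⤳ x) {ω : RationalOneForms f} (hω : ω ∈ logOneFormsAt f D' x) :
    ∃ a : X.presheaf.stalk x, ρ ω - ofGerm x a ∈ vanishingAt ζ ∧ (Y ∉ D' → a = 0) := by
  induction hω using Submodule.span_induction with
  | mem ω hω =>
    rcases hω with ⟨g, rfl⟩ | ⟨Z, hZ, t, ht, hω⟩
    · refine ⟨0, ?_, fun _ => rfl⟩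
      rw [ofGerm_zero, sub_zero, ← ofGerm_stalkSpecializes hx]
      exact h.regular _
    · have h0 := hSNC.localEquation_ne_zero (hD hZ) ht
      have h1 : ω = dlog f ζ (X.presheaf.stalkSpecializes hx t) := by
        rw [dlog_specializes, dlog, ← hω, inv_smul_smul₀ (ofGerm_ne_zero h0)]
      have h0' : X.presheaf.stalkSpecializes hx t ≠ 0 := by
        intro h2
        apply ofGerm_ne_zero h0
        rw [← ofGerm_stalkSpecializes hx, h2, ofGerm_zero]
      by_cases hZY : Z = Y
      · subst hZY
        refine ⟨1, ?_, fun h => absurd hZ h⟩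
        have : ofGerm x 1 = 1 := map_one _
        rw [this, h1]
        exact h.self _ (ht.specializes hx) h0'
      · refine ⟨0, ?_, fun _ => rfl⟩
        rw [ofGerm_zero, sub_zero, h1]
        exact h.other Z (hD hZ) hZY _ (ht.specializes hx)
  | zero =>
    refine ⟨0, ?_, fun _ => rfl⟩
    rw [map_zero, ofGerm_zero, sub_zero]
    exact zero_mem _
  | add v w _ _ hv hw =>
    obtain ⟨a, ha, ha'⟩ := hv
    obtain ⟨b, hb, hb'⟩ := hw
    refine ⟨a + b, ?_, fun h => by rw [ha' h, hb' h, add_zero]⟩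
    rw [map_add, ofGerm_add, add_sub_add_comm]
    exact add_mem ha hb
  | smul r v _ hv =>
    obtain ⟨_, r, rfl⟩ := r
    obtain ⟨a, ha, ha'⟩ := hv
    refine ⟨r * a, ?_, fun h => by rw [ha' h, mul_zero]⟩
    have h1 : ρ ((⟨_, r, rfl⟩ : localRing x) • v) = ofGerm x r * ρ v := map_smul ρ (ofGerm x r) v
    rw [h1, ofGerm_mul, ← mul_sub]
    exact mul_mem_vanishingAt (localRing_mono hx ⟨r, rfl⟩) ha

lemma genericImage_inclusion_mem (Y : IrreducibleCloseds X) : genericImage (inclusion Y) ∈ Y := by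
  have : genericImage (inclusion Y) ∈ Set.range (inclusion Y) := ⟨_, rfl⟩
  rwa [range_inclusion] at this

lemma genericImage_inclusion_specializes {Y : IrreducibleCloseds X} {x : X} (hx : x ∈ Y) :
    genericImage (inclusion Y) ⤳ x := by
  have : x ∈ Set.range (inclusion Y) := by
    rw [range_inclusion]
    exact hx
  obtain ⟨z, rfl⟩ := this
  exact genericImage_specializes _ z

/-- The residues of a global logarithmic form are constant. -/
lemma IsResidue.exists_constant [UniversallyClosed f] {D : Finset (IrreducibleCloseds X)}
    {Y : IrreducibleCloseds X} {ρ : RationalOneForms f →ₗ[X.functionField] X.functionField}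
    (h : IsResidue f D Y (genericImage (inclusion Y)) ρ) (hSNC : IsSNC D) {ω : RationalOneForms f}
    (hω : ∀ x, ω ∈ logOneFormsAt f D x) :
    ∃ c : ℂ, ρ ω - (constants f).hom c ∈ vanishingAt (genericImage (inclusion Y)) := by
  let i := inclusion Y
  let ζ := genericImage i
  let φ := (i.stalkMap (genericPoint (subvariety Y))).hom
  have hsub : ∀ a b : X.presheaf.stalk ζ, ofGerm ζ a - ofGerm ζ b ∈ vanishingAt ζ ↔ φ a = φ b := by
    intro a b
    have h1 : ofGerm ζ a - ofGerm ζ b = ofGerm ζ (a - b) := (map_sub _ _ _).symm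
    rw [h1, ofGerm_mem_vanishingAt_self, ← ker_stalkMap_genericPoint i, RingHom.mem_ker, map_sub,
      sub_eq_zero]
  obtain ⟨b, hb, -⟩ := h.exists_of_mem hSNC subset_rfl (specializes_refl ζ) (hω ζ)
  -- As a rational function on `Y` the residue is regular at every point, hence constant on the
  -- complete variety `Y`.
  have key : ∀ z, (φ b : (subvariety Y).functionField) ∈ localRing z := by
    intro z
    have hz := genericImage_specializes i z
    obtain ⟨a, ha, -⟩ := h.exists_of_mem hSNC subset_rfl hz (hω (i z))
    refine ⟨i.stalkMap z a, (ofGerm_stalkMap i z a).trans ?_⟩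
    refine ((hsub _ _).1 ?_).symm
    rw [ofGerm_stalkSpecializes]
    have := sub_mem ha hb
    rwa [sub_sub_sub_cancel_left] at this
  obtain ⟨c, hc⟩ := LogBott.exists_constant (i ≫ f) key
  refine ⟨c, ?_⟩
  have h1 : φ b = φ (germC (globalConst f) ζ c) := by
    rw [hc]
    exact (stalkMap_germC i f _ c).symm
  have h2 := add_mem hb ((hsub _ _).2 h1)
  rw [sub_add_sub_cancel] at h2
  rwa [constants_eq f ζ]

end Residue

end LogBott

namespace LogBott

/-! ### Trivializations -/

section Trivialization

variable {X : Scheme.{0}}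

/-- The structure sheaf, as a module. -/
def unitModule (X : Scheme.{0}) : X.Modules := (SheafOfModules.unit X.ringCatSheaf : SheafOfModules.{0} _)

/-- The inclusion of a summand of a trivial bundle. -/
def trivialι (r : ℕ) (i : Fin r) : unitModule X ⟶ trivialBundle X r :=
  (SheafOfModules.ιFree (R := X.ringCatSheaf) i)

lemma trivialBundle_hom_ext {r : ℕ} {M : X.Modules} {a b : trivialBundle X r ⟶ M}
    (h : ∀ i, trivialι r i ≫ a = trivialι r i ≫ b) : a = b :=
  Limits.Cofan.IsColimit.hom_ext (SheafOfModules.isColimitFreeCofan (R := X.ringCatSheaf) (Fin r)) _ _ h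

lemma exists_trivial_projections (X : Scheme.{0}) (r : ℕ) :
    ∃ p : Fin r → (trivialBundle X r ⟶ unitModule X),
      (∀ i j, trivialι r j ≫ p i = if i = j then 𝟙 _ else 0) ∧ ∑ i, p i ≫ trivialι r i = 𝟙 _ := by
  have h : ∀ i : Fin r, ∃ p : trivialBundle X r ⟶ unitModule X,
      ∀ j, trivialι r j ≫ p = if i = j then 𝟙 _ else 0 := by
    intro i
    let q : ∀ j : Fin r, unitModule X ⟶ unitModule X := fun j => if i = j then 𝟙 _ else 0
    exact ⟨Limits.Cofan.IsColimit.desc (SheafOfModules.isColimitFreeCofan (R := X.ringCatSheaf) (Fin r)) q,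
      fun j => Limits.Cofan.IsColimit.fac (SheafOfModules.isColimitFreeCofan (R := X.ringCatSheaf) (Fin r)) q j⟩
  choose p hp using h
  refine ⟨p, hp, trivialBundle_hom_ext fun j => ?_⟩
  rw [Preadditive.comp_sum, Finset.sum_eq_single j]
  · rw [← Category.assoc, hp, if_pos rfl, Category.id_comp, Category.comp_id]
  · intro i _ hij
    rw [← Category.assoc, hp, if_neg hij, Limits.zero_comp]
  · exact fun h => absurd (Finset.mem_univ j) h

lemma app_sum {M N : X.Modules} {I : Type} (s : Finset I) (a : I → (M ⟶ N)) (U : X.Opens) (m : Γ(M, U)) :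
    (∑ i ∈ s, a i).app U m = ∑ i ∈ s, (a i).app U m := by
  classical
  induction s using Finset.induction_on with
  | empty => rfl
  | insert i s hi ih =>
    rw [Finset.sum_insert hi, Finset.sum_insert hi, ← ih]
    rfl

/-- The coordinates on a trivial bundle. -/
lemma exists_coordinates {M : X.Modules} {r : ℕ} (φ : M ≅ trivialBundle X r) :
    ∃ (e : Fin r → Γ(M, ⊤)) (ψ : Fin r → ∀ U : X.Opens, Γ(M, U) →+ Γ(X, U)),
      (∀ i U (a : Γ(X, U)) (m : Γ(M, U)), ψ i U (a • m) = a * ψ i U m) ∧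
      (∀ U (m : Γ(M, U)), m = ∑ i, ψ i U m • M.presheaf.map (homOfLE le_top).op (e i)) ∧
      ∀ i j U, ψ i U (M.presheaf.map (homOfLE le_top).op (e j)) = if i = j then 1 else 0 := by
  obtain ⟨p, hp, hsum⟩ := exists_trivial_projections X r
  let ε : Fin r → (unitModule X ⟶ M) := fun i => trivialι r i ≫ φ.inv
  let π : Fin r → (M ⟶ unitModule X) := fun i => φ.hom ≫ p i
  have h1 : ∀ i j, ε j ≫ π i = if i = j then 𝟙 _ else 0 := by
    intro i j
    simp only [ε, π, Category.assoc, Iso.inv_hom_id_assoc, hp]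
  have h2 : ∑ i, π i ≫ ε i = 𝟙 _ := by
    have : ∀ i, π i ≫ ε i = φ.hom ≫ (p i ≫ trivialι r i) ≫ φ.inv := fun i => by
      simp only [ε, π, Category.assoc]
    simp only [this]
    rw [← Preadditive.comp_sum, ← Preadditive.sum_comp, hsum, Category.id_comp, Iso.hom_inv_id]
  let one : ∀ U : X.Opens, Γ(unitModule X, U) := fun U => (1 : Γ(X, U))
  have hone : ∀ U i, (ε i).app U (one U) =
      M.presheaf.map (homOfLE (le_top : U ≤ ⊤)).op ((ε i).app ⊤ (one ⊤)) := by
    intro U i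
    have h3 := ConcreteCategory.congr_hom
      ((ε i).mapPresheaf.naturality (homOfLE (le_top : U ≤ ⊤)).op) (one ⊤)
    refine Eq.trans ?_ h3
    refine congrArg ((ε i).app U) ?_
    exact (map_one (X.presheaf.map (homOfLE (le_top : U ≤ ⊤)).op).hom).symm
  refine ⟨fun i => (ε i).app ⊤ (one ⊤), fun i U => ((π i).app U).hom, fun i U a m => ?_,
    fun U m => ?_, fun i j U => ?_⟩
  · exact Scheme.Modules.Hom.app_smul (π i) a m
  · have h3 : (∑ i, π i ≫ ε i).app U m = m := by rw [h2]; rfl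
    rw [app_sum] at h3
    refine h3.symm.trans (Finset.sum_congr rfl fun i _ => ?_)
    rw [← hone]
    refine Eq.trans ?_ (Scheme.Modules.Hom.app_smul (ε i) _ (one U))
    refine congrArg ((ε i).app U) ?_
    exact (mul_one (show Γ(X, U) from (π i).app U m)).symm
  · rw [← hone]
    have h3 : (ε j ≫ π i).app U (one U) = (if i = j then (1 : Γ(X, U)) else 0) := by
      rw [h1]
      split_ifs
      · rfl
      · rfl
    exact h3

variable [IsIntegral X] {V : Type} [AddCommGroup V] [Module X.functionField V]

/-- Two non-empty open fibres of `s` would have to meet. -/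
lemma IsLocallyConstant.eq_of_irreducible {U : X.Opens} {s : U → V} (hs : IsLocallyConstant s)
    (x y : U) : s x = s y := by
  have hU : PreirreducibleSpace U := Subtype.preirreducibleSpace
    ((PreirreducibleSpace.isPreirreducible_univ (X := X)).open_subset U.2 (Set.subset_univ _))
  obtain ⟨z, -, hzx, hzy⟩ := hU.isPreirreducible_univ (s ⁻¹' {s x}) (s ⁻¹' {s y}) (hs _) (hs _)
    ⟨x, trivial, rfl⟩ ⟨y, trivial, rfl⟩
  exact hzx.symm.trans hzy

/-- A lattice sheaf which is a trivial bundle is generated by a basis. -/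
lemma exists_basis_of_trivial {L : ∀ x : X, Submodule (localRing x) V}
    (hL : ∀ x, ∀ v ∈ L x, ∃ U : X.Opens, x ∈ U ∧ ∀ y ∈ U, v ∈ L y)
    (htop : ∀ x, Submodule.span X.functionField (L x : Set V) = ⊤) {r : ℕ}
    (φ : latticeSheaf L ≅ trivialBundle X r) :
    ∃ e : Module.Basis (Fin r) X.functionField V, ∀ x,
      L x = Submodule.span (localRing x) (Set.range e) := by
  classical
  obtain ⟨s, ψ, hψ, hsum, hδ⟩ := exists_coordinates φ
  obtain ⟨η⟩ : Nonempty X := inferInstance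
  let sec : ∀ U : X.Opens, Γ(latticeSheaf L, U) → latticeSections L U := fun U m => m
  let e : Fin r → V := fun i => (sec ⊤ (s i)).1 ⟨η, trivial⟩
  have he : ∀ i (x : X), (sec ⊤ (s i)).1 ⟨x, trivial⟩ = e i := fun i x =>
    IsLocallyConstant.eq_of_irreducible (sec ⊤ (s i)).2.1 _ _
  have hmem : ∀ i x, e i ∈ L x := fun i x => by
    rw [← he i x]
    exact (sec ⊤ (s i)).2.2 ⟨x, trivial⟩
  have hres : ∀ i (U : X.Opens), (latticeSheaf L).presheaf.map (homOfLE (le_top : U ≤ ⊤)).op (s i) =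
      constSection (e i) fun y _ => hmem i y := fun i U =>
    Subtype.ext (funext fun y => he i y.1)
  have hval : ∀ (U : X.Opens) (x : U) (a : Fin r → Γ(X, U)),
      (sec U (∑ i, a i • constSection (L := L) (U := U) (e i) fun y _ => hmem i y)).1 x =
        ∑ i, toRational (a i) x • e i := by
    intro U x a
    let ev : latticeSections L U →+ V := ⟨⟨fun t => t.1 x, rfl⟩, fun _ _ => rfl⟩
    exact map_sum ev _ _
  have hspan : ∀ x, L x = Submodule.span (localRing x) (Set.range e) := by
    intro x
    refine le_antisymm (fun v hv => ?_) (Submodule.span_le.2 ?_)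
    · obtain ⟨U, hx, hU⟩ := hL x v hv
      have h1 := hsum U (constSection v hU)
      simp only [hres] at h1
      have h2 := congrArg (fun m => (sec U m).1 ⟨x, hx⟩) h1
      simp only [hval] at h2
      have h3 : v = ∑ i, toRational (ψ i U (constSection v hU)) ⟨x, hx⟩ • e i := h2
      rw [h3]
      exact Submodule.sum_mem _ fun i _ => Submodule.smul_mem _ (⟨_, toRational_mem _ ⟨x, hx⟩⟩ : localRing x)
        (Submodule.subset_span ⟨i, rfl⟩)
    · rintro _ ⟨i, rfl⟩
      exact hmem i x
  -- A relation over the function field is multiplied by a common denominator at `η`. It becomes a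
  -- relation between sections near `η`, and the coordinates `ψ` show that its coefficients vanish.
  have hli : LinearIndependent X.functionField e := by
    rw [Fintype.linearIndependent_iff]
    intro a ha j
    obtain ⟨c, hc⟩ := IsLocalization.exist_integer_multiples_of_finset
      (nonZeroDivisors (X.presheaf.stalk η)) (Finset.univ.image a)
    choose b hb using fun i => hc (a i) (Finset.mem_image_of_mem a (Finset.mem_univ i))
    choose W hW t ht using fun i => exists_germ (b i)
    have hle : ∀ i, Finset.univ.inf W ≤ W i := fun i => Finset.inf_le (Finset.mem_univ i)
    have hη : η ∈ Finset.univ.inf W := by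
      rw [← SetLike.mem_coe, Opens.coe_finset_inf]
      simpa using hW
    have h1 : (∑ i, (rs (hle i) (t i)) • constSection (L := L) (e i) fun y _ => hmem i y :
        Γ(latticeSheaf L, Finset.univ.inf W)) = 0 := by
      refine Subtype.ext (funext fun y => ?_)
      rw [IsLocallyConstant.eq_of_irreducible (sec _ _).2.1 y ⟨η, hη⟩]
      refine (hval _ _ _).trans ?_
      have h2 : ∀ i, toRational (rs (hle i) (t i)) ⟨η, hη⟩ = ofGerm η c.1 * a i := by
        intro i
        rw [toRational, germ_rs, ht]
        exact (hb i).trans (Algebra.smul_def _ _)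
      simp only [h2, mul_smul, ← Finset.smul_sum]
      rw [ha, smul_zero]
      rfl
    have h3 := congrArg (ψ j _) h1
    simp only [← hres, map_sum, hψ, hδ, map_zero, mul_ite, mul_one, mul_zero, Finset.sum_ite_eq,
      Finset.mem_univ, if_true] at h3
    have h4 : b j = 0 := by
      rw [← ht j, ← germ_rs (hle j) (t j) η hη, h3, map_zero]
    have h5 : ofGerm η c.1 * a j = 0 := by
      have := hb j
      rw [h4, map_zero] at this
      exact ((Algebra.smul_def _ _).symm.trans this.symm)
    exact (mul_eq_zero.1 h5).resolve_left (IsFractionRing.to_map_ne_zero_of_mem_nonZeroDivisors c.2)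
  have hKspan : ⊤ ≤ Submodule.span X.functionField (Set.range e) := by
    rw [← htop η, Submodule.span_le]
    intro v hv
    rw [hspan η] at hv
    exact Submodule.span_le_restrictScalars (localRing η) X.functionField _ hv
  refine ⟨Module.Basis.mk hli hKspan, fun x => ?_⟩
  rw [Module.Basis.coe_mk, hspan x]

end Trivialization

end LogBott

namespace LogBott

/-! ### The residues of the global logarithmic forms -/

section LogData

variable {X : Scheme.{0}} [IsIntegral X] (f : X ⟶ Spec (.of ℂ))

lemma span_range_d : Submodule.span X.functionField (Set.range (d f)) = ⊤ := by
  let := (constants f).hom.toAlgebra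
  exact KaehlerDifferential.span_range_derivation ℂ X.functionField

/-- The quotient rule q d(p/q) = dp - (p/q) dq. -/
lemma d_mem_span_logOneFormsAt (D : Finset (IrreducibleCloseds X)) (x : X) (a : X.functionField) :
    d f a ∈ Submodule.span X.functionField (logOneFormsAt f D x : Set (RationalOneForms f)) := by
  obtain ⟨p, q, hq, rfl⟩ := IsFractionRing.div_surjective (A := X.presheaf.stalk x) a
  have hq0 : ofGerm x q ≠ 0 := IsFractionRing.to_map_ne_zero_of_mem_nonZeroDivisors hq
  have h1 : ofGerm x q • d f (ofGerm x p / ofGerm x q) =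
      d f (ofGerm x p) - (ofGerm x p / ofGerm x q) • d f (ofGerm x q) := by
    have h2 := d_mul f (ofGerm x q) (ofGerm x p / ofGerm x q)
    rw [mul_div_cancel₀ _ hq0] at h2
    rw [h2, add_sub_cancel_right]
  rw [← Submodule.smul_mem_iff _ hq0]
  change ofGerm x q • d f (ofGerm x p / ofGerm x q) ∈ _
  rw [h1]
  exact sub_mem (Submodule.subset_span (d_mem_logOneFormsAt f D x p))
    (Submodule.smul_mem _ _ (Submodule.subset_span (d_mem_logOneFormsAt f D x q)))

lemma span_logOneFormsAt (D : Finset (IrreducibleCloseds X)) (x : X) :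
    Submodule.span X.functionField (logOneFormsAt f D x : Set (RationalOneForms f)) = ⊤ := by
  rw [← top_le_iff, ← span_range_d, Submodule.span_le]
  rintro _ ⟨a, rfl⟩
  exact d_mem_span_logOneFormsAt f D x a

/-- The identification of the first exterior power. -/
def oneFormsEquiv : RationalForms f 1 ≃ₗ[X.functionField] RationalOneForms f :=
  exteriorPower.oneEquiv X.functionField (RationalOneForms f)

lemma oneFormsEquiv_mk (ω : Fin 1 → RationalOneForms f) :
    oneFormsEquiv f (ModuleCat.exteriorPower.mk ω) = ω 0 := exteriorPower.oneEquiv_ιMulti _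

lemma mem_logFormsAt_one (D : Finset (IrreducibleCloseds X)) (x : X) (η : RationalForms f 1) :
    η ∈ logFormsAt f D 1 x ↔ oneFormsEquiv f η ∈ logOneFormsAt f D x := by
  constructor
  · intro h
    induction h using Submodule.span_induction with
    | mem η h =>
      obtain ⟨ω, hω, rfl⟩ := h
      rw [oneFormsEquiv_mk]
      exact hω 0
    | zero => rw [map_zero]; exact zero_mem _
    | add a b _ _ ha hb => rw [map_add]; exact add_mem ha hb
    | smul r a _ ha =>
      have h1 : oneFormsEquiv f (r • a) = r • oneFormsEquiv f a := map_smul (oneFormsEquiv f) r.1 a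
      rw [h1]
      exact Submodule.smul_mem _ r ha
  · intro h
    refine Submodule.subset_span ⟨fun _ => oneFormsEquiv f η, fun _ => h, ?_⟩
    apply (oneFormsEquiv f).injective
    rw [oneFormsEquiv_mk]

lemma mem_span_of_linearMap {K V W : Type} [Field K] {R : Subring K} [AddCommGroup V] [Module K V]
    [AddCommGroup W] [Module K W] (g : V →ₗ[K] W) {S : Set V} {v : V}
    (hv : v ∈ Submodule.span R S) : g v ∈ Submodule.span R (g '' S) := by
  induction hv using Submodule.span_induction with
  | mem v hv => exact Submodule.subset_span ⟨v, hv, rfl⟩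
  | zero => rw [map_zero]; exact zero_mem _
  | add a b _ _ ha hb => rw [map_add]; exact add_mem ha hb
  | smul r a _ ha =>
    have h1 : g (r • a) = r • g a := map_smul g r.1 a
    rw [h1]
    exact Submodule.smul_mem _ r ha

lemma mem_span_linearEquiv_iff {K V W : Type} [Field K] {R : Subring K} [AddCommGroup V] [Module K V]
    [AddCommGroup W] [Module K W] (g : V ≃ₗ[K] W) {S : Set V} {v : V} :
    v ∈ Submodule.span R S ↔ g v ∈ Submodule.span R (g '' S) := by
  refine ⟨mem_span_of_linearMap g.toLinearMap, fun h => ?_⟩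
  have h1 := mem_span_of_linearMap g.symm.toLinearMap h
  rw [LinearEquiv.coe_coe, LinearEquiv.symm_apply_apply, ← Set.image_comp] at h1
  have : (g.symm ∘ g : V → V) = id := funext fun v => g.symm_apply_apply v
  rwa [this, Set.image_id] at h1

/-- The trivialization concerns the sheaf in the first exterior power; `oneFormsEquiv` carries the
resulting basis over to the one-forms themselves. -/
lemma exists_basis_logOneForms [IsLocallyNoetherian X] {D : Finset (IrreducibleCloseds X)} {r : ℕ}
    (φ : logForms f D 1 ≅ trivialBundle X r) :
    ∃ e : Module.Basis (Fin r) X.functionField (RationalOneForms f), ∀ x,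
      logOneFormsAt f D x = Submodule.span (localRing x) (Set.range e) := by
  have hL : ∀ x, ∀ v ∈ logFormsAt f D 1 x, ∃ U : X.Opens, x ∈ U ∧ ∀ y ∈ U, v ∈ logFormsAt f D 1 y := by
    intro x v hv
    obtain ⟨U, hx, h⟩ := logOneFormsAt_spread f D x _ ((mem_logFormsAt_one f D x v).1 hv)
    exact ⟨U, hx, fun y hy => (mem_logFormsAt_one f D y v).2 (h y hy)⟩
  have htop : ∀ x, Submodule.span X.functionField (logFormsAt f D 1 x : Set (RationalForms f 1)) = ⊤ := by
    intro x
    rw [← top_le_iff]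
    intro η _
    have h1 : oneFormsEquiv f η ∈ Submodule.span X.functionField
        (logOneFormsAt f D x : Set (RationalOneForms f)) := by
      rw [span_logOneFormsAt]
      trivial
    have h2 := Submodule.mem_map_of_mem (f := (oneFormsEquiv f).symm.toLinearMap) h1
    rw [Submodule.map_span, LinearEquiv.coe_coe, LinearEquiv.symm_apply_apply] at h2
    refine Submodule.span_mono ?_ h2
    rintro _ ⟨ω, hω, rfl⟩
    refine (mem_logFormsAt_one f D x _).2 ?_
    have : oneFormsEquiv f ((oneFormsEquiv f).symm ω) = ω := LinearEquiv.apply_symm_apply _ _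
    exact this.symm ▸ hω
  obtain ⟨e, he⟩ := exists_basis_of_trivial hL htop φ
  refine ⟨e.map (oneFormsEquiv f), fun x => Submodule.ext fun ω => ?_⟩
  obtain ⟨η, rfl⟩ := (oneFormsEquiv f).surjective ω
  rw [← mem_logFormsAt_one, he, mem_span_linearEquiv_iff (oneFormsEquiv f), ← Set.range_comp]
  rfl

/-- A trivialization of the logarithmic forms, and the residues of its members. -/
structure LogData (D : Finset (IrreducibleCloseds X)) (r : ℕ) where
  snc : IsSNC D
  e : Module.Basis (Fin r) X.functionField (RationalOneForms f)
  span_eq : ∀ x, logOneFormsAt f D x = Submodule.span (localRing x) (Set.range e)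
  resMap : {Z : IrreducibleCloseds X // Z ∈ D} →
    (RationalOneForms f →ₗ[X.functionField] X.functionField)
  isResidue : ∀ j, IsResidue f D j.1 (genericImage (inclusion j.1)) (resMap j)
  res : {Z : IrreducibleCloseds X // Z ∈ D} → ((Fin r → ℂ) →ₗ[ℂ] ℂ)
  res_spec : ∀ j i, resMap j (e i) - (constants f).hom (res j (Pi.single i 1)) ∈
    vanishingAt (genericImage (inclusion j.1))

lemma exists_logData [Smooth f] [UniversallyClosed f] {D : Finset (IrreducibleCloseds X)}
    (hD : IsSNC D) {r : ℕ} (φ : logForms f D 1 ≅ trivialBundle X r) : Nonempty (LogData f D r) := by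
  have := isLocallyNoetherian_of_smooth f
  obtain ⟨e, he⟩ := exists_basis_logOneForms f φ
  choose ρ hρ using fun j : {Z : IrreducibleCloseds X // Z ∈ D} =>
    exists_residue f hD j.2 (genericImage_inclusion_mem j.1) fun z hz =>
      genericImage_inclusion_specializes hz
  choose c hc using fun (j : {Z : IrreducibleCloseds X // Z ∈ D}) (i : Fin r) =>
    (hρ j).exists_constant hD (ω := e i) fun x => by
      rw [he x]
      exact Submodule.subset_span ⟨i, rfl⟩
  refine ⟨⟨hD, e, he, ρ, hρ, fun j => (Pi.basisFun ℂ (Fin r)).constr ℂ (c j), fun j i => ?_⟩⟩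
  have h1 : (Pi.basisFun ℂ (Fin r)).constr ℂ (c j) (Pi.single i 1) = c j i := by
    have := (Pi.basisFun ℂ (Fin r)).constr_basis ℂ (c j) i
    rwa [Pi.basisFun_apply] at this
  rw [h1]
  exact hc j i

variable {f} {D : Finset (IrreducibleCloseds X)} {r : ℕ} (F : LogData f D r)

/-- The logarithmic form with given constant coefficients. -/
def LogData.form : (Fin r → ℂ) →ₛₗ[(constants f).hom] RationalOneForms f where
  toFun v := ∑ i, (constants f).hom (v i) • F.e i
  map_add' v w := by
    simp only [Pi.add_apply, map_add, add_smul, Finset.sum_add_distrib]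
  map_smul' c v := by
    simp only [Pi.smul_apply, smul_eq_mul, map_mul, mul_smul, Finset.smul_sum]

lemma LogData.form_apply (v : Fin r → ℂ) : F.form v = ∑ i, (constants f).hom (v i) • F.e i := rfl

lemma LogData.form_single (i : Fin r) : F.form (Pi.single i 1) = F.e i := by
  rw [F.form_apply, Finset.sum_eq_single i]
  · rw [Pi.single_eq_same, map_one, one_smul]
  · intro j _ hj
    rw [Pi.single_eq_of_ne hj, map_zero, zero_smul]
  · exact fun h => absurd (Finset.mem_univ i) h

lemma constants_mem_localRing (x : X) (c : ℂ) : (constants f).hom c ∈ localRing x :=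
  ⟨_, (constants_eq f x c).symm⟩

lemma LogData.form_mem (v : Fin r → ℂ) (x : X) : F.form v ∈ logOneFormsAt f D x := by
  rw [F.span_eq, F.form_apply]
  refine Submodule.sum_mem _ fun i _ => ?_
  have h1 : F.e i ∈ Submodule.span (localRing x) (Set.range F.e) :=
    Submodule.subset_span (Set.mem_range_self i)
  exact Submodule.smul_mem _ (⟨(constants f).hom (v i), constants_mem_localRing x (v i)⟩ : localRing x) h1

lemma LogData.resMap_form (j : {Z : IrreducibleCloseds X // Z ∈ D}) (v : Fin r → ℂ) :
    F.resMap j (F.form v) - (constants f).hom (F.res j v) ∈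
      vanishingAt (genericImage (inclusion j.1)) := by
  have h1 : F.res j v = ∑ i, v i * F.res j (Pi.single i 1) := by
    conv_lhs => rw [← Finset.univ_sum_single v]
    rw [map_sum]
    refine Finset.sum_congr rfl fun i _ => ?_
    have : (Pi.single i (v i) : Fin r → ℂ) = v i • Pi.single i 1 := by
      rw [← Pi.single_smul, smul_eq_mul, mul_one]
    rw [this, map_smul, smul_eq_mul]
  rw [h1, F.form_apply, map_sum, map_sum, ← Finset.sum_sub_distrib]
  refine sum_mem fun i _ => ?_
  rw [map_smul, smul_eq_mul, map_mul, ← mul_sub]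
  exact mul_mem_vanishingAt (constants_mem_localRing _ _) (F.res_spec j i)

lemma specIdeal_genericImage {Y : IrreducibleCloseds X} {x : X} (hx : x ∈ Y) :
    specIdeal (genericImage_inclusion_specializes hx) = stalkIdeal Y x :=
  (stalkIdeal_eq_specIdeal _ (genericImage_inclusion_mem Y) fun _ hz =>
    genericImage_inclusion_specializes hz).symm

/-- Comparison of the residue of a combination of global forms, modulo the ideal of the
component. -/
lemma LogData.sub_mem_stalkIdeal {j : {Z : IrreducibleCloseds X // Z ∈ D}} {x : X} (hx : x ∈ j.1)
    {κ : Type} (s : Finset κ) (α : κ → X.presheaf.stalk x) (w : κ → Fin r → ℂ)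
    {a : X.presheaf.stalk x}
    (ha : F.resMap j (∑ k ∈ s, ofGerm x (α k) • F.form (w k)) - ofGerm x a ∈
      vanishingAt (genericImage (inclusion j.1))) :
    a - ∑ k ∈ s, α k * germC (globalConst f) x (F.res j (w k)) ∈ stalkIdeal j.1 x := by
  have hs := genericImage_inclusion_specializes hx
  rw [← specIdeal_genericImage hx, ← ofGerm_mem_vanishingAt hs]
  have h1 : F.resMap j (∑ k ∈ s, ofGerm x (α k) • F.form (w k)) -
      ofGerm x (∑ k ∈ s, α k * germC (globalConst f) x (F.res j (w k))) ∈
        vanishingAt (genericImage (inclusion j.1)) := by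
    have h2 : ofGerm x (∑ k ∈ s, α k * germC (globalConst f) x (F.res j (w k))) =
        ∑ k ∈ s, ofGerm x (α k) * (constants f).hom (F.res j (w k)) := by
      refine (map_sum (algebraMap (X.presheaf.stalk x) X.functionField) _ _).trans
        (Finset.sum_congr rfl fun k _ => ?_)
      rw [map_mul, constants_eq f x]
    rw [h2, map_sum, ← Finset.sum_sub_distrib]
    refine sum_mem fun k _ => ?_
    rw [map_smul, smul_eq_mul, ← mul_sub]
    exact mul_mem_vanishingAt (localRing_mono hs ⟨_, rfl⟩) (F.resMap_form j (w k))
  have h3 := sub_mem h1 ha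
  rw [sub_sub_sub_cancel_left] at h3
  have h4 : ofGerm x (a - ∑ k ∈ s, α k * germC (globalConst f) x (F.res j (w k))) =
      ofGerm x a - ofGerm x (∑ k ∈ s, α k * germC (globalConst f) x (F.res j (w k))) := map_sub _ _ _
  rwa [h4]

lemma stalkIdeal_le_maximalIdeal {Y : IrreducibleCloseds X} {x : X} (hx : x ∈ Y) :
    stalkIdeal Y x ≤ IsLocalRing.maximalIdeal (X.presheaf.stalk x) :=
  IsLocalRing.le_maximalIdeal fun h => (stalkIdeal_eq_top_iff Y x).1 h hx

end LogData

end LogBott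

namespace LogBott

/-! ### Adapted local coordinates -/

/-- Independent functionals are part of the coordinates with respect to a basis. -/
lemma exists_adapted_basis {k J : Type} [Field k] {r : ℕ} (Λ : J → (Fin r → k) →ₗ[k] k)
    (h : LinearIndependent k Λ) : ∃ (v : Module.Basis (Fin r) k (Fin r → k)) (σ : J ↪ Fin r),
      ∀ j i, Λ j (v i) = if σ j = i then 1 else 0 := by
  classical
  let b := Module.Basis.sumExtend h
  have hb : ∀ j, b (Sum.inl j) = Λ j := by
    intro j
    simp only [b, Module.Basis.sumExtend, Module.Basis.reindex_apply, Module.Basis.extend_apply_self]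
    exact (congrArg Subtype.val (Equiv.Set.sumDiffSubset_apply_inl
      (h.linearIndepOn_id.subset_extend (Set.subset_univ _)) ⟨_, j, rfl⟩))
  have hfin : Finite (J ⊕ ↑(Module.Basis.sumExtendIndex h)) := Module.Finite.finite_basis b
  have := Fintype.ofFinite (J ⊕ ↑(Module.Basis.sumExtendIndex h))
  have hcard : Fintype.card (J ⊕ ↑(Module.Basis.sumExtendIndex h)) = r := by
    rw [← Module.finrank_eq_card_basis b, Subspace.dual_finrank_eq, Module.finrank_fin_fun]
  let ε := Fintype.equivFinOfCardEq hcard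
  let B := b.reindex ε
  -- The functionals are completed to a basis of the dual space, and `v` is the basis of the space
  -- itself to which that basis is dual.
  let v := B.dualBasis.map (Module.evalEquiv k (Fin r → k)).symm
  have hv : ∀ i l, B i (v l) = if i = l then 1 else 0 := by
    intro i l
    have h1 : B i (v l) = Module.evalEquiv k (Fin r → k) (v l) (B i) := rfl
    rw [h1, Module.Basis.map_apply, LinearEquiv.apply_symm_apply]
    rw [Module.Basis.dualBasis_apply_self]
  refine ⟨v, ⟨fun j => ε (Sum.inl j), fun a c hac => Sum.inl_injective (ε.injective hac)⟩, fun j i => ?_⟩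
  rw [← hv, ← hb]
  congr 1
  exact (b.reindex_apply ε _).trans (congrArg b (ε.symm_apply_apply _)) |>.symm

section Chart

variable {X : Scheme.{0}} [IsIntegral X] {f : X ⟶ Spec (.of ℂ)} {D : Finset (IrreducibleCloseds X)}
  {r : ℕ}

/-- The product of the local equations of the components outside `S` attached to a basis vector. -/
def coordFactor {x : X} (t : {Z : IrreducibleCloseds X // Z ∈ D} → X.presheaf.stalk x)
    (σ : {j : {Z : IrreducibleCloseds X // Z ∈ D} // x ∈ j.1} ↪ Fin r)
    (S : Finset {Z : IrreducibleCloseds X // Z ∈ D}) (k : Fin r) : X.presheaf.stalk x :=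
  open Classical in ∏ j with j.1 ∉ S ∧ σ j = k, t j.1

/-- Local equations at `x` and a basis of the space of global logarithmic forms adapted to the
residues. -/
structure LogData.Chart (F : LogData f D r) (x : X) where
  t : {Z : IrreducibleCloseds X // Z ∈ D} → X.presheaf.stalk x
  eqn : ∀ j, IsLocalEquation j.1 x (t j)
  v : Module.Basis (Fin r) ℂ (Fin r → ℂ)
  σ : {j : {Z : IrreducibleCloseds X // Z ∈ D} // x ∈ j.1} ↪ Fin r
  res_v : ∀ j k, F.res j.1 (v k) = if σ j = k then 1 else 0
  dlog_sub : ∀ j, F.form (v (σ j)) - dlog f x (t j.1) ∈ logOneFormsAt f ∅ x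
  span_eq : ∀ S : Finset {Z : IrreducibleCloseds X // Z ∈ D},
    logOneFormsAt f (S.map (Function.Embedding.subtype _)) x =
      Submodule.span (localRing x) (Set.range fun k => ofGerm x (coordFactor t σ S k) • F.form (v k))

variable (F : LogData f D r)

lemma LogData.exists_coeff (v : Module.Basis (Fin r) ℂ (Fin r → ℂ)) {x : X} {ω : RationalOneForms f}
    (hω : ω ∈ logOneFormsAt f D x) :
    ∃ α : Fin r → X.presheaf.stalk x, ω = ∑ k, ofGerm x (α k) • F.form (v k) := by
  have h1 : ω ∈ Submodule.span (localRing x) (Set.range fun k => F.form (v k)) := by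
    rw [F.span_eq] at hω
    refine Submodule.span_le.2 ?_ hω
    rintro _ ⟨i, rfl⟩
    have h2 : F.e i = ∑ k, (constants f).hom (v.repr (Pi.single i 1) k) • F.form (v k) := by
      rw [← F.form_single]
      conv_lhs => rw [← v.sum_repr (Pi.single i 1), map_sum]
      exact Finset.sum_congr rfl fun k _ => map_smulₛₗ F.form _ _
    rw [h2]
    refine Submodule.sum_mem _ fun k _ => ?_
    have h3 : F.form (v k) ∈ Submodule.span (localRing x) (Set.range fun k => F.form (v k)) :=
      Submodule.subset_span (Set.mem_range_self k)
    exact Submodule.smul_mem _ (⟨_, constants_mem_localRing x _⟩ : localRing x) h3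
  obtain ⟨c, hc⟩ := (Submodule.mem_span_range_iff_exists_fun _).1 h1
  choose α hα using fun k => (c k).2
  refine ⟨α, hc.symm.trans (Finset.sum_congr rfl fun k _ => ?_)⟩
  have : ofGerm x (α k) = (c k).1 := hα k
  rw [this]
  rfl

lemma LogData.resMap_dlog {x : X} {j l : {Z : IrreducibleCloseds X // Z ∈ D}} (hj : x ∈ j.1)
    {t : X.presheaf.stalk x} (ht : IsLocalEquation l.1 x t) :
    F.resMap j (dlog f x t) - ofGerm x (open Classical in if l = j then 1 else 0) ∈
      vanishingAt (genericImage (inclusion j.1)) := by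
  have hs := genericImage_inclusion_specializes hj
  rw [← dlog_specializes f hs]
  split_ifs with h
  · subst h
    have : ofGerm x 1 = 1 := map_one _
    rw [this]
    refine (F.isResidue l).self _ (ht.specializes hs) fun h0 => ?_
    exact F.snc.localEquation_ne_zero l.2 (ht.specializes hs) h0
  · rw [ofGerm_zero, sub_zero]
    exact (F.isResidue j).other l.1 l.2 (fun h' => h (Subtype.ext h')) _ (ht.specializes hs)

/-- Write the logarithmic differential of an equation of the l-th component as a combination of
global forms with coefficients in the local ring. Its residues along the components through `x` are
Kronecker symbols modulo the maximal ideal. A relation between the residues, valid on all global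
forms, therefore puts the constant `c l` into the maximal ideal, so it is zero. -/
lemma LogData.res_linearIndependent (x : X) : LinearIndependent ℂ
    (fun j : {j : {Z : IrreducibleCloseds X // Z ∈ D} // x ∈ j.1} => F.res j.1) := by
  classical
  have := Fintype.ofFinite {j : {Z : IrreducibleCloseds X // Z ∈ D} // x ∈ j.1}
  rw [Fintype.linearIndependent_iff]
  intro c hc l
  obtain ⟨t, ht, -⟩ := F.snc.exists_equations x
  obtain ⟨α, hα⟩ := F.exists_coeff (Pi.basisFun ℂ (Fin r))
    (dlog_mem_logOneFormsAt f l.1.2 (ht l.1) (F.snc.localEquation_ne_zero l.1.2 (ht l.1)))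
  let γ := germC (globalConst f) x
  have h1 : ∀ j : {j : {Z : IrreducibleCloseds X // Z ∈ D} // x ∈ j.1},
      (if l.1 = j.1 then 1 else 0) - ∑ k, α k * γ (F.res j.1 (Pi.basisFun ℂ (Fin r) k)) ∈
        IsLocalRing.maximalIdeal (X.presheaf.stalk x) := by
    intro j
    refine stalkIdeal_le_maximalIdeal j.2 (F.sub_mem_stalkIdeal j.2 Finset.univ α _ ?_)
    rw [← hα]
    convert! F.resMap_dlog j.2 (ht l.1)
  have h2 : ∑ j, γ (c j) * ((if l.1 = j.1 then 1 else 0) -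
      ∑ k, α k * γ (F.res j.1 (Pi.basisFun ℂ (Fin r) k))) ∈
        IsLocalRing.maximalIdeal (X.presheaf.stalk x) :=
    sum_mem fun j _ => Ideal.mul_mem_left _ _ (h1 j)
  have h3 : ∀ k, ∑ j, γ (c j) * γ (F.res j.1 (Pi.basisFun ℂ (Fin r) k)) = 0 := by
    intro k
    have := congrArg (fun φ : (Fin r → ℂ) →ₗ[ℂ] ℂ => γ (φ (Pi.basisFun ℂ (Fin r) k))) hc
    simpa only [LinearMap.sum_apply, LinearMap.smul_apply, smul_eq_mul, map_sum, map_mul,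
      LinearMap.zero_apply, map_zero] using this
  have h4 : ∑ j, γ (c j) * ∑ k, α k * γ (F.res j.1 (Pi.basisFun ℂ (Fin r) k)) = 0 := by
    simp only [Finset.mul_sum]
    rw [Finset.sum_comm]
    refine Finset.sum_eq_zero fun k _ => ?_
    have : ∀ j : {j : {Z : IrreducibleCloseds X // Z ∈ D} // x ∈ j.1},
        γ (c j) * (α k * γ (F.res j.1 (Pi.basisFun ℂ (Fin r) k))) =
        α k * (γ (c j) * γ (F.res j.1 (Pi.basisFun ℂ (Fin r) k))) := fun j => mul_left_comm _ _ _
    simp only [this]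
    rw [← Finset.mul_sum, h3, mul_zero]
  simp only [mul_sub, Finset.sum_sub_distrib, h4, sub_zero] at h2
  rw [Finset.sum_eq_single l] at h2
  · rw [if_pos rfl, mul_one] at h2
    have h5 : (constants f).hom (c l) ∈ vanishingAt x := by
      rw [constants_eq f x, ofGerm_mem_vanishingAt_self]
      exact h2
    exact (constants_mem_vanishingAt f).1 h5
  · intro j _ hj
    rw [if_neg fun h => hj (Subtype.ext h.symm), mul_zero]
  · exact fun h => absurd (Finset.mem_univ l) h

lemma dlog_unit_mem {x : X} {u : X.presheaf.stalk x} (hu : IsUnit u) :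
    dlog f x u ∈ logOneFormsAt f ∅ x := by
  obtain ⟨u, rfl⟩ := hu
  have : (ofGerm x (u : X.presheaf.stalk x))⁻¹ = ofGerm x ((u⁻¹ : (X.presheaf.stalk x)ˣ) : X.presheaf.stalk x) := by
    refine (eq_inv_of_mul_eq_one_left ?_).symm
    rw [← ofGerm_mul, Units.inv_mul]
    exact map_one _
  rw [dlog, this]
  exact smul_mem_logOneFormsAt f _ (d_mem_logOneFormsAt f _ x _)

lemma dlog_mul {x : X} {s t : X.presheaf.stalk x} (hs : s ≠ 0) (ht : t ≠ 0) :
    dlog f x (s * t) = dlog f x s + dlog f x t := by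
  have h1 := ofGerm_ne_zero hs
  have h2 := ofGerm_ne_zero ht
  rw [dlog, dlog, dlog, ofGerm_mul, d_mul, smul_add, smul_smul, smul_smul, add_comm]
  congr 2
  · field_simp
  · field_simp

/-- Two equations of a component differ by a unit, and the logarithmic differential of a unit is
regular. -/
lemma IsSNC.exists_decomposition (hD : IsSNC D) [Fintype {Z : IrreducibleCloseds X // Z ∈ D}] {x : X}
    {t : {Z : IrreducibleCloseds X // Z ∈ D} → X.presheaf.stalk x}
    (ht : ∀ j, IsLocalEquation j.1 x (t j)) {ω : RationalOneForms f} (hω : ω ∈ logOneFormsAt f D x) :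
    ∃ b : {Z : IrreducibleCloseds X // Z ∈ D} → X.presheaf.stalk x,
      ω - ∑ j, ofGerm x (b j) • dlog f x (t j) ∈ logOneFormsAt f ∅ x := by
  classical
  induction hω using Submodule.span_induction with
  | mem ω hω =>
    rcases hω with ⟨g, rfl⟩ | ⟨Z, hZ, s, hs, hω⟩
    · refine ⟨0, ?_⟩
      simp only [Pi.zero_apply, ofGerm_zero, zero_smul, Finset.sum_const_zero, sub_zero]
      exact d_mem_logOneFormsAt f _ x g
    · have hs0 := hD.localEquation_ne_zero hZ hs
      have ht0 := hD.localEquation_ne_zero hZ (ht ⟨Z, hZ⟩)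
      have h1 : ω = dlog f x s := by
        rw [dlog, ← hω, inv_smul_smul₀ (ofGerm_ne_zero hs0)]
      obtain ⟨u, hu⟩ := Ideal.span_singleton_eq_span_singleton.1
        ((isLocalEquation_iff.1 (ht ⟨Z, hZ⟩)).symm.trans (isLocalEquation_iff.1 hs))
      refine ⟨Pi.single ⟨Z, hZ⟩ 1, ?_⟩
      rw [Finset.sum_eq_single (⟨Z, hZ⟩ : {Z : IrreducibleCloseds X // Z ∈ D})]
      · have : ofGerm x (Pi.single (M := fun _ => X.presheaf.stalk x)
            (⟨Z, hZ⟩ : {Z : IrreducibleCloseds X // Z ∈ D}) 1 ⟨Z, hZ⟩) = 1 := by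
          rw [Pi.single_eq_same]
          exact map_one _
        rw [this, one_smul, h1, ← hu, dlog_mul ht0 u.ne_zero, add_sub_cancel_left]
        exact dlog_unit_mem u.isUnit
      · intro j _ hj
        rw [Pi.single_eq_of_ne (M := fun _ => X.presheaf.stalk x) hj, ofGerm_zero, zero_smul]
      · exact fun h => absurd (Finset.mem_univ _) h
  | zero =>
    refine ⟨0, ?_⟩
    simp only [Pi.zero_apply, ofGerm_zero, zero_smul, Finset.sum_const_zero, sub_zero]
    exact zero_mem _
  | add v w _ _ hv hw =>
    obtain ⟨b, hb⟩ := hv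
    obtain ⟨c, hc⟩ := hw
    refine ⟨b + c, ?_⟩
    simp only [Pi.add_apply, ofGerm_add, add_smul, Finset.sum_add_distrib]
    rw [add_sub_add_comm]
    exact add_mem hb hc
  | smul a v _ hv =>
    obtain ⟨_, a, rfl⟩ := a
    obtain ⟨b, hb⟩ := hv
    refine ⟨fun j => a * b j, ?_⟩
    simp only [ofGerm_mul, mul_smul]
    rw [← Finset.smul_sum]
    have := smul_mem_logOneFormsAt f a hb
    rw [smul_sub] at this
    exact this

/-- The polar part of a global logarithmic form at a point. -/
lemma LogData.form_sub_mem [Fintype {Z : IrreducibleCloseds X // Z ∈ D}] {x : X}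
    {t : {Z : IrreducibleCloseds X // Z ∈ D} → X.presheaf.stalk x}
    (ht : ∀ j, IsLocalEquation j.1 x (t j)) (w : Fin r → ℂ) :
    F.form w - ∑ j, (constants f).hom (F.res j w) • dlog f x (t j) ∈ logOneFormsAt f ∅ x := by
  classical
  obtain ⟨b, hb⟩ := F.snc.exists_decomposition ht (F.form_mem w x)
  -- If `x` is on the component, `b j` and the constant residue agree modulo t_j, and t_j dlog t_j =
  -- dt_j is regular. Otherwise t_j is a unit and dlog t_j itself is regular.
  have h1 : ∀ j, (ofGerm x (b j) - (constants f).hom (F.res j w)) • dlog f x (t j) ∈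
      logOneFormsAt f ∅ x := by
    intro j
    rw [constants_eq f x]
    have hsub : ofGerm x (b j) - ofGerm x (germC (globalConst f) x (F.res j w)) =
        ofGerm x (b j - germC (globalConst f) x (F.res j w)) := (map_sub _ _ _).symm
    rw [hsub]
    by_cases hj : x ∈ j.1
    · have h2 : F.resMap j (F.form w) - ofGerm x (b j) ∈
          vanishingAt (genericImage (inclusion j.1)) := by
        have h3 : F.resMap j (F.form w - ∑ l, ofGerm x (b l) • dlog f x (t l)) ∈
            vanishingAt (genericImage (inclusion j.1)) := by
          obtain ⟨a, ha, ha'⟩ := (F.isResidue j).exists_of_mem F.snc (Finset.empty_subset D)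
            (genericImage_inclusion_specializes hj) hb
          rwa [ha' (Finset.notMem_empty _), ofGerm_zero, sub_zero] at ha
        have h4 : ∑ l, ofGerm x (b l) * (F.resMap j (dlog f x (t l)) -
            ofGerm x (open Classical in if l = j then 1 else 0)) ∈
              vanishingAt (genericImage (inclusion j.1)) :=
          sum_mem fun l _ => mul_mem_vanishingAt
            (localRing_mono (genericImage_inclusion_specializes hj) ⟨_, rfl⟩) (F.resMap_dlog hj (ht l))
        have h5 := add_mem h3 h4
        rw [map_sub, map_sum] at h5
        simp only [map_smul, smul_eq_mul, mul_sub, Finset.sum_sub_distrib] at h5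
        rw [sub_add_sub_cancel, Finset.sum_eq_single j] at h5
        · rw [← ofGerm_mul, if_pos rfl, mul_one] at h5
          exact h5
        · intro l _ hl
          rw [if_neg hl, ofGerm_zero, mul_zero]
        · exact fun h => absurd (Finset.mem_univ _) h
      have h3 := F.sub_mem_stalkIdeal hj {()} (fun _ => (1 : X.presheaf.stalk x)) (fun _ => w)
        (a := b j) (by
          have : ofGerm x 1 = 1 := map_one _
          rwa [Finset.sum_singleton, this, one_smul])
      rw [Finset.sum_singleton, one_mul, stalkIdeal, (ht j).ofIdealSheaf_at,
        Ideal.mem_span_singleton'] at h3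
      obtain ⟨c, hc⟩ := h3
      rw [← hc, ofGerm_mul, mul_smul, smul_dlog f (F.snc.localEquation_ne_zero j.2 (ht j))]
      exact smul_mem_logOneFormsAt f _ (d_mem_logOneFormsAt f _ x _)
    · refine smul_mem_logOneFormsAt f _ (dlog_unit_mem ?_)
      rw [← stalkIdeal_eq_top_iff, stalkIdeal, (ht j).ofIdealSheaf_at, Ideal.span_singleton_eq_top] at hj
      exact hj
  have h2 := add_mem hb (Submodule.sum_mem _ fun j (_ : j ∈ Finset.univ) => h1 j)
  simp only [sub_smul, Finset.sum_sub_distrib] at h2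
  rwa [sub_add_sub_cancel] at h2

lemma coordFactor_of_mem {x : X} {t : {Z : IrreducibleCloseds X // Z ∈ D} → X.presheaf.stalk x}
    {σ : {j : {Z : IrreducibleCloseds X // Z ∈ D} // x ∈ j.1} ↪ Fin r}
    {S : Finset {Z : IrreducibleCloseds X // Z ∈ D}}
    {j : {j : {Z : IrreducibleCloseds X // Z ∈ D} // x ∈ j.1}} (hj : j.1 ∉ S) :
    coordFactor t σ S (σ j) = t j.1 := by
  classical
  rw [coordFactor, Finset.prod_eq_single_of_mem j (by simp [hj])]
  intro i hi hij
  exact absurd (σ.injective (Finset.mem_filter.1 hi).2.2) hij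

lemma coordFactor_eq_one {x : X} {t : {Z : IrreducibleCloseds X // Z ∈ D} → X.presheaf.stalk x}
    {σ : {j : {Z : IrreducibleCloseds X // Z ∈ D} // x ∈ j.1} ↪ Fin r}
    {S : Finset {Z : IrreducibleCloseds X // Z ∈ D}} {k : Fin r}
    (h : ∀ j, σ j = k → j.1 ∈ S) : coordFactor t σ S k = 1 := by
  classical
  refine Finset.prod_eq_one fun j hj => ?_
  have := (Finset.mem_filter.1 hj).2
  exact absurd (h j this.2) this.1

/-- The basis is chosen dual to the independent residue functionals at `x`. By `form_sub_mem` the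
basis vector attached to a component is its logarithmic differential up to a regular form, and a
basis vector attached to no component is regular. -/
lemma LogData.exists_chart (x : X) : Nonempty (F.Chart x) := by
  classical
  have := Fintype.ofFinite {Z : IrreducibleCloseds X // Z ∈ D}
  obtain ⟨t, ht, -⟩ := F.snc.exists_equations x
  have ht0 : ∀ j, t j ≠ 0 := fun j => F.snc.localEquation_ne_zero j.2 (ht j)
  obtain ⟨v, σ, hσ⟩ := exists_adapted_basis _ (F.res_linearIndependent x)
  have hunit : ∀ j : {Z : IrreducibleCloseds X // Z ∈ D}, x ∉ j.1 →
      dlog f x (t j) ∈ logOneFormsAt f ∅ x := by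
    intro j hj
    refine dlog_unit_mem ?_
    rw [← stalkIdeal_eq_top_iff, stalkIdeal, (ht j).ofIdealSheaf_at, Ideal.span_singleton_eq_top] at hj
    exact hj
  have hconst : ∀ c ω, ω ∈ logOneFormsAt f ∅ x → (constants f).hom c • ω ∈ logOneFormsAt f ∅ x :=
    fun c ω h => (logOneFormsAt f ∅ x).smul_mem ⟨_, constants_mem_localRing x c⟩ h
  have hdlog : ∀ j, F.form (v (σ j)) - dlog f x (t j.1) ∈ logOneFormsAt f ∅ x := by
    intro j
    have h1 := F.form_sub_mem ht (v (σ j))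
    rw [← Finset.add_sum_erase _ _ (Finset.mem_univ j.1), hσ, if_pos rfl, map_one, one_smul] at h1
    have h2 : ∑ l ∈ Finset.univ.erase j.1, (constants f).hom (F.res l (v (σ j))) • dlog f x (t l) ∈
        logOneFormsAt f ∅ x := by
      refine Submodule.sum_mem _ fun l hl => ?_
      by_cases hx : x ∈ l.1
      · rw [hσ ⟨l, hx⟩, if_neg, map_zero, zero_smul]
        · exact zero_mem _
        · intro h
          exact (Finset.mem_erase.1 hl).1 (congrArg Subtype.val (σ.injective h))
      · exact hconst _ _ (hunit l hx)
    have h3 := add_mem h1 h2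
    rwa [← sub_sub, sub_add_cancel] at h3
  have hreg : ∀ k, k ∉ Set.range σ → F.form (v k) ∈ logOneFormsAt f ∅ x := by
    intro k hk
    have h1 := F.form_sub_mem ht (v k)
    have h2 : ∑ l, (constants f).hom (F.res l (v k)) • dlog f x (t l) ∈ logOneFormsAt f ∅ x := by
      refine Submodule.sum_mem _ fun l _ => ?_
      by_cases hx : x ∈ l.1
      · rw [hσ ⟨l, hx⟩, if_neg, map_zero, zero_smul]
        · exact zero_mem _
        · exact fun h => hk ⟨_, h⟩
      · exact hconst _ _ (hunit l hx)
    have h3 := add_mem h1 h2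
    rwa [sub_add_cancel] at h3
  refine ⟨⟨t, ht, v, σ, hσ, hdlog, fun S => ?_⟩⟩
  have hSD : S.map (Function.Embedding.subtype _) ⊆ D := by
    intro Y hY
    obtain ⟨j, -, rfl⟩ := Finset.mem_map.1 hY
    exact j.2
  have hmem : ∀ j : {Z : IrreducibleCloseds X // Z ∈ D},
      j.1 ∈ S.map (Function.Embedding.subtype _) ↔ j ∈ S := fun j => by simp
  refine le_antisymm (fun ω hω => ?_) (Submodule.span_le.2 ?_)
  · obtain ⟨α, rfl⟩ := F.exists_coeff v (logOneFormsAt_mono f hSD x hω)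
    -- A form that is logarithmic only along `S` has no residue along a component outside `S`, so
    -- its coefficient at the corresponding basis vector is divisible by the equation.
    have key : ∀ k, ∃ β, α k = β * coordFactor t σ S k := by
      intro k
      by_cases hk : ∃ j, σ j = k ∧ j.1 ∉ S
      · obtain ⟨j, rfl, hj⟩ := hk
        obtain ⟨a, ha, ha'⟩ := (F.isResidue j.1).exists_of_mem F.snc hSD
          (genericImage_inclusion_specializes j.2) hω
        rw [ha' fun h => hj ((hmem j.1).1 h)] at ha
        have h1 := F.sub_mem_stalkIdeal j.2 _ _ _ ha
        have h2 : ∑ k, α k * germC (globalConst f) x (F.res j.1 (v k)) = α (σ j) := by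
          rw [Finset.sum_eq_single (σ j)]
          · rw [hσ, if_pos rfl, map_one, mul_one]
          · intro k _ hk
            rw [hσ, if_neg hk.symm, map_zero, mul_zero]
          · exact fun h => absurd (Finset.mem_univ _) h
        rw [h2, zero_sub, neg_mem_iff, stalkIdeal, (ht j.1).ofIdealSheaf_at,
          Ideal.mem_span_singleton'] at h1
        obtain ⟨β, hβ⟩ := h1
        exact ⟨β, by rw [coordFactor_of_mem hj, hβ]⟩
      · push Not at hk
        exact ⟨α k, by rw [coordFactor_eq_one hk, mul_one]⟩
    choose β hβ using key
    refine Submodule.sum_mem _ fun k _ => ?_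
    rw [hβ k, ofGerm_mul, mul_smul]
    have h1 : ofGerm x (coordFactor t σ S k) • F.form (v k) ∈ Submodule.span (localRing x)
        (Set.range fun k => ofGerm x (coordFactor t σ S k) • F.form (v k)) :=
      Submodule.subset_span (Set.mem_range_self k)
    exact Submodule.smul_mem _ (⟨ofGerm x (β k), _, rfl⟩ : localRing x) h1
  · rintro _ ⟨k, rfl⟩
    have hmono := logOneFormsAt_mono f (Finset.empty_subset (S.map (Function.Embedding.subtype _))) x
    by_cases hk : k ∈ Set.range σ
    · obtain ⟨j, rfl⟩ := hk
      have h1 := smul_mem_logOneFormsAt f (coordFactor t σ S (σ j)) (hmono (hdlog j))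
      rw [smul_sub] at h1
      have h2 : ofGerm x (coordFactor t σ S (σ j)) • dlog f x (t j.1) ∈
          logOneFormsAt f (S.map (Function.Embedding.subtype _)) x := by
        by_cases hj : j.1 ∈ S
        · exact smul_mem_logOneFormsAt f _ (dlog_mem_logOneFormsAt f ((hmem j.1).2 hj) (ht j.1) (ht0 j.1))
        · rw [coordFactor_of_mem hj, smul_dlog f (ht0 j.1)]
          exact d_mem_logOneFormsAt f _ x _
      have h3 := add_mem h1 h2
      rwa [sub_add_cancel] at h3
    · exact smul_mem_logOneFormsAt f _ (hmono (hreg k hk))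

end Chart

end LogBott

namespace LogBott

/-! ### Exterior powers and constant coordinates -/

section Wedge

open Set

variable {k K W V I κ : Type} [Field k] [Field K] [AddCommGroup W] [Module k W] [AddCommGroup V]
  [Module K V] [LinearOrder I] [LinearOrder κ]

lemma repr_semilinear {γ : k →+* K} {s : Module.Basis I k W} {e : Module.Basis I K V}
    {β : W →ₛₗ[γ] V} (he : ∀ i, β (s i) = e i) (w : W) (i : I) :
    e.repr (β w) i = γ (s.repr w i) := by
  have h1 : β w = (s.repr w).sum fun j c => γ c • e j := by
    conv_lhs => rw [← s.linearCombination_repr w]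
    rw [Finsupp.linearCombination_apply, Finsupp.sum, map_sum, Finsupp.sum]
    exact Finset.sum_congr rfl fun j _ => by rw [LinearMap.map_smulₛₗ, he]
  rw [h1, Finsupp.sum, map_sum, Finsupp.finsetSum_apply]
  simp only [map_smul, Module.Basis.repr_self, Finsupp.smul_single, smul_eq_mul, mul_one,
    Finsupp.single_apply, Finset.sum_ite_eq', Finsupp.mem_support_iff]
  split_ifs with h
  · rfl
  · rw [Finsupp.notMem_support_iff.1 (by simpa using h), map_zero]

/-- The coordinates of a product of vectors with constant coordinates are constant. -/
lemma repr_ιMulti_semilinear {γ : k →+* K} {s : Module.Basis I k W} {e : Module.Basis I K V}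
    {β : W →ₛₗ[γ] V} (he : ∀ i, β (s i) = e i) {p : ℕ} (v : Fin p → W) (Q : powersetCard I p) :
    (e.exteriorPower p).repr (exteriorPower.ιMulti K p (β ∘ v)) Q =
      γ ((s.exteriorPower p).repr (exteriorPower.ιMulti k p v) Q) := by
  rw [exteriorPower.basis_repr_apply, exteriorPower.basis_repr_apply,
    exteriorPower.ιMultiDual_apply_ιMulti, exteriorPower.ιMultiDual_apply_ιMulti, RingHom.map_det]
  congr 1
  ext i j
  exact repr_semilinear he _ _

/-- The basis of the exterior power of a basis, in coordinates. -/
def wedgeBasis [Finite I] (s : Module.Basis I k W) (v : Module.Basis κ k W) (p : ℕ) :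
    Module.Basis (powersetCard κ p) k (powersetCard I p → k) :=
  (v.exteriorPower p).map (s.exteriorPower p).equivFun

lemma wedgeBasis_apply [Finite I] (s : Module.Basis I k W) (v : Module.Basis κ k W) {p : ℕ}
    (P : powersetCard κ p) (Q : powersetCard I p) : wedgeBasis s v p P Q =
      (s.exteriorPower p).repr (exteriorPower.ιMulti_family k p v P) Q := by
  rw [wedgeBasis, Module.Basis.map_apply, Module.Basis.equivFun_apply, exteriorPower.basis_apply]

lemma prod_powersetCard {M : Type} [CommMonoid M] {p : ℕ} (P : powersetCard κ p) (u : κ → M) :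
    ∏ i, u (powersetCard.ofFinEmbEquiv.symm P i) = ∏ a ∈ P.1, u a := by
  classical
  refine Finset.prod_bij (fun i _ => powersetCard.ofFinEmbEquiv.symm P i)
    (fun i _ => (powersetCard.mem_range_ofFinEmbEquiv_symm_iff_mem P _).1 ⟨i, rfl⟩)
    (fun i _ j _ h => (powersetCard.ofFinEmbEquiv.symm P).injective h)
    (fun a ha => ?_) (fun _ _ => rfl)
  obtain ⟨i, rfl⟩ := (powersetCard.mem_range_ofFinEmbEquiv_symm_iff_mem P a).2 ha
  exact ⟨i, Finset.mem_univ i, rfl⟩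

/-- The values of an alternating map on a module over a ring contained in the base field. -/
lemma span_alternatingMap_eq (R : Type) [CommRing R] [Algebra R K] [Module R V] [IsScalarTower R K V]
    {T : Type} [AddCommGroup T] [Module K T] [Module R T] [IsScalarTower R K T] {p : ℕ}
    (A : V [⋀^Fin p]→ₗ[K] T) {L : Submodule R V} {u : κ → K} {x : κ → V}
    (hL : L = Submodule.span R (range fun a => u a • x a)) :
    Submodule.span R {η | ∃ ω : Fin p → V, (∀ j, ω j ∈ L) ∧ η = A ω} =
      Submodule.span R (range fun P : powersetCard κ p =>
        (∏ a ∈ P.1, u a) • A (x ∘ powersetCard.ofFinEmbEquiv.symm P)) := by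
  have hmem : ∀ a, u a • x a ∈ L := fun a => by
    rw [hL]
    exact Submodule.subset_span ⟨a, rfl⟩
  have hfam : ∀ P : powersetCard κ p, (∏ a ∈ P.1, u a) • A (x ∘ powersetCard.ofFinEmbEquiv.symm P) =
      A fun i => u (powersetCard.ofFinEmbEquiv.symm P i) •
        x (powersetCard.ofFinEmbEquiv.symm P i) := by
    intro P
    rw [AlternatingMap.map_smul_univ, prod_powersetCard]
    rfl
  apply le_antisymm
  · let y : κ → L := fun a => ⟨u a • x a, hmem a⟩
    have hy : Submodule.span R (range y) = ⊤ := by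
      apply Submodule.map_injective_of_injective L.subtype_injective
      rw [Submodule.map_span, Submodule.map_top, Submodule.range_subtype, ← range_comp]
      exact hL.symm
    -- Factoring the restriction of `A` to `L` through the exterior power over `R` reduces the claim
    -- to the fact that the ordered products of generators span the exterior power of `L`.
    let A' : L [⋀^Fin p]→ₗ[R] T :=
      { toMultilinearMap := (A.toMultilinearMap.restrictScalars R).compLinearMap fun _ => L.subtype
        map_eq_zero_of_eq' := fun v i j h hij =>
          A.map_eq_zero_of_eq _ (congrArg L.subtype h) hij }
    let Φ := exteriorPower.alternatingMapLinearEquiv A'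
    have hΦ : ∀ ω, Φ (exteriorPower.ιMulti R p ω) = A fun i => (ω i : V) :=
      fun ω => exteriorPower.alternatingMapLinearEquiv_apply_ιMulti A' ω
    refine Submodule.span_le.2 ?_
    rintro _ ⟨ω, hω, rfl⟩
    have h1 : exteriorPower.ιMulti R p (fun i => (⟨ω i, hω i⟩ : L)) ∈
        Submodule.span R (range (exteriorPower.ιMulti_family R p y)) := by
      rw [exteriorPower.ιMulti_family_span_of_span R hy]
      trivial
    have h2 := Submodule.mem_map_of_mem (f := Φ) h1
    rw [Submodule.map_span, hΦ, ← range_comp] at h2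
    have h3 : (fun P : powersetCard κ p => (∏ a ∈ P.1, u a) • A (x ∘ powersetCard.ofFinEmbEquiv.symm P)) =
        Φ ∘ exteriorPower.ιMulti_family R p y :=
      funext fun P => (hfam P).trans (hΦ (y ∘ powersetCard.ofFinEmbEquiv.symm P)).symm
    rw [h3]
    exact h2
  · refine Submodule.span_mono ?_
    rintro _ ⟨P, rfl⟩
    exact ⟨_, fun j => hmem _, hfam P⟩

end Wedge

/-! ### Lattices generated by multiples of constant vectors -/

section Frames

variable {X : Scheme.{0}} [IsIntegral X] (f : X ⟶ Spec (.of ℂ)) {V : Type} [AddCommGroup V]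
  [Module X.functionField V] {ι κ : Type} [Fintype ι] [Fintype κ]
  (b : Module.Basis ι X.functionField V)

/-- A vector with constant coordinates. -/
def constVec (w : ι → ℂ) : V := ∑ i, (constants f).hom (w i) • b i

lemma repr_constVec (w : ι → ℂ) (i : ι) : b.repr (constVec f b w) i = (constants f).hom (w i) := by
  classical
  rw [constVec, map_sum, Finsupp.finsetSum_apply]
  simp [Finsupp.single_apply]

variable {b} {f} {L : ∀ x : X, Submodule (localRing x) V} {E : X.Modules} {x : X}

lemma repr_smul_constVec (c : X.presheaf.stalk x) (w : ι → ℂ) (i : ι) :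
    b.repr (ofGerm x c • constVec f b w) i = ofGerm x (c * germC (globalConst f) x (w i)) := by
  rw [map_smul, Finsupp.smul_apply, repr_constVec, smul_eq_mul, ofGerm_mul, constants_eq f x]

lemma coef_smul_constVec (c : X.presheaf.stalk x) (w : ι → ℂ) (i : ι) :
    coef b x (ofGerm x c • constVec f b w) i = c * germC (globalConst f) x (w i) := by
  apply ofGerm_injective
  have h := repr_smul_constVec (f := f) (b := b) c w i
  rw [ofGerm_coef (h ▸ ⟨_, rfl⟩), h]

variable (f b L E) in
/-- The lattice is generated at `x` by multiples of the members of a basis of constant vectors,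
the multipliers being injective on `E`. -/
def IsConstFrame (x : X) (w : Module.Basis κ ℂ (ι → ℂ)) (c : κ → X.presheaf.stalk x) : Prop :=
  L x = Submodule.span (localRing x) (Set.range fun a => ofGerm x (c a) • constVec f b (w a)) ∧
    ∀ a, ∀ m : St E x, c a • m = 0 → m = 0

variable {w : Module.Basis κ ℂ (ι → ℂ)} {c : κ → X.presheaf.stalk x}

lemma IsConstFrame.mem (h : IsConstFrame f b L E x w c) (a : κ) :
    ofGerm x (c a) • constVec f b (w a) ∈ L x := by
  rw [h.1]
  exact Submodule.subset_span ⟨a, rfl⟩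

lemma IsConstFrame.exists_sum (h : IsConstFrame f b L E x w c) {v : V} (hv : v ∈ L x) :
    ∃ α : κ → X.presheaf.stalk x,
      v = ∑ a, ofGerm x (α a * c a) • constVec f b (w a) := by
  rw [h.1] at hv
  obtain ⟨α, hα⟩ := (Submodule.mem_span_range_iff_exists_fun _).1 hv
  choose β hβ using fun a => (α a).2
  refine ⟨β, hα.symm.trans (Finset.sum_congr rfl fun a _ => ?_)⟩
  have : ofGerm x (β a) = (α a).1 := hβ a
  rw [ofGerm_mul, mul_smul, this]
  rfl

lemma repr_sum_constVec (α : κ → X.presheaf.stalk x) (w : κ → ι → ℂ) (i : ι) :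
    b.repr (∑ a, ofGerm x (α a) • constVec f b (w a)) i =
      ofGerm x (∑ a, α a * germC (globalConst f) x (w a i)) := by
  rw [map_sum, Finsupp.finsetSum_apply]
  refine Eq.trans ?_ (map_sum (algebraMap (X.presheaf.stalk x) X.functionField) _ _).symm
  exact Finset.sum_congr rfl fun a _ => repr_smul_constVec _ _ _

/-- Independence on `E`: in the coordinates of the constant basis a vanishing combination has the
entries `c a • n a`, and multiplication by `c a` is injective on `E`. -/
lemma IsFrame.of_constFrame (hs : ∀ x, ∀ v ∈ L x, ∃ U : X.Opens, x ∈ U ∧ ∀ y ∈ U, v ∈ L y)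
    (h : ∀ x, ∃ (κ : Type) (_ : Fintype κ) (w : Module.Basis κ ℂ (ι → ℂ))
      (c : κ → X.presheaf.stalk x), IsConstFrame f b L E x w c) : IsFrame b L E where
  spread := hs
  integral x v hv i := by
    obtain ⟨κ, _, w, c, h⟩ := h x
    obtain ⟨α, rfl⟩ := h.exists_sum hv
    rw [repr_sum_constVec]
    exact ⟨_, rfl⟩
  independent x := by
    classical
    obtain ⟨κ, _, w, c, h⟩ := h x
    refine ⟨κ, inferInstance, _, h.mem, h.1.le, fun n hn => ?_⟩
    have h1 : basisEquiv (germC (globalConst f) x) (St E x) w (fun a => c a • n a) = 0 := by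
      rw [← Finset.univ_sum_single fun a => c a • n a, map_sum]
      funext i
      rw [Finset.sum_apply]
      refine Eq.trans (Finset.sum_congr rfl fun a _ => ?_) (hn i)
      rw [basisEquiv_single, coef_smul_constVec, mul_comm, mul_smul]
    have h2 := (LinearEquiv.map_eq_zero_iff _).1 h1
    exact funext fun a => h.2 a _ (congrFun h2 a)

/-- The coordinates with respect to the constant basis diagonalize the tensor product: the entry at
`a` runs through the multiples of `c a`. In this form it can be compared with `stratH_eq`. -/
lemma IsFrame.fam_at_constFrame [DecidableEq ι] (hF : IsFrame b L E)
    (h : IsConstFrame f b L E x w c) :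
    hF.fam.at' x = (piIdeal (St E x) fun a => Ideal.span {c a}).map
      (basisEquiv (germC (globalConst f) x) (St E x) w).toLinearMap := by
  classical
  rw [hF.fam_at, piIdeal_eq_span, Submodule.map_span]
  apply le_antisymm
  · refine Submodule.span_le.2 ?_
    rintro _ ⟨v, hv, m, rfl⟩
    rw [← Submodule.map_span, ← piIdeal_eq_span]
    obtain ⟨α, rfl⟩ := h.exists_sum hv
    refine ⟨fun a => (α a * c a) • m, mem_piIdeal.2 fun a => Submodule.smul_mem_smul
      (Ideal.mul_mem_left _ _ (Ideal.mem_span_singleton_self _)) trivial, ?_⟩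
    rw [LinearEquiv.coe_coe, ← Finset.univ_sum_single fun a => (α a * c a) • m, map_sum]
    funext i
    have h1 : coef b x (∑ a, ofGerm x (α a * c a) • constVec f b (w a)) i =
        ∑ a, α a * c a * germC (globalConst f) x (w a i) := by
      apply ofGerm_injective
      have h2 := repr_sum_constVec (f := f) (b := b) (fun a => α a * c a) (fun a => w a) i
      rw [ofGerm_coef (h2 ▸ ⟨_, rfl⟩), h2]
    rw [h1, Finset.sum_apply, Finset.sum_smul]
    refine Finset.sum_congr rfl fun a _ => ?_
    rw [basisEquiv_single]
    change germC (globalConst f) x (w a i) • (α a * c a) • m = _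
    rw [smul_smul, mul_comm]
  · refine Submodule.span_mono ?_
    rintro _ ⟨_, ⟨a, r, hr, m, rfl⟩, rfl⟩
    obtain ⟨s, rfl⟩ := Ideal.mem_span_singleton'.1 hr
    refine ⟨_, h.mem a, s • m, ?_⟩
    rw [LinearEquiv.coe_coe, basisEquiv_single]
    funext i
    rw [coef_smul_constVec, smul_smul, smul_smul]
    congr 1
    ring

end Frames

end LogBott

namespace LogBott

/-! ### The sheaves of logarithmic forms as lattices -/

section FormsSpread

variable {X : Scheme.{0}} [IsIntegral X] [IsLocallyNoetherian X] (f : X ⟶ Spec (.of ℂ))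
  (D : Finset (IrreducibleCloseds X)) (p : ℕ)

lemma logFormsAt_spread (x : X) : ∀ η ∈ logFormsAt f D p x, ∃ U : X.Opens, x ∈ U ∧
    ∀ y ∈ U, η ∈ logFormsAt f D p y := by
  refine fun η hη => spread_of_span _ ?_ hη
  rintro _ ⟨ω, hω, rfl⟩
  choose U hU h using fun j => logOneFormsAt_spread f D x (ω j) (hω j)
  refine ⟨Finset.univ.inf U, ?_, fun y hy => Submodule.subset_span ⟨ω, fun j =>
    h j y ((Finset.inf_le (f := U) (Finset.mem_univ j)) hy), rfl⟩⟩
  rw [← SetLike.mem_coe, Opens.coe_finset_inf]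
  simpa using hU

lemma logFormsTwistAt_spread (x : X) : ∀ η ∈ logFormsTwistAt f D p x, ∃ U : X.Opens, x ∈ U ∧
    ∀ y ∈ U, η ∈ logFormsTwistAt f D p y := by
  classical
  refine fun η hη => spread_of_span _ ?_ hη
  rintro _ ⟨t, ht, ω, hω, rfl⟩
  obtain ⟨W, hxW, hW⟩ := logFormsAt_spread f D p x ω hω
  choose U hU g hg h using fun Z : {Z // Z ∈ D} => (ht Z.1 Z.2).spread
  have hle : ∀ Z, Finset.univ.inf U ≤ U Z := fun Z => Finset.inf_le (Finset.mem_univ Z)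
  have hxU : x ∈ Finset.univ.inf U := by
    rw [← SetLike.mem_coe, Opens.coe_finset_inf]
    simpa using hU
  refine ⟨W ⊓ Finset.univ.inf U, ⟨hxW, hxU⟩, fun y hy => Submodule.subset_span
    ⟨fun Z => if hZ : Z ∈ D then X.presheaf.germ (U ⟨Z, hZ⟩) y (hle _ hy.2) (g ⟨Z, hZ⟩) else 1,
      fun Z hZ => ?_, ω, hW y hy.1, ?_⟩⟩
  · have h1 := h ⟨Z, hZ⟩ y (hle _ hy.2)
    beta_reduce
    rwa [dif_pos hZ]
  · congr 1
    refine (map_prod (algebraMap (X.presheaf.stalk x) X.functionField) _ _).trans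
      (Eq.trans (Finset.prod_congr rfl fun Z hZ => ?_)
      (map_prod (algebraMap (X.presheaf.stalk y) X.functionField) _ _).symm)
    rw [dif_pos hZ, ← hg ⟨Z, hZ⟩]
    exact ofGerm_germ (g ⟨Z, hZ⟩) x y _ _

end FormsSpread

/-! ### Monomial generators of the logarithmic p-forms. -/

section FormsFrame

variable {X : Scheme.{0}} [IsIntegral X] (f : X ⟶ Spec (.of ℂ)) (D : Finset (IrreducibleCloseds X))
  (p : ℕ)

variable {f} in
/-- The products of the members of a basis of the rational one-forms. -/
def formsBasis {I : Type} [LinearOrder I]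
    (e : Module.Basis I X.functionField (RationalOneForms f)) :
    Module.Basis (Set.powersetCard I p) X.functionField (RationalForms f p) :=
  e.exteriorPower p

/-- The map `β` sends a complex basis to a basis of the rational one-forms, so products of its
values have constant coordinates, and the multipliers `u` factor out of the products. The space `W`
is left arbitrary so that the statement serves both for `X` and for the strata. -/
lemma logFormsAt_eq_span {I κ W : Type} [Fintype I] [LinearOrder I] [LinearOrder κ] [AddCommGroup W]
    [Module ℂ W] {s : Module.Basis I ℂ W} {e : Module.Basis I X.functionField (RationalOneForms f)}
    {β : W →ₛₗ[(constants f).hom] RationalOneForms f} (he : ∀ i, β (s i) = e i) {x : X}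
    (v : Module.Basis κ ℂ W) {u : κ → X.presheaf.stalk x}
    (hL : logOneFormsAt f D x =
      Submodule.span (localRing x) (Set.range fun k => ofGerm x (u k) • β (v k))) :
    logFormsAt f D p x = Submodule.span (localRing x) (Set.range fun P : Set.powersetCard κ p =>
      ofGerm x (∏ k ∈ P.1, u k) •
        constVec f (formsBasis p e) (wedgeBasis s v p P)) := by
  refine (span_alternatingMap_eq (localRing x)
    (exteriorPower.ιMulti X.functionField p (M := RationalOneForms f)) hL).trans (congrArg (Submodule.span _) (congrArg Set.range
    (funext fun P => ?_)))
  have h1 : ∏ k ∈ P.1, ofGerm x (u k) = ofGerm x (∏ k ∈ P.1, u k) :=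
    (map_prod (algebraMap (X.presheaf.stalk x) X.functionField) _ _).symm
  have h2 : exteriorPower.ιMulti_family X.functionField p (fun k => β (v k)) P =
      constVec f (formsBasis p e) (wedgeBasis s v p P) := by
    refine (formsBasis p e).ext_elem fun Q => ?_
    rw [repr_constVec, wedgeBasis_apply]
    exact repr_ιMulti_semilinear he _ Q
  rw [h1]
  exact congrArg (ofGerm x (∏ k ∈ P.1, u k) • ·) h2

lemma IsLocalEquation.exists_mul {Z : IrreducibleCloseds X} {x : X} {s t : X.presheaf.stalk x}
    (hs : IsLocalEquation Z x s) (ht : IsLocalEquation Z x t) : ∃ a, s = a * t := by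
  have h1 : s ∈ Ideal.span {t} := by
    rw [← ht.ofIdealSheaf_at, hs.ofIdealSheaf_at]
    exact Ideal.mem_span_singleton_self s
  obtain ⟨a, ha⟩ := Ideal.mem_span_singleton'.1 h1
  exact ⟨a, ha.symm⟩

/-- Any other choice of local equations consists of multiples of the chosen `t`, so one choice
suffices. -/
lemma logFormsTwistAt_eq_span {κ : Type} {x : X} {t : IrreducibleCloseds X → X.presheaf.stalk x}
    (ht : ∀ Z ∈ D, IsLocalEquation Z x (t Z)) {u : κ → X.presheaf.stalk x} {n : κ → RationalForms f p}
    (h : logFormsAt f D p x = Submodule.span (localRing x) (Set.range fun a => ofGerm x (u a) • n a)) :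
    logFormsTwistAt f D p x = Submodule.span (localRing x)
      (Set.range fun a => ofGerm x ((∏ Z ∈ D, t Z) * u a) • n a) := by
  apply le_antisymm
  · refine Submodule.span_le.2 ?_
    rintro _ ⟨s, hs, ω, hω, rfl⟩
    have h1 : ∃ a, ∏ Z ∈ D, s Z = a * ∏ Z ∈ D, t Z := by
      choose! a ha using fun Z hZ => (hs Z hZ).exists_mul (ht Z hZ)
      exact ⟨∏ Z ∈ D, a Z, by rw [← Finset.prod_mul_distrib]; exact Finset.prod_congr rfl ha⟩
    obtain ⟨a, ha⟩ := h1
    rw [h] at hω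
    rw [ha]
    change _ ∈ Submodule.span _ _
    induction hω using Submodule.span_induction with
    | mem ω hω =>
      obtain ⟨k, rfl⟩ := hω
      have h2 : ofGerm x ((∏ Z ∈ D, t Z) * u k) • n k ∈ Submodule.span (localRing x)
        (Set.range fun a => ofGerm x ((∏ Z ∈ D, t Z) * u a) • n a) := Submodule.subset_span ⟨k, rfl⟩
      have h3 := Submodule.smul_mem _ (⟨ofGerm x a, a, rfl⟩ : localRing x) h2
      convert! h3 using 1
      change ofGerm x _ • ofGerm x _ • n k = ofGerm x a • ofGerm x _ • n k
      rw [smul_smul, smul_smul, ← ofGerm_mul, ← ofGerm_mul, mul_assoc]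
    | zero => rw [smul_zero]; exact zero_mem _
    | add v w _ _ hv hw => rw [smul_add]; exact add_mem hv hw
    | smul r v _ hv =>
      have h2 : ofGerm x (a * ∏ Z ∈ D, t Z) • r • v = r • ofGerm x (a * ∏ Z ∈ D, t Z) • v :=
        smul_comm (ofGerm x (a * ∏ Z ∈ D, t Z)) r.1 v
      rw [h2]
      exact Submodule.smul_mem _ r hv
  · refine Submodule.span_le.2 ?_
    rintro _ ⟨k, rfl⟩
    refine Submodule.subset_span ⟨t, ht, ofGerm x (u k) • n k, ?_, ?_⟩
    · rw [h]
      exact Submodule.subset_span ⟨k, rfl⟩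
    · change ofGerm x _ • n k = _
      rw [ofGerm_mul, mul_smul]

end FormsFrame

/-! ### Products of global forms with prescribed vanishing residues. -/

section StratForms

variable {X : Scheme.{0}} [IsIntegral X] {f : X ⟶ Spec (.of ℂ)} {D : Finset (IrreducibleCloseds X)}
  {r : ℕ} (F : LogData f D r)

/-- The space of the products of global logarithmic forms without residues along given
components, in coordinates. -/
def LogData.constForms (p : ℕ) (B : Finset {Z : IrreducibleCloseds X // Z ∈ D}) :
    Submodule ℂ (Set.powersetCard (Fin r) p → ℂ) :=
  (Submodule.span ℂ {η | ∃ w : Fin p → Fin r → ℂ,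
    (∀ i, w i ∈ (⨅ j ∈ B, LinearMap.ker (F.res j))) ∧ η = exteriorPower.ιMulti ℂ p w}).map
    ((Pi.basisFun ℂ (Fin r)).exteriorPower p).equivFun.toLinearMap

lemma LogData.constForms_anti (p : ℕ) : Antitone (F.constForms p) := by
  intro B B' h
  refine Submodule.map_mono (Submodule.span_mono ?_)
  rintro _ ⟨w, hw, rfl⟩
  exact ⟨w, fun i => (biInf_mono h : (⨅ j ∈ B', LinearMap.ker (F.res j)) ≤ _) (hw i), rfl⟩

variable {F} {x : X} (C : F.Chart x)

/-- The components attached to a set of basis vectors. -/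
def LogData.Chart.labels (P : Finset (Fin r)) : Finset {Z : IrreducibleCloseds X // Z ∈ D} :=
  open Classical in Finset.univ.filter fun j => ∃ h : x ∈ j.1, C.σ ⟨j, h⟩ ∈ P

lemma LogData.Chart.mem_labels {P : Finset (Fin r)} {j : {Z : IrreducibleCloseds X // Z ∈ D}} :
    j ∈ C.labels P ↔ ∃ h : x ∈ j.1, C.σ ⟨j, h⟩ ∈ P := by
  classical
  simp [labels]

lemma LogData.Chart.iInf_ker_res {B : Finset {Z : IrreducibleCloseds X // Z ∈ D}} (hB : ∀ j ∈ B, x ∈ j.1) :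
    (⨅ j ∈ B, LinearMap.ker (F.res j)) =
      Submodule.span ℂ (C.v '' {k | ∀ j, C.σ j = k → j.1 ∉ B}) := by
  classical
  apply le_antisymm
  · intro w hw
    simp only [Submodule.mem_iInf] at hw
    rw [← C.v.sum_repr w]
    refine Submodule.sum_mem _ fun k _ => ?_
    by_cases hk : ∃ j, C.σ j = k ∧ j.1 ∈ B
    · obtain ⟨j, rfl, hj⟩ := hk
      have h1 : F.res j.1 w = 0 := hw j.1 hj
      rw [← C.v.sum_repr w, map_sum] at h1
      simp only [map_smul, C.res_v, smul_eq_mul, mul_ite, mul_one, mul_zero, Finset.sum_ite_eq,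
        Finset.mem_univ, if_true] at h1
      rw [h1, zero_smul]
      exact zero_mem _
    · exact Submodule.smul_mem _ _ (Submodule.subset_span
        ⟨k, fun j hj hB => hk ⟨j, hj, hB⟩, rfl⟩)
  · refine Submodule.span_le.2 ?_
    rintro _ ⟨k, hk, rfl⟩
    simp only [SetLike.mem_coe, Submodule.mem_iInf]
    intro j hj
    have h1 := C.res_v ⟨j, hB j hj⟩ k
    rwa [if_neg fun h => hk _ h hj] at h1

/-- The forms without residues along `B` are spanned by the basis vectors not attached to `B`, and a
product of basis vectors remains when none of its factors is attached to `B`. The multipliers `u`,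
equal to 0 or 1, bring this into the form treated by `span_alternatingMap_eq`. -/
lemma LogData.Chart.constForms_eq (p : ℕ) {B : Finset {Z : IrreducibleCloseds X // Z ∈ D}}
    (hB : ∀ j ∈ B, x ∈ j.1) : F.constForms p B = Submodule.span ℂ
      (wedgeBasis (Pi.basisFun ℂ (Fin r)) C.v p '' {P | Disjoint (C.labels P.1) B}) := by
  classical
  let u : Fin r → ℂ := fun k => if ∃ j, C.σ j = k ∧ j.1 ∈ B then 0 else 1
  have hL : (⨅ j ∈ B, LinearMap.ker (F.res j)) =
      Submodule.span ℂ (Set.range fun k => u k • C.v k) := by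
    rw [C.iInf_ker_res hB]
    apply le_antisymm
    · refine Submodule.span_mono ?_
      rintro _ ⟨k, hk, rfl⟩
      refine ⟨k, ?_⟩
      have : u k = 1 := if_neg fun ⟨j, hj, hB⟩ => hk j hj hB
      beta_reduce
      rw [this, one_smul]
    · refine Submodule.span_le.2 ?_
      rintro _ ⟨k, rfl⟩
      change u k • C.v k ∈ _
      by_cases hk : ∃ j, C.σ j = k ∧ j.1 ∈ B
      · have : u k = 0 := if_pos hk
        rw [this, zero_smul]
        exact zero_mem _
      · exact Submodule.smul_mem _ _ (Submodule.subset_span ⟨k, fun j hj hB => hk ⟨j, hj, hB⟩, rfl⟩)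
  have hu : ∀ P : Set.powersetCard (Fin r) p, ∏ k ∈ P.1, u k =
      if Disjoint (C.labels P.1) B then 1 else 0 := by
    intro P
    split_ifs with h
    · refine Finset.prod_eq_one fun k hk => if_neg ?_
      rintro ⟨j, rfl, hj⟩
      exact Finset.disjoint_left.1 h (C.mem_labels.2 ⟨j.2, hk⟩) hj
    · obtain ⟨j, hj, hjB⟩ := Finset.not_disjoint_iff.1 h
      obtain ⟨hx, hj⟩ := C.mem_labels.1 hj
      exact Finset.prod_eq_zero hj (if_pos ⟨_, rfl, hjB⟩)
  rw [constForms, span_alternatingMap_eq ℂ (exteriorPower.ιMulti ℂ p) hL, Submodule.map_span]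
  have hw : ∀ P, ((Pi.basisFun ℂ (Fin r)).exteriorPower p).equivFun
      (exteriorPower.ιMulti ℂ p (C.v ∘ Set.powersetCard.ofFinEmbEquiv.symm P)) =
        wedgeBasis (Pi.basisFun ℂ (Fin r)) C.v p P := by
    intro P
    rw [wedgeBasis, Module.Basis.map_apply, exteriorPower.basis_apply]
    rfl
  apply le_antisymm
  · refine Submodule.span_le.2 ?_
    rintro _ ⟨_, ⟨P, rfl⟩, rfl⟩
    rw [LinearEquiv.coe_coe, map_smul, hu, hw]
    split_ifs with h
    · rw [one_smul]
      exact Submodule.subset_span ⟨P, h, rfl⟩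
    · rw [zero_smul]
      exact zero_mem _
  · refine Submodule.span_mono ?_
    rintro _ ⟨P, hP, rfl⟩
    refine ⟨_, ⟨P, rfl⟩, ?_⟩
    rw [LinearEquiv.coe_coe, map_smul, hu, hw, if_pos (show Disjoint (C.labels P.1) B from hP), one_smul]

/-- The ideals of the components of the divisor. -/
abbrev divisorIdeals (D : Finset (IrreducibleCloseds X)) (j : {Z : IrreducibleCloseds X // Z ∈ D}) :
    IdFam X := IdFam.ofIdealSheaf (idealOf j.1)

open Classical in
lemma LogData.Chart.isAdapted (p : ℕ) : IsAdapted (fun j => (divisorIdeals D j).at' x)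
    (F.constForms p) (wedgeBasis (Pi.basisFun ℂ (Fin r)) C.v p) (fun P => C.labels P.1)
    (Finset.univ.filter fun j => x ∈ j.1) where
  anti := F.constForms_anti p
  eq_top j hj := (stalkIdeal_eq_top_iff j.1 x).2 (by simpa using hj)
  subset P j hj := by simpa using (C.mem_labels.1 hj).1
  eq_span B hB := C.constForms_eq p fun j hj => by simpa using hB hj

-- Grouping the components outside `S` by the basis vector attached to them turns the double product
-- into a single product over the labels.
open Classical in
lemma LogData.Chart.span_prod_coordFactor (S : Finset {Z : IrreducibleCloseds X // Z ∈ D})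
    (P : Finset (Fin r)) : Ideal.span {∏ k ∈ P, coordFactor C.t C.σ S k} =
      ∏ j ∈ C.labels P \ S, (divisorIdeals D j).at' x := by
  have h1 : ∏ k ∈ P, coordFactor C.t C.σ S k = ∏ j ∈ C.labels P \ S, C.t j := by
    have h2 : ∀ k ∈ P, coordFactor C.t C.σ S k =
        ∏ j ∈ (Finset.univ.filter fun j : {j : {Z : IrreducibleCloseds X // Z ∈ D} // x ∈ j.1} =>
          j.1 ∉ S ∧ C.σ j ∈ P) with C.σ j = k, C.t j.1 := by
      intro k hk
      refine Finset.prod_congr ?_ fun _ _ => rfl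
      ext j
      simp only [Finset.mem_filter, Finset.mem_univ, true_and]
      constructor
      · rintro ⟨h, rfl⟩
        exact ⟨⟨h, hk⟩, rfl⟩
      · rintro ⟨⟨h, -⟩, h'⟩
        exact ⟨h, h'⟩
    rw [Finset.prod_congr rfl h2, Finset.prod_fiberwise_of_maps_to (fun j hj => (Finset.mem_filter.1 hj).2.2)]
    refine Finset.prod_bij (fun j _ => j.1) (fun j hj => ?_) (fun i _ j _ h => Subtype.ext h)
      (fun j hj => ?_) (fun _ _ => rfl)
    · have := (Finset.mem_filter.1 hj).2
      exact Finset.mem_sdiff.2 ⟨C.mem_labels.2 ⟨j.2, this.2⟩, this.1⟩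
    · obtain ⟨hj, hS⟩ := Finset.mem_sdiff.1 hj
      obtain ⟨hx, hj⟩ := C.mem_labels.1 hj
      exact ⟨⟨j, hx⟩, by simp [hj, hS], rfl⟩
  rw [h1, ← Ideal.prod_span_singleton]
  exact Finset.prod_congr rfl fun j _ => (C.eqn j).ofIdealSheaf_at.symm

end StratForms

end LogBott

namespace LogBott

/-! ### The tensor products with the sheaves of logarithmic forms -/

lemma smul_top_eq_piIdeal {O N κ : Type} [CommRing O] [AddCommGroup N] [Module O N] [Fintype κ]
    (I : Ideal O) : I • (⊤ : Submodule O (κ → N)) = piIdeal N fun _ => I := by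
  have h : (⊤ : Submodule O (κ → N)) = piIdeal N fun _ => ⊤ := by
    refine (eq_top_iff.2 fun n _ => mem_piIdeal.2 fun a => ?_).symm
    rw [Submodule.top_smul]
    trivial
  rw [h, smul_piIdeal]
  simp only [Ideal.mul_top]

lemma map_basisEquiv_const {k O N ι κ : Type} [Field k] [CommRing O] [AddCommGroup N] [Module O N]
    (γ : k →+* O) [Fintype ι] [Fintype κ] [DecidableEq ι] (w : Module.Basis κ k (ι → k)) (I : Ideal O) :
    (piIdeal N fun _ : κ => I).map (basisEquiv γ N w).toLinearMap = piIdeal N fun _ => I := by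
  rw [← smul_top_eq_piIdeal, Submodule.map_smul'', Submodule.map_top, LinearEquiv.range,
    smul_top_eq_piIdeal]

/-- Meant for the top degree, where the exterior power has a single basis vector and only the ideal
multiplying it remains. -/
lemma acyc_unique_iff {X : Scheme.{0}} {E : X.Modules} {ι : Type} [Unique ι] {H : Fam E ι} {I : IdFam X}
    (h : ∀ x, H.at' x = piIdeal (St E x) fun _ => I.at' x) :
    Acyc H ⊥ ↔ Acyc (I • Fam.full E Unit) ⊥ := by
  classical
  let φ : FibreMap E Unit E ι := FibreMap.single E default
  have hs : ∀ (x : X) (m : Unit → St E x) (i : ι), φ.φ x m i = m () := by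
    intro x m i
    rw [Unique.eq_default i]
    exact Pi.single_eq_same (M := fun _ : ι => St E x) default (m ())
  have hI : ∀ x, (I • Fam.full E Unit).at' x = piIdeal (St E x) fun _ => I.at' x :=
    fun x => smul_top_eq_piIdeal (I.at' x)
  refine (Acyc.iff_of_fibreMap φ (fun x m hm => ?_) (fun x m hm => ?_)
    (fun x m hm h0 => ?_) (fun x m hm => ?_)).symm
  · rw [hI, mem_piIdeal] at hm
    rw [h, mem_piIdeal]
    intro i
    rw [hs]
    exact hm ()
  · have hm0 : m = 0 := hm
    rw [hm0, map_zero]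
    exact zero_mem _
  · have h1 : φ.φ x m = 0 := h0
    have h2 := congrFun h1 default
    rw [hs] at h2
    have h3 : m = 0 := funext fun _ => h2
    rw [h3]
    exact zero_mem _
  · rw [h, mem_piIdeal] at hm
    refine ⟨fun _ => m default, ?_, ?_⟩
    · rw [hI, mem_piIdeal]
      exact fun _ => hm default
    · have : m - φ.φ x (fun _ => m default) = 0 := by
        funext i
        rw [Pi.sub_apply, hs, Unique.eq_default i]
        exact sub_self _
      rw [this]
      exact zero_mem _

lemma regularOn_smul_eq_zero {X : Scheme.{0}} {E : X.Modules} {D : Finset (IrreducibleCloseds X)} {x : X}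
    (hreg : RegularOn (fun j => (divisorIdeals D j).at' x) (St E x))
    {j : {Z : IrreducibleCloseds X // Z ∈ D}} {t : X.presheaf.stalk x} (ht : IsLocalEquation j.1 x t)
    (m : St E x) (hm : t • m = 0) : m = 0 := by
  obtain ⟨s, hs, h, -⟩ := hreg
  have h1 : s j ∈ Ideal.span {t} := by
    rw [← ht.ofIdealSheaf_at]
    exact (hs j).ge (Ideal.mem_span_singleton_self (s j))
  obtain ⟨a, ha⟩ := Ideal.mem_span_singleton'.1 h1
  refine h j m ?_
  rw [← ha, mul_smul, hm, smul_zero]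

lemma prod_smul_eq_zero {O N κ : Type} [CommRing O] [AddCommGroup N] [Module O N] (s : Finset κ)
    (c : κ → O) (h : ∀ a ∈ s, ∀ m : N, c a • m = 0 → m = 0) (m : N) (hm : (∏ a ∈ s, c a) • m = 0) :
    m = 0 := by
  classical
  induction s using Finset.induction_on generalizing m with
  | empty => rwa [Finset.prod_empty, one_smul] at hm
  | insert a s ha ih =>
    rw [Finset.prod_insert ha, mul_smul] at hm
    exact ih (fun b hb => h b (Finset.mem_insert_of_mem hb)) m (h a (Finset.mem_insert_self _ _) _ hm)

/-! ### Frames of the logarithmic forms, with multipliers injective on the stalks of `E`. -/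

section Frames

variable {X : Scheme.{0}} [IsIntegral X] {f : X ⟶ Spec (.of ℂ)} {D : Finset (IrreducibleCloseds X)}
  {r : ℕ} {F : LogData f D r} {x : X} (C : F.Chart x) {E : X.Modules} (p : ℕ)
  (S : Finset {Z : IrreducibleCloseds X // Z ∈ D})

lemma LogData.Chart.logFormsAt_eq : logFormsAt f (S.map (Function.Embedding.subtype _)) p x =
    Submodule.span (localRing x) (Set.range fun P : Set.powersetCard (Fin r) p =>
      ofGerm x (∏ k ∈ P.1, coordFactor C.t C.σ S k) •
        constVec f (formsBasis p F.e) (wedgeBasis (Pi.basisFun ℂ (Fin r)) C.v p P)) :=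
  logFormsAt_eq_span f _ p (β := F.form)
    (fun i => by rw [Pi.basisFun_apply, F.form_single]) C.v (C.span_eq S)

lemma LogData.Chart.coordFactor_smul_eq_zero
    (hreg : RegularOn (fun j => (divisorIdeals D j).at' x) (St E x)) (k : Fin r) (m : St E x)
    (hm : coordFactor C.t C.σ S k • m = 0) : m = 0 :=
  prod_smul_eq_zero _ _ (fun j _ => regularOn_smul_eq_zero hreg (C.eqn j.1)) m hm

lemma LogData.Chart.isConstFrame
    (hreg : RegularOn (fun j => (divisorIdeals D j).at' x) (St E x)) : IsConstFrame f (formsBasis p F.e)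
    (logFormsAt f (S.map (Function.Embedding.subtype _)) p) E x
    (wedgeBasis (Pi.basisFun ℂ (Fin r)) C.v p) (fun P => ∏ k ∈ P.1, coordFactor C.t C.σ S k) :=
  ⟨C.logFormsAt_eq p S, fun _ => prod_smul_eq_zero _ _ fun k _ => C.coordFactor_smul_eq_zero S hreg k⟩

lemma LogData.Chart.isConstFrame_twist
    (hreg : RegularOn (fun j => (divisorIdeals D j).at' x) (St E x)) : IsConstFrame f (formsBasis p F.e)
    (logFormsTwistAt f (S.map (Function.Embedding.subtype _)) p) E x
    (wedgeBasis (Pi.basisFun ℂ (Fin r)) C.v p)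
    (fun P => (∏ j ∈ S, C.t j) * ∏ k ∈ P.1, coordFactor C.t C.σ S k) := by
  classical
  refine ⟨?_, fun P m hm => ?_⟩
  · let t : IrreducibleCloseds X → X.presheaf.stalk x := fun Z =>
      if h : Z ∈ D then C.t ⟨Z, h⟩ else 1
    have ht : ∀ j : {Z : IrreducibleCloseds X // Z ∈ D}, t j.1 = C.t j := fun j => dif_pos j.2
    have hprod : ∏ Z ∈ S.map (Function.Embedding.subtype _), t Z = ∏ j ∈ S, C.t j := by
      rw [Finset.prod_map]
      exact Finset.prod_congr rfl fun j _ => ht j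
    have h1 := logFormsTwistAt_eq_span f (S.map (Function.Embedding.subtype _)) p (t := t)
      (fun Z hZ => by
        obtain ⟨j, -, rfl⟩ := Finset.mem_map.1 hZ
        exact (ht j).symm ▸ C.eqn j) (C.logFormsAt_eq p S)
    rwa [hprod] at h1
  · rw [mul_smul] at hm
    exact prod_smul_eq_zero _ _ (fun k _ => C.coordFactor_smul_eq_zero S hreg k) m
      (prod_smul_eq_zero _ _ (fun j _ => regularOn_smul_eq_zero hreg (C.eqn j)) _ hm)

end Frames

/-! ### The tensor products identified with members of the configuration. -/

section Global

variable {X : Scheme.{0}} [IsIntegral X] [IsLocallyNoetherian X] {f : X ⟶ Spec (.of ℂ)}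
  {D : Finset (IrreducibleCloseds X)} {r : ℕ} (F : LogData f D r) {E : X.Modules}

lemma LogData.isFrame_twist
    (hreg : ∀ x, RegularOn (fun j => (divisorIdeals D j).at' x) (St E x)) (p : ℕ) (S : Finset {Z : IrreducibleCloseds X // Z ∈ D}) :
    IsFrame (formsBasis p F.e) (logFormsTwistAt f (S.map (Function.Embedding.subtype _)) p) E :=
  IsFrame.of_constFrame (f := f) (logFormsTwistAt_spread f _ p) fun x => by
    obtain ⟨C⟩ := F.exists_chart x
    exact ⟨_, inferInstance, _, _, C.isConstFrame_twist p S (hreg x)⟩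

-- In a chart both sides are diagonal with the same ideals: the twist contributes the product of the
-- ideals of `S`, and the absence of poles outside `S` contributes those of the labels of P outside
-- `S`.
open Classical in
lemma LogData.acyclic_twist_iff
    (hreg : ∀ x, RegularOn (fun j => (divisorIdeals D j).at' x) (St E x)) (p : ℕ) (S : Finset {Z : IrreducibleCloseds X // Z ∈ D}) :
    (∀ k : ℕ, 1 ≤ k → Subsingleton (cohomology
      (tensor (logFormsTwist f (S.map (Function.Embedding.subtype _)) p) E) k)) ↔
    Acyc (stratFam (globalConst f) (divisorIdeals D) (F.constForms p) E (Finset.univ \ S).toList S ∅) ⊥ := by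
  refine (F.isFrame_twist hreg p S).acyclic_iff.trans ?_
  have h : (F.isFrame_twist hreg p S).fam = stratFam (globalConst f) (divisorIdeals D)
      (F.constForms p) E (Finset.univ \ S).toList S ∅ := by
    refine Fam.ext (funext fun x => ?_)
    obtain ⟨C⟩ := F.exists_chart x
    rw [stratFam_at, stratH_eq (germC (globalConst f) x) (C.isAdapted p) _ _ _ (Finset.empty_subset _)
      (Finset.nodup_toList _) (fun j hj => (Finset.mem_sdiff.1 (Finset.mem_toList.1 hj)).2),
      IsFrame.fam_at_constFrame _ (C.isConstFrame_twist p S (hreg x))]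
    congr 2
    funext P
    rw [stratC, if_pos (Finset.disjoint_empty_right _), ← Ideal.span_singleton_mul_span_singleton,
      ← Ideal.prod_span_singleton, C.span_prod_coordFactor S P.1]
    congr 1
    · exact Finset.prod_congr rfl fun j _ => (C.eqn j).ofIdealSheaf_at.symm
    · rw [← List.prod_toFinset _ ((Finset.nodup_toList _).filter _)]
      refine Finset.prod_congr ?_ fun _ _ => rfl
      ext j
      simp [and_comm]
  rw [h]

lemma LogData.isFrame
    (hreg : ∀ x, RegularOn (fun j => (divisorIdeals D j).at' x) (St E x)) (p : ℕ) (S : Finset {Z : IrreducibleCloseds X // Z ∈ D}) :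
    IsFrame (formsBasis p F.e) (logFormsAt f (S.map (Function.Embedding.subtype _)) p) E :=
  IsFrame.of_constFrame (f := f) (logFormsAt_spread f _ p) fun x => by
    obtain ⟨C⟩ := F.exists_chart x
    exact ⟨_, inferInstance, _, _, C.isConstFrame p S (hreg x)⟩

/-- In top degree the only product is that of all basis vectors, and the regular forms are its
multiples by the equations of all components: ω_X = 𝒪_X(-D). -/
lemma LogData.acyclic_canonicalSheaf_iff {r : ℕ} (F : LogData f D r)
    (hreg : ∀ x, RegularOn (fun j => (divisorIdeals D j).at' x) (St E x)) : (∀ k : ℕ, 1 ≤ k → Subsingleton (cohomology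
      (tensor (canonicalSheaf f) E) k)) ↔
    Acyc (IdFam.prod (divisorIdeals D) Finset.univ • Fam.full E Unit) ⊥ := by
  classical
  have hr : Module.finrank X.functionField (RationalOneForms f) = r := by
    rw [Module.finrank_eq_card_basis F.e, Fintype.card_fin]
  have huniv : ∀ P : Set.powersetCard (Fin r) (Module.finrank X.functionField (RationalOneForms f)),
      P.1 = Finset.univ := fun P => by
    have h1 : P.1.card = _ := P.2
    rw [← Finset.card_eq_iff_eq_univ, h1, hr, Fintype.card_fin]
  let : Unique (Set.powersetCard (Fin r) (Module.finrank X.functionField (RationalOneForms f))) :=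
    { default := ⟨Finset.univ, (Finset.card_univ.trans (Fintype.card_fin r)).trans hr.symm⟩
      uniq := fun P => Subtype.ext (huniv P) }
  refine (F.isFrame hreg _ ∅).acyclic_iff.trans (acyc_unique_iff fun x => ?_)
  obtain ⟨C⟩ := F.exists_chart x
  rw [IsFrame.fam_at_constFrame _ (C.isConstFrame _ ∅ (hreg x))]
  have h1 : ∀ P : Set.powersetCard (Fin r) (Module.finrank X.functionField (RationalOneForms f)),
      Ideal.span {∏ k ∈ P.1, coordFactor C.t C.σ ∅ k} =
        (IdFam.prod (divisorIdeals D) Finset.univ).at' x := by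
    intro P
    rw [C.span_prod_coordFactor, IdFam.prod_at, Finset.sdiff_empty]
    refine Finset.prod_subset (Finset.subset_univ _) fun j _ hj => ?_
    refine ((stalkIdeal_eq_top_iff j.1 x).2 fun hx => hj (C.mem_labels.2 ⟨hx, ?_⟩)).trans
      Ideal.one_eq_top.symm
    rw [huniv P]
    exact Finset.mem_univ _
  simp only [h1]
  exact map_basisEquiv_const _ _ _

end Global

end LogBott

namespace LogBott

/-! ### Restriction of differential forms to a subvariety -/

/-- The restriction of the forms with coefficients in a ring to a quotient of the ring. -/
lemma exists_restrict_rational_forms {k R K B : Type} [Field k] [CommRing R] [IsDomain R] [Field K]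
    [Algebra k R] [Algebra R K] [Algebra k K] [IsScalarTower k R K] [IsFractionRing R K]
    [Algebra.FormallySmooth k R] [CommRing B] [Algebra R B] [Algebra k B] [IsScalarTower k R B]
    (h : Function.Surjective (algebraMap R B)) {L : AddSubgroup (Ω[K⁄k])}
    (hL : L = AddSubgroup.closure {η | ∃ r g : R, η = algebraMap R K r •
      KaehlerDifferential.D k K (algebraMap R K g)}) {I : Ideal R} (hI : RingHom.ker (algebraMap R B) = I) :
    ∃ ρ : Ω[K⁄k] → Ω[B⁄k], (∀ ω ∈ L, ∀ ω' ∈ L, ρ (ω + ω') = ρ ω + ρ ω') ∧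
      (∀ a : R, ∀ ω ∈ L, ρ (algebraMap R K a • ω) = algebraMap R B a • ρ ω) ∧
      (∀ a : R, ρ (KaehlerDifferential.D k K (algebraMap R K a)) =
        KaehlerDifferential.D k B (algebraMap R B a)) ∧
      ∀ ω ∈ L, ρ ω = 0 → ∃ t ∈ I, ω - KaehlerDifferential.D k K (algebraMap R K t) ∈
        AddSubgroup.closure {η | ∃ s ∈ I, ∃ ω' ∈ L, η = algebraMap R K s • ω'} := by
  classical
  subst hI
  obtain ⟨ρ, h1, h2⟩ := exists_restrict_forms (k := k) (K := K) h
  have hmem : ∀ ω, ω ∈ L ↔ ω ∈ integralForms (R := R) k K := by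
    intro ω
    rw [hL]
    constructor
    · intro hω
      induction hω using AddSubgroup.closure_induction with
      | mem ω hω =>
        obtain ⟨r, g, rfl⟩ := hω
        rw [algebraMap_smul]
        exact Submodule.smul_mem _ r (D_mem_integralForms g)
      | zero => exact zero_mem _
      | add a b _ _ ha hb => exact add_mem ha hb
      | neg a _ ha => exact neg_mem ha
    · intro hω
      refine Submodule.span_induction (p := fun ω _ => ω ∈ AddSubgroup.closure {η | ∃ r g : R,
        η = algebraMap R K r • KaehlerDifferential.D k K (algebraMap R K g)}) ?_ (zero_mem _)
        (fun a b _ _ ha hb => add_mem ha hb) ?_ hω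
      · rintro _ ⟨g, rfl⟩
        exact AddSubgroup.subset_closure ⟨1, g, by rw [map_one, one_smul]⟩
      · intro s ω h' hω
        clear h'
        induction hω using AddSubgroup.closure_induction with
        | mem ω hω =>
          obtain ⟨r, g, rfl⟩ := hω
          refine AddSubgroup.subset_closure ⟨s * r, g, ?_⟩
          rw [map_mul, mul_smul, algebraMap_smul K s]
        | zero => rw [smul_zero]; exact zero_mem _
        | add a b _ _ ha hb => rw [smul_add]; exact add_mem ha hb
        | neg a _ ha => rw [smul_neg]; exact neg_mem ha
  -- The restriction is meaningful on `L` only; the value 0 elsewhere is a convention.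
  let ρ' : Ω[K⁄k] → Ω[B⁄k] := fun ω => if h : ω ∈ L then ρ ⟨ω, (hmem ω).1 h⟩ else 0
  have hρ : ∀ ω (h : ω ∈ L), ρ' ω = ρ ⟨ω, (hmem ω).1 h⟩ := fun ω h => dif_pos h
  have hsm : ∀ (a : R) (ω : Ω[K⁄k]), ω ∈ L → algebraMap R K a • ω ∈ L := by
    intro a ω hω
    rw [hmem, algebraMap_smul]
    exact Submodule.smul_mem _ a ((hmem ω).1 hω)
  have hd : ∀ a : R, KaehlerDifferential.D k K (algebraMap R K a) ∈ L :=
    fun a => (hmem _).2 (D_mem_integralForms a)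
  refine ⟨ρ', fun ω hω ω' hω' => ?_, fun a ω hω => ?_, fun a => ?_, fun ω hω h0 => ?_⟩
  · rw [hρ _ hω, hρ _ hω', hρ _ (add_mem hω hω')]
    exact map_add ρ ⟨ω, (hmem ω).1 hω⟩ ⟨ω', (hmem ω').1 hω'⟩
  · rw [hρ _ hω, hρ _ (hsm a ω hω)]
    refine (congrArg ρ (Subtype.ext (algebraMap_smul K a ω))).trans
      ((map_smul ρ a ⟨ω, (hmem ω).1 hω⟩).trans (algebraMap_smul B a _).symm)
  · rw [hρ _ (hd a)]
    exact h1 a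
  · rw [hρ _ hω] at h0
    obtain ⟨t, ht, h3⟩ := h2 _ h0
    refine ⟨t, ht, ?_⟩
    have key : ∀ η : integralForms (R := R) k K,
        η ∈ RingHom.ker (algebraMap R B) • (⊤ : Submodule R (integralForms (R := R) k K)) →
        (η : Ω[K⁄k]) ∈ AddSubgroup.closure
          {η | ∃ s ∈ RingHom.ker (algebraMap R B), ∃ ω' ∈ L, η = algebraMap R K s • ω'} := by
      intro η hη
      refine Submodule.smul_induction_on hη (fun s hs n _ => ?_) (fun a b ha hb => add_mem ha hb)
      exact AddSubgroup.subset_closure ⟨s, hs, n.1, (hmem _).2 n.2, (algebraMap_smul K s n.1).symm⟩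
    exact key _ h3

/-! ### Restriction of rational forms to a closed integral subscheme. -/

section Restriction

variable {X Z : Scheme.{0}} [IsIntegral X] [IsIntegral Z] (i : Z ⟶ X) (f : X ⟶ Spec (.of ℂ))

/-- The properties of the restriction of differential forms. -/
structure IsRestriction (ρ : RationalOneForms f → RationalOneForms (i ≫ f)) : Prop where
  add : ∀ ω ∈ logOneFormsAt f ∅ (genericImage i), ∀ ω' ∈ logOneFormsAt f ∅ (genericImage i),
    ρ (ω + ω') = ρ ω + ρ ω'
  smul : ∀ (a : X.presheaf.stalk (genericImage i)), ∀ ω ∈ logOneFormsAt f ∅ (genericImage i),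
    ρ (ofGerm (genericImage i) a • ω) = (i.stalkMap (genericPoint Z) a : Z.functionField) • ρ ω
  map_d : ∀ a : X.presheaf.stalk (genericImage i),
    ρ (d f (ofGerm (genericImage i) a)) = d (i ≫ f) (i.stalkMap (genericPoint Z) a)
  ker : ∀ ω ∈ logOneFormsAt f ∅ (genericImage i), ρ ω = 0 →
    ∃ t ∈ IsLocalRing.maximalIdeal (X.presheaf.stalk (genericImage i)),
      ω - d f (ofGerm (genericImage i) t) ∈ AddSubgroup.closure
        {η | ∃ s ∈ IsLocalRing.maximalIdeal (X.presheaf.stalk (genericImage i)),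
          ∃ ω' ∈ logOneFormsAt f ∅ (genericImage i), η = ofGerm (genericImage i) s • ω'}

lemma logOneFormsAt_empty_toAddSubgroup (x : X) : (logOneFormsAt f ∅ x).toAddSubgroup =
    AddSubgroup.closure {η | ∃ r g : X.presheaf.stalk x, η = ofGerm x r • d f (ofGerm x g)} := by
  apply le_antisymm
  · intro ω h
    change ω ∈ logOneFormsAt f ∅ x at h
    induction h using Submodule.span_induction with
    | mem ω h =>
      rcases h with ⟨a, rfl⟩ | ⟨Z, hZ, -⟩
      · refine AddSubgroup.subset_closure ⟨1, a, ?_⟩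
        have : ofGerm x 1 = 1 := map_one _
        rw [this, one_smul]
      · exact absurd hZ (Finset.notMem_empty Z)
    | zero => exact zero_mem _
    | add a b _ _ ha hb => exact add_mem ha hb
    | smul r a h' ha =>
      clear h'
      obtain ⟨_, s, rfl⟩ := r
      induction ha using AddSubgroup.closure_induction with
      | mem ω hω =>
        obtain ⟨r, g, rfl⟩ := hω
        refine AddSubgroup.subset_closure ⟨s * r, g, ?_⟩
        rw [ofGerm_mul, mul_smul]
        rfl
      | zero => rw [smul_zero]; exact zero_mem _
      | add a b _ _ ha hb => rw [smul_add]; exact add_mem ha hb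
      | neg a _ ha => rw [smul_neg]; exact neg_mem ha
  · rw [AddSubgroup.closure_le]
    rintro _ ⟨r, g, rfl⟩
    exact smul_mem_logOneFormsAt f r (d_mem_logOneFormsAt f ∅ x g)

/-- The local ring of `X` at the generic point of `Z` is formally smooth, and its quotient by the
maximal ideal is the function field of `Z`, so the conormal sequence applies. -/
lemma exists_isRestriction [Smooth f] [IsClosedImmersion i] : ∃ ρ, IsRestriction i f ρ := by
  let x := genericImage i
  let := stalkAlgebra f x
  let : Algebra ℂ X.functionField := (constants f).hom.toAlgebra
  have : IsScalarTower ℂ (X.presheaf.stalk x) X.functionField :=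
    IsScalarTower.of_algebraMap_eq fun c => constants_eq f x c
  have hsm := (smooth_stalk f x).1
  let φ : X.presheaf.stalk x →+* Z.functionField := (i.stalkMap (genericPoint Z)).hom
  let : Algebra (X.presheaf.stalk x) Z.functionField := φ.toAlgebra
  let : Algebra ℂ Z.functionField := (constants (i ≫ f)).hom.toAlgebra
  have : IsScalarTower ℂ (X.presheaf.stalk x) Z.functionField :=
    IsScalarTower.of_algebraMap_eq fun c => (stalkMap_germC i f (genericPoint Z) c).symm
  have hs : Function.Surjective φ := i.stalkMap_surjective _
  obtain ⟨ρ, h1, h2, h3, h4⟩ := exists_restrict_rational_forms (k := ℂ) (R := X.presheaf.stalk x)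
    (K := X.functionField) (B := Z.functionField) hs (logOneFormsAt_empty_toAddSubgroup f x)
    (ker_stalkMap_genericPoint i)
  exact ⟨ρ, h1, h2, h3, h4⟩

variable {i f} {ρ : RationalOneForms f → RationalOneForms (i ≫ f)}

lemma mem_generic_of_mem {z : Z} {ω : RationalOneForms f} (h : ω ∈ logOneFormsAt f ∅ (i z)) :
    ω ∈ logOneFormsAt f ∅ (genericImage i) := by
  induction h using Submodule.span_induction with
  | mem ω h =>
    rcases h with ⟨a, rfl⟩ | ⟨Z, hZ, -⟩
    · rw [← ofGerm_stalkSpecializes (genericImage_specializes i z)]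
      exact d_mem_logOneFormsAt f ∅ _ _
    · exact absurd hZ (Finset.notMem_empty Z)
  | zero => exact zero_mem _
  | add a b _ _ ha hb => exact add_mem ha hb
  | smul r a _ ha =>
    obtain ⟨r, hr⟩ := r
    exact Submodule.smul_mem _ (⟨r, localRing_mono (genericImage_specializes i z) hr⟩ :
      localRing (genericImage i)) ha

lemma IsRestriction.map_zero (hρ : IsRestriction i f ρ) : ρ 0 = 0 := by
  have h := hρ.add 0 (zero_mem _) 0 (zero_mem _)
  rw [add_zero] at h
  exact left_eq_add.1 h

lemma IsRestriction.smul_at (hρ : IsRestriction i f ρ) (z : Z) (a : X.presheaf.stalk (i z)) {ω : RationalOneForms f}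
    (hω : ω ∈ logOneFormsAt f ∅ (genericImage i)) :
    ρ (ofGerm (i z) a • ω) = ofGerm z (i.stalkMap z a) • ρ ω := by
  rw [← ofGerm_stalkSpecializes (genericImage_specializes i z), hρ.smul _ _ hω, ofGerm_stalkMap]

lemma IsRestriction.d_at (hρ : IsRestriction i f ρ) (z : Z) (a : X.presheaf.stalk (i z)) :
    ρ (d f (ofGerm (i z) a)) = d (i ≫ f) (ofGerm z (i.stalkMap z a)) := by
  rw [← ofGerm_stalkSpecializes (genericImage_specializes i z), hρ.map_d, ofGerm_stalkMap]

lemma IsRestriction.const_smul (hρ : IsRestriction i f ρ) (c : ℂ) {ω : RationalOneForms f}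
    (hω : ω ∈ logOneFormsAt f ∅ (genericImage i)) :
    ρ ((constants f).hom c • ω) = (constants (i ≫ f)).hom c • ρ ω := by
  rw [constants_eq f (genericImage i), hρ.smul _ _ hω, stalkMap_germC i f (genericPoint Z) c]
  rfl

/-- The restriction of a generating family generates the forms on the subvariety. -/
lemma IsRestriction.logOneFormsAt_eq (hρ : IsRestriction i f ρ) [IsClosedImmersion i] (z : Z) {κ : Type} {n : κ → RationalOneForms f}
    (h : logOneFormsAt f ∅ (i z) = Submodule.span (localRing (i z)) (Set.range n)) :
    logOneFormsAt (i ≫ f) ∅ z = Submodule.span (localRing z) (Set.range fun k => ρ (n k)) := by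
  apply le_antisymm
  · have key : ∀ ω ∈ logOneFormsAt f ∅ (i z),
        ρ ω ∈ Submodule.span (localRing z) (Set.range fun k => ρ (n k)) := by
      intro ω hω
      suffices ω ∈ logOneFormsAt f ∅ (genericImage i) ∧
          ρ ω ∈ Submodule.span (localRing z) (Set.range fun k => ρ (n k)) from this.2
      rw [h] at hω
      induction hω using Submodule.span_induction with
      | mem ω hω =>
        obtain ⟨k, rfl⟩ := hω
        refine ⟨mem_generic_of_mem (z := z) ?_, Submodule.subset_span ⟨k, rfl⟩⟩
        rw [h]
        exact Submodule.subset_span ⟨k, rfl⟩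
      | zero =>
        rw [hρ.map_zero]
        exact ⟨zero_mem _, zero_mem _⟩
      | add a b _ _ ha hb =>
        rw [hρ.add a ha.1 b hb.1]
        exact ⟨add_mem ha.1 hb.1, add_mem ha.2 hb.2⟩
      | smul r a _ ha =>
        obtain ⟨_, r, rfl⟩ := r
        refine ⟨Submodule.smul_mem _ (⟨_, localRing_mono (genericImage_specializes i z) ⟨r, rfl⟩⟩ :
          localRing (genericImage i)) ha.1, ?_⟩
        have h1 : ρ (ofGerm (i z) r • a) = ofGerm z (i.stalkMap z r) • ρ a := hρ.smul_at z r ha.1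
        change ρ (ofGerm (i z) r • a) ∈ _
        rw [h1]
        exact Submodule.smul_mem _ (⟨_, ⟨_, rfl⟩⟩ : localRing z) ha.2
    refine Submodule.span_le.2 ?_
    rintro _ (⟨b, rfl⟩ | ⟨Z, hZ, -⟩)
    · obtain ⟨a, rfl⟩ := i.stalkMap_surjective z b
      rw [← hρ.d_at]
      exact key _ (d_mem_logOneFormsAt f ∅ _ a)
    · exact absurd hZ (Finset.notMem_empty Z)
  · refine Submodule.span_le.2 ?_
    rintro _ ⟨k, rfl⟩
    have h1 : n k ∈ logOneFormsAt f ∅ (i z) := by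
      rw [h]
      exact Submodule.subset_span ⟨k, rfl⟩
    change ρ (n k) ∈ _
    generalize n k = ω at h1
    have h2 : ω ∈ logOneFormsAt f ∅ (genericImage i) ∧ ρ ω ∈ logOneFormsAt (i ≫ f) ∅ z := by
      refine ⟨mem_generic_of_mem h1, ?_⟩
      induction h1 using Submodule.span_induction with
      | mem ω hω =>
        rcases hω with ⟨a, rfl⟩ | ⟨Z, hZ, -⟩
        · rw [hρ.d_at]
          exact d_mem_logOneFormsAt _ ∅ z _
        · exact absurd hZ (Finset.notMem_empty Z)
      | zero =>
        rw [hρ.map_zero]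
        exact zero_mem _
      | add a b ha' hb' ha hb =>
        rw [hρ.add a (mem_generic_of_mem ha') b (mem_generic_of_mem hb')]
        exact add_mem ha hb
      | smul r a ha' ha =>
        obtain ⟨_, r, rfl⟩ := r
        have h1 : ρ (ofGerm (i z) r • a) = ofGerm z (i.stalkMap z r) • ρ a :=
          hρ.smul_at z r (mem_generic_of_mem ha')
        change ρ (ofGerm (i z) r • a) ∈ _
        rw [h1]
        exact smul_mem_logOneFormsAt _ _ ha
    exact h2.2

end Restriction

end LogBott

namespace LogBott

/-! ### Forms on the components of the intersections -/

section FreeBasis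

variable {X : Scheme.{0}} [IsIntegral X] {f : X ⟶ Spec (.of ℂ)} {D : Finset (IrreducibleCloseds X)}
  {r : ℕ} (F : LogData f D r) (A : Finset {Z : IrreducibleCloseds X // Z ∈ D})

/-- The global logarithmic forms without residues along given components. -/
abbrev LogData.residueFree : Submodule ℂ (Fin r → ℂ) := ⨅ j ∈ A, LinearMap.ker (F.res j)

variable {F} {x : X} (C : F.Chart x)

/-- The indices of the members of the adapted basis without residues along given components. -/
abbrev LogData.Chart.FreeIndex : Type := {k : Fin r // ∀ j, C.σ j = k → j.1 ∉ A}

variable {A}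

/-- The basis of the space of global logarithmic forms without residues along given components. -/
def LogData.Chart.freeBasis (hA : ∀ j ∈ A, x ∈ j.1) :
    Module.Basis (C.FreeIndex A) ℂ (F.residueFree A) :=
  (Module.Basis.span (C.v.linearIndependent.comp (Subtype.val : C.FreeIndex A → Fin r)
    Subtype.val_injective)).map (LinearEquiv.ofEq _ _ (by
      have h : Set.range (Subtype.val : C.FreeIndex A → Fin r) = {k | ∀ j, C.σ j = k → j.1 ∉ A} :=
        Subtype.range_coe_subtype
      rw [LogData.residueFree, C.iInf_ker_res hA, Set.range_comp, h]))

lemma LogData.Chart.coe_freeBasis (hA : ∀ j ∈ A, x ∈ j.1) (k : C.FreeIndex A) :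
    (C.freeBasis hA k : Fin r → ℂ) = C.v k.1 := by
  rw [freeBasis, Module.Basis.map_apply, LinearEquiv.coe_ofEq_apply, Module.Basis.span_apply]
  rfl

lemma LogData.exists_formBasis (v : Module.Basis (Fin r) ℂ (Fin r → ℂ)) :
    ∃ b : Module.Basis (Fin r) X.functionField (RationalOneForms f), ∀ k, b k = F.form (v k) := by
  obtain ⟨x, -⟩ : ∃ x : X, True := ⟨genericPoint X, trivial⟩
  have hspan : ⊤ ≤ Submodule.span X.functionField (Set.range fun k => F.form (v k)) := by
    rw [← F.e.span_eq, Submodule.span_le]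
    rintro _ ⟨i, rfl⟩
    have h1 : F.e i ∈ logOneFormsAt f D x := by
      rw [F.span_eq]
      exact Submodule.subset_span ⟨i, rfl⟩
    obtain ⟨α, hα⟩ := F.exists_coeff v h1
    rw [hα]
    exact Submodule.sum_mem _ fun k _ => Submodule.smul_mem _ _ (Submodule.subset_span ⟨k, rfl⟩)
  have hcard : Fintype.card (Fin r) = Module.finrank X.functionField (RationalOneForms f) :=
    (Module.finrank_eq_card_basis F.e).symm
  exact ⟨basisOfTopLeSpanOfCardEqFinrank _ hspan hcard, fun k =>
    congrFun (coe_basisOfTopLeSpanOfCardEqFinrank _ hspan hcard) k⟩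

end FreeBasis

/-! ### The restricted global forms as a frame on a stratum. -/

section Component

variable {X : Scheme.{0}} [IsIntegral X] {f : X ⟶ Spec (.of ℂ)} [Smooth f]
  {D : Finset (IrreducibleCloseds X)} {r : ℕ} {F : LogData f D r}
  {A : Finset {Z : IrreducibleCloseds X // Z ∈ D}} {Z : IrreducibleCloseds X}

lemma IsComponent.mem (hZ : IsComponent A Z) (z : subvariety Z) : ∀ j ∈ A, inclusion Z z ∈ j.1 := by
  intro j hj
  have h1 : inclusion Z z ∈ Set.range (inclusion Z) := ⟨z, rfl⟩
  rw [range_inclusion] at h1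
  exact hZ.1 j hj h1

/-- Only the members of `A` pass through the generic point of `Z`, so a form without residues along
`A` has no pole there. -/
lemma LogData.form_mem_generic (F : LogData f D r) (hZ : IsComponent A Z) {w : Fin r → ℂ}
    (hw : w ∈ F.residueFree A) : F.form w ∈ logOneFormsAt f ∅ (genericImage (inclusion Z)) := by
  obtain ⟨C⟩ := F.exists_chart (genericImage (inclusion Z))
  rw [LogData.residueFree, C.iInf_ker_res (hZ.mem _)] at hw
  induction hw using Submodule.span_induction with
  | mem w hw =>
    obtain ⟨k, hk, rfl⟩ := hw
    have h1 : coordFactor C.t C.σ ∅ k = 1 := coordFactor_eq_one fun j hj =>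
      absurd (F.snc.mem_of_generic_mem f hZ (genericImage_inclusion_mem Z)
        (fun z hz => genericImage_inclusion_specializes hz) j.1 j.2) (hk j hj)
    have h2 : logOneFormsAt f ∅ (genericImage (inclusion Z)) = _ := C.span_eq ∅
    rw [h2]
    refine Submodule.subset_span ⟨k, ?_⟩
    have h3 : ofGerm (genericImage (inclusion Z)) 1 = 1 := map_one _
    beta_reduce
    rw [h1, h3, one_smul]
  | zero => rw [map_zero]; exact zero_mem _
  | add a b _ _ ha hb => rw [map_add]; exact add_mem ha hb
  | smul c a _ ha =>
    rw [LinearMap.map_smulₛₗ]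
    exact Submodule.smul_mem _ (⟨_, constants_mem_localRing _ c⟩ :
      localRing (genericImage (inclusion Z))) ha

variable {ρ : RationalOneForms f → RationalOneForms (inclusion Z ≫ f)}

/-- The restriction of global logarithmic forms to a component of an intersection. -/
def LogData.restrictForm (F : LogData f D r) (hZ : IsComponent A Z)
    (hρ : IsRestriction (inclusion Z) f ρ) :
    F.residueFree A →ₛₗ[(constants (inclusion Z ≫ f)).hom] RationalOneForms (inclusion Z ≫ f) where
  toFun w := ρ (F.form w)
  map_add' v w := by
    rw [Submodule.coe_add, map_add, hρ.add _ (F.form_mem_generic hZ v.2) _ (F.form_mem_generic hZ w.2)]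
  map_smul' c w := by
    rw [Submodule.coe_smul, LinearMap.map_smulₛₗ, hρ.const_smul c (F.form_mem_generic hZ w.2)]

lemma LogData.restrictForm_apply (hZ : IsComponent A Z) (hρ : IsRestriction (inclusion Z) f ρ)
    (w : F.residueFree A) : F.restrictForm hZ hρ w = ρ (F.form w) := rfl

lemma stalkMap_inclusion_eq_zero_iff (f : X ⟶ Spec (.of ℂ)) [Smooth f] (hD : IsSNC D) (hZ : IsComponent A Z) (z : subvariety Z)
    (a : X.presheaf.stalk (inclusion Z z)) : (inclusion Z).stalkMap z a = 0 ↔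
      a ∈ interIdeal A (inclusion Z z) := by
  have h1 : inclusion Z z ∈ Z := by
    have h1 : inclusion Z z ∈ Set.range (inclusion Z) := ⟨z, rfl⟩
    rwa [range_inclusion] at h1
  rw [stalkMap_eq_zero_iff, ← hD.stalkIdeal_component f hZ h1, ← specIdeal_genericImage h1]

/-- The forms with poles along a component of the intersection restrict to zero, after
multiplication with an equation. -/
lemma LogData.Chart.restrict_eq_zero (hZ : IsComponent A Z) (hρ : IsRestriction (inclusion Z) f ρ)
    {z : subvariety Z} (C : F.Chart (inclusion Z z))
    (j : {j : {Z : IrreducibleCloseds X // Z ∈ D} // inclusion Z z ∈ j.1}) (hj : j.1 ∈ A) :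
    ρ (ofGerm (inclusion Z z) (coordFactor C.t C.σ ∅ (C.σ j)) • F.form (C.v (C.σ j))) = 0 := by
  have h0 := F.snc.localEquation_ne_zero j.1.2 (C.eqn j.1)
  have ht : (inclusion Z).stalkMap z (C.t j.1) = 0 := by
    rw [stalkMap_inclusion_eq_zero_iff f F.snc hZ, interIdeal_eq_span C.eqn]
    exact Ideal.subset_span ⟨j.1, hj, rfl⟩
  have h1 : ofGerm (inclusion Z z) (C.t j.1) • F.form (C.v (C.σ j)) =
      ofGerm (inclusion Z z) (C.t j.1) •
        (F.form (C.v (C.σ j)) - dlog f (inclusion Z z) (C.t j.1)) +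
      d f (ofGerm (inclusion Z z) (C.t j.1)) := by
    rw [smul_sub, smul_dlog f h0, sub_add_cancel]
  rw [coordFactor_of_mem (Finset.notMem_empty _), h1,
    hρ.add _ (mem_generic_of_mem (smul_mem_logOneFormsAt f _ (C.dlog_sub j))) _
      (mem_generic_of_mem (d_mem_logOneFormsAt f _ _ _)),
    hρ.smul_at _ _ (mem_generic_of_mem (C.dlog_sub j)), hρ.d_at, ht, ofGerm_zero, zero_smul, zero_add]
  have h2 := d_add (inclusion Z ≫ f) 0 0
  rw [add_zero] at h2
  exact left_eq_add.1 h2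

/-- Of the generators of the regular forms on `X`, those attached to members of `A` restrict to
zero, and the others to multiples of the restricted forms without residues along `A`. -/
lemma LogData.Chart.logOneFormsAt_restrict (hZ : IsComponent A Z)
    (hρ : IsRestriction (inclusion Z) f ρ) {z : subvariety Z} (C : F.Chart (inclusion Z z)) :
    logOneFormsAt (inclusion Z ≫ f) ∅ z = Submodule.span (localRing z)
      (Set.range fun k : C.FreeIndex A =>
        ofGerm z ((inclusion Z).stalkMap z (coordFactor C.t C.σ ∅ k.1)) •
          F.restrictForm hZ hρ (C.freeBasis (hZ.mem z) k)) := by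
  have h1 : logOneFormsAt f ∅ (inclusion Z z) = _ := C.span_eq ∅
  have hfree : ∀ k : C.FreeIndex A,
      ρ (ofGerm (inclusion Z z) (coordFactor C.t C.σ ∅ k.1) • F.form (C.v k.1)) =
        ofGerm z ((inclusion Z).stalkMap z (coordFactor C.t C.σ ∅ k.1)) •
          F.restrictForm hZ hρ (C.freeBasis (hZ.mem z) k) := by
    intro k
    have hk := F.form_mem_generic hZ (C.freeBasis (hZ.mem z) k).2
    rw [C.coe_freeBasis] at hk
    rw [hρ.smul_at _ _ hk, F.restrictForm_apply, C.coe_freeBasis]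
  rw [hρ.logOneFormsAt_eq z h1]
  apply le_antisymm
  · refine Submodule.span_le.2 ?_
    rintro _ ⟨k, rfl⟩
    by_cases hk : ∀ j, C.σ j = k → j.1 ∉ A
    · exact Submodule.subset_span ⟨⟨k, hk⟩, (hfree ⟨k, hk⟩).symm⟩
    · push Not at hk
      obtain ⟨j, rfl, hj⟩ := hk
      have := C.restrict_eq_zero hZ hρ j hj
      beta_reduce
      rw [this]
      exact zero_mem _
  · refine Submodule.span_mono ?_
    rintro _ ⟨k, rfl⟩
    exact ⟨k.1, hfree k⟩

lemma IsRestriction.sum (hρ : IsRestriction (inclusion Z) f ρ) {κ : Type} (s : Finset κ)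
    (ω : κ → RationalOneForms f) (h : ∀ k, ω k ∈ logOneFormsAt f ∅ (genericImage (inclusion Z))) :
    ρ (∑ k ∈ s, ω k) = ∑ k ∈ s, ρ (ω k) := by
  classical
  induction s using Finset.induction_on with
  | empty => exact hρ.map_zero
  | insert a s ha ih =>
    rw [Finset.sum_insert ha, Finset.sum_insert ha,
      hρ.add _ (h a) _ (Submodule.sum_mem _ fun k _ => h k), ih]

/-- If a combination restricts to zero, the conormal sequence writes its lift as dt plus forms with
coefficients in the maximal ideal, where `t` lies in the maximal ideal, which is generated by the
equations t_j, j ∈ A. Each dt_j is t_j times the basis vector attached to `j`, up to forms with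
coefficients in the maximal ideal. Hence the coefficients at the basis vectors not attached to `A`
vanish at the generic point of `Z`. -/
lemma LogData.Chart.linearIndependent_restrictForm (hZ : IsComponent A Z)
    (hρ : IsRestriction (inclusion Z) f ρ) (C : F.Chart (genericImage (inclusion Z))) :
    LinearIndependent (subvariety Z).functionField (fun k : C.FreeIndex A =>
      F.restrictForm hZ hρ (C.freeBasis (hZ.mem _) k)) := by
  classical
  have hmem : ∀ k : C.FreeIndex A, F.form (C.v k.1) ∈
      logOneFormsAt f ∅ (genericImage (inclusion Z)) := by
    intro k
    have hk := F.form_mem_generic hZ (C.freeBasis (hZ.mem _) k).2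
    rwa [C.coe_freeBasis] at hk
  obtain ⟨b, hb⟩ := F.exists_formBasis C.v
  have hint : ∀ (k : C.FreeIndex A), ∀ ω ∈ logOneFormsAt f ∅ (genericImage (inclusion Z)),
      b.repr ω k.1 ∈ localRing (genericImage (inclusion Z)) := by
    intro k ω hω
    have h1 : logOneFormsAt f ∅ (genericImage (inclusion Z)) = _ := C.span_eq ∅
    rw [h1] at hω
    induction hω using Submodule.span_induction with
    | mem ω hω =>
      obtain ⟨l, rfl⟩ := hω
      beta_reduce
      rw [← hb, map_smul, b.repr_self, Finsupp.smul_apply, Finsupp.single_apply, smul_eq_mul]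
      split_ifs
      · rw [mul_one]
        exact ⟨_, rfl⟩
      · rw [mul_zero]
        exact zero_mem _
    | zero => rw [map_zero]; exact zero_mem _
    | add a c _ _ ha hc => rw [map_add]; exact add_mem ha hc
    | smul s a _ ha =>
      have h2 : b.repr (s • a) k.1 = s.1 * b.repr a k.1 :=
        (congrArg (fun v => v k.1) (map_smul b.repr s.1 a)).trans rfl
      rw [h2]
      exact mul_mem s.2 ha
  have hvan : ∀ (k : C.FreeIndex A) (s : X.presheaf.stalk (genericImage (inclusion Z))),
      s ∈ IsLocalRing.maximalIdeal _ → ∀ ω ∈ logOneFormsAt f ∅ (genericImage (inclusion Z)),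
      b.repr (ofGerm _ s • ω) k.1 ∈ vanishingAt (genericImage (inclusion Z)) := by
    intro k s hs ω hω
    rw [map_smul, Finsupp.smul_apply, smul_eq_mul, mul_comm]
    exact mul_mem_vanishingAt (hint k ω hω) (ofGerm_mem_vanishingAt_self.2 hs)
  have hmax := F.snc.maximalIdeal_eq f hZ (genericImage_inclusion_mem Z)
    (fun z hz => genericImage_inclusion_specializes hz)
  have hd : ∀ (k : C.FreeIndex A), ∀ t ∈ IsLocalRing.maximalIdeal
      (X.presheaf.stalk (genericImage (inclusion Z))),
      b.repr (d f (ofGerm _ t)) k.1 ∈ vanishingAt (genericImage (inclusion Z)) := by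
    intro k t ht
    have ht' := ht
    rw [hmax, interIdeal_eq_span C.eqn] at ht'
    obtain ⟨c, hc⟩ : ∃ c : {Z : IrreducibleCloseds X // Z ∈ D} →
        X.presheaf.stalk (genericImage (inclusion Z)), t = ∑ j ∈ A, c j * C.t j := by
      obtain ⟨c, hc⟩ := (Submodule.mem_span_image_finset_iff_exists_fun _).1 ht'
      refine ⟨fun j => if h : j ∈ A then c ⟨j, h⟩ else 0, ?_⟩
      rw [← hc, ← Finset.sum_coe_sort A]
      refine Finset.sum_congr rfl fun j _ => ?_
      beta_reduce
      rw [dif_pos j.2]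
      rfl
    have htA : ∀ j ∈ A, C.t j ∈ IsLocalRing.maximalIdeal
        (X.presheaf.stalk (genericImage (inclusion Z))) := by
      intro j hj
      rw [hmax, interIdeal_eq_span C.eqn]
      exact Ideal.subset_span ⟨j, hj, rfl⟩
    have hsum : d f (ofGerm _ t) = ∑ j ∈ A, (ofGerm (genericImage (inclusion Z)) (c j) •
        d f (ofGerm _ (C.t j)) + ofGerm (genericImage (inclusion Z)) (C.t j) • d f (ofGerm _ (c j))) := by
      let Δ : X.functionField →+ RationalOneForms f := AddMonoidHom.mk' (d f) (d_add f)
      have h1 : ofGerm _ t = ∑ j ∈ A, ofGerm (genericImage (inclusion Z)) (c j) * ofGerm _ (C.t j) := by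
        rw [hc]
        refine (map_sum (algebraMap (X.presheaf.stalk (genericImage (inclusion Z)))
          X.functionField) _ _).trans (Finset.sum_congr rfl fun j _ => ofGerm_mul _ _ _)
      rw [h1]
      refine (map_sum Δ _ _).trans (Finset.sum_congr rfl fun j _ => d_mul f _ _)
    rw [hsum, map_sum, Finsupp.finsetSum_apply]
    refine sum_mem fun j hj => ?_
    rw [map_add, Finsupp.add_apply]
    refine add_mem ?_ (hvan k _ (htA j hj) _ (d_mem_logOneFormsAt f _ _ _))
    rw [map_smul, Finsupp.smul_apply, smul_eq_mul]
    refine mul_mem_vanishingAt ⟨_, rfl⟩ ?_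
    let j' : {j : {Z : IrreducibleCloseds X // Z ∈ D} // genericImage (inclusion Z) ∈ j.1} :=
      ⟨j, hZ.mem _ j hj⟩
    have h0 := F.snc.localEquation_ne_zero j.2 (C.eqn j)
    have h1 : d f (ofGerm _ (C.t j)) = ofGerm (genericImage (inclusion Z)) (C.t j) •
        F.form (C.v (C.σ j')) - ofGerm (genericImage (inclusion Z)) (C.t j) •
          (F.form (C.v (C.σ j')) - dlog f _ (C.t j)) := by
      rw [smul_sub, smul_dlog f h0, sub_sub_cancel]
    rw [h1, map_sub, Finsupp.sub_apply]
    refine sub_mem ?_ (hvan k _ (htA j hj) _ (C.dlog_sub j'))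
    rw [← hb, map_smul, b.repr_self, Finsupp.smul_apply, Finsupp.single_apply,
      if_neg fun h => k.2 j' h hj, smul_zero]
    exact zero_mem _
  rw [Fintype.linearIndependent_iff]
  intro β hβ k
  choose α hα using fun k : C.FreeIndex A =>
    (inclusion Z).stalkMap_surjective (genericPoint (subvariety Z)) (β k)
  have hα0 : ∀ k, ofGerm (genericImage (inclusion Z)) (α k) • F.form (C.v k.1) ∈
      logOneFormsAt f ∅ (genericImage (inclusion Z)) := fun k => smul_mem_logOneFormsAt f _ (hmem k)
  have h1 : ρ (∑ k, ofGerm (genericImage (inclusion Z)) (α k) • F.form (C.v k.1)) = 0 := by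
    rw [hρ.sum _ _ hα0]
    refine Eq.trans (Finset.sum_congr rfl fun k _ => ?_) hβ
    rw [hρ.smul _ _ (hmem k), hα, F.restrictForm_apply, C.coe_freeBasis]
  obtain ⟨t, ht, h2⟩ := hρ.ker _ (Submodule.sum_mem _ fun k _ => hα0 k) h1
  have h3 : ∀ η ∈ AddSubgroup.closure
        {η | ∃ s ∈ IsLocalRing.maximalIdeal (X.presheaf.stalk (genericImage (inclusion Z))),
          ∃ ω' ∈ logOneFormsAt f ∅ (genericImage (inclusion Z)),
            η = ofGerm (genericImage (inclusion Z)) s • ω'},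
      b.repr η k.1 ∈ vanishingAt (genericImage (inclusion Z)) := by
    intro η hη
    induction hη using AddSubgroup.closure_induction with
    | mem η hη =>
      obtain ⟨s, hs, ω, hω, rfl⟩ := hη
      exact hvan k s hs ω hω
    | zero => rw [map_zero]; exact zero_mem _
    | add a c _ _ ha hc => rw [map_add]; exact add_mem ha hc
    | neg a _ ha => rw [map_neg]; exact neg_mem ha
  have h4 := add_mem (h3 _ h2) (hd k t ht)
  rw [map_sub, Finsupp.sub_apply, sub_add_cancel, map_sum, Finsupp.finsetSum_apply,
    Finset.sum_eq_single k, ← hb, map_smul, b.repr_self, Finsupp.smul_apply, Finsupp.single_eq_same,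
    smul_eq_mul, mul_one, ofGerm_mem_vanishingAt_self, ← ker_stalkMap_genericPoint] at h4
  · rw [← hα]
    exact h4
  · intro l _ hl
    rw [← hb, map_smul, b.repr_self, Finsupp.smul_apply, Finsupp.single_eq_of_ne
      (fun h => hl (Subtype.ext h.symm)), smul_zero]
  · exact fun h => absurd (Finset.mem_univ k) h

/-- Generation: the regular forms at a point of `Z` span the rational ones, and they are
combinations of restricted forms without residues along `A`. -/
lemma LogData.Chart.exists_restrictBasis (hZ : IsComponent A Z)
    (hρ : IsRestriction (inclusion Z) f ρ) (C : F.Chart (genericImage (inclusion Z))) :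
    ∃ e : Module.Basis (C.FreeIndex A) (subvariety Z).functionField
      (RationalOneForms (inclusion Z ≫ f)),
      ∀ k, F.restrictForm hZ hρ (C.freeBasis (hZ.mem _) k) = e k := by
  classical
  have hspan : ⊤ ≤ Submodule.span (subvariety Z).functionField (Set.range fun k : C.FreeIndex A =>
      F.restrictForm hZ hρ (C.freeBasis (hZ.mem _) k)) := by
    obtain ⟨z, -⟩ : ∃ z : subvariety Z, True := ⟨genericPoint _, trivial⟩
    have hform : ∀ w : F.residueFree A, F.restrictForm hZ hρ w ∈
        Submodule.span (subvariety Z).functionField (Set.range fun k : C.FreeIndex A =>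
          F.restrictForm hZ hρ (C.freeBasis (hZ.mem _) k)) := by
      intro w
      rw [← (C.freeBasis (hZ.mem _)).sum_repr w, map_sum]
      refine Submodule.sum_mem _ fun k _ => ?_
      rw [LinearMap.map_smulₛₗ]
      exact Submodule.smul_mem _ _ (Submodule.subset_span ⟨k, rfl⟩)
    obtain ⟨C'⟩ := F.exists_chart (inclusion Z z)
    rw [← span_logOneFormsAt (inclusion Z ≫ f) ∅ z, C'.logOneFormsAt_restrict hZ hρ, Submodule.span_le]
    intro ω hω
    induction hω using Submodule.span_induction with
    | mem ω hω =>
      obtain ⟨k, rfl⟩ := hω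
      exact Submodule.smul_mem _ _ (hform _)
    | zero => exact zero_mem _
    | add a c _ _ ha hc => exact add_mem ha hc
    | smul s a _ ha => exact Submodule.smul_mem _ s.1 ha
  exact ⟨Module.Basis.mk (C.linearIndependent_restrictForm hZ hρ) hspan,
    fun k => (congrFun (Module.Basis.coe_mk (C.linearIndependent_restrictForm hZ hρ) hspan) k).symm⟩

end Component

end LogBott

namespace LogBott

/-! ### The canonical sheaf of a component of an intersection -/

/-- The inverse image of a family of ideals. -/
def IdFam.pull {X Z : Scheme.{0}} (i : Z ⟶ X) (I : IdFam X) : IdFam Z :=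
  ⟨fun z => (I.at' (i z)).map (i.stalkMap z).hom, fun z a ha => by
    induction ha using Submodule.span_induction with
    | mem a ha =>
      obtain ⟨a, ha, rfl⟩ := ha
      obtain ⟨U, hU, g, rfl, h⟩ := I.spread _ a ha
      refine ⟨i ⁻¹ᵁ U, hU, i.app U g, (Scheme.Hom.germ_stalkMap_apply i U z hU g).symm,
        fun y hy => ?_⟩
      have h1 : Z.presheaf.germ (i ⁻¹ᵁ U) y hy (i.app U g) = i.stalkMap y (X.presheaf.germ U (i y) hy g) :=
        (Scheme.Hom.germ_stalkMap_apply i U y hy g).symm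
      rw [h1]
      exact Ideal.mem_map_of_mem _ (h _ hy)
    | zero => exact IdealSpread.zero _ _
    | add m m' _ _ hm hm' => exact hm.add hm'
    | smul r m _ hm => exact hm.mul_left r⟩

lemma IdFam.pull_at {X Z : Scheme.{0}} (i : Z ⟶ X) (I : IdFam X) (z : Z) :
    (IdFam.pull i I).at' z = (I.at' (i z)).map (i.stalkMap z).hom := rfl

lemma RegularOn.mem_sup_smul {O N J : Type} [CommRing O] [AddCommGroup N] [Module O N]
    {I : J → Ideal O} (h : RegularOn I N) {A : Finset J} {j : J} (hj : j ∉ A) {t : O}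
    (ht : I j = Ideal.span {t}) {m : N} (hm : t • m ∈ A.sup I • (⊤ : Submodule O N)) :
    m ∈ A.sup I • (⊤ : Submodule O N) := by
  obtain ⟨s, hs, -, h⟩ := h
  have h1 : s j ∈ Ideal.span {t} := by
    rw [← ht]
    exact (hs j).ge (Ideal.mem_span_singleton_self (s j))
  obtain ⟨a, ha⟩ := Ideal.mem_span_singleton'.1 h1
  refine h A j hj m ?_
  rw [← ha, mul_smul]
  exact Submodule.smul_mem _ _ hm

section Strata

variable {X : Scheme.{0}} [IsIntegral X] {f : X ⟶ Spec (.of ℂ)} [Smooth f]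
  {D : Finset (IrreducibleCloseds X)} {r : ℕ} {F : LogData f D r}
  {A : Finset {Z : IrreducibleCloseds X // Z ∈ D}} {Z : IrreducibleCloseds X} {E : X.Modules}

lemma ker_stalkMap_inclusion (f : X ⟶ Spec (.of ℂ)) [Smooth f] (hD : IsSNC D) (hZ : IsComponent A Z)
    (z : subvariety Z) :
    RingHom.ker ((inclusion Z).stalkMap z).hom = interIdeal A (inclusion Z z) :=
  Ideal.ext fun a => stalkMap_inclusion_eq_zero_iff f hD hZ z a

/-- The stalk of the pull-back is the stalk of `E` modulo I_A, and on this quotient the equation of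
a component outside `A` is a non-zero-divisor by regularity. -/
lemma smul_pullStalk_eq_zero (f : X ⟶ Spec (.of ℂ)) [Smooth f] (hD : IsSNC D) (hZ : IsComponent A Z)
    {z : subvariety Z}
    (hreg : RegularOn (fun j => (divisorIdeals D j).at' (inclusion Z z)) (St E (inclusion Z z)))
    {j : {Z : IrreducibleCloseds X // Z ∈ D}} (hj : j ∉ A) {t : X.presheaf.stalk (inclusion Z z)}
    (ht : IsLocalEquation j.1 (inclusion Z z) t)
    (n : St ((Scheme.Modules.pullback (inclusion Z)).obj E) z)
    (hn : (inclusion Z).stalkMap z t • n = 0) : n = 0 := by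
  have hf := (inclusion Z).stalkMap_surjective
  obtain ⟨m, rfl⟩ := pullStalk_surjective E hf z n
  rw [← pullStalk_smul, pullStalk_eq_zero_iff E hf, ker_stalkMap_inclusion f hD hZ] at hn
  rw [pullStalk_eq_zero_iff E hf, ker_stalkMap_inclusion f hD hZ]
  exact hreg.mem_sup_smul hj ht.ofIdealSheaf_at hn

variable {ρ : RationalOneForms f → RationalOneForms (inclusion Z ≫ f)}

-- Two bases of the same complex space of forms without residues along `A` occur: the one from the
-- chart `C₀` at the generic point of `Z` fixes the coordinates, and the one from the chart `C` at
-- `z` generates the regular forms.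
open Classical in
lemma LogData.Chart.isConstFrame_restrict (hZ : IsComponent A Z) (hρ : IsRestriction (inclusion Z) f ρ)
    {z : subvariety Z} (C : F.Chart (inclusion Z z)) (C₀ : F.Chart (genericImage (inclusion Z)))
    {e : Module.Basis (C₀.FreeIndex A) (subvariety Z).functionField
      (RationalOneForms (inclusion Z ≫ f))}
    (he : ∀ k, F.restrictForm hZ hρ (C₀.freeBasis (hZ.mem _) k) = e k) (p : ℕ)
    (hreg : RegularOn (fun j => (divisorIdeals D j).at' (inclusion Z z)) (St E (inclusion Z z))) :
    IsConstFrame (inclusion Z ≫ f) (formsBasis p e) (logFormsAt (inclusion Z ≫ f) ∅ p)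
      ((Scheme.Modules.pullback (inclusion Z)).obj E) z
      (wedgeBasis (C₀.freeBasis (hZ.mem _)) (C.freeBasis (hZ.mem z)) p)
      (fun P => ∏ k ∈ P.1, (inclusion Z).stalkMap z (coordFactor C.t C.σ ∅ k.1)) := by
  refine ⟨logFormsAt_eq_span (inclusion Z ≫ f) ∅ p he _ (C.logOneFormsAt_restrict hZ hρ), fun P => ?_⟩
  refine prod_smul_eq_zero _ _ fun k _ n hn => ?_
  by_cases h : ∃ j, C.σ j = k.1
  · obtain ⟨j, hj⟩ := h
    rw [← hj, coordFactor_of_mem (Finset.notMem_empty _)] at hn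
    exact smul_pullStalk_eq_zero f F.snc hZ hreg (k.2 j hj) (C.eqn j.1) n hn
  · have h1 : (inclusion Z).stalkMap z 1 = 1 := map_one ((inclusion Z).stalkMap z).hom
    rwa [coordFactor_eq_one fun j hj => absurd ⟨j, hj⟩ h, h1, one_smul] at hn

-- Every component outside `A` through the point is attached to a vector of the free basis, so its
-- equation occurs in the product; the components that miss the point contribute the unit ideal.
open Classical in
lemma LogData.Chart.span_prod_restrict {z : subvariety Z}
    (C : F.Chart (inclusion Z z)) (P : Finset (C.FreeIndex A)) (hP : ∀ k, k ∈ P) :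
    Ideal.span {∏ k ∈ P, (inclusion Z).stalkMap z (coordFactor C.t C.σ ∅ k.1)} =
      (IdFam.pull (inclusion Z) (IdFam.prod (divisorIdeals D) (Finset.univ \ A))).at' z := by
  have h1 : ∏ k ∈ P, (inclusion Z).stalkMap z (coordFactor C.t C.σ ∅ k.1) =
      (inclusion Z).stalkMap z (∏ k ∈ P.map (Function.Embedding.subtype _),
        coordFactor C.t C.σ ∅ k) := by
    rw [Finset.prod_map]
    exact (map_prod ((inclusion Z).stalkMap z).hom _ _).symm
  have h2 := C.span_prod_coordFactor ∅ (P.map (Function.Embedding.subtype _))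
  rw [h1, IdFam.pull_at, IdFam.prod_at]
  refine (Ideal.map_span ((inclusion Z).stalkMap z).hom _ |>.trans (by rw [Set.image_singleton])).symm.trans ?_
  rw [h2, Finset.sdiff_empty]
  congr 1
  refine Finset.prod_subset (fun j hj => ?_) fun j hj hj' => ?_
  · obtain ⟨hx, hj⟩ := C.mem_labels.1 hj
    obtain ⟨k, -, hk⟩ := Finset.mem_map.1 hj
    exact Finset.mem_sdiff.2 ⟨Finset.mem_univ _, k.2 ⟨j, hx⟩ hk.symm⟩
  · refine ((stalkIdeal_eq_top_iff j.1 _).2 fun hx => hj' (C.mem_labels.2 ⟨hx, ?_⟩)).trans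
      Ideal.one_eq_top.symm
    refine Finset.mem_map.2 ⟨⟨C.σ ⟨j, hx⟩, fun i hi => ?_⟩, hP _, rfl⟩
    rw [C.σ.injective hi]
    exact (Finset.mem_sdiff.1 hj).2

-- The top-degree regular forms on `Z` are the multiples of the product of all restricted forms of a
-- basis by the equations of the components outside `A`: ω_Z = 𝒪_Z(-Σ_{j ∉ A} D_j).
open Classical in
lemma LogData.acyclic_canonicalSheaf_component_iff (F : LogData f D r) (hZ : IsComponent A Z)
    (hreg : ∀ x, RegularOn (fun j => (divisorIdeals D j).at' x) (St E x)) :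
    (∀ k : ℕ, 1 ≤ k → Subsingleton (cohomology (tensor (canonicalSheaf (inclusion Z ≫ f))
      ((Scheme.Modules.pullback (inclusion Z)).obj E)) k)) ↔
    Acyc (IdFam.pull (inclusion Z) (IdFam.prod (divisorIdeals D) (Finset.univ \ A)) •
      Fam.full ((Scheme.Modules.pullback (inclusion Z)).obj E) Unit) ⊥ := by
  have := isLocallyNoetherian_of_smooth f
  have : IsLocallyNoetherian (subvariety Z) := LocallyOfFiniteType.isLocallyNoetherian (inclusion Z)
  obtain ⟨ρ, hρ⟩ := exists_isRestriction (inclusion Z) f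
  obtain ⟨C₀⟩ := F.exists_chart (genericImage (inclusion Z))
  obtain ⟨e, he⟩ := C₀.exists_restrictBasis hZ hρ
  set p := Module.finrank (subvariety Z).functionField (RationalOneForms (inclusion Z ≫ f)) with hp
  have hcard : ∀ {x : X} (C : F.Chart x) (hA : ∀ j ∈ A, x ∈ j.1), Fintype.card (C.FreeIndex A) = p := by
    intro x C hA
    rw [hp, Module.finrank_eq_card_basis e, ← Module.finrank_eq_card_basis (C.freeBasis hA),
      ← Module.finrank_eq_card_basis (C₀.freeBasis (hZ.mem _))]
  have huniv : ∀ {x : X} (C : F.Chart x) (hA : ∀ j ∈ A, x ∈ j.1)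
      (P : Set.powersetCard (C.FreeIndex A) p), P.1 = Finset.univ := fun C hA P => by
    have h1 : P.1.card = _ := P.2
    rw [← Finset.card_eq_iff_eq_univ, h1, hcard C hA]
  let : Unique (Set.powersetCard (C₀.FreeIndex A) p) :=
    { default := ⟨Finset.univ, Finset.card_univ.trans (hcard C₀ (hZ.mem _))⟩
      uniq := fun P => Subtype.ext (huniv C₀ (hZ.mem _) P) }
  have hframe : IsFrame (formsBasis p e) (logFormsAt (inclusion Z ≫ f) ∅ p)
      ((Scheme.Modules.pullback (inclusion Z)).obj E) :=
    IsFrame.of_constFrame (f := inclusion Z ≫ f) (logFormsAt_spread (inclusion Z ≫ f) _ p) fun z => by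
      obtain ⟨C⟩ := F.exists_chart (inclusion Z z)
      exact ⟨_, inferInstance, _, _, C.isConstFrame_restrict hZ hρ C₀ he p (hreg _)⟩
  refine hframe.acyclic_iff.trans (acyc_unique_iff fun z => ?_)
  obtain ⟨C⟩ := F.exists_chart (inclusion Z z)
  rw [IsFrame.fam_at_constFrame _ (C.isConstFrame_restrict hZ hρ C₀ he p (hreg _))]
  have h1 : ∀ P : Set.powersetCard (C.FreeIndex A) p,
      Ideal.span {∏ k ∈ P.1, (inclusion Z).stalkMap z (coordFactor C.t C.σ ∅ k.1)} =
        (IdFam.pull (inclusion Z) (IdFam.prod (divisorIdeals D) (Finset.univ \ A))).at' z :=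
    fun P => C.span_prod_restrict P.1 fun k => by
      rw [huniv C (hZ.mem z) P]
      exact Finset.mem_univ _
  simp only [h1]
  exact map_basisEquiv_const _ _ _

end Strata

end LogBott

namespace LogBott

/-! ### The vanishing theorem -/

/-- The equations of the members of `S` are divided out one after another: if t_j n lies in I_A N,
then so does n, by regularity. -/
lemma RegularOn.mem_sup_smul_prod {O N J : Type} [CommRing O] [AddCommGroup N] [Module O N]
    {I : J → Ideal O} (h : RegularOn I N) {A S : Finset J} (hSA : Disjoint S A) {m : N}
    (hm : m ∈ (∏ j ∈ S, I j) • (⊤ : Submodule O N)) (hm' : m ∈ A.sup I • (⊤ : Submodule O N)) :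
    m ∈ A.sup I • (∏ j ∈ S, I j) • (⊤ : Submodule O N) := by
  classical
  induction S using Finset.induction_on generalizing m with
  | empty => simpa using hm'
  | insert j S hj ih =>
    obtain ⟨hjA, hSA⟩ := Finset.disjoint_insert_left.1 hSA
    obtain ⟨t, ht, -, -⟩ := id h
    rw [Finset.prod_insert hj, ← smul_eq_mul, Submodule.smul_assoc] at hm ⊢
    rw [ht, Submodule.ideal_span_singleton_smul] at hm
    obtain ⟨n, hn, rfl⟩ := (Submodule.mem_smul_pointwise_iff_exists _ _ _).1 hm
    have h1 := ih hSA hn (h.mem_sup_smul hjA (ht j) hm')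
    rw [← Submodule.smul_assoc, smul_eq_mul, mul_comm, ← smul_eq_mul, Submodule.smul_assoc]
    refine Submodule.smul_mem_smul ?_ h1
    rw [ht]
    exact Ideal.mem_span_singleton_self _

section Full

variable {X : Scheme.{0}} {E : X.Modules} (I J : IdFam X) {x : X} (m : Unit → St E x)

lemma mem_smul_full : m ∈ (I • Fam.full E Unit).at' x ↔
    m () ∈ I.at' x • (⊤ : Submodule (X.presheaf.stalk x) (St E x)) := by
  have h : (I • Fam.full E Unit).at' x = piIdeal (St E x) fun _ => I.at' x :=
    smul_top_eq_piIdeal (I.at' x)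
  rw [h, mem_piIdeal]
  exact ⟨fun h => h (), fun h _ => h⟩

lemma mem_smul_smul_full : m ∈ (I • J • Fam.full E Unit).at' x ↔
    m () ∈ I.at' x • J.at' x • (⊤ : Submodule (X.presheaf.stalk x) (St E x)) := by
  have h : (I • J • Fam.full E Unit).at' x = piIdeal (St E x) fun _ => I.at' x * J.at' x :=
    (Submodule.smul_assoc (I.at' x) (J.at' x) _).symm.trans (smul_top_eq_piIdeal _)
  rw [h, mem_piIdeal, ← Submodule.smul_assoc]
  exact ⟨fun h => h (), fun h _ => h⟩

end Full

section Theorem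

variable {X : Scheme.{0}} [IsIntegral X] {f : X ⟶ Spec (.of ℂ)} [Smooth f]
  {D : Finset (IrreducibleCloseds X)} {r : ℕ}
  {A S : Finset {Z : IrreducibleCloseds X // Z ∈ D}} {E : X.Modules}

/-- The product of the ideals of finitely many subvarieties. -/
def listIdeal : List (IrreducibleCloseds X) → IdFam X
  | [] => 1
  | Z :: l => IdFam.ofIdealSheaf (idealOf Z) * listIdeal l

lemma listIdeal_cons_at (Z : IrreducibleCloseds X) (l : List (IrreducibleCloseds X)) (x : X) :
    (listIdeal (Z :: l)).at' x = stalkIdeal Z x * (listIdeal l).at' x := rfl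

lemma listIdeal_at_of_notMem {l : List (IrreducibleCloseds X)} {x : X} (h : ∀ Z ∈ l, x ∉ Z) :
    (listIdeal l).at' x = ⊤ := by
  induction l with
  | nil => rfl
  | cons Z l ih =>
    rw [listIdeal_cons_at, ih fun W hW => h W (List.mem_cons_of_mem _ hW),
      (stalkIdeal_eq_top_iff Z x).2 (h Z List.mem_cons_self), Ideal.mul_top]

/-- Distinct components of the intersection are disjoint, so at a point of `Z` all other factors are
the unit ideal. -/
lemma listIdeal_at_of_mem (f : X ⟶ Spec (.of ℂ)) [Smooth f] (hD : IsSNC D)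
    {l : List (IrreducibleCloseds X)} (hl : l.Nodup)
    (hc : ∀ Z ∈ l, IsComponent A Z) {Z : IrreducibleCloseds X} (hZ : Z ∈ l) {x : X} (hx : x ∈ Z) :
    (listIdeal l).at' x = interIdeal A x := by
  induction l with
  | nil => exact absurd hZ List.not_mem_nil
  | cons W l ih =>
    rw [List.nodup_cons] at hl
    rw [listIdeal_cons_at]
    rcases List.mem_cons.1 hZ with rfl | h
    · rw [listIdeal_at_of_notMem fun V hV hxV => hl.1 (hD.component_unique f (hc Z hZ) hx
        (hc V (List.mem_cons_of_mem _ hV)) hxV ▸ hV), Ideal.mul_top,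
        hD.stalkIdeal_component f (hc Z hZ) hx]
    · have h1 : x ∉ W := fun hxW => hl.1 (hD.component_unique f (hc Z hZ) hx
        (hc W List.mem_cons_self) hxW ▸ h)
      rw [(stalkIdeal_eq_top_iff W x).2 h1, Ideal.top_mul]
      exact ih hl.2 (fun V hV => hc V (List.mem_cons_of_mem _ hV)) h

/-- Multiplication by the ideal of one further component `Z` changes the module only along `Z`, and
the quotient is the restriction to `Z`. The kernel of the restriction is identified by
`RegularOn.mem_sup_smul_prod`. -/
lemma acyc_component (f : X ⟶ Spec (.of ℂ)) [Smooth f] (hD : IsSNC D)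
    (hreg : ∀ x, RegularOn (fun j => (divisorIdeals D j).at' x) (St E x)) (hSA : Disjoint S A)
    {Z : IrreducibleCloseds X} {l : List (IrreducibleCloseds X)} (hl : (Z :: l).Nodup)
    (hc : ∀ W ∈ Z :: l, IsComponent A W)
    (hG : Acyc (IdFam.pull (inclusion Z) (IdFam.prod (divisorIdeals D) S) •
      Fam.full ((Scheme.Modules.pullback (inclusion Z)).obj E) Unit) ⊥) :
    Acyc (listIdeal l • IdFam.prod (divisorIdeals D) S • Fam.full E Unit)
      (listIdeal (Z :: l) • IdFam.prod (divisorIdeals D) S • Fam.full E Unit) := by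
  have hZ := hc Z List.mem_cons_self
  have hmem : ∀ z, inclusion Z z ∈ Z := fun z => by
    have h1 : inclusion Z z ∈ Set.range (inclusion Z) := ⟨z, rfl⟩
    rwa [range_inclusion] at h1
  have hf := (inclusion Z).stalkMap_surjective
  have hl1 : ∀ z, (listIdeal l).at' (inclusion Z z) = ⊤ := fun z =>
    listIdeal_at_of_notMem fun V hV hxV => (List.nodup_cons.1 hl).1
      (hD.component_unique f hZ (hmem z) (hc V (List.mem_cons_of_mem _ hV)) hxV ▸ hV)
  have hl2 : ∀ z, (listIdeal (Z :: l)).at' (inclusion Z z) = interIdeal A (inclusion Z z) := fun z =>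
    listIdeal_at_of_mem f hD hl hc List.mem_cons_self (hmem z)
  have h1 : ∀ z m, m ∈ (listIdeal l • IdFam.prod (divisorIdeals D) S • Fam.full E Unit).at' (inclusion Z z) ↔
      m () ∈ (∏ j ∈ S, (divisorIdeals D j).at' (inclusion Z z)) •
        (⊤ : Submodule (X.presheaf.stalk (inclusion Z z)) (St E (inclusion Z z))) := by
    intro z m
    rw [mem_smul_smul_full, hl1, Submodule.top_smul, IdFam.prod_at]
  have h2 : ∀ z m, m ∈ (listIdeal (Z :: l) • IdFam.prod (divisorIdeals D) S • Fam.full E Unit).at' (inclusion Z z) ↔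
      m () ∈ interIdeal A (inclusion Z z) • (∏ j ∈ S, (divisorIdeals D j).at' (inclusion Z z)) •
        (⊤ : Submodule (X.presheaf.stalk (inclusion Z z)) (St E (inclusion Z z))) := by
    intro z m
    rw [mem_smul_smul_full, hl2, IdFam.prod_at]
  have h3 : ∀ z m, m ∈ (IdFam.pull (inclusion Z) (IdFam.prod (divisorIdeals D) S) •
      Fam.full ((Scheme.Modules.pullback (inclusion Z)).obj E) Unit).at' z ↔
      m () ∈ (∏ j ∈ S, (divisorIdeals D j).at' (inclusion Z z)).map ((inclusion Z).stalkMap z).hom •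
        (⊤ : Submodule ((subvariety Z).presheaf.stalk z) (St ((Scheme.Modules.pullback (inclusion Z)).obj E) z)) :=
    fun z m => mem_smul_full _ m
  refine Acyc.of_closedImmersion (f := inclusion Z) (fun z m hm => ?_) (fun z m hm => ?_)
    (fun z m hm hm0 => ?_) (fun z a ha => ?_) (fun x hx => ?_) hG
  · rw [h1] at hm
    rw [h3]
    generalize m () = n at hm
    induction hm using Submodule.smul_induction_on' with
    | smul s hs n hn =>
      rw [pullStalk_smul]
      exact Submodule.smul_mem_smul (Ideal.mem_map_of_mem _ hs) trivial
    | add m n _ _ hm hn => rw [map_add]; exact add_mem hm hn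
  · rw [h2] at hm
    funext i
    refine (pullStalk_eq_zero_iff E hf z _).2 ?_
    rw [ker_stalkMap_inclusion f hD hZ]
    exact Submodule.smul_mono le_rfl le_top hm
  · rw [h1] at hm
    rw [h2]
    refine (hreg _).mem_sup_smul_prod hSA hm ?_
    have h4 := (pullStalk_eq_zero_iff E hf z _).1 (congrFun hm0 ())
    rwa [ker_stalkMap_inclusion f hD hZ] at h4
  · rw [h3] at ha
    suffices h4 : ∃ n ∈ (∏ j ∈ S, (divisorIdeals D j).at' (inclusion Z z)) •
        (⊤ : Submodule (X.presheaf.stalk (inclusion Z z)) (St E (inclusion Z z))),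
        pullStalk (inclusion Z) E z n = a () by
      obtain ⟨n, hn, h⟩ := h4
      exact ⟨fun _ => n, (h1 z _).2 hn, funext fun _ => h⟩
    generalize a () = b at ha
    induction ha using Submodule.smul_induction_on' with
    | smul s hs n hn =>
      obtain ⟨s, hs', rfl⟩ := (Ideal.mem_map_iff_of_surjective _ (hf z)).1 hs
      obtain ⟨n, rfl⟩ := pullStalk_surjective E hf z n
      exact ⟨s • n, Submodule.smul_mem_smul hs' trivial, pullStalk_smul _ _ _ _ _⟩
    | add m n _ _ hm hn =>
      obtain ⟨m', hm, hm'⟩ := hm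
      obtain ⟨n', hn, hn'⟩ := hn
      exact ⟨m' + n', add_mem hm hn, by rw [map_add, hm', hn']⟩
  · rw [range_inclusion] at hx
    rw [Fam.smul_at, Fam.smul_at, Fam.smul_at, listIdeal_cons_at, (stalkIdeal_eq_top_iff Z x).2 hx,
      Ideal.top_mul]
    exact le_rfl

/-- The ideal of the intersection is the product of the ideals of its disjoint components, so the
components are split off one at a time. -/
lemma acyc_sum_of_components (f : X ⟶ Spec (.of ℂ)) [Smooth f] [NoetherianSpace X] (hD : IsSNC D)
    (hreg : ∀ x, RegularOn (fun j => (divisorIdeals D j).at' x) (St E x)) (hSA : Disjoint S A)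
    (hG : ∀ Z, IsComponent A Z → Acyc (IdFam.pull (inclusion Z) (IdFam.prod (divisorIdeals D) S) •
      Fam.full ((Scheme.Modules.pullback (inclusion Z)).obj E) Unit) ⊥) :
    Acyc (IdFam.prod (divisorIdeals D) S • Fam.full E Unit)
      (IdFam.sum (divisorIdeals D) A • IdFam.prod (divisorIdeals D) S • Fam.full E Unit) := by
  classical
  obtain ⟨C, hC⟩ := exists_components A
  have key : ∀ l : List (IrreducibleCloseds X), l.Nodup → (∀ Z ∈ l, IsComponent A Z) →
      Acyc (IdFam.prod (divisorIdeals D) S • Fam.full E Unit)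
        (listIdeal l • IdFam.prod (divisorIdeals D) S • Fam.full E Unit) := by
    intro l
    induction l with
    | nil =>
      intro _ _
      refine Acyc.of_le fun x => ?_
      have h1 : (listIdeal ([] : List (IrreducibleCloseds X))).at' x = ⊤ := rfl
      rw [Fam.smul_at (listIdeal _), h1, Submodule.top_smul]
    | cons Z l ih =>
      intro hl hc
      refine Acyc.trans (fun x => ?_) (fun x => ?_)
        (ih (List.nodup_cons.1 hl).2 fun W hW => hc W (List.mem_cons_of_mem _ hW))
        (acyc_component f hD hreg hSA hl hc (hG Z (hc Z List.mem_cons_self)))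
      · exact Submodule.smul_le_right
      · rw [Fam.smul_at, Fam.smul_at (listIdeal l)]
        exact Submodule.smul_mono_left (Ideal.mul_le_right (I := stalkIdeal Z x))
  -- At a point of the intersection only the component through it contributes to the product; at all
  -- other points both ideals are the unit ideal.
  have hl : IdFam.sum (divisorIdeals D) A =
      listIdeal (C.filter (IsComponent A)).toList := by
    refine IdFam.ext (funext fun x => ?_)
    have hmem : ∀ Z ∈ (C.filter (IsComponent A)).toList, IsComponent A Z := fun Z hZ =>
      (Finset.mem_filter.1 (Finset.mem_toList.1 hZ)).2
    by_cases h : ∀ j ∈ A, x ∈ j.1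
    · obtain ⟨Z, hZ, hx, -⟩ := hD.exists_component f h
      exact (listIdeal_at_of_mem f hD (Finset.nodup_toList _) hmem
        (Finset.mem_toList.2 (Finset.mem_filter.2 ⟨hC Z hZ, hZ⟩)) hx).symm
    · push Not at h
      obtain ⟨j, hj, hx⟩ := h
      rw [listIdeal_at_of_notMem fun Z hZ hxZ => hx ((hmem Z hZ).1 j hj hxZ), IdFam.sum_at, eq_top_iff,
        ← (stalkIdeal_eq_top_iff j.1 x).2 hx]
      exact Finset.le_sup (f := fun j : {Z : IrreducibleCloseds X // Z ∈ D} => stalkIdeal j.1 x) hj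
  rw [hl]
  exact key _ (Finset.nodup_toList _) fun Z hZ =>
    (Finset.mem_filter.1 (Finset.mem_toList.1 hZ)).2

/-- The base of the induction. Here `S` is the complement of `A`, and the quotient is ω_X ⊗ E if `A`
is empty and is built from the sheaves ω_Z ⊗ E|_Z, Z a component of the intersection of `A`,
otherwise. The generic point of such a Z lies on no component outside `A`, and `A` avoids `D'`, so Z
is not contained in `D'`. -/
lemma acyc_strata {D' : Finset (IrreducibleCloseds X)} (F : LogData f D r) [NoetherianSpace X]
    (hreg : ∀ x, RegularOn (fun j => (divisorIdeals D j).at' x) (St E x))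
    (hvanX : ∀ k : ℕ, 1 ≤ k → Subsingleton (cohomology (tensor (canonicalSheaf f) E) k))
    (hvanZ : ∀ Z : IrreducibleCloseds X, IsStratum D Z → ¬ (Z : Set X) ⊆ support D' →
      ∀ k : ℕ, 1 ≤ k → Subsingleton (cohomology (tensor (canonicalSheaf (inclusion Z ≫ f))
        ((Scheme.Modules.pullback (inclusion Z)).obj E)) k))
    (hSA : Disjoint S A) (huniv : ∀ j, j ∈ S ∨ j ∈ A) (hA : ∀ j ∈ A, j.1 ∉ D')
    (hD' : D' ⊆ D) :
    Acyc (IdFam.prod (divisorIdeals D) S • Fam.full E Unit)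
      (IdFam.sum (divisorIdeals D) A • IdFam.prod (divisorIdeals D) S • Fam.full E Unit) := by
  classical
  have := isLocallyNoetherian_of_smooth f
  rcases A.eq_empty_or_nonempty with rfl | hne
  · have h1 : S = Finset.univ := Finset.eq_univ_of_forall fun j =>
      (huniv j).resolve_right (Finset.notMem_empty j)
    have h2 : IdFam.sum (divisorIdeals D) ∅ • IdFam.prod (divisorIdeals D) S • Fam.full E Unit =
        (⊥ : Fam E Unit) := Fam.ext (funext fun x => Submodule.bot_smul _)
    rw [h2, h1]
    exact (F.acyclic_canonicalSheaf_iff hreg).1 hvanX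
  · have h1 : S = Finset.univ \ A := by
      ext j
      rw [Finset.mem_sdiff]
      exact ⟨fun h => ⟨Finset.mem_univ _, Finset.disjoint_left.1 hSA h⟩,
        fun h => (huniv j).resolve_right h.2⟩
    refine acyc_sum_of_components f F.snc hreg hSA fun Z hZ => ?_
    rw [h1]
    refine (F.acyclic_canonicalSheaf_component_iff hZ hreg).1
      (hvanZ Z (hZ.isStratum hne) fun hsupp => ?_)
    obtain ⟨Y, hY, hmem⟩ := hsupp (genericImage_inclusion_mem Z)
    exact hA _ (F.snc.mem_of_generic_mem f hZ (genericImage_inclusion_mem Z)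
      (fun z hz => genericImage_inclusion_specializes hz) ⟨Y, hD' hY⟩ hmem) hY

end Theorem

end LogBott

theorem proposition2p2 (X : AlgebraicGeometry.Scheme.{0})
    (f : X ⟶ AlgebraicGeometry.Spec (.of ℂ))
    [AlgebraicGeometry.IsIntegral X] [AlgebraicGeometry.Smooth f]
    (hX : LogBott.IsProjective f)
    (D : Finset (TopologicalSpace.IrreducibleCloseds X)) (hD : LogBott.IsSNC D)
    (r : ℕ) (htriv : Nonempty (LogBott.logForms f D 1 ≅ LogBott.trivialBundle X r))
    (D' : Finset (TopologicalSpace.IrreducibleCloseds X)) (hD' : D' ⊆ D)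
    (E : X.Modules) (hE : LogBott.IsQuasicoherent E) (hreg : LogBott.IsDivisorRegular D E)
    (hvanX : ∀ k : ℕ, 1 ≤ k →
      Subsingleton (LogBott.cohomology (LogBott.tensor (LogBott.canonicalSheaf f) E) k))
    (hvanZ : ∀ Z : TopologicalSpace.IrreducibleCloseds X, LogBott.IsStratum D Z →
      ¬ (Z : Set X) ⊆ LogBott.support D' → ∀ k : ℕ, 1 ≤ k →
        Subsingleton (LogBott.cohomology
          (LogBott.tensor (LogBott.canonicalSheaf (LogBott.inclusion Z ≫ f))
            ((AlgebraicGeometry.Scheme.Modules.pullback (LogBott.inclusion Z)).obj E)) k)) :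
    ∀ p k : ℕ, 1 ≤ k →
      Subsingleton (LogBott.cohomology (LogBott.tensor (LogBott.logFormsTwist f D' p) E) k) := by
  classical
  have : IsProper f := hX.isProper
  have := LogBott.isLocallyNoetherian_of_smooth f
  have : CompactSpace X := QuasiCompact.compactSpace_of_compactSpace f
  have : IsNoetherian X := {}
  have : NoetherianSpace X := inferInstance
  obtain ⟨φ⟩ := htriv
  obtain ⟨F⟩ := LogBott.exists_logData f hD φ
  have hreg' := hreg.regularOn hE
  intro p
  let S : Finset {Z : IrreducibleCloseds X // Z ∈ D} := Finset.univ.filter (·.1 ∈ D')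
  have hS : S.map (Function.Embedding.subtype _) = D' := by
    ext Z
    simp only [S, Finset.mem_map, Finset.mem_filter, Finset.mem_univ, true_and,
      Function.Embedding.coe_subtype, Subtype.exists, exists_and_right, exists_eq_right]
    exact ⟨fun ⟨_, h⟩ => h, fun h => ⟨hD' h, h⟩⟩
  rw [← hS]
  refine (F.acyclic_twist_iff hreg' p S).2 ?_
  -- The induction starts with all components outside `D'` still to be distributed and `A` empty;
  -- taking the complement of `S` as bound keeps every `A` that occurs disjoint from `D'`.
  have h1 := LogBott.acyc_stratFam (LogBott.globalConst f) (LogBott.divisorIdeals D) (F.constForms p)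
    (E := E) (fun x => by
      obtain ⟨C⟩ := F.exists_chart x
      exact ⟨_, inferInstance, _, _, _, C.isAdapted p⟩) hreg' (Finset.univ \ S)
    (fun B A hBA hdisj hA => LogBott.acyc_ofConst (LogBott.globalConst f) _
      (LogBott.acyc_strata F hreg' hvanX hvanZ hdisj
        (fun j => Finset.mem_union.1 (hBA ▸ Finset.mem_univ j))
        (fun j hj h => (Finset.mem_sdiff.1 (hA hj)).2 (Finset.mem_filter.2 ⟨Finset.mem_univ _, h⟩))
        hD'))
    (Finset.univ \ S).toList S ∅ (Finset.nodup_toList _)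
    (fun j hj => (Finset.mem_sdiff.1 (Finset.mem_toList.1 hj)).2)
    (fun j _ => Finset.notMem_empty j) (Finset.disjoint_empty_right _)
    (fun j => by
      by_cases h : j ∈ S
      · exact Or.inr (Or.inl h)
      · exact Or.inl (Finset.mem_toList.2 (Finset.mem_sdiff.2 ⟨Finset.mem_univ _, h⟩)))
    (Finset.empty_subset _) (fun j hj => Finset.mem_toList.1 hj)
  -- The sum of no ideals is zero, so for `A` empty the quotient is the sheaf itself.
  have h2 : LogBott.IdFam.sum (LogBott.divisorIdeals D) ∅ • LogBott.stratFam (LogBott.globalConst f)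
      (LogBott.divisorIdeals D) (F.constForms p) E (Finset.univ \ S).toList S ∅ = ⊥ :=
    LogBott.Fam.ext (funext fun x => Submodule.bot_smul _)
  rwa [h2] at h1

end
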